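/- Let $N=2^n$ with $n=m^2$, $m\ge 1$, and let $f_0,f_1:\mathbb{Z}/N\to X$ be injective functions with a hidden shift $s\in\mathbb{Z}/N$, $f_1(a)=f_0(a+s)$. They are given by an oracle which applies $|j,a,x\rangle\mapsto|j,a,x+f_j(a)\rangle$ with $x=0$ and then discards the output register. The modified collimation sieve for the parity of $s$ is the following algorithm; put $\ell_0=2^{m+1}$. * A phase vector of height $h$ is a state $|\psi\rangle\propto\sum_{0\le j<\ell}\exp(2\pi i\,b(j)s/2^h)|j\rangle$ with classically stored phase multipliers $b(j)$. Initial phase vectors, of height $n$ and length $\ell_0$, are formed from $m+1$ qubits $|0\rangle+\exp(2\pi i\,bs/2^n)|1\rangle$; each qubit is obtained by sending $\sum_{j,a}|j,a\rangle$ through the oracle and measuring the Fourier mode of $a$. * Stages: two phase vectors of height $h>m$ and length $\ell_0$, with multipliers $b_1,b_2$, are combined. The value $c=b_1(j_1)+b_2(j_2)\bmod 2^m$ is measured. The remaining index pairs are listed and divided into segments of length $\ell_0$ and a shorter leftover, and it is measured which of these the index lies in. If it is not the leftover, the segment is reindexed by $0,\dots,\ell_0-1$ and gives a phase vector of height $h-m$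 with multipliers $(b_1+b_2-c)/2^m$; otherwise (and without the second measurement if fewer than $\ell_0$ pairs remain) the vector is discarded. The tree of phase vectors is explored depth first. * Last stage: for a phase vector of height $m$, the lowest $m-1$ bits of the phase multiplier are measured, the remaining indices are divided into pairs and at most one singleton, and it is measured which of these the index lies in. If this gives a qubit $|0\rangle+(-1)^s|1\rangle$, up to a scalar, it is measured in the basis $|\pm\rangle$, which reveals the parity of $s$. In all other cases the whole computation is restarted. To find $s$ itself one proceeds by induction on its bits: if $l$ with $l+s\equiv 0 \pmod{2^t}$ is known, then $a\mapsto f_0(2^ta)$ and $a\mapsto f_1(l+2^ta)$, on $\mathbb{Z}/2^{n-t}$, have the hidden shift $(l+s)/2^t$. Its parity is found by the same sieve with the same $m$, starting at height $n-t$; when the height has become $h\le m$, the last stage measures the lowest $h-1$ bits. Computations are carried out by programs on a RAM machine with a classical memory and a quantum memory, both classically addressed. The time is the total number of elementary operations: gates (NOT, CNOT, Toffoli, Hadamard, and phase gates $\mathrm{diag}(1,e^{2\pi i y/2^k})$, charged $k$), one-qubit measurements, oracle queries (charged at least $n+1$), and classical operations, charged by the bit length of the numbers involved. Classical space is the number of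 memory cells used times the largest bit length of a number, and quantum space is the number of qubits used (including the $n+1$ qubits of the input of the oracle, but not the output register that the oracle discards). Then there is a constant $C$ such that for all $m\ge1$ and all such $X,f_0,f_1,s$, the modified collimation sieve, implemented by an explicit program for this machine that is the same for all $n$ and receives $n$ as its input, outputs the parity of $s$ with probability $1$, in expected time at most $2^{C\sqrt n}$, always using at most $2^{C\sqrt n}$ bits of classical space and at most $C\log_2 N$ qubits. The program that finds $s$ by the induction above outputs $s$ with probability $1$, within bounds of the same form. -/

import Mathlib

/-! ## A RAM machine with a classical memory and a quantum memory

The machine has classically addressed classical memory (finitely many tapes of natural numbers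
are used by any program) and classically addressed quantum memory (qubits).  Programs are
classical `while` programs which may also apply elementary gates to qubits at classically
computed addresses, measure qubits, and query the hiding function.  Classical operations are
charged by the logarithmic cost criterion (the bit lengths of all the numbers involved). -/

/-- Binary operations on natural numbers (`sub` is truncated, `lt` and `eq` return `0` or `1`). -/
inductive BinOp where
  | add | sub | mul | div | mod | lt | eq

def BinOp.eval : BinOp → ℕ → ℕ → ℕ
  | .add, a, b => a + b
  | .sub, a, b => a - b
  | .mul, a, b => a * b
  | .div, a, b => a / b
  | .mod, a, b => a % b
  | .lt, a, b => if a < b then 1 else 0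
  | .eq, a, b => if a = b then 1 else 0

/-- Classical expressions; `rd t i` reads the cell with address `i` of tape `t`, and
`pow e` is the number `2 ^ e`. -/
inductive Expr where
  | lit (k : ℕ)
  | rd (t : ℕ) (i : Expr)
  | bin (o : BinOp) (a b : Expr)
  | pow (e : Expr)

namespace Expr

/-- The value of an expression on a classical memory (tape, address ↦ content). -/
def eval (M : ℕ → ℕ → ℕ) : Expr → ℕ
  | lit k => k
  | rd t i => M t (i.eval M)
  | bin o a b => o.eval (a.eval M) (b.eval M)
  | pow e => 2 ^ e.eval M

/-- The logarithmic cost of the evaluation: every node costs one plus the bit length of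
its value. -/
def cost (M : ℕ → ℕ → ℕ) : Expr → ℕ
  | lit k => 1 + k.size
  | rd t i => i.cost M + 1 + (M t (i.eval M)).size
  | bin o a b => a.cost M + b.cost M + 1 + (o.eval (a.eval M) (b.eval M)).size
  | pow e => e.cost M + 1 + (2 ^ e.eval M).size

/-- The largest bit length of a number (content or address) occurring in the evaluation. -/
def word (M : ℕ → ℕ → ℕ) : Expr → ℕ
  | lit k => k.size
  | rd t i => max (i.word M) (M t (i.eval M)).size
  | bin o a b => max (max (a.word M) (b.word M)) (o.eval (a.eval M) (b.eval M)).size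
  | pow e => max (e.word M) (2 ^ e.eval M).size

instance (k : ℕ) : OfNat Expr k := ⟨lit k⟩
instance : Add Expr := ⟨bin .add⟩
instance : Sub Expr := ⟨bin .sub⟩
instance : Mul Expr := ⟨bin .mul⟩
instance : Div Expr := ⟨bin .div⟩
instance : Mod Expr := ⟨bin .mod⟩

/-- The bit of weight `2 ^ i` of `e`. -/
def bit (e i : Expr) : Expr := e / pow i % 2

end Expr

/-- Programs. -/
inductive Cmd where
  | skip
  /-- write `e` into the cell with address `i` of tape `t` -/
  | set (t : ℕ) (i e : Expr)
  | seq (c d : Cmd)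
  /-- `c` if `e ≠ 0`, else `d` -/
  | ite (e : Expr) (c d : Cmd)
  /-- repeat `c` while `e ≠ 0` -/
  | loop (e : Expr) (c : Cmd)
  /-- the NOT gate -/
  | notGate (q : Expr)
  /-- the Hadamard gate -/
  | had (q : Expr)
  /-- the phase gate `diag(1, exp(2πi y/2^k))` -/
  | phase (q y k : Expr)
  /-- controlled NOT with control `a` and target `q` -/
  | cnot (a q : Expr)
  /-- the Toffoli gate with controls `a`, `b` and target `q` -/
  | ccnot (a b q : Expr)
  /-- measure qubit `q` and write the outcome into the cell `0` of tape `t` -/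
  | meas (q : Expr) (t : ℕ)
  /-- send qubit `j` and the `n` qubits starting at address `a` through the oracle -/
  | query (j a : Expr)

/-- (Unnormalized) state vectors of the quantum memory.  The basis vector `|S⟩` is the
one in which the qubits with address in `S` are `1` and all others are `0`. -/
abbrev QState := Finset ℕ →₀ ℂ

namespace QState

/-- The linear map with given values on the basis vectors. -/
noncomputable def gate (g : Finset ℕ → QState) (ψ : QState) : QState :=
  Finsupp.linearCombination ℂ g ψ

noncomputable def notGate (q : ℕ) : QState → QState :=
  gate fun S => Finsupp.single (symmDiff S {q}) 1

noncomputable def had (q : ℕ) : QState → QState :=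
  gate fun S => Finsupp.single (S.erase q) (1 / (Real.sqrt 2 : ℂ)) +
    Finsupp.single (insert q S) ((if q ∈ S then -1 else 1) / (Real.sqrt 2 : ℂ))

noncomputable def phase (q y k : ℕ) : QState → QState :=
  gate fun S => Finsupp.single S
    (if q ∈ S then Complex.exp (2 * Real.pi * Complex.I * (y : ℂ) / (2 : ℂ) ^ k) else 1)

/-- (The identity if control and target coincide.) -/
noncomputable def cnot (a q : ℕ) : QState → QState :=
  gate fun S => Finsupp.single (if a ∈ S ∧ a ≠ q then symmDiff S {q} else S) 1

/-- (The identity if the target is one of the controls.) -/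
noncomputable def ccnot (a b q : ℕ) : QState → QState :=
  gate fun S =>
    Finsupp.single (if a ∈ S ∧ b ∈ S ∧ a ≠ q ∧ b ≠ q then symmDiff S {q} else S) 1

open Classical in
/-- The projection to the span of the basis vectors satisfying `p`. -/
noncomputable def proj (p : Finset ℕ → Prop) (ψ : QState) : QState := ψ.filter p

/-- The squared norm. -/
noncomputable def normSq (ψ : QState) : ℝ := ψ.sum fun _ z => ‖z‖ ^ 2

end QState

/-- The configuration of the machine along one branch of the computation, i.e. for one sequence
of outcomes of all the measurements made so far.  The state vector is not renormalized
after a measurement, so that its squared norm is the probability of the branch.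
The last fields are meters. -/
structure Config where
  mem : ℕ → ℕ → ℕ
  qstate : QState
  /-- the time used so far -/
  time : ℕ
  /-- the cells (tape, address) of the classical memory written so far -/
  cells : Finset (ℕ × ℕ)
  /-- the largest bit length of a number handled so far -/
  word : ℕ
  /-- the addresses of the qubits used so far -/
  qubits : Finset ℕ
  /-- the computation was cut off -/
  stuck : Bool

namespace Config

noncomputable def prob (σ : Config) : ℝ := σ.qstate.normSq

/-- Classical space, in bits: the number of cells used times the word length. -/
def classicalSpace (σ : Config) : ℕ := σ.cells.card * σ.word

/-- Quantum space: the number of qubits used. -/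
def quantumSpace (σ : Config) : ℕ := σ.qubits.card

/-- Charge for the evaluation of the expressions `es`, for `k` further units of time, and for
the use of the qubits in `Q`. -/
def charge (es : List Expr) (k : ℕ) (Q : Finset ℕ) (σ : Config) : Config :=
  { σ with
    time := σ.time + (es.map (Expr.cost σ.mem)).sum + k
    word := (es.map (Expr.word σ.mem)).foldr max σ.word
    qubits := σ.qubits ∪ Q }

def write (t a v : ℕ) (σ : Config) : Config :=
  { σ with
    mem := Function.update σ.mem t (Function.update (σ.mem t) a v)
    cells := insert (t, a) σ.cells }

def withQ (ψ : QState) (σ : Config) : Config := { σ with qstate := ψ }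

/-- The branches of the measurement of qubit `q` with outcome written to cell `0` of
tape `t`. -/
noncomputable def measure (q t : ℕ) (σ : Config) : Multiset Config :=
  {(σ.withQ (σ.qstate.proj fun S => q ∉ S)).write t 0 0,
    (σ.withQ (σ.qstate.proj fun S => q ∈ S)).write t 0 1}

/-- The number in binary, least significant bit first, on the `n` qubits from address `a` on. -/
def readout (n a : ℕ) (S : Finset ℕ) : ℕ :=
  ∑ i ∈ Finset.range n, if a + i ∈ S then 2 ^ i else 0

open Classical in
/-- The oracle: the unitary `|j, a, x⟩ ↦ |j, a, x + f_j(a)⟩` applied with output register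
`x = 0`, after which the output register is discarded.  Equivalently, the value `f_j(a)` is
measured and the outcome is not revealed: the classical memory is the same in all branches. -/
noncomputable def query {X : Type*} {n : ℕ} (f : Bool → ZMod (2 ^ n) → X)
    (j a : ℕ) (σ : Config) : Multiset Config :=
  (Finset.univ.image fun p : Bool × ZMod (2 ^ n) => f p.1 p.2).val.map fun x =>
    σ.withQ (σ.qstate.proj fun S => f (decide (j ∈ S)) (readout n a S : ZMod (2 ^ n)) = x)

/-- The branches of a `while` loop, cut off after `k` rounds. -/
noncomputable def iterate (e : Expr) (body : Config → Multiset Config) :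
    ℕ → Config → Multiset Config
  | 0, σ => {{ σ with stuck := true }}
  | k + 1, σ =>
    if σ.stuck then {σ}
    else if e.eval σ.mem = 0 then {σ.charge [e] 1 ∅}
    else (body (σ.charge [e] 1 ∅)).bind (iterate e body k)

end Config

open Config in
/-- The branches of the computation of a program with oracle `f`.  The computation
along a branch is cut off when one of its loops would be repeated `fuel` times or more, and then
`stuck` is set; so for `fuel → ∞` the computation is followed up to arbitrarily late times. -/
noncomputable def exec {X : Type*} {n : ℕ} (f : Bool → ZMod (2 ^ n) → X) (fuel : ℕ) :
    Cmd → Config → Multiset Config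
  | .seq c d, σ => (exec f fuel c σ).bind (exec f fuel d)
  | .loop e c, σ => iterate e (exec f fuel c) fuel σ
  | .skip, σ => {σ}
  | .ite e c d, σ =>
    if σ.stuck then {σ}
    else if e.eval σ.mem = 0 then exec f fuel d (σ.charge [e] 1 ∅)
    else exec f fuel c (σ.charge [e] 1 ∅)
  | .set t i e, σ =>
    if σ.stuck then {σ}
    else {(σ.charge [i, e] 1 ∅).write t (i.eval σ.mem) (e.eval σ.mem)}
  | .notGate q, σ =>
    if σ.stuck then {σ}
    else {(σ.charge [q] 1 {q.eval σ.mem}).withQ (σ.qstate.notGate (q.eval σ.mem))}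
  | .had q, σ =>
    if σ.stuck then {σ}
    else {(σ.charge [q] 1 {q.eval σ.mem}).withQ (σ.qstate.had (q.eval σ.mem))}
  | .phase q y k, σ =>
    if σ.stuck then {σ}
    else {(σ.charge [q, y, k] (1 + k.eval σ.mem) {q.eval σ.mem}).withQ
      (σ.qstate.phase (q.eval σ.mem) (y.eval σ.mem) (k.eval σ.mem))}
  | .cnot a q, σ =>
    if σ.stuck then {σ}
    else {(σ.charge [a, q] 1 {a.eval σ.mem, q.eval σ.mem}).withQ
      (σ.qstate.cnot (a.eval σ.mem) (q.eval σ.mem))}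
  | .ccnot a b q, σ =>
    if σ.stuck then {σ}
    else {(σ.charge [a, b, q] 1 {a.eval σ.mem, b.eval σ.mem, q.eval σ.mem}).withQ
      (σ.qstate.ccnot (a.eval σ.mem) (b.eval σ.mem) (q.eval σ.mem))}
  | .meas q t, σ =>
    if σ.stuck then {σ}
    else (σ.charge [q] 1 {q.eval σ.mem}).measure (q.eval σ.mem) t
  | .query j a, σ =>
    if σ.stuck then {σ}
    else (σ.charge [j, a] (n + 1)
      (insert (j.eval σ.mem) ((Finset.range n).image (a.eval σ.mem + ·)))).query f
        (j.eval σ.mem) (a.eval σ.mem)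

/-! ## The modified collimation sieve

Scalar variables are the cells `0` of their own tapes. -/

namespace Sieve

open Expr Cmd

/-- The value of a scalar variable. -/
def var (v : ℕ) : Expr := rd v 0
/-- Assignment to a scalar variable. -/
def asg (v : ℕ) (e : Expr) : Cmd := .set v 0 e
def block (l : List Cmd) : Cmd := l.foldr seq skip
def when (e : Expr) (l : List Cmd) : Cmd := ite e (block l) skip
/-- `for v = 0, …, e - 1`. -/
def forLt (v : ℕ) (e : Expr) (l : List Cmd) : Cmd :=
  block [asg v 0, loop (bin .lt (var v) e) (block [block l, asg v (var v + 1)])]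

/-! Scalar variables. -/

/-- input and output -/
abbrev vn : ℕ := 0
abbrev vout : ℕ := 1
/-- the square root `m` of `n`, and `m + 1` (so the phase vectors have length `2 ^ (m + 1)`) -/
abbrev vm : ℕ := 2
abbrev vw : ℕ := 3
/-- number `t` of bits of the shift found so far, and a number `l` with
`l + s ≡ 0 (mod 2 ^ t)` -/
abbrev vt : ℕ := 4
abbrev vl : ℕ := 5
/-- addresses of the working qubits -/
abbrev qa : ℕ := 6
abbrev qf : ℕ := 7
abbrev qg : ℕ := 8
abbrev qy : ℕ := 9
/-- number of collimation stages, and the height that remains after them -/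
abbrev vD : ℕ := 10
abbrev vh : ℕ := 11
/-- number of phase vectors on the stack, end of the sieve, parity found -/
abbrev vsp : ℕ := 12
abbrev vdone : ℕ := 13
abbrev vpar : ℕ := 14
/-- parameters and results of the partial measurements -/
abbrev vbase : ℕ := 15
abbrev vR : ℕ := 16
abbrev vc : ℕ := 17
abbrev ve : ℕ := 18
abbrev vval : ℕ := 19
abbrev vseg : ℕ := 20
abbrev vlen : ℕ := 21
abbrev vok : ℕ := 22
/-- outcome of a one-qubit measurement, measured Fourier mode -/
abbrev vo : ℕ := 23
abbrev vy : ℕ := 24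
/-- loop variables -/
abbrev i0 : ℕ := 25
abbrev i1 : ℕ := 26
abbrev i2 : ℕ := 27
abbrev i3 : ℕ := 28
abbrev i4 : ℕ := 29
/-- arrays: stages passed by the phase vectors on the stack and their tables of phase multipliers
(that of the vector in place `p` starts at address `p * 2 ^ (m + 1)`) -/
abbrev Alev : ℕ := 30
abbrev Ab : ℕ := 31
/-- arrays: phase multipliers before and after a partial measurement, labels that
are measured, indices with the measured label -/
abbrev As : ℕ := 32
abbrev Anew : ℕ := 33
abbrev Alab : ℕ := 34
abbrev Aind : ℕ := 35

/-- Flip qubit `q` if the `r` qubits from address `b` on read the number `v`, least significant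
bit first. -/
def flipIf (b r v q : Expr) : Cmd := block [
  notGate (var qg),
  forLt i0 r [
    ite (bit v (var i0)) skip (notGate (b + var i0)),
    ccnot (b + var i0) (var qg + var i0) (var qg + var i0 + 1)],
  cnot (var qg + r) q,
  forLt i0 r [
    ccnot (b + (r - 1 - var i0)) (var qg + (r - 1 - var i0)) (var qg + (r - 1 - var i0) + 1),
    ite (bit v (r - 1 - var i0)) skip (notGate (b + (r - 1 - var i0)))],
  notGate (var qg)]

/-- Measure qubit `q` and reset it to `0`; the outcome is in `vo`. -/
def measReset (q : Expr) : Cmd := block [meas q vo, when (var vo) [notGate q]]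

/-- Measure the label `Alab[y] < 2 ^ k` of the index `y < 2 ^ vR` that is on the `vR` qubits from
address `vbase` on; put the outcome into `v`. -/
def measLabel (k : Expr) (v : ℕ) : Cmd := block [
  asg v 0,
  forLt i1 k [
    forLt i2 (pow (var vR)) [
      when (bit (rd Alab (var i2)) (var i1)) [flipIf (var vbase) (var vR) (var i2) (var qf)]],
    measReset (var qf),
    when (var vo) [asg v (var v + pow (var i1))]]]

/-- The address in `Aind` of entry `i` of the measured segment. -/
def segIx (i : Expr) : Expr := var vseg * pow (var ve) + i

/-- Collimation and trimming of the phase vector on the `vR` qubits from address `vbase` on, with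
phase multipliers `As[y]`, `y < 2 ^ vR`.  First the phase multiplier is measured mod `2 ^ vc`.
The indices `y` that remain are then listed in increasing order and divided into segments of
length `2 ^ ve` and a shorter leftover, and it is measured which segment `y` belongs to.  If
this is not the leftover, then `vok = 1`, the segment is reindexed by `0, …, 2 ^ ve - 1`, and
its new phase multipliers are written to `Anew`.  Otherwise (in particular, without a second
measurement, if there are fewer than `2 ^ ve` indices), the vector is discarded. -/
def collimate : Cmd := block [
  forLt i3 (pow (var vR)) [.set Alab (var i3) (rd As (var i3) % pow (var vc))],
  measLabel (var vc) vval,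
  asg vlen 0,
  forLt i3 (pow (var vR)) [
    when (bin .eq (rd Alab (var i3)) (var vval)) [
      .set Aind (var vlen) (var i3), asg vlen (var vlen + 1)]],
  asg vok 0,
  when (bin .lt (pow (var ve)) (var vlen + 1)) [
    forLt i3 (var vlen) [.set Alab (rd Aind (var i3)) (var i3 / pow (var ve))],
    measLabel (var vR - var ve) vseg,
    asg vok (bin .lt (segIx (pow (var ve))) (var vlen + 1))],
  ite (var vok)
    (block [
      -- write the new index on fresh qubits, then erase the old one
      forLt i3 (pow (var ve)) [forLt i4 (var ve) [
        when (bit (var i3) (var i4)) [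
          flipIf (var vbase) (var vR) (rd Aind (segIx (var i3))) (var qy + var i4)]]],
      forLt i3 (pow (var ve)) [forLt i4 (var vR) [
        when (bit (rd Aind (segIx (var i3))) (var i4)) [
          flipIf (var qy) (var ve) (var i3) (var vbase + var i4)]]],
      forLt i4 (var ve) [
        cnot (var qy + var i4) (var vbase + var i4),
        cnot (var vbase + var i4) (var qy + var i4)],
      forLt i3 (pow (var ve)) [
        .set Anew (var i3) (rd As (rd Aind (segIx (var i3))) / pow (var vc))]])
    (forLt i4 (var vR) [measReset (var vbase + var i4)])]

/-- Put a new phase vector of length `2 ^ (m + 1)` on the stack, formed from `m + 1` qubits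
`|0⟩ + exp(2πi b s'/2^(n - t)) |1⟩`, where `s' = (l + s)/2^t`.  Such a qubit is obtained from the
oracle, restricted to `a ∈ 2^t ℤ` for `f_0` and to `a ∈ l + 2^t ℤ` for `f_1`, by measuring the
Fourier mode of `a` (one qubit at a time), which makes `b` uniformly random. -/
def leaf : Cmd := block [
  asg vbase (var vsp * var vw),
  .set Alev (var vsp) 0,
  .set Ab (var vsp * pow (var vw)) 0,
  forLt i3 (var vw) [
    had (var vbase + var i3),
    forLt i4 (var vn) [
      ite (bin .lt (var i4) (var vt))
        (when (bit (var vl) (var i4)) [cnot (var vbase + var i3) (var qa + var i4)])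
        (had (var qa + var i4))],
    query (var vbase + var i3) (var qa),
    forLt i4 (var vt) [
      when (bit (var vl) (var i4)) [cnot (var vbase + var i3) (var qa + var i4)]],
    asg vy 0,
    forLt i4 (var vn - var vt) [
      phase (var qa + (var vn - 1 - var i4)) (var vy) (var i4 + 1),
      had (var qa + (var vn - 1 - var i4)),
      measReset (var qa + (var vn - 1 - var i4)),
      when (var vo) [asg vy (var vy + pow (var i4))]],
    forLt i4 (pow (var i3)) [
      .set Ab (var vsp * pow (var vw) + pow (var i3) + var i4)
        (rd Ab (var vsp * pow (var vw) + var i4) + (pow (var vn - var vt) - var vy))]],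
  asg vsp (var vsp + 1)]

/-- Combine the two uppermost phase vectors of the stack, align `m` low bits, trim the
result to length `2 ^ (m + 1)`. -/
def stage : Cmd := block [
  asg vbase ((var vsp - 2) * var vw),
  asg vR (2 * var vw),
  asg vc (var vm),
  asg ve (var vw),
  forLt i3 (pow (var vR)) [
    .set As (var i3) (rd Ab ((var vsp - 2) * pow (var vw) + var i3 % pow (var vw)) +
      rd Ab ((var vsp - 1) * pow (var vw) + var i3 / pow (var vw)))],
  collimate,
  asg vsp (var vsp - 2),
  when (var vok) [
    forLt i3 (pow (var vw)) [.set Ab (var vsp * pow (var vw) + var i3) (rd Anew (var i3))],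
    .set Alev (var vsp) (rd Alev (var vsp) + 1),
    asg vsp (var vsp + 1)]]

/-- The last stage: align all bits of the phase multiplier but the highest one, then measure
a pair of indices.  If the two phase multipliers, now mod `2`, differ, the qubit obtained
is `|0⟩ + (-1)^s' |1⟩`, and the parity of `s'` is measured.  In all other cases the
whole computation is restarted. -/
def lastStage : Cmd := block [
  asg vbase ((var vsp - 1) * var vw),
  asg vR (var vw),
  asg vc (var vh - 1),
  asg ve 1,
  forLt i3 (pow (var vR)) [
    .set As (var i3) (rd Ab ((var vsp - 1) * pow (var vw) + var i3))],
  collimate,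
  asg vsp 0,
  when (var vok) [
    ite ((rd Anew 0 + rd Anew 1) % 2)
      (block [
        had (var vbase),
        measReset (var vbase),
        asg vpar (var vo),
        asg vdone 1])
      (measReset (var vbase))]]

/-- The collimation sieve for the parity of `s' = (l + s)/2^t`, a shift in `ℤ/2^(n - t)`.  The
tree of phase vectors is explored depth first: two vectors that have passed the same
number of stages are combined as soon as they are present. -/
def sieve : Cmd := block [
  asg vD ((var vn - var vt - 1) / var vm),
  asg vh (var vn - var vt - var vD * var vm),
  asg vdone 0,
  asg vsp 0,
  loop (bin .eq (var vdone) 0) (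
    ite (bin .lt 0 (var vsp) * bin .eq (rd Alev (var vsp - 1)) (var vD))
      lastStage
      (ite (bin .lt 1 (var vsp) *
          bin .eq (rd Alev (var vsp - 1)) (rd Alev (var vsp - 2)))
        stage
        leaf))]

/-- Compute `m` with `m ^ 2 = n`, and lay out the quantum memory. -/
def setup : Cmd := block [
  asg vm 0,
  loop (bin .lt (var vm * var vm) (var vn)) (asg vm (var vm + 1)),
  asg vw (var vm + 1),
  asg qa (var vw * var vw),
  asg qf (var qa + var vn),
  asg qg (var qf + 1),
  asg qy (var qg + 2 * var vw + 1),
  asg vt 0,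
  asg vl 0]

/-- Find the parity of the hidden shift. -/
def parityProgram : Cmd := block [setup, sieve, asg vout (var vpar)]

/-- Find the hidden shift, by induction on its bits: given `l` with `l + s ≡ 0 (mod 2 ^ t)`,
the functions `a ↦ f_0(2^t a)` and `a ↦ f_1(l + 2^t a)` on `ℤ/2^(n - t)` have
the hidden shift `(l + s)/2^t`, of which the sieve finds the parity. -/
def shiftProgram : Cmd := block [
  setup,
  forLt vt (var vn) [sieve, asg vl (var vl + var vpar * pow (var vt))],
  asg vout ((pow (var vn) - var vl) % pow (var vn))]

/-- The initial configuration: `n` is in its cell, everything else is `0`. -/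
noncomputable def start (n : ℕ) : Config where
  mem := fun t a => if t = vn ∧ a = 0 then n else 0
  qstate := Finsupp.single ∅ 1
  time := 0
  cells := {(vn, 0)}
  word := n.size
  qubits := ∅
  stuck := false

end Sieve

/-! ## Hidden shifts, and the meaning of the bounds -/

/-- `f_0` and `f_1` are injective functions on `ℤ/2^n` with hidden shift `s`. -/
structure IsHiddenShift {X : Type*} {n : ℕ} (f : Bool → ZMod (2 ^ n) → X) (s : ZMod (2 ^ n)) :
    Prop where
  injective : ∀ j, Function.Injective (f j)
  shift : ∀ a, f true a = f false (a + s)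

section

variable {X : Type*} {n : ℕ}

/-- The branches of the run of a program on input `n` with oracle `f`, cut off by `fuel`. -/
noncomputable def branches (P : Cmd) (f : Bool → ZMod (2 ^ n) → X) (fuel : ℕ) :
    Multiset Config :=
  exec f fuel P (Sieve.start n)

open Classical in
/-- The probability that the run ends before it is cut off, with output `v`. -/
noncomputable def outputProb (P : Cmd) (f : Bool → ZMod (2 ^ n) → X) (v fuel : ℕ) : ℝ :=
  (((branches P f fuel).filter fun σ =>
    σ.stuck = false ∧ σ.mem Sieve.vout 0 = v).map Config.prob).sum

/-- The expected time of the run until it ends or is cut off.  It increases with `fuel`,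
and its supremum is the expected running time. -/
noncomputable def expectedTime (P : Cmd) (f : Bool → ZMod (2 ^ n) → X) (fuel : ℕ) : ℝ :=
  ((branches P f fuel).map fun σ => σ.prob * (σ.time : ℝ)).sum

/-- The program `P` outputs `v` with probability one. -/
def Outputs (P : Cmd) (f : Bool → ZMod (2 ^ n) → X) (v : ℕ) : Prop :=
  Filter.Tendsto (outputProb P f v) Filter.atTop (nhds 1)

/-- The program runs in expected time at most `T` and always uses at most `A` bits of classical
space and at most `Q` qubits. -/
structure RunsWithin (P : Cmd) (f : Bool → ZMod (2 ^ n) → X) (T A Q : ℝ) : Prop where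
  time : ∀ fuel, expectedTime P f fuel ≤ T
  classicalSpace : ∀ fuel, ∀ σ ∈ branches P f fuel, σ.prob ≠ 0 → (σ.classicalSpace : ℝ) ≤ A
  quantumSpace : ∀ fuel, ∀ σ ∈ branches P f fuel, σ.prob ≠ 0 → (σ.quantumSpace : ℝ) ≤ Q

end

/-! ## General facts on the execution of programs -/

/-! The argument separates the machine from the random process that it performs. Along each branch
the classical memory holds the multipliers of all phase vectors on the stack, so the unnormalized
state is a scalar times an explicit product of phase vectors (`stackState`), and the probabilities
of measurement outcomes are found by counting indices. A program logic carries this through the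
code: `Det` treats commands with a single branch, `Prb` commands whose branches are described by an
expectation functional. Both also carry the bounds for numbers, addresses, qubits and time.

The quantum content lies in three lemmas. By `Prb.phaseQubit` the measured Fourier mode is uniform
and its negative is the multiplier of the qubit. By `Prb.collimate`, indices whose multipliers agree
in the low `c` bits form, up to a common phase, a vector of height smaller by `c`. By
`Prb.measParity`, at height `1` two multipliers of different parity give a qubit that the Hadamard
gate turns into `s' mod 2`. Hence a parity that is announced is always correct, and what remains is
to bound the expected number of steps.

For this, fix all bits of the initial multipliers except the highest ones, which are then
independent fair bits. Two different entries of the table of an initial vector are different subset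
sums, so the signs given by their top bits are uncorrelated (`BalancedTable`). This survives the
merging of two vectors, because the carry into the top bit depends on fixed bits only, and it
survives collimation, because the measured labels are fixed bits as well. At the end, the two
members of a pair therefore have different parities with probability exactly `1/2`. In a stage there
are `2 ^ (2 * m + 2)` index pairs and `2 ^ m` labels, and each label loses fewer than `2 ^ (m + 1)`
pairs in its leftover; so a stage fails with probability at most `1/2`. A similar count shows that
the last stage finds the parity with probability at least `1/4`.

Give a vector that has passed `λ` stages the weight `6 ^ λ`. A new vector adds `1`; a stage replaces
`2 * 6 ^ λ` by at least `6 ^ (λ + 1) / 2 = 3 * 6 ^ λ` on average. So the total weight rises by at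
least `1` per step while it is at most `2 * 6 ^ D` for `D` stages, and the expected number of steps,
with restarts, is at most `4 * (2 + 6 ^ D)` (`stackMean_sieveCost_le`). As `D < m`, this is `2 ^
O(m)`. The levels on the stack are distinct except perhaps for the two uppermost, so at most `D + 1
≤ m` vectors of `m + 1` qubits are present at a time, which gives `O(n)` qubits.

A branch that is cut off has used time at least `fuel` (`exec_stuck_time`). By Markov's inequality
such branches have a probability that tends to `0`, which proves that the output has probability `1`
(`Avg.outputs`). -/

namespace QState

theorem gate_add (g : Finset ℕ → QState) (ψ φ : QState) :
    gate g (ψ + φ) = gate g ψ + gate g φ := map_add _ _ _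

theorem gate_smul (g : Finset ℕ → QState) (z : ℂ) (ψ : QState) :
    gate g (z • ψ) = z • gate g ψ := map_smul _ _ _

theorem gate_sum (g : Finset ℕ → QState) {ι : Type*} (Y : Finset ι) (ψ : ι → QState) :
    gate g (∑ y ∈ Y, ψ y) = ∑ y ∈ Y, gate g (ψ y) := map_sum _ _ _

theorem gate_zero (g : Finset ℕ → QState) : gate g 0 = 0 := map_zero _

theorem gate_mapDomain (g : Finset ℕ → QState) (u : Finset ℕ → Finset ℕ) (ψ : QState) :
    gate g (ψ.mapDomain u) = gate (g ∘ u) ψ := by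
  simp [gate, Finsupp.linearCombination_mapDomain]

/-- A gate that permutes basis vectors. -/
theorem gate_single (u : Finset ℕ → Finset ℕ) (ψ : QState) :
    gate (fun S => Finsupp.single (u S) 1) ψ = ψ.mapDomain u := by
  simp [gate, Finsupp.linearCombination_apply, Finsupp.mapDomain]

theorem notGate_eq (q : ℕ) (ψ : QState) :
    notGate q ψ = ψ.mapDomain fun S => symmDiff S {q} := gate_single _ _

theorem cnot_eq (a q : ℕ) (ψ : QState) :
    cnot a q ψ = ψ.mapDomain fun S => if a ∈ S ∧ a ≠ q then symmDiff S {q} else S :=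
  gate_single _ _

theorem ccnot_eq (a b q : ℕ) (ψ : QState) :
    ccnot a b q ψ = ψ.mapDomain fun S =>
      if a ∈ S ∧ b ∈ S ∧ a ≠ q ∧ b ≠ q then symmDiff S {q} else S :=
  gate_single _ _

theorem symmDiff_involutive (q : ℕ) :
    Function.Involutive fun S : Finset ℕ => symmDiff S {q} := fun S => by simp

theorem mem_toggle {q a : ℕ} {S : Finset ℕ} (h : a ≠ q) : a ∈ symmDiff S {q} ↔ a ∈ S := by
  simp [Finset.mem_symmDiff, h]

theorem normSq_mapDomain {u : Finset ℕ → Finset ℕ} (hu : Function.Injective u) (ψ : QState) :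
    normSq (ψ.mapDomain u) = normSq ψ := by
  rw [normSq, Finsupp.sum_mapDomain_index_inj hu, normSq]

theorem normSq_notGate (q : ℕ) (ψ : QState) : normSq (notGate q ψ) = normSq ψ := by
  rw [notGate_eq, normSq_mapDomain (symmDiff_involutive q).injective]

theorem normSq_cnot (a q : ℕ) (ψ : QState) : normSq (cnot a q ψ) = normSq ψ := by
  rw [cnot_eq]
  refine normSq_mapDomain (Function.Involutive.injective fun S => ?_) ψ
  by_cases h : a ∈ S ∧ a ≠ q
  · simp [h, mem_toggle h.2]
  · simp [h]

theorem normSq_ccnot (a b q : ℕ) (ψ : QState) : normSq (ccnot a b q ψ) = normSq ψ := by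
  rw [ccnot_eq]
  refine normSq_mapDomain (Function.Involutive.injective fun S => ?_) ψ
  by_cases h : a ∈ S ∧ b ∈ S ∧ a ≠ q ∧ b ≠ q
  · simp [h, mem_toggle h.2.2.1, mem_toggle h.2.2.2]
  · simp only [h, if_false]

theorem normSq_eq_sum {ψ : QState} {U : Finset (Finset ℕ)} (h : ψ.support ⊆ U) :
    normSq ψ = ∑ S ∈ U, ‖ψ S‖ ^ 2 :=
  Finsupp.sum_of_support_subset _ h _ (by simp)

theorem normSq_nonneg (ψ : QState) : 0 ≤ normSq ψ :=
  Finset.sum_nonneg fun _ _ => by positivity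

@[simp] theorem normSq_zero : normSq 0 = 0 := by simp [normSq]

theorem normSq_eq_zero {ψ : QState} : normSq ψ = 0 ↔ ψ = 0 := by
  refine ⟨fun h => ?_, fun h => by simp [h]⟩
  rw [normSq, Finsupp.sum, Finset.sum_eq_zero_iff_of_nonneg fun _ _ => by positivity] at h
  ext S
  by_cases hS : S ∈ ψ.support
  · simpa using h S hS
  · simpa using hS

theorem normSq_smul (z : ℂ) (ψ : QState) : normSq (z • ψ) = ‖z‖ ^ 2 * normSq ψ := by
  rw [normSq_eq_sum (Finsupp.support_smul), normSq_eq_sum subset_rfl, Finset.mul_sum]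
  simp [mul_pow]

theorem phase_apply (q y k : ℕ) (ψ : QState) (S : Finset ℕ) :
    phase q y k ψ S =
      (if q ∈ S then Complex.exp (2 * Real.pi * Complex.I * (y : ℂ) / (2 : ℂ) ^ k) else 1) *
        ψ S := by
  induction ψ using Finsupp.induction_linear with
  | zero => simp [phase, gate_zero]
  | add f g hf hg => rw [phase, gate_add]; simp only [phase] at hf hg; simp [hf, hg, mul_add]
  | single T z =>
    by_cases h : T = S
    · subst h; simp [phase, gate, mul_comm]
    · simp [phase, gate, Finsupp.single_eq_of_ne' h]

theorem norm_exp_phase (y k : ℕ) :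
    ‖Complex.exp (2 * Real.pi * Complex.I * (y : ℂ) / (2 : ℂ) ^ k)‖ = 1 := by
  have : 2 * Real.pi * Complex.I * (y : ℂ) / (2 : ℂ) ^ k =
      ((2 * Real.pi * y / 2 ^ k : ℝ) : ℂ) * Complex.I := by push_cast; ring
  rw [this, Complex.norm_exp_ofReal_mul_I]

theorem normSq_phase (q y k : ℕ) (ψ : QState) : normSq (phase q y k ψ) = normSq ψ := by
  have hsub : (phase q y k ψ).support ⊆ ψ.support := fun S hS => by
    rw [Finsupp.mem_support_iff, phase_apply] at hS
    exact Finsupp.mem_support_iff.2 (right_ne_zero_of_mul hS)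
  rw [normSq_eq_sum hsub, normSq_eq_sum subset_rfl]
  refine Finset.sum_congr rfl fun S _ => ?_
  rw [phase_apply, norm_mul]
  split_ifs <;> simp [norm_exp_phase]

theorem had_apply (q : ℕ) (ψ : QState) (S : Finset ℕ) :
    had q ψ S = (ψ (S.erase q) + (if q ∈ S then -1 else 1) * ψ (insert q S)) /
      (Real.sqrt 2 : ℂ) := by
  induction ψ using Finsupp.induction_linear with
  | zero => simp [had, gate_zero]
  | add f g hf hg =>
    rw [had, gate_add]; simp only [had] at hf hg
    simp only [Finsupp.add_apply, hf, hg]; ring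
  | single T z =>
    simp only [had, gate, Finsupp.linearCombination_single, Finsupp.smul_apply,
      Finsupp.add_apply, smul_eq_mul, Finsupp.single_apply]
    by_cases hT : q ∈ T <;> by_cases hS : q ∈ S
    · have h1 : T.erase q ≠ S := fun h => by simp [← h] at hS
      have h2 : T ≠ S.erase q := fun h => by simp [h] at hT
      simp only [h1, h2, hT, hS, Finset.insert_eq_of_mem, if_true, if_false]
      split_ifs <;> ring
    · have h1 : T ≠ S := fun h => hS (h ▸ hT)
      have h2 : T ≠ S.erase q := fun h => by simp [h] at hT
      have h3 : T.erase q = S ↔ T = insert q S :=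
        ⟨fun h => by rw [← h, Finset.insert_erase hT], fun h => by rw [h, Finset.erase_insert hS]⟩
      simp only [h1, h2, h3, hT, hS, Finset.insert_eq_of_mem, if_true, if_false]
      split_ifs <;> ring
    · have h1 : T ≠ S := fun h => hT (h ▸ hS)
      have h2 : T ≠ insert q S := fun h => by simp [h] at hT
      have h3 : insert q T = S ↔ T = S.erase q :=
        ⟨fun h => by rw [← h, Finset.erase_insert hT], fun h => by rw [h, Finset.insert_erase hS]⟩
      simp only [Finset.erase_eq_of_notMem hT, Finset.insert_eq_of_mem hS, h1, h3, hS, hT,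
        if_true, if_false]
      split_ifs <;> ring
    · have h1 : insert q T ≠ S := fun h => by simp [← h] at hS
      have h2 : T ≠ insert q S := fun h => by simp [h] at hT
      simp only [Finset.erase_eq_of_notMem hT, Finset.erase_eq_of_notMem hS, h1, h2, hS,
        if_false]
      split_ifs <;> ring

/-- The gate mixes only the amplitudes at `S` and at the toggle of `S`, and it preserves the sum of
their squared norms by the parallelogram law. The sum over a finite set closed under the toggle
counts each such pair twice. -/
theorem normSq_had (q : ℕ) (ψ : QState) : normSq (had q ψ) = normSq ψ := by
  set τ : Finset ℕ → Finset ℕ := fun S => symmDiff S {q} with hτ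
  have hinv : Function.Involutive τ := symmDiff_involutive q
  set V := ψ.support ∪ (had q ψ).support
  set U := V ∪ V.image τ with hU
  have hUτ : ∀ S ∈ U, τ S ∈ U := fun S hS => by
    simp only [hU, Finset.mem_union, Finset.mem_image] at hS ⊢
    rcases hS with h | ⟨T, h, rfl⟩
    · exact .inr ⟨S, h, rfl⟩
    · left; rwa [hinv T]
  have hsum : ∀ F : Finset ℕ → ℝ, ∑ S ∈ U, F (τ S) = ∑ S ∈ U, F S := fun F =>
    Finset.sum_bij' (fun S _ => τ S) (fun S _ => τ S) hUτ hUτ (fun S _ => hinv S)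
      (fun S _ => hinv S) fun S _ => rfl
  have h1 : ψ.support ⊆ U := Finset.subset_union_left.trans Finset.subset_union_left
  have h2 : (had q ψ).support ⊆ U := Finset.subset_union_right.trans Finset.subset_union_left
  rw [normSq_eq_sum h1, normSq_eq_sum h2]
  have hs : ‖(Real.sqrt 2 : ℂ)‖ ^ 2 = 2 := by
    rw [Complex.norm_real, Real.norm_eq_abs, sq_abs, Real.sq_sqrt (by norm_num)]
  have key : ∀ S, ‖had q ψ S‖ ^ 2 + ‖had q ψ (τ S)‖ ^ 2 = ‖ψ S‖ ^ 2 + ‖ψ (τ S)‖ ^ 2 := by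
    have aux : ∀ a b : ℂ, ‖(a + b) / (Real.sqrt 2 : ℂ)‖ ^ 2 + ‖(a - b) / (Real.sqrt 2 : ℂ)‖ ^ 2 =
        ‖a‖ ^ 2 + ‖b‖ ^ 2 := fun a b => by
      have := parallelogram_law_with_norm ℝ a b
      rw [norm_div, norm_div, div_pow, div_pow, hs]
      linarith [sq ‖a + b‖, sq ‖a - b‖, sq ‖a‖, sq ‖b‖]
    intro S
    rw [had_apply, had_apply]
    by_cases h : q ∈ S
    · have e1 : τ S = S.erase q := by ext a; simp [hτ, Finset.mem_symmDiff]; grind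
      have e2 : insert q (S.erase q) = S := Finset.insert_erase h
      rw [e1, Finset.insert_eq_of_mem h, Finset.erase_idem, e2]
      simp only [h, if_true, Finset.mem_erase, ne_eq, not_true_eq_false, false_and, if_false]
      have := aux (ψ (S.erase q)) (ψ S)
      rw [show ψ (S.erase q) + -1 * ψ S = ψ (S.erase q) - ψ S by ring, one_mul]
      linarith
    · have e1 : τ S = insert q S := by ext a; simp [hτ, Finset.mem_symmDiff]; grind
      rw [e1, Finset.erase_insert h, Finset.erase_eq_of_notMem h, Finset.insert_idem]
      simp only [h, if_false, Finset.mem_insert, true_or, if_true]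
      rw [one_mul, show ψ S + -1 * ψ (insert q S) = ψ S - ψ (insert q S) by ring]
      exact aux _ _
  have := Finset.sum_congr rfl fun S (_ : S ∈ U) => key S
  rw [Finset.sum_add_distrib, Finset.sum_add_distrib, hsum fun S => ‖had q ψ S‖ ^ 2,
    hsum fun S => ‖ψ S‖ ^ 2] at this
  linarith

theorem proj_apply (p : Finset ℕ → Prop) [DecidablePred p] (ψ : QState) (S : Finset ℕ) :
    proj p ψ S = if p S then ψ S else 0 := by
  classical
  rw [proj, Finsupp.filter_apply]; congr

theorem proj_add (p : Finset ℕ → Prop) (ψ φ : QState) :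
    proj p (ψ + φ) = proj p ψ + proj p φ := by
  classical
  exact Finsupp.filter_add

theorem proj_zero (p : Finset ℕ → Prop) : proj p 0 = 0 := by
  classical
  exact Finsupp.filter_zero _

theorem proj_smul (p : Finset ℕ → Prop) (z : ℂ) (ψ : QState) :
    proj p (z • ψ) = z • proj p ψ := by
  classical
  exact Finsupp.filter_smul

theorem proj_sum (p : Finset ℕ → Prop) {ι : Type*} (Y : Finset ι) (ψ : ι → QState) :
    proj p (∑ y ∈ Y, ψ y) = ∑ y ∈ Y, proj p (ψ y) := by
  classical
  induction Y using Finset.induction_on with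
  | empty => simp [proj_zero]
  | insert a s ha ih => rw [Finset.sum_insert ha, Finset.sum_insert ha, proj_add, ih]

/-- A projective measurement preserves the total probability. -/
theorem sum_normSq_proj {κ : Type*} [DecidableEq κ] (g : Finset ℕ → κ) (K : Finset κ)
    (ψ : QState) (h : ∀ S, g S ∈ K) :
    ∑ x ∈ K, normSq (proj (fun S => g S = x) ψ) = normSq ψ := by
  classical
  have h1 : ∀ x, normSq (proj (fun S => g S = x) ψ) =
      ∑ S ∈ ψ.support, if g S = x then ‖ψ S‖ ^ 2 else 0 := fun x => by
    have : (proj (fun S => g S = x) ψ).support ⊆ ψ.support := fun S hS => by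
      rw [Finsupp.mem_support_iff, proj_apply] at hS
      rw [Finsupp.mem_support_iff]
      intro h0; simp [h0] at hS
    rw [normSq_eq_sum this]
    refine Finset.sum_congr rfl fun S _ => ?_
    rw [proj_apply]; split_ifs <;> simp
  simp_rw [h1]
  rw [Finset.sum_comm, normSq_eq_sum subset_rfl]
  exact Finset.sum_congr rfl fun S _ => by simp [h S]

theorem normSq_proj_add (p : Finset ℕ → Prop) (ψ : QState) :
    normSq (proj (fun S => ¬ p S) ψ) + normSq (proj p ψ) = normSq ψ := by
  classical
  have := sum_normSq_proj (fun S => decide (p S)) Finset.univ ψ fun _ => Finset.mem_univ _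
  rw [Fintype.sum_bool] at this
  simp only [decide_eq_true_eq, decide_eq_false_iff_not] at this
  linarith

end QState

section

variable {X : Type*} {n : ℕ} (f : Bool → ZMod (2 ^ n) → X) (fuel : ℕ)

theorem exec_of_stuck (c : Cmd) {σ : Config} (h : σ.stuck = true) : exec f fuel c σ = {σ} := by
  induction c generalizing σ with
  | seq c d ihc ihd => simp [exec, ihc h, ihd h]
  | loop e c ih =>
    cases fuel with
    | zero => cases σ; simp_all [exec, Config.iterate]
    | succ k => simp [exec, Config.iterate, h]
  | _ => simp [exec, h]

/-- Induction principle: a reflexive and transitive relation that holds for each elementary step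
holds between the initial configuration and all the branches. -/
theorem exec_induction {R : Config → Config → Prop} (refl : ∀ σ, R σ σ)
    (trans : ∀ {a b c}, R a b → R b c → R a c)
    (hcharge : ∀ σ es k Q, R σ (σ.charge es k Q))
    (hwrite : ∀ σ t a v, R σ (σ.write t a v))
    (hgate : ∀ σ g, R σ (σ.withQ (QState.gate g σ.qstate)))
    (hproj : ∀ σ p, R σ (σ.withQ (QState.proj p σ.qstate)))
    (hstuck : ∀ σ : Config, R σ { σ with stuck := true })
    (c : Cmd) {σ σ' : Config} (h : σ' ∈ exec f fuel c σ) : R σ σ' := by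
  induction c generalizing σ σ' with
  | seq c d ihc ihd =>
    simp only [exec, Multiset.mem_bind] at h
    obtain ⟨τ, h1, h2⟩ := h
    exact trans (ihc h1) (ihd h2)
  | loop e c ih =>
    simp only [exec] at h
    suffices H : ∀ k σ, σ' ∈ Config.iterate e (exec f fuel c) k σ → R σ σ' from H fuel σ h
    clear h
    intro k
    induction k with
    | zero => intro σ h; simp only [Config.iterate, Multiset.mem_singleton] at h; exact h ▸ hstuck σ
    | succ k ihk =>
      intro σ h
      simp only [Config.iterate] at h
      split_ifs at h with h1 h2
      · simp at h; exact h ▸ refl σ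
      · simp at h; exact h ▸ hcharge _ _ _ _
      · simp only [Multiset.mem_bind] at h
        obtain ⟨τ, h3, h4⟩ := h
        exact trans (hcharge _ _ _ _) (trans (ih h3) (ihk _ h4))
  | ite e c d ihc ihd =>
    simp only [exec] at h
    split_ifs at h with h1 h2
    · simp at h; exact h ▸ refl σ
    · exact trans (hcharge _ _ _ _) (ihd h)
    · exact trans (hcharge _ _ _ _) (ihc h)
  | skip => simp [exec] at h; exact h ▸ refl σ
  | set t i e =>
    simp only [exec] at h
    split_ifs at h
    · simp at h; exact h ▸ refl σ
    · simp at h; exact h ▸ trans (hcharge _ _ _ _) (hwrite _ _ _ _)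
  | meas q t =>
    simp only [exec] at h
    split_ifs at h
    · simp at h; exact h ▸ refl σ
    · simp only [Config.measure, Multiset.insert_eq_cons, Multiset.mem_cons,
        Multiset.mem_singleton] at h
      rcases h with h | h <;>
        exact h ▸ trans (hcharge _ _ _ _) (trans (hproj _ _) (hwrite _ _ _ _))
  | query j a =>
    simp only [exec] at h
    split_ifs at h
    · simp at h; exact h ▸ refl σ
    · simp only [Config.query, Multiset.mem_map] at h
      obtain ⟨x, -, h⟩ := h
      exact h ▸ trans (hcharge _ _ _ _) (hproj _ _)
  | _ =>
    simp only [exec] at h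
    split_ifs at h
    · simp at h; exact h ▸ refl σ
    · simp at h; exact h ▸ trans (hcharge _ _ _ _) (hgate (Config.charge _ _ _ σ) _)

theorem exec_time_mono (c : Cmd) {σ σ' : Config} (h : σ' ∈ exec f fuel c σ) :
    σ.time ≤ σ'.time :=
  exec_induction f fuel (R := fun σ σ' => σ.time ≤ σ'.time) (fun _ => le_rfl) le_trans
    (fun _ _ _ _ => by simp only [Config.charge]; omega) (fun _ _ _ _ => le_rfl)
    (fun _ _ => le_rfl) (fun _ _ => le_rfl) (fun _ => le_rfl) c h

theorem exec_qstate_zero (c : Cmd) {σ σ' : Config} (h : σ' ∈ exec f fuel c σ)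
    (h0 : σ.qstate = 0) : σ'.qstate = 0 :=
  exec_induction f fuel (R := fun σ σ' => σ.qstate = 0 → σ'.qstate = 0) (fun _ => id)
    (fun h1 h2 h => h2 (h1 h)) (fun _ _ _ _ => id) (fun _ _ _ _ => id)
    (fun σ g h => by simp [Config.withQ, h, QState.gate_zero])
    (fun _ _ h => by simp [Config.withQ, h, QState.proj_zero]) (fun _ => id) c h h0

/-- To be cut off, some loop must have used up all its rounds, and each test of its condition costs
at least one unit. This is what turns a bound for the expected time into one for the probability of
being cut off. -/
theorem exec_stuck_time (c : Cmd) {σ σ' : Config} (h : σ' ∈ exec f fuel c σ)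
    (h0 : σ.stuck = false) (h1 : σ'.stuck = true) : σ.time + fuel ≤ σ'.time := by
  induction c generalizing σ σ' with
  | seq c d ihc ihd =>
    simp only [exec, Multiset.mem_bind] at h
    obtain ⟨τ, h2, h3⟩ := h
    cases hτ : τ.stuck with
    | false => exact (Nat.add_le_add_right (exec_time_mono f fuel c h2) _).trans (ihd h3 hτ h1)
    | true => exact (ihc h2 h0 hτ).trans (exec_time_mono f fuel d h3)
  | loop e c ih =>
    simp only [exec] at h
    suffices H : ∀ k ≤ fuel, σ' ∈ Config.iterate e (exec f fuel c) k σ → σ.time + k ≤ σ'.time from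
      H fuel le_rfl h
    clear h
    intro k
    induction k generalizing σ with
    | zero =>
      intro _ h
      simp only [Config.iterate, Multiset.mem_singleton] at h
      simp [h]
    | succ k ihk =>
      intro hk h
      simp only [Config.iterate, h0, Bool.false_eq_true, if_false] at h
      split_ifs at h with h2
      · simp only [Multiset.mem_singleton] at h
        simp [h, Config.charge, h0] at h1
      · simp only [Multiset.mem_bind] at h
        obtain ⟨τ, h3, h4⟩ := h
        have hc : σ.time + 1 ≤ (σ.charge [e] 1 ∅).time := by simp only [Config.charge]; omega
        have h5 := exec_time_mono f fuel c h3
        cases hτ : τ.stuck with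
        | false => have := ihk hτ (by omega) h4; omega
        | true =>
          have := ih h3 (by simp [Config.charge, h0]) hτ
          have h6 : τ.time ≤ σ'.time := by
            cases k with
            | zero => simp [Config.iterate] at h4; simp [h4]
            | succ k => simp [Config.iterate, hτ] at h4; simp [h4]
          omega
  | ite e c d ihc ihd =>
    simp only [exec, h0, Bool.false_eq_true, if_false] at h
    have hc : σ.time ≤ (σ.charge [e] 1 ∅).time := by simp only [Config.charge]; omega
    split_ifs at h with h2
    · exact (Nat.add_le_add_right hc _).trans (ihd h h0 h1)
    · exact (Nat.add_le_add_right hc _).trans (ihc h h0 h1)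
  | skip => simp [exec] at h; simp [h, h0] at h1
  | meas q t =>
    simp only [exec, h0] at h
    simp only [Bool.false_eq_true, if_false, Config.measure, Multiset.insert_eq_cons,
      Multiset.mem_cons, Multiset.mem_singleton] at h
    rcases h with h | h <;> simp [h, Config.write, Config.withQ, Config.charge, h0] at h1
  | query j a =>
    simp only [exec, h0] at h
    simp only [Bool.false_eq_true, if_false, Config.query, Multiset.mem_map] at h
    obtain ⟨x, -, h⟩ := h
    simp [← h, Config.withQ, Config.charge, h0] at h1
  | _ =>
    simp [exec, h0] at h
    simp [h, Config.write, Config.withQ, Config.charge, h0] at h1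

theorem sum_map_bind {α β : Type*} (M : Multiset α) (φ : α → Multiset β) (G : β → ℝ) :
    ((M.bind φ).map G).sum = (M.map fun a => ((φ a).map G).sum).sum := by
  simp [Multiset.map_bind, Multiset.sum_bind]

/-- The total probability is preserved. -/
theorem exec_prob (c : Cmd) (σ : Config) :
    ((exec f fuel c σ).map Config.prob).sum = σ.prob := by
  classical
  have hw : ∀ (σ : Config) t a v, (σ.write t a v).prob = σ.prob := fun _ _ _ _ => rfl
  have hc : ∀ (σ : Config) es k Q, (σ.charge es k Q).prob = σ.prob := fun _ _ _ _ => rfl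
  induction c generalizing σ with
  | seq c d ihc ihd => simp only [exec, sum_map_bind, ihd, ihc]
  | loop e c ih =>
    simp only [exec]
    have : ∀ k σ, ((Config.iterate e (exec f fuel c) k σ).map Config.prob).sum = σ.prob := by
      intro k
      induction k with
      | zero => intro σ; simp [Config.iterate, Config.prob]
      | succ k ihk =>
        intro σ
        simp only [Config.iterate]
        split_ifs
        · simp
        · simp [hc]
        · simp only [sum_map_bind, ihk, ih, hc]
    exact this fuel σ
  | ite e c d ihc ihd =>
    simp only [exec]
    split_ifs <;> simp [ihc, ihd, hc]
  | skip => simp [exec]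
  | set t i e => simp only [exec]; split_ifs <;> simp [hc, hw]
  | meas q t =>
    simp only [exec]
    split_ifs
    · simp
    · simpa [Config.measure, Config.prob, Config.withQ, Config.write, Config.charge] using
        QState.normSq_proj_add (fun S => q.eval σ.mem ∈ S) σ.qstate
  | query j a =>
    simp only [exec]
    split_ifs
    · simp
    · simp only [Config.query, Multiset.map_map]
      exact QState.sum_normSq_proj (fun S => f (decide (j.eval σ.mem ∈ S))
        (Config.readout n (a.eval σ.mem) S : ZMod (2 ^ n))) _ σ.qstate fun S => by simp
  | notGate q =>
    simp only [exec]; split_ifs <;> simp [Config.prob, Config.withQ, QState.normSq_notGate]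
  | had q => simp only [exec]; split_ifs <;> simp [Config.prob, Config.withQ, QState.normSq_had]
  | phase q y k =>
    simp only [exec]; split_ifs <;> simp [Config.prob, Config.withQ, QState.normSq_phase]
  | cnot a q =>
    simp only [exec]; split_ifs <;> simp [Config.prob, Config.withQ, QState.normSq_cnot]
  | ccnot a b q =>
    simp only [exec]; split_ifs <;> simp [Config.prob, Config.withQ, QState.normSq_ccnot]

end

/-! ## A program logic with resource bounds -/

namespace Expr

@[simp] theorem eval_zero (M : ℕ → ℕ → ℕ) : (0 : Expr).eval M = 0 := rfl
@[simp] theorem eval_one (M : ℕ → ℕ → ℕ) : (1 : Expr).eval M = 1 := rfl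
@[simp] theorem eval_two (M : ℕ → ℕ → ℕ) : (2 : Expr).eval M = 2 := rfl
@[simp] theorem eval_add (M : ℕ → ℕ → ℕ) (a b : Expr) :
    (a + b).eval M = a.eval M + b.eval M := rfl
@[simp] theorem eval_sub (M : ℕ → ℕ → ℕ) (a b : Expr) :
    (a - b).eval M = a.eval M - b.eval M := rfl
@[simp] theorem eval_mul (M : ℕ → ℕ → ℕ) (a b : Expr) :
    (a * b).eval M = a.eval M * b.eval M := rfl
@[simp] theorem eval_div (M : ℕ → ℕ → ℕ) (a b : Expr) :
    (a / b).eval M = a.eval M / b.eval M := rfl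
@[simp] theorem eval_mod (M : ℕ → ℕ → ℕ) (a b : Expr) :
    (a % b).eval M = a.eval M % b.eval M := rfl
@[simp] theorem eval_pow (M : ℕ → ℕ → ℕ) (e : Expr) : (pow e).eval M = 2 ^ e.eval M := rfl
@[simp] theorem eval_rd (M : ℕ → ℕ → ℕ) (t : ℕ) (i : Expr) :
    (rd t i).eval M = M t (i.eval M) := rfl
@[simp] theorem eval_var (M : ℕ → ℕ → ℕ) (v : ℕ) : (Sieve.var v).eval M = M v 0 := rfl
@[simp] theorem eval_lt (M : ℕ → ℕ → ℕ) (a b : Expr) :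
    (bin .lt a b).eval M = if a.eval M < b.eval M then 1 else 0 := rfl
@[simp] theorem eval_eq (M : ℕ → ℕ → ℕ) (a b : Expr) :
    (bin .eq a b).eval M = if a.eval M = b.eval M then 1 else 0 := rfl

theorem eval_bit (M : ℕ → ℕ → ℕ) (e i : Expr) :
    (bit e i).eval M = if (e.eval M).testBit (i.eval M) then 1 else 0 := by
  have : (bit e i).eval M = e.eval M / 2 ^ i.eval M % 2 := rfl
  rw [this, Nat.testBit_eq_decide_div_mod_eq]
  rcases Nat.mod_two_eq_zero_or_one (e.eval M / 2 ^ i.eval M) with h | h <;> simp [h]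

@[simp] theorem eval_bit_eq_zero (M : ℕ → ℕ → ℕ) (e i : Expr) :
    (bit e i).eval M = 0 ↔ (e.eval M).testBit (i.eval M) = false := by
  rw [eval_bit]; split_ifs with h <;> simp [h]

/-- Tapes that hold numbers, not only bit lengths, of size `2 ^ O(m)`. -/
def smallTape (t : ℕ) : Bool :=
  t ∉ [Sieve.vout, Sieve.vl, Sieve.vy, Sieve.Ab, Sieve.As, Sieve.Anew]

def nodes : Expr → ℕ
  | lit _ => 1
  | rd _ i => i.nodes + 1
  | bin _ a b => a.nodes + b.nodes + 1
  | pow e => e.nodes + 1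

/-- The value of such an expression is polynomial in the bound of `MemOK`, which is why `pow` is
excluded. It may then stand in an exponent, and word lengths still are polynomial in that bound. -/
def small : Expr → Bool
  | lit k => k ≤ 2
  | rd t _ => smallTape t
  | bin _ a b => a.small && b.small
  | pow _ => false

/-- Only numbers on small tapes occur in exponents. -/
def ok : Expr → Bool
  | lit k => k ≤ 2
  | rd _ i => i.ok
  | bin _ a b => a.ok && b.ok
  | pow e => e.ok && e.small

theorem one_le_nodes (e : Expr) : 1 ≤ e.nodes := by cases e <;> simp [nodes]

end Expr

/-- The contents of the small tapes are at most `B`, and so are all bit lengths. -/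
structure MemOK (B : ℕ) (M : ℕ → ℕ → ℕ) : Prop where
  le : ∀ t, Expr.smallTape t = true → ∀ i, M t i ≤ B
  size_le : ∀ t i, (M t i).size ≤ B

theorem Nat.size_le_self' (a : ℕ) : a.size ≤ a := Nat.size_le.2 Nat.lt_two_pow_self

theorem BinOp.size_eval_le (o : BinOp) (a b : ℕ) :
    (o.eval a b).size ≤ a.size + b.size + 1 := by
  have ha := Nat.lt_size_self a
  have hb := Nat.lt_size_self b
  have h1 : 2 ^ a.size ≤ 2 ^ (a.size + b.size) := Nat.pow_le_pow_right (by omega) (by omega)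
  have h2 : 2 ^ b.size ≤ 2 ^ (a.size + b.size) := Nat.pow_le_pow_right (by omega) (by omega)
  have h3 : 1 ≤ 2 ^ (a.size + b.size) := Nat.one_le_two_pow
  refine Nat.size_le.2 ?_
  rw [Nat.pow_succ]
  cases o with
  | add => simp only [eval]; omega
  | sub => simp only [eval]; omega
  | mul =>
    have : a * b < 2 ^ a.size * 2 ^ b.size := Nat.mul_lt_mul'' ha hb
    rw [← pow_add] at this
    simp only [eval]; omega
  | div => have := Nat.div_le_self a b; simp only [eval]; omega
  | mod => have := Nat.mod_le a b; simp only [eval]; omega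
  | lt => simp only [eval]; split_ifs <;> omega
  | eq => simp only [eval]; split_ifs <;> omega

namespace Expr

variable {B : ℕ} {M : ℕ → ℕ → ℕ}

theorem size_eval_le_word (e : Expr) : (e.eval M).size ≤ e.word M := by
  cases e <;> simp [eval, word]

theorem two_le_pow_nodes (B : ℕ) (e : Expr) : 2 ≤ (B + 2) ^ e.nodes :=
  le_trans (by omega) (Nat.le_self_pow (by have := e.one_le_nodes; omega) _)

theorem eval_le_of_small (h : MemOK B M) (e : Expr) (he : e.small = true) :
    e.eval M ≤ (B + 2) ^ e.nodes := by
  induction e with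
  | lit k => simp [small] at he; simp [eval, nodes]; omega
  | rd t i _ =>
    have := h.le t he (i.eval M)
    have h2 : (B + 2) ^ 1 ≤ (B + 2) ^ (i.nodes + 1) := Nat.pow_le_pow_right (by omega) (by omega)
    rw [pow_one] at h2
    simp only [eval, nodes]; omega
  | bin o a b iha ihb =>
    simp only [small, Bool.and_eq_true] at he
    have ha := iha he.1
    have hb := ihb he.2
    have h1 := two_le_pow_nodes B a
    have h2 := two_le_pow_nodes B b
    simp only [eval, nodes]
    set x := (B + 2) ^ a.nodes
    set y := (B + 2) ^ b.nodes
    -- Both factors are at least `2`, so that one product dominates sums as well as products.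
    have hxy : x + y ≤ x * y := by nlinarith
    have h3 : (B + 2) ^ (a.nodes + b.nodes + 1) = x * y * (B + 2) := by
      rw [pow_succ, pow_add]
    have h4 : x * y * 2 ≤ x * y * (B + 2) := Nat.mul_le_mul_left _ (by omega)
    have h5 : o.eval (a.eval M) (b.eval M) ≤ x * y := by
      have hm : a.eval M * b.eval M ≤ x * y := Nat.mul_le_mul ha hb
      cases o with
      | add => simp only [BinOp.eval]; omega
      | sub => simp only [BinOp.eval]; omega
      | mul => exact hm
      | div => have := Nat.div_le_self (a.eval M) (b.eval M); simp only [BinOp.eval]; omega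
      | mod => have := Nat.mod_le (a.eval M) (b.eval M); simp only [BinOp.eval]; omega
      | lt => simp only [BinOp.eval]; split_ifs <;> omega
      | eq => simp only [BinOp.eval]; split_ifs <;> omega
    rw [h3]; omega
  | pow e _ => simp [small] at he

/-- Bit lengths at most add up under the operations, and `2 ^ e` has length `e + 1`, polynomial in
`B` for a small exponent. Lengths are bounded rather than values, since multipliers can be as large
as `2 ^ n`, which no power of `B` with a fixed exponent bounds. -/
theorem word_le_of_ok (h : MemOK B M) (e : Expr) (he : e.ok = true) :
    e.word M ≤ (B + 2) ^ e.nodes := by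
  induction e with
  | lit k =>
    simp [ok] at he
    have := Nat.size_le_self' k
    simp [word, nodes]; omega
  | rd t i ih =>
    have h0 := ih he
    have h1 := h.size_le t (i.eval M)
    have h2 : (B + 2) ^ i.nodes ≤ (B + 2) ^ (i.nodes + 1) :=
      Nat.pow_le_pow_right (by omega) (by omega)
    have h3 : (B + 2) ^ 1 ≤ (B + 2) ^ (i.nodes + 1) := Nat.pow_le_pow_right (by omega) (by omega)
    rw [pow_one] at h3
    simp only [word, nodes]; omega
  | bin o a b iha ihb =>
    simp only [ok, Bool.and_eq_true] at he
    have ha := iha he.1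
    have hb := ihb he.2
    have ha' := a.size_eval_le_word (M := M)
    have hb' := b.size_eval_le_word (M := M)
    have h1 := two_le_pow_nodes B a
    have h2 := two_le_pow_nodes B b
    have h5 := o.size_eval_le (a.eval M) (b.eval M)
    simp only [word, nodes]
    set x := (B + 2) ^ a.nodes
    set y := (B + 2) ^ b.nodes
    have hxy : x + y ≤ x * y := by nlinarith
    have h3 : (B + 2) ^ (a.nodes + b.nodes + 1) = x * y * (B + 2) := by
      rw [pow_succ, pow_add]
    have h4 : x * y * 2 ≤ x * y * (B + 2) := Nat.mul_le_mul_left _ (by omega)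
    omega
  | pow e ih =>
    simp only [ok, Bool.and_eq_true] at he
    have h0 := ih he.1
    have h1 := eval_le_of_small h e he.2
    have h2 := two_le_pow_nodes B e
    have h3 : (B + 2) ^ e.nodes * 2 ≤ (B + 2) ^ e.nodes * (B + 2) :=
      Nat.mul_le_mul_left _ (by omega)
    simp only [word, nodes, Nat.size_pow, pow_succ]
    omega

theorem cost_le (e : Expr) : e.cost M ≤ e.nodes * (1 + e.word M) := by
  induction e with
  | lit k => simp [cost, nodes, word]
  | rd t i ih =>
    simp only [cost, nodes, word, add_mul, one_mul]
    have : i.nodes * (1 + i.word M) ≤ i.nodes * (1 + max (i.word M) (M t (i.eval M)).size) :=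
      Nat.mul_le_mul_left _ (by omega)
    omega
  | bin o a b iha ihb =>
    simp only [cost, nodes, word, add_mul, one_mul]
    set w := max (max (a.word M) (b.word M)) (o.eval (a.eval M) (b.eval M)).size
    have h1 : a.nodes * (1 + a.word M) ≤ a.nodes * (1 + w) := Nat.mul_le_mul_left _ (by omega)
    have h2 : b.nodes * (1 + b.word M) ≤ b.nodes * (1 + w) := Nat.mul_le_mul_left _ (by omega)
    omega
  | pow e ih =>
    simp only [cost, nodes, word, add_mul, one_mul]
    have : e.nodes * (1 + e.word M) ≤ e.nodes * (1 + max (e.word M) (2 ^ e.eval M).size) :=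
      Nat.mul_le_mul_left _ (by omega)
    omega

/-- An admissible expression. -/
def Adm (e : Expr) : Prop := e.ok = true ∧ e.nodes ≤ 40

end Expr

/-- A bound for the word length. -/
def wordBound (B : ℕ) : ℕ := (B + 2) ^ 40

/-- A bound for the time of an elementary operation. -/
def stepBound (B n : ℕ) : ℕ := 120 * (1 + wordBound B) + wordBound B + n + 2

theorem Expr.Adm.word_le {B : ℕ} {M : ℕ → ℕ → ℕ} {e : Expr} (he : e.Adm) (h : MemOK B M) :
    e.word M ≤ wordBound B :=
  (e.word_le_of_ok h he.1).trans (Nat.pow_le_pow_right (by omega) he.2)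

theorem Expr.Adm.cost_le {B : ℕ} {M : ℕ → ℕ → ℕ} {e : Expr} (he : e.Adm) (h : MemOK B M) :
    e.cost M ≤ 40 * (1 + wordBound B) :=
  e.cost_le.trans (Nat.mul_le_mul he.2 (Nat.add_le_add_left (he.word_le h) _))

/-- A bound for the time of a command, all loops of which are repeated at most `B` times, where
`κ` is a bound for the time of an elementary operation. -/
def Cmd.timeBound (κ B : ℕ) : Cmd → ℕ
  | .skip => 0
  | .seq c d => c.timeBound κ B + d.timeBound κ B
  | .ite _ c d => κ + c.timeBound κ B + d.timeBound κ B
  | .loop _ c => (B + 1) * (κ + c.timeBound κ B)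
  | _ => κ

/-- An oracle, a cut-off, and bounds for the numbers and the addresses of the qubits. -/
structure Setting (X : Type*) (n : ℕ) where
  f : Bool → ZMod (2 ^ n) → X
  fuel : ℕ
  B : ℕ
  Qb : ℕ

/-- The memory after writing a cell. -/
def upd (M : ℕ → ℕ → ℕ) (t a v : ℕ) : ℕ → ℕ → ℕ :=
  Function.update M t (Function.update (M t) a v)

theorem upd_apply (M : ℕ → ℕ → ℕ) (t a v t' a' : ℕ) :
    upd M t a v t' a' = if t' = t ∧ a' = a then v else M t' a' := by
  unfold upd
  by_cases h : t' = t
  · subst h; by_cases h' : a' = a <;> simp [h']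
  · simp [h]

theorem upd_ne {M : ℕ → ℕ → ℕ} {t a v t' : ℕ} (h : t' ≠ t) : upd M t a v t' = M t' := by
  simp [upd, h]

@[simp] theorem upd_self (M : ℕ → ℕ → ℕ) (t a v : ℕ) : upd M t a v t a = v := by simp [upd]

/-- Only the tapes in `ts` differ. -/
def Frame (ts : List ℕ) (M M' : ℕ → ℕ → ℕ) : Prop := ∀ t, t ∉ ts → M' t = M t

theorem Frame.refl (ts : List ℕ) (M : ℕ → ℕ → ℕ) : Frame ts M M := fun _ _ => rfl

theorem Frame.trans {ts us : List ℕ} {M M' M'' : ℕ → ℕ → ℕ} (h : Frame ts M M')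
    (h' : Frame us M' M'') (hu : us ⊆ ts) : Frame ts M M'' := fun t ht =>
  (h' t fun h => ht (hu h)).trans (h t ht)

theorem Frame.mono {ts us : List ℕ} {M M' : ℕ → ℕ → ℕ} (h : Frame us M M') (hu : us ⊆ ts) :
    Frame ts M M' := fun t ht => h t fun h => ht (hu h)

theorem Frame.upd {ts : List ℕ} {M M' : ℕ → ℕ → ℕ} (h : Frame ts M M') {t : ℕ} (ht : t ∈ ts)
    (a v : ℕ) : Frame ts M (upd M' t a v) := fun t' ht' =>
  (upd_ne fun e => ht' (by rwa [e])).trans (h t' ht')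

theorem MemOK.upd {B : ℕ} {M : ℕ → ℕ → ℕ} (h : MemOK B M) {t a v : ℕ}
    (h1 : Expr.smallTape t = true → v ≤ B) (h2 : v.size ≤ B) : MemOK B (upd M t a v) := by
  constructor
  · intro t' ht i
    rw [upd_apply]; split_ifs with h'
    · exact h1 (h'.1 ▸ ht)
    · exact h.le t' ht i
  · intro t' i
    rw [upd_apply]; split_ifs with h'
    · exact h2
    · exact h.size_le t' i

namespace Setting

variable {X : Type*} {n : ℕ} (K : Setting X n)

/-- The meters are within the bounds. -/
structure Res (σ : Config) : Prop where
  mem : MemOK K.B σ.mem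
  word : σ.word ≤ wordBound K.B
  cells : σ.cells ⊆ Finset.range 36 ×ˢ Finset.range (K.B + 1)
  qubits : σ.qubits ⊆ Finset.range K.Qb

def tau (c : Cmd) : ℕ := c.timeBound (stepBound K.B n) K.B

/-- The deadline `T` is met by every branch and not only on average. Expected times enter only with
the outer loop of the sieve, in `Avg`. -/
structure Live (T : ℕ) (σ : Config) : Prop where
  stuck : σ.stuck = false
  time : σ.time ≤ T
  res : K.Res σ

/-- A configuration of probability `0`, or one that has been cut off. -/
def Dead (T : ℕ) (σ : Config) : Prop :=
  σ.qstate = 0 ∨ (σ.stuck = true ∧ σ.time ≤ T ∧ K.Res σ)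

theorem Dead.mono {T T' : ℕ} {σ : Config} (h : K.Dead T σ) (hT : T ≤ T') : K.Dead T' σ :=
  h.imp id fun ⟨a, b, c⟩ => ⟨a, b.trans hT, c⟩

theorem Live.mono {T T' : ℕ} {σ : Config} (h : K.Live T σ) (hT : T ≤ T') : K.Live T' σ :=
  ⟨h.stuck, h.time.trans hT, h.res⟩

/-- Started with memory `M` and state vector `ψ`, the command has a single branch, and `Q` holds
unless it has been cut off. -/
def Det (c : Cmd) (M : ℕ → ℕ → ℕ) (ψ : QState) (Q : (ℕ → ℕ → ℕ) → QState → Prop) : Prop :=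
  ∀ σ : Config, σ.mem = M → σ.qstate = ψ → σ.stuck = false → K.Res σ →
    ∃ σ', exec K.f K.fuel c σ = {σ'} ∧ σ'.time ≤ σ.time + K.tau c ∧ K.Res σ' ∧
      (σ'.stuck = false → Q σ'.mem σ'.qstate)

/-- Started with memory `M` and state vector `ψ`, the command has branches that satisfy `Q i` for
some `i`, where the (unnormalized) expectation of functions `h i` is at most `E h`. -/
def Prb {ι : Type*} (c : Cmd) (M : ℕ → ℕ → ℕ) (ψ : QState) (E : (ι → ℝ) → ℝ)
    (Q : ι → (ℕ → ℕ → ℕ) → QState → Prop) : Prop :=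
  ∀ (σ : Config) (T : ℕ), σ.mem = M → σ.qstate = ψ → σ.stuck = false → K.Res σ → σ.time ≤ T →
    ∀ (G : Config → ℝ) (h : ι → ℝ), (∀ i, 0 ≤ h i) →
      (∀ i σ', K.Live (T + K.tau c) σ' → Q i σ'.mem σ'.qstate → G σ' ≤ σ'.prob * h i) →
      (∀ σ', K.Dead (T + K.tau c) σ' → G σ' ≤ 0) →
      ((exec K.f K.fuel c σ).map G).sum ≤ E h

variable {K}
variable {c d : Cmd} {l : List Cmd} {M : ℕ → ℕ → ℕ} {ψ : QState}
  {Q R : (ℕ → ℕ → ℕ) → QState → Prop}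

theorem Res.charge {σ : Config} (h : K.Res σ) {es : List Expr} {k : ℕ} {U : Finset ℕ}
    (hes : ∀ e ∈ es, e.Adm) (hU : U ⊆ Finset.range K.Qb) : K.Res (σ.charge es k U) where
  mem := h.mem
  word := by
    have : ∀ l : List Expr, (∀ e ∈ l, e.Adm) →
        (l.map (Expr.word σ.mem)).foldr max σ.word ≤ wordBound K.B := by
      intro l hl
      induction l with
      | nil => exact h.word
      | cons e l ih =>
        simp only [List.map_cons, List.foldr_cons]
        exact max_le ((hl e (by simp)).word_le h.mem) (ih fun e he => hl e (by simp [he]))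
    exact this es hes
  cells := h.cells
  qubits := Finset.union_subset h.qubits hU

/-- No operation evaluates more than three expressions, each of cost at most `40 * (1 + wordBound
K.B)`; hence the `120` in `stepBound`. The rest of `stepBound` covers the charge for the precision
of a phase gate and the `n + 1` units of a query. -/
theorem Res.charge_time {σ : Config} (h : K.Res σ) {es : List Expr} {k : ℕ} {U : Finset ℕ}
    (hes : ∀ e ∈ es, e.Adm) (hl : es.length ≤ 3) (hk : k ≤ wordBound K.B + n + 2) :
    (σ.charge es k U).time ≤ σ.time + stepBound K.B n := by
  have : ∀ l : List Expr, (∀ e ∈ l, e.Adm) →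
      (l.map (Expr.cost σ.mem)).sum ≤ l.length * (40 * (1 + wordBound K.B)) := by
    intro l hl
    induction l with
    | nil => simp
    | cons e l ih =>
      simp only [List.map_cons, List.sum_cons, List.length_cons, add_mul, one_mul]
      have := (hl e (by simp)).cost_le h.mem
      have := ih fun e he => hl e (by simp [he])
      omega
  have h1 := this es hes
  have h2 : es.length * (40 * (1 + wordBound K.B)) ≤ 3 * (40 * (1 + wordBound K.B)) :=
    Nat.mul_le_mul_right _ hl
  simp only [Config.charge, stepBound]
  omega

theorem Res.write {σ : Config} (h : K.Res σ) {t a v : ℕ} (ht : t < 36) (ha : a ≤ K.B)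
    (h1 : Expr.smallTape t = true → v ≤ K.B) (h2 : v.size ≤ K.B) : K.Res (σ.write t a v) where
  mem := h.mem.upd h1 h2
  word := h.word
  cells := by
    intro x hx
    simp only [Config.write, Finset.mem_insert] at hx
    rcases hx with rfl | hx
    · simp [ht]; omega
    · exact h.cells hx
  qubits := h.qubits

theorem Res.stuck {σ : Config} (h : K.Res σ) : K.Res { σ with stuck := true } :=
  ⟨h.mem, h.word, h.cells, h.qubits⟩

theorem Res.withQ {σ : Config} (h : K.Res σ) (φ : QState) : K.Res (σ.withQ φ) :=
  ⟨h.mem, h.word, h.cells, h.qubits⟩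

theorem Det.mono (h : K.Det c M ψ Q) (hQ : ∀ M' ψ', Q M' ψ' → R M' ψ') : K.Det c M ψ R :=
  fun σ h1 h2 h3 h4 =>
    let ⟨σ', a, b, c, d⟩ := h σ h1 h2 h3 h4
    ⟨σ', a, b, c, fun e => hQ _ _ (d e)⟩

theorem Det.skip (h : Q M ψ) : K.Det .skip M ψ Q := fun σ h1 h2 _ h4 =>
  ⟨σ, by simp [exec], by simp [tau, Cmd.timeBound], h4, fun _ => by rwa [h1, h2]⟩

/-- The second command may rely on `MemOK`, which holds in every configuration within the bounds; so
bounds on the numbers need not be part of each postcondition. -/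
theorem Det.seq (h : K.Det c M ψ fun M' ψ' => MemOK K.B M' → K.Det d M' ψ' Q) :
    K.Det (.seq c d) M ψ Q := by
  intro σ h1 h2 h3 h4
  obtain ⟨σ', e1, t1, r1, q1⟩ := h σ h1 h2 h3 h4
  cases hs : σ'.stuck with
  | true =>
    refine ⟨σ', by simp [exec, e1, exec_of_stuck _ _ d hs], ?_, r1, by simp [hs]⟩
    simp only [tau, Cmd.timeBound] at *; omega
  | false =>
    obtain ⟨σ'', e2, t2, r2, q2⟩ := q1 hs r1.mem σ' rfl rfl hs r1
    refine ⟨σ'', by simp [exec, e1, e2], ?_, r2, q2⟩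
    simp only [tau, Cmd.timeBound] at *; omega

theorem Det.nil (h : Q M ψ) : K.Det (Sieve.block []) M ψ Q := Det.skip h

theorem Det.cons (h : K.Det c M ψ fun M' ψ' => MemOK K.B M' → K.Det (Sieve.block l) M' ψ' Q) :
    K.Det (Sieve.block (c :: l)) M ψ Q := Det.seq h

theorem Det.single (h : K.Det c M ψ Q) : K.Det (Sieve.block [c]) M ψ Q :=
  Det.cons (h.mono fun _ _ h _ => Det.nil h)

theorem Det.set {t : ℕ} {i e : Expr} (hi : i.Adm) (he : e.Adm) (ht : t < 36)
    (ha : i.eval M ≤ K.B) (hv : Expr.smallTape t = true → e.eval M ≤ K.B)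
    (hs : (e.eval M).size ≤ K.B) (h : Q (upd M t (i.eval M) (e.eval M)) ψ) :
    K.Det (.set t i e) M ψ Q := by
  intro σ h1 h2 h3 h4
  subst h1 h2
  have hes : ∀ e' ∈ [i, e], e'.Adm := by simp [hi, he]
  exact ⟨(σ.charge [i, e] 1 ∅).write t (i.eval σ.mem) (e.eval σ.mem), by simp [exec, h3],
    h4.charge_time (U := ∅) hes (by simp) (by omega), (h4.charge (k := 1) (U := ∅) hes (by simp)).write ht ha hv hs, fun _ => h⟩

theorem adm_zero : Expr.Adm 0 := ⟨rfl, by decide⟩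

theorem Det.asg {v : ℕ} {e : Expr} (he : e.Adm) (ht : v < 36)
    (hv : Expr.smallTape v = true → e.eval M ≤ K.B) (hs : (e.eval M).size ≤ K.B)
    (h : Q (upd M v 0 (e.eval M)) ψ) : K.Det (Sieve.asg v e) M ψ Q :=
  Det.set adm_zero he ht (Nat.zero_le _) hv hs h

theorem Det.asgSmall {v : ℕ} {e : Expr} (he : e.Adm) (ht : v < 36) (hv : e.eval M ≤ K.B)
    (h : Q (upd M v 0 (e.eval M)) ψ) : K.Det (Sieve.asg v e) M ψ Q :=
  Det.asg he ht (fun _ => hv) ((Nat.size_le_self' _).trans hv) h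

theorem Det.setSmall {t : ℕ} {i e : Expr} (hi : i.Adm) (he : e.Adm) (ht : t < 36)
    (ha : i.eval M ≤ K.B) (hv : e.eval M ≤ K.B) (h : Q (upd M t (i.eval M) (e.eval M)) ψ) :
    K.Det (.set t i e) M ψ Q :=
  Det.set hi he ht ha (fun _ => hv) ((Nat.size_le_self' _).trans hv) h

theorem Det.notGate {q : Expr} (hq : q.Adm) (hb : q.eval M < K.Qb)
    (h : Q M (ψ.notGate (q.eval M))) : K.Det (.notGate q) M ψ Q := by
  intro σ h1 h2 h3 h4
  subst h1 h2
  have hes : ∀ e' ∈ [q], e'.Adm := by simp [hq]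
  exact ⟨(σ.charge [q] 1 {q.eval σ.mem}).withQ (σ.qstate.notGate (q.eval σ.mem)),
    by simp [exec, h3], h4.charge_time (U := ∅) hes (by simp) (by omega),
    (h4.charge (k := 1) (U := {q.eval σ.mem}) hes (by simpa using hb)).withQ _, fun _ => h⟩

theorem Det.had {q : Expr} (hq : q.Adm) (hb : q.eval M < K.Qb)
    (h : Q M (ψ.had (q.eval M))) : K.Det (.had q) M ψ Q := by
  intro σ h1 h2 h3 h4
  subst h1 h2
  have hes : ∀ e' ∈ [q], e'.Adm := by simp [hq]
  exact ⟨(σ.charge [q] 1 {q.eval σ.mem}).withQ (σ.qstate.had (q.eval σ.mem)),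
    by simp [exec, h3], h4.charge_time (U := ∅) hes (by simp) (by omega),
    (h4.charge (k := 1) (U := {q.eval σ.mem}) hes (by simpa using hb)).withQ _, fun _ => h⟩

theorem Det.phase {q y k : Expr} (hq : q.Adm) (hy : y.Adm) (hk : k.Adm)
    (hks : k.small = true) (hb : q.eval M < K.Qb)
    (h : Q M (ψ.phase (q.eval M) (y.eval M) (k.eval M))) : K.Det (.phase q y k) M ψ Q := by
  intro σ h1 h2 h3 h4
  subst h1 h2
  have hes : ∀ e' ∈ [q, y, k], e'.Adm := by simp [hq, hy, hk]
  have hkv : k.eval σ.mem ≤ wordBound K.B :=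
    (Expr.eval_le_of_small h4.mem k hks).trans (Nat.pow_le_pow_right (by omega) hk.2)
  exact ⟨(σ.charge [q, y, k] (1 + k.eval σ.mem) {q.eval σ.mem}).withQ (σ.qstate.phase (q.eval σ.mem) (y.eval σ.mem) (k.eval σ.mem)),
    by simp [exec, h3], h4.charge_time (U := ∅) hes (by simp) (by omega),
    (h4.charge (U := {q.eval σ.mem}) hes (by simpa using hb)).withQ _, fun _ => h⟩

theorem Det.cnot {a q : Expr} (ha : a.Adm) (hq : q.Adm) (hab : a.eval M < K.Qb)
    (hb : q.eval M < K.Qb) (h : Q M (ψ.cnot (a.eval M) (q.eval M))) :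
    K.Det (.cnot a q) M ψ Q := by
  intro σ h1 h2 h3 h4
  subst h1 h2
  have hes : ∀ e' ∈ [a, q], e'.Adm := by simp [hq, ha]
  exact ⟨(σ.charge [a, q] 1 {a.eval σ.mem, q.eval σ.mem}).withQ (σ.qstate.cnot (a.eval σ.mem) (q.eval σ.mem)),
    by simp [exec, h3], h4.charge_time (U := ∅) hes (by simp) (by omega),
    (h4.charge (k := 1) (U := {a.eval σ.mem, q.eval σ.mem}) hes
      (by simp [Finset.insert_subset_iff, hb, hab])).withQ _, fun _ => h⟩

theorem Det.ccnot {a b q : Expr} (ha : a.Adm) (hb : b.Adm) (hq : q.Adm) (hab : a.eval M < K.Qb)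
    (hbb : b.eval M < K.Qb) (hqb : q.eval M < K.Qb)
    (h : Q M (ψ.ccnot (a.eval M) (b.eval M) (q.eval M))) :
    K.Det (.ccnot a b q) M ψ Q := by
  intro σ h1 h2 h3 h4
  subst h1 h2
  have hes : ∀ e' ∈ [a, b, q], e'.Adm := by simp [hq, ha, hb]
  exact ⟨(σ.charge [a, b, q] 1 {a.eval σ.mem, b.eval σ.mem, q.eval σ.mem}).withQ (σ.qstate.ccnot (a.eval σ.mem) (b.eval σ.mem) (q.eval σ.mem)),
    by simp [exec, h3], h4.charge_time (U := ∅) hes (by simp) (by omega),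
    (h4.charge (k := 1) (U := {a.eval σ.mem, b.eval σ.mem, q.eval σ.mem}) hes
      (by simp [Finset.insert_subset_iff, hbb, hab, hqb])).withQ _, fun _ => h⟩

theorem Det.ite {e : Expr} (he : e.Adm) (h1 : e.eval M ≠ 0 → K.Det c M ψ Q)
    (h2 : e.eval M = 0 → K.Det d M ψ Q) : K.Det (.ite e c d) M ψ Q := by
  intro σ e1 e2 h3 h4
  subst e1 e2
  have hes : ∀ e' ∈ [e], e'.Adm := by simp [he]
  have ht := h4.charge_time (U := ∅) (k := 1) hes (by simp) (by omega)
  have hr := h4.charge (k := 1) (U := ∅) hes (by simp)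
  simp only [exec, h3, tau, Cmd.timeBound]
  by_cases h0 : e.eval σ.mem = 0
  · obtain ⟨σ', a, b, c, d⟩ := h2 h0 (σ.charge [e] 1 ∅) rfl rfl h3 hr
    exact ⟨σ', by simp [h0, a], by simp only [tau] at b; omega, c, d⟩
  · obtain ⟨σ', a, b, c, d⟩ := h1 h0 (σ.charge [e] 1 ∅) rfl rfl h3 hr
    exact ⟨σ', by simp [h0, a], by simp only [tau] at b; omega, c, d⟩

theorem Det.when {e : Expr} (he : e.Adm) (h1 : e.eval M ≠ 0 → K.Det (Sieve.block l) M ψ Q)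
    (h2 : e.eval M = 0 → Q M ψ) : K.Det (Sieve.when e l) M ψ Q :=
  Det.ite he h1 fun h => Det.skip (h2 h)

/-- The condition `N ≤ K.B` is what makes the static bound `Cmd.timeBound` valid. If the fuel ends
before `N` rounds are over, the single branch is a cut-off one, for which only the bounds are
claimed. -/
theorem Det.loop {e : Expr} (he : e.Adm) {N : ℕ} (hN : N ≤ K.B)
    (I : ℕ → (ℕ → ℕ → ℕ) → QState → Prop) (h0 : I 0 M ψ)
    (hlt : ∀ j < N, ∀ M' ψ', I j M' ψ' → e.eval M' ≠ 0)
    (hle : ∀ M' ψ', I N M' ψ' → e.eval M' = 0)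
    (hstep : ∀ j < N, ∀ M' ψ', I j M' ψ' → MemOK K.B M' → K.Det c M' ψ' (I (j + 1)))
    (hQ : ∀ M' ψ', I N M' ψ' → Q M' ψ') : K.Det (.loop e c) M ψ Q := by
  intro σ e1 e2 h3 h4
  subst e1 e2
  have hes : ∀ e' ∈ [e], e'.Adm := by simp [he]
  suffices H : ∀ j ≤ N, ∀ k (σ : Config), I (N - j) σ.mem σ.qstate → σ.stuck = false → K.Res σ →
      ∃ σ', Config.iterate e (exec K.f K.fuel c) k σ = {σ'} ∧
        σ'.time ≤ σ.time + (j + 1) * (stepBound K.B n + K.tau c) ∧ K.Res σ' ∧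
        (σ'.stuck = false → Q σ'.mem σ'.qstate) by
    obtain ⟨σ', a, b, c', d⟩ := H N le_rfl K.fuel σ (by simpa using h0) h3 h4
    refine ⟨σ', by simpa [exec] using a, b.trans ?_, c', d⟩
    simp only [tau, Cmd.timeBound]
    exact Nat.add_le_add_left (Nat.mul_le_mul_right _ (by omega)) _
  intro j
  induction j with
  | zero =>
    intro _ k σ hI hs hr
    cases k with
    | zero => exact ⟨_, rfl, Nat.le_add_right _ _, hr.stuck, by simp⟩
    | succ k =>
      refine ⟨σ.charge [e] 1 ∅, ?_, ?_, hr.charge hes (by simp), fun _ => hQ _ _ hI⟩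
      · simp [Config.iterate, hs, hle _ _ hI]
      · have := hr.charge_time (U := ∅) (k := 1) hes (by simp) (by omega)
        simp; omega
  | succ j ih =>
    intro hj k σ hI hs hr
    cases k with
    | zero => exact ⟨_, rfl, Nat.le_add_right _ _, hr.stuck, by simp⟩
    | succ k =>
      have ht := hr.charge_time (U := ∅) (k := 1) hes (by simp) (by omega)
      obtain ⟨σ', a, b, r, d⟩ := hstep _ (by omega) _ _ hI hr.mem (σ.charge [e] 1 ∅) rfl rfl hs
        (hr.charge hes (by simp))
      have hit : Config.iterate e (exec K.f K.fuel c) (k + 1) σ =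
          Config.iterate e (exec K.f K.fuel c) k σ' := by
        simp [Config.iterate, hs, hlt _ (by omega) _ _ hI, a]
      rw [hit]
      have hmul : (j + 1 + 1) * (stepBound K.B n + K.tau c) =
          (j + 1) * (stepBound K.B n + K.tau c) + (stepBound K.B n + K.tau c) := by ring
      cases hs' : σ'.stuck with
      | true =>
        refine ⟨σ', ?_, by omega, r, by simp [hs']⟩
        cases k with
        | zero => cases σ'; simp_all [Config.iterate]
        | succ k => simp [Config.iterate, hs']
      | false =>
        have hI' := d hs'
        rw [show N - (j + 1) + 1 = N - j by omega] at hI'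
        obtain ⟨σ'', a', b', r', d'⟩ := ih (by omega) k σ' hI' hs' r
        exact ⟨σ'', a', by omega, r', d'⟩

theorem Det.forLt {v : ℕ} {e : Expr} (he : (Expr.bin .lt (Sieve.var v) e).Adm) (hv : v < 36)
    {N : ℕ} (hN : N ≤ K.B) (I : ℕ → (ℕ → ℕ → ℕ) → QState → Prop) (h0 : I 0 (upd M v 0 0) ψ)
    (hev : ∀ j ≤ N, ∀ M' ψ', I j M' ψ' → M' v 0 = j → e.eval M' = N)
    (hstep : ∀ j < N, ∀ M' ψ', I j M' ψ' → M' v 0 = j → MemOK K.B M' →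
      K.Det (Sieve.block l) M' ψ' fun M'' ψ'' => M'' v 0 = j ∧ I (j + 1) (upd M'' v 0 (j + 1)) ψ'')
    (hQ : ∀ M' ψ', I N M' ψ' → M' v 0 = N → Q M' ψ') : K.Det (Sieve.forLt v e l) M ψ Q := by
  have hvar : (Sieve.var v + 1).Adm := ⟨rfl, show 4 ≤ 40 by omega⟩
  refine Det.cons (Det.asgSmall adm_zero hv (by simp) fun _ => Det.single ?_)
  refine Det.loop he hN (fun j M' ψ' => I j M' ψ' ∧ M' v 0 = j) ⟨h0, by simp⟩ ?_ ?_ ?_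
    fun M' ψ' h => hQ _ _ h.1 h.2
  · rintro j hj M' ψ' ⟨h, hj'⟩
    simp [hev j hj.le _ _ h hj', hj', hj]
  · rintro M' ψ' ⟨h, hj'⟩
    simp [hev N le_rfl _ _ h hj', hj']
  · rintro j hj M' ψ' ⟨h, hj'⟩ hM
    refine Det.cons ((hstep j hj _ _ h hj' hM).mono fun M'' ψ'' h' _ => Det.single ?_)
    refine Det.asgSmall hvar hv (by simp [h'.1]; omega) ?_
    simp only [Expr.eval_add, Expr.eval_var, Expr.eval_one, h'.1]
    exact ⟨h'.2, upd_self _ _ _ _⟩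

/-! ### Rules for commands with several branches. -/

variable {ι : Type*} {ι' : Type*} {E E' : (ι → ℝ) → ℝ} {P P' : ι → (ℕ → ℕ → ℕ) → QState → Prop}

theorem Prb.mono (h : K.Prb c M ψ E P) (hE : ∀ g : ι → ℝ, (∀ i, 0 ≤ g i) → E g ≤ E' g)
    (hP : ∀ i M' ψ', P i M' ψ' → P' i M' ψ') : K.Prb c M ψ E' P' :=
  fun σ T h1 h2 h3 h4 h5 G g hg hG hD =>
    (h σ T h1 h2 h3 h4 h5 G g hg (fun i σ' hl hp => hG i σ' hl (hP _ _ _ hp)) hD).trans (hE g hg)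

theorem Prb.of_det {i : ι} (h : K.Det c M ψ (P i)) :
    K.Prb c M ψ (fun g => ψ.normSq * g i) P := by
  intro σ T h1 h2 h3 h4 h5 G g hg hG hD
  obtain ⟨σ', a, b, r, d⟩ := h σ h1 h2 h3 h4
  have hp : σ'.prob = ψ.normSq := by
    have := exec_prob K.f K.fuel c σ
    rw [a] at this
    simpa [Config.prob, h2] using this
  rw [a]
  simp only [Multiset.map_singleton, Multiset.sum_singleton]
  cases hs : σ'.stuck with
  | true =>
    exact (hD σ' (.inr ⟨hs, by omega, r⟩)).trans (mul_nonneg (QState.normSq_nonneg _) (hg i))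
  | false => rw [← hp]; exact hG i σ' ⟨hs, by omega, r⟩ (d hs)

theorem sum_map_nonpos {α : Type*} (m : Multiset α) (G : α → ℝ) (h : ∀ a ∈ m, G a ≤ 0) :
    (m.map G).sum ≤ 0 := by
  induction m using Multiset.induction_on with
  | empty => simp
  | cons a s ih =>
    rw [Multiset.map_cons, Multiset.sum_cons]
    have := h a (by simp)
    have := ih fun b hb => h b (by simp [hb])
    linarith

/-- The branches of a dead configuration are dead. -/
theorem Dead.exec_sum_le {T : ℕ} {σ : Config} (hσ : K.Dead T σ) (c : Cmd) {G : Config → ℝ}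
    (hG : ∀ σ', K.Dead T σ' → G σ' ≤ 0) : ((exec K.f K.fuel c σ).map G).sum ≤ 0 := by
  refine sum_map_nonpos _ _ fun σ' hσ' => hG σ' ?_
  rcases hσ with h | ⟨h, h'⟩
  · exact .inl (exec_qstate_zero _ _ c hσ' h)
  · rw [exec_of_stuck _ _ c h, Multiset.mem_singleton] at hσ'
    exact hσ' ▸ .inr ⟨h, h'⟩

/-- Expectations compose backwards: a function of the final label is replaced by its conditional
expectation `F i` given the intermediate label `i`, which the first command then averages. Branches
with state `0` contribute nothing whatever `F` is, so the second command may assume `ψ' ≠ 0`. -/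
theorem Prb.seq {E₁ : (ι → ℝ) → ℝ} {P₁ : ι → (ℕ → ℕ → ℕ) → QState → Prop}
    {P₂ : ι' → (ℕ → ℕ → ℕ) → QState → Prop} (F : ι → (ι' → ℝ) → ℝ)
    (h : K.Prb c M ψ E₁ P₁) (hF : ∀ i g, (∀ j, 0 ≤ g j) → 0 ≤ F i g)
    (h' : ∀ i M' ψ', P₁ i M' ψ' → ψ' ≠ 0 → MemOK K.B M' →
      K.Prb d M' ψ' (fun g => ψ'.normSq * F i g) P₂) :
    K.Prb (.seq c d) M ψ (fun g => E₁ fun i => F i g) P₂ := by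
  intro σ T h1 h2 h3 h4 h5 G g hg hG hD
  simp only [exec, sum_map_bind]
  have ht : K.tau (.seq c d) = K.tau c + K.tau d := rfl
  rw [ht, ← add_assoc] at hD hG
  refine h σ T h1 h2 h3 h4 h5 _ _ (fun i => hF i g hg) ?_ ?_
  · intro i σ' hl hp
    by_cases h0 : σ'.qstate = 0
    · refine ((Dead.exec_sum_le (.inl h0) d hD)).trans ?_
      simp [Config.prob, h0]
    · exact h' i σ'.mem σ'.qstate hp h0 hl.res.mem σ' _ rfl rfl hl.stuck hl.res hl.time G g hg
        hG hD
  · intro σ' hd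
    exact (hd.mono _ (Nat.le_add_right _ _)).exec_sum_le d hD

/-- As the total probability is preserved, a single branch keeps the norm of the state, and the
second command may use this. -/
theorem Prb.det_seq (h : K.Det c M ψ fun M' ψ' => MemOK K.B M' → ψ'.normSq = ψ.normSq →
      K.Prb d M' ψ' E P) (hE : ∀ g : ι → ℝ, (∀ j, 0 ≤ g j) → 0 ≤ E g) :
    K.Prb (.seq c d) M ψ E P := by
  intro σ T h1 h2 h3 h4 h5 G g hg hG hD
  obtain ⟨σ', a, b, r, q⟩ := h σ h1 h2 h3 h4
  have ht : K.tau (.seq c d) = K.tau c + K.tau d := rfl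
  rw [ht, ← add_assoc] at hD hG
  simp only [exec, a, Multiset.singleton_bind]
  have hp : σ'.prob = ψ.normSq := by
    have := exec_prob K.f K.fuel c σ
    rw [a] at this
    simpa [Config.prob, h2] using this
  cases hs : σ'.stuck with
  | true => exact (Dead.exec_sum_le (.inr ⟨hs, by omega, r⟩) d hD).trans (hE g hg)
  | false => exact q hs r.mem hp σ' _ rfl rfl hs r (by omega) G g hg hG hD

theorem Prb.cons {E₁ : (ι → ℝ) → ℝ} {P₁ : ι → (ℕ → ℕ → ℕ) → QState → Prop}
    {P₂ : ι' → (ℕ → ℕ → ℕ) → QState → Prop} (F : ι → (ι' → ℝ) → ℝ)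
    (h : K.Prb c M ψ E₁ P₁) (hF : ∀ i g, (∀ j, 0 ≤ g j) → 0 ≤ F i g)
    (h' : ∀ i M' ψ', P₁ i M' ψ' → ψ' ≠ 0 → MemOK K.B M' →
      K.Prb (Sieve.block l) M' ψ' (fun g => ψ'.normSq * F i g) P₂) :
    K.Prb (Sieve.block (c :: l)) M ψ (fun g => E₁ fun i => F i g) P₂ := Prb.seq F h hF h'

theorem Prb.det_cons (h : K.Det c M ψ fun M' ψ' => MemOK K.B M' → ψ'.normSq = ψ.normSq →
      K.Prb (Sieve.block l) M' ψ' E P) (hE : ∀ g, (∀ j, 0 ≤ g j) → 0 ≤ E g) :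
    K.Prb (Sieve.block (c :: l)) M ψ E P := Prb.det_seq h hE

/-- A probabilistic command followed by deterministic ones. -/
theorem Prb.cons_det {E₁ : (ι → ℝ) → ℝ} {P₁ : ι → (ℕ → ℕ → ℕ) → QState → Prop}
    (h : K.Prb c M ψ E₁ P₁)
    (h' : ∀ i M' ψ', P₁ i M' ψ' → ψ' ≠ 0 → MemOK K.B M' → K.Det (Sieve.block l) M' ψ' (P i)) :
    K.Prb (Sieve.block (c :: l)) M ψ E₁ P :=
  Prb.cons (fun i g => g i) h (fun i _ hg => hg i) fun i M' ψ' hp h0 hM =>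
    Prb.of_det (h' i M' ψ' hp h0 hM)

theorem Prb.single (h : K.Prb c M ψ E P) : K.Prb (Sieve.block [c]) M ψ E P :=
  Prb.cons_det h fun _ _ _ hp _ _ => Det.nil hp

theorem Prb.ite {e : Expr} (he : e.Adm) (h1 : e.eval M ≠ 0 → K.Prb c M ψ E P)
    (h2 : e.eval M = 0 → K.Prb d M ψ E P) : K.Prb (.ite e c d) M ψ E P := by
  intro σ T e1 e2 h3 h4 h5 G g hg hG hD
  subst e1 e2
  have hes : ∀ e' ∈ [e], e'.Adm := by simp [he]
  have ht := h4.charge_time (U := ∅) (k := 1) hes (by simp) (by omega)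
  have hr := h4.charge (k := 1) (U := ∅) hes (by simp)
  have htau : K.tau (.ite e c d) = stepBound K.B n + K.tau c + K.tau d := rfl
  rw [htau] at hG hD
  simp only [exec, h3, Bool.false_eq_true, if_false]
  split_ifs with h0
  · exact h2 h0 (σ.charge [e] 1 ∅) (T + stepBound K.B n) rfl rfl h3 hr (by omega) G g hg
      (fun i σ' hl => hG i σ' (hl.mono _ (by omega)))
      (fun σ' hd => hD σ' (hd.mono _ (by omega)))
  · exact h1 h0 (σ.charge [e] 1 ∅) (T + stepBound K.B n) rfl rfl h3 hr (by omega) G g hg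
      (fun i σ' hl => hG i σ' (hl.mono _ (by omega)))
      (fun σ' hd => hD σ' (hd.mono _ (by omega)))

theorem Prb.when {e : Expr} (he : e.Adm) (h1 : e.eval M ≠ 0 → K.Prb (Sieve.block l) M ψ E P)
    (h2 : e.eval M = 0 → K.Prb .skip M ψ E P) : K.Prb (Sieve.when e l) M ψ E P :=
  Prb.ite he h1 h2

theorem Prb.skip {i : ι} (h : P i M ψ) :
    K.Prb .skip M ψ (fun g => ψ.normSq * g i) P := Prb.of_det (Det.skip h)

/-- `V j` is the mean of a function of the label after `j` rounds and `F j` is the transition in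
round `j`, so `hV` plays the part of the Markov property; an inequality is enough, since only upper
bounds are derived. -/
theorem Prb.loop {e : Expr} (he : e.Adm) {N : ℕ} (hN : N ≤ K.B)
    (I : ℕ → ι → (ℕ → ℕ → ℕ) → QState → Prop) (F : ℕ → ι → (ι → ℝ) → ℝ)
    (hF : ∀ j i g, (∀ j, 0 ≤ g j) → 0 ≤ F j i g) (V : ℕ → (ι → ℝ) → ℝ) {i₀ : ι}
    (hV0 : ∀ g, (∀ i, 0 ≤ g i) → ψ.normSq * g i₀ ≤ V 0 g)
    (hV : ∀ j < N, ∀ g, (∀ i, 0 ≤ g i) → V j (fun i => F j i g) ≤ V (j + 1) g)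
    (h0 : I 0 i₀ M ψ)
    (hlt : ∀ j < N, ∀ i M' ψ', I j i M' ψ' → e.eval M' ≠ 0)
    (hle : ∀ i M' ψ', I N i M' ψ' → e.eval M' = 0)
    (hstep : ∀ j < N, ∀ i M' ψ', I j i M' ψ' → ψ' ≠ 0 → MemOK K.B M' →
      K.Prb c M' ψ' (fun g => ψ'.normSq * F j i g) (I (j + 1)))
    (hP : ∀ i M' ψ', I N i M' ψ' → P i M' ψ') :
    K.Prb (.loop e c) M ψ (V N) P := by
  intro σ T e1 e2 h3 h4 h5 G g hg hG hD
  subst e1 e2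
  have hes : ∀ e' ∈ [e], e'.Adm := by simp [he]
  -- `r j` is `g` pulled back through the last `j` rounds.
  let r : ℕ → ι → ℝ := fun j =>
    Nat.rec (motive := fun _ => ι → ℝ) g (fun j r i => F (N - 1 - j) i r) j
  have hr0 : ∀ j i, 0 ≤ r j i := by
    intro j
    induction j with
    | zero => exact hg
    | succ j ih => exact fun i => hF _ _ _ ih
  have hstuck : ∀ k (σ : Config) T', T' ≤ T + K.tau (.loop e c) → K.Dead T' σ →
      ((Config.iterate e (exec K.f K.fuel c) k σ).map G).sum ≤ 0 := by
    intro k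
    induction k with
    | zero =>
      intro σ T' hT hd
      simp only [Config.iterate, Multiset.map_singleton, Multiset.sum_singleton]
      exact hD _ (hd.imp id fun ⟨_, b, c⟩ => ⟨rfl, b.trans hT, c.stuck⟩)
    | succ k ih =>
      intro σ T' hT hd
      have hd' := hd.mono _ hT
      simp only [Config.iterate]
      split_ifs with hs hz
      · simpa using hD _ hd'
      · rcases hd with hd | hd
        · simpa using hD (σ.charge [e] 1 ∅) (.inl hd)
        · exact absurd hd.1 hs
      · rcases hd with hd | hd
        · rw [sum_map_bind]
          refine sum_map_nonpos _ _ fun σ' hσ' => ih σ' _ hT (.inl ?_)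
          exact exec_qstate_zero _ _ c hσ' hd
        · exact absurd hd.1 hs
  suffices H : ∀ j ≤ N, ∀ k (σ : Config) T' i, I (N - j) i σ.mem σ.qstate → σ.stuck = false →
      K.Res σ → σ.time ≤ T' →
      T' + (j + 1) * (stepBound K.B n + K.tau c) ≤ T + K.tau (.loop e c) →
      ((Config.iterate e (exec K.f K.fuel c) k σ).map G).sum ≤ σ.prob * r j i by
    have hVr : ∀ j ≤ N, V (N - j) (r j) ≤ V N g := by
      intro j
      induction j with
      | zero => exact fun _ => le_rfl
      | succ j ih =>
        intro hj
        refine le_trans ?_ (ih (by omega))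
        have := hV (N - (j + 1)) (by omega) (r j) (hr0 j)
        rw [show N - (j + 1) + 1 = N - j by omega] at this
        refine le_trans (le_of_eq ?_) this
        show V (N - (j + 1)) (fun i => F (N - 1 - j) i (r j)) = _
        rw [show N - 1 - j = N - (j + 1) by omega]
    refine le_trans ?_ (hVr N le_rfl)
    rw [Nat.sub_self]
    refine le_trans ?_ (hV0 _ (hr0 N))
    refine H N le_rfl K.fuel σ T i₀ (by simpa using h0) h3 h4 h5 ?_
    have : K.tau (.loop e c) = (K.B + 1) * (stepBound K.B n + K.tau c) := rfl
    rw [this]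
    exact Nat.add_le_add_left (Nat.mul_le_mul_right _ (by omega)) _
  intro j
  induction j with
  | zero =>
    intro _ k σ T' i hI hs hres hT' hT
    have hpr : 0 ≤ σ.prob * r 0 i := mul_nonneg (QState.normSq_nonneg _) (hr0 0 i)
    cases k with
    | zero =>
      simp only [Config.iterate, Multiset.map_singleton, Multiset.sum_singleton]
      refine (hD _ (.inr ⟨rfl, ?_, hres.stuck⟩)).trans hpr
      show σ.time ≤ _
      omega
    | succ k =>
      have ht := hres.charge_time (U := ∅) (k := 1) hes (by simp) (by omega)
      simp only [Config.iterate, hs, Bool.false_eq_true, if_false, hle _ _ _ hI, if_true,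
        Multiset.map_singleton, Multiset.sum_singleton]
      exact hG i _ ⟨hs, by omega, hres.charge hes (by simp)⟩ (hP _ _ _ hI)
  | succ j ih =>
    intro hj k σ T' i hI hs hres hT' hT
    have hpr : 0 ≤ σ.prob * r (j + 1) i := mul_nonneg (QState.normSq_nonneg _) (hr0 (j + 1) i)
    cases k with
    | zero =>
      simp only [Config.iterate, Multiset.map_singleton, Multiset.sum_singleton]
      refine (hD _ (.inr ⟨rfl, ?_, hres.stuck⟩)).trans hpr
      show σ.time ≤ _
      omega
    | succ k =>
      by_cases hz : σ.qstate = 0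
      · exact (hstuck _ σ T' (by omega) (.inl hz)).trans hpr
      have ht := hres.charge_time (U := ∅) (k := 1) hes (by simp) (by omega)
      have hmul : (j + 1 + 1) * (stepBound K.B n + K.tau c) =
          (j + 1) * (stepBound K.B n + K.tau c) + (stepBound K.B n + K.tau c) := by ring
      simp only [Config.iterate, hs, Bool.false_eq_true, if_false,
        hlt _ (show N - (j + 1) < N by omega) _ _ _ hI, sum_map_bind]
      have key := hstep _ (show N - (j + 1) < N by omega) _ _ _ hI hz hres.mem
        (σ.charge [e] 1 ∅) (T' + stepBound K.B n) rfl rfl hs (hres.charge hes (by simp))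
        (by omega) (fun σ' => ((Config.iterate e (exec K.f K.fuel c) k σ').map G).sum) (r j)
        (hr0 j) (fun i σ' hl hI' => ih (by omega) k σ' _ i
          (by rwa [show N - (j + 1) + 1 = N - j by omega] at hI') hl.stuck hl.res hl.time (by omega))
        (fun σ' hd => hstuck _ _ _ (by omega) hd)
      refine key.trans (le_of_eq ?_)
      have : r (j + 1) i = F (N - 1 - j) i (r j) := rfl
      rw [this, show N - 1 - j = N - (j + 1) by omega]
      rfl

theorem Prb.forLt {v : ℕ} {e : Expr} (he : (Expr.bin .lt (Sieve.var v) e).Adm) (hv : v < 36)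
    {N : ℕ} (hN : N ≤ K.B)
    (I : ℕ → ι → (ℕ → ℕ → ℕ) → QState → Prop) (F : ℕ → ι → (ι → ℝ) → ℝ)
    (hF : ∀ j i g, (∀ j, 0 ≤ g j) → 0 ≤ F j i g) (V : ℕ → (ι → ℝ) → ℝ) {i₀ : ι}
    (hV0 : ∀ g, (∀ i, 0 ≤ g i) → ψ.normSq * g i₀ ≤ V 0 g)
    (hV : ∀ j < N, ∀ g, (∀ i, 0 ≤ g i) → V j (fun i => F j i g) ≤ V (j + 1) g)
    (hVnn : ∀ g, (∀ i, 0 ≤ g i) → 0 ≤ V N g)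
    (h0 : I 0 i₀ (upd M v 0 0) ψ)
    (hev : ∀ j ≤ N, ∀ i M' ψ', I j i M' ψ' → M' v 0 = j → e.eval M' = N)
    (hstep : ∀ j < N, ∀ i M' ψ', I j i M' ψ' → M' v 0 = j → ψ' ≠ 0 → MemOK K.B M' →
      K.Prb (Sieve.block l) M' ψ' (fun g => ψ'.normSq * F j i g) fun i' M'' ψ'' =>
        M'' v 0 = j ∧ I (j + 1) i' (upd M'' v 0 (j + 1)) ψ'')
    (hP : ∀ i M' ψ', I N i M' ψ' → M' v 0 = N → P i M' ψ') :
    K.Prb (Sieve.forLt v e l) M ψ (V N) P := by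
  have hvar : (Sieve.var v + 1).Adm := ⟨rfl, show 4 ≤ 40 by omega⟩
  refine Prb.det_cons (Det.asgSmall adm_zero hv (by simp) fun _ _ => Prb.single ?_) hVnn
  refine Prb.loop he hN (fun j i M' ψ' => I j i M' ψ' ∧ M' v 0 = j) F hF V hV0 hV
    ⟨h0, by simp⟩ ?_ ?_ ?_ fun i M' ψ' h => hP i _ _ h.1 h.2
  · rintro j hj i M' ψ' ⟨h, hj'⟩
    simp [hev j hj.le _ _ _ h hj', hj', hj]
  · rintro i M' ψ' ⟨h, hj'⟩
    simp [hev N le_rfl _ _ _ h hj', hj']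
  · rintro j hj i M' ψ' ⟨h, hj'⟩ h0 hM
    refine Prb.cons_det (hstep j hj i _ _ h hj' h0 hM) fun i' M'' ψ'' h' _ _ => Det.single ?_
    refine Det.asgSmall hvar hv (by simp [h'.1]; omega) ?_
    simp only [Expr.eval_add, Expr.eval_var, Expr.eval_one, h'.1]
    exact ⟨h'.2, upd_self _ _ _ _⟩

/-- Measurement of one qubit. -/
theorem Prb.meas {q : Expr} {t : ℕ} (hq : q.Adm) (hb : q.eval M < K.Qb) (ht : t < 36)
    (hB : 1 ≤ K.B) : K.Prb (.meas q t) M ψ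
      (fun g : Bool → ℝ => (ψ.proj fun S => q.eval M ∉ S).normSq * g false +
        (ψ.proj fun S => q.eval M ∈ S).normSq * g true)
      fun o M' ψ' => M' = upd M t 0 o.toNat ∧
        ψ' = ψ.proj fun S => q.eval M ∈ S ↔ o = true := by
  intro σ T h1 h2 h3 h4 h5 G g hg hG hD
  subst h1 h2
  have hes : ∀ e' ∈ [q], e'.Adm := by simp [hq]
  have ht' := h4.charge_time (U := {q.eval σ.mem}) (k := 1) hes (by simp) (by omega)
  have hr := h4.charge (k := 1) (U := {q.eval σ.mem}) hes (by simpa using hb)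
  have hs : (1 : ℕ).size ≤ K.B := (Nat.size_le_self' 1).trans hB
  have htau : K.tau (.meas q t) = stepBound K.B n := rfl
  simp only [exec, h3, Bool.false_eq_true, if_false, Config.measure, Multiset.insert_eq_cons,
    Multiset.map_cons, Multiset.map_singleton, Multiset.sum_cons, Multiset.sum_singleton]
  refine add_le_add (hG false _ ⟨h3, ?_, ?_⟩ ⟨rfl, ?_⟩) (hG true _ ⟨h3, ?_, ?_⟩ ⟨rfl, ?_⟩)
  · show (Config.charge [q] 1 {q.eval σ.mem} σ).time ≤ _; omega
  · exact (hr.withQ _).write ht (by simp) (by simp) (by simp)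
  · simp [Config.write, Config.withQ, Config.charge]
  · show (Config.charge [q] 1 {q.eval σ.mem} σ).time ≤ _; omega
  · exact (hr.withQ _).write ht (by simp) (fun _ => hB) hs
  · simp [Config.write, Config.withQ, Config.charge]

open Classical in
/-- A query.  The branches are labelled by the values of the oracle. -/
theorem Prb.query {j a : Expr} (hj : j.Adm) (ha : a.Adm) (hjb : j.eval M < K.Qb)
    (hab : a.eval M + n ≤ K.Qb) : K.Prb (.query j a) M ψ
      (fun g : X → ℝ => ∑ x ∈ Finset.univ.image fun p : Bool × ZMod (2 ^ n) => K.f p.1 p.2,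
        (ψ.proj fun S => K.f (decide (j.eval M ∈ S))
          (Config.readout n (a.eval M) S : ZMod (2 ^ n)) = x).normSq * g x)
      fun x M' ψ' => M' = M ∧ ψ' = ψ.proj fun S => K.f (decide (j.eval M ∈ S))
          (Config.readout n (a.eval M) S : ZMod (2 ^ n)) = x := by
  intro σ T h1 h2 h3 h4 h5 G g hg hG hD
  subst h1 h2
  set U : Finset ℕ := insert (j.eval σ.mem) ((Finset.range n).image (a.eval σ.mem + ·)) with hU
  have hUs : U ⊆ Finset.range K.Qb := by
    rw [hU, Finset.insert_subset_iff, Finset.image_subset_iff]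
    simp only [Finset.mem_range]
    exact ⟨hjb, fun i hi => by omega⟩
  have hes : ∀ e' ∈ [j, a], e'.Adm := by simp [hj, ha]
  have ht' := h4.charge_time (U := U) (k := n + 1) hes (by simp) (by omega)
  have hr := h4.charge (k := n + 1) (U := U) hes hUs
  have htau : K.tau (.query j a) = stepBound K.B n := rfl
  simp only [exec, h3, Bool.false_eq_true, if_false, Config.query, Multiset.map_map]
  refine Finset.sum_le_sum fun x _ => ?_
  exact hG x _ ⟨h3, by show (Config.charge [j, a] (n + 1) U σ).time ≤ _; omega, hr.withQ _⟩
    ⟨rfl, rfl⟩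

end Setting

/-! ## Superpositions of labelled registers -/

/-- The number `x` in binary on the `k` qubits from address `q` on. -/
def encode (q k x : ℕ) : Finset ℕ :=
  ((Finset.range k).filter fun i => x.testBit i = true).image (q + ·)

theorem mem_encode {q k x a : ℕ} :
    a ∈ encode q k x ↔ q ≤ a ∧ a < q + k ∧ x.testBit (a - q) = true := by
  simp only [encode, Finset.mem_image, Finset.mem_filter, Finset.mem_range]
  constructor
  · rintro ⟨i, ⟨h1, h2⟩, rfl⟩
    exact ⟨by omega, by omega, by simpa using h2⟩
  · rintro ⟨h1, h2, h3⟩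
    exact ⟨a - q, ⟨by omega, h3⟩, by omega⟩

/-- The `r` qubits from address `b` on read `v`. -/
def Reads (b r : ℕ) (S : Finset ℕ) (v : ℕ) : Prop :=
  ∀ i < r, (b + i ∈ S ↔ v.testBit i = true)

theorem reads_unique {b r v w : ℕ} {S : Finset ℕ} (h : Reads b r S v) (h' : Reads b r S w)
    (hv : v < 2 ^ r) (hw : w < 2 ^ r) : v = w := by
  refine Nat.eq_of_testBit_eq fun i => ?_
  by_cases hi : i < r
  · have := (h i hi).symm.trans (h' i hi)
    rwa [← Bool.eq_iff_iff] at this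
  · have h2 : 2 ^ r ≤ 2 ^ i := Nat.pow_le_pow_right (by omega) (by omega)
    rw [Nat.testBit_lt_two_pow (hv.trans_le h2), Nat.testBit_lt_two_pow (hw.trans_le h2)]

theorem reads_encode (b r y : ℕ) : Reads b r (encode b r y) y := fun i hi => by
  simp [mem_encode, hi]

theorem reads_encode_iff {b r y v : ℕ} (hy : y < 2 ^ r) (hv : v < 2 ^ r) :
    Reads b r (encode b r y) v ↔ y = v :=
  ⟨fun h => reads_unique (reads_encode b r y) h hy hv, fun h => h ▸ reads_encode b r y⟩

theorem readout_of_reads {b r v : ℕ} {S : Finset ℕ} (h : Reads b r S v) (hv : v < 2 ^ r) :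
    Config.readout r b S = v := by
  have : ∀ k ≤ r, (∑ i ∈ Finset.range k, if b + i ∈ S then 2 ^ i else 0) = v % 2 ^ k := by
    intro k
    induction k with
    | zero => simp [Nat.mod_one]
    | succ k ih =>
      intro hk
      have h2 := Nat.mod_mul (x := v) (a := 2 ^ k) (b := 2)
      rw [Finset.sum_range_succ, ih (by omega), pow_succ, h2]
      simp only [h k (by omega), Nat.testBit_eq_decide_div_mod_eq, decide_eq_true_eq]
      rcases Nat.mod_two_eq_zero_or_one (v / 2 ^ k) with h' | h' <;> simp [h']
  rw [Config.readout, this r le_rfl, Nat.mod_eq_of_lt hv]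

theorem encode_injOn (b r : ℕ) : Set.InjOn (encode b r) {y | y < 2 ^ r} := fun x hx y hy h =>
  reads_unique (reads_encode b r x) (h ▸ reads_encode b r y) hx hy

namespace QState

/-- Only qubits with address below `b` occur. -/
def Below (b : ℕ) (φ : QState) : Prop := ∀ S ∈ φ.support, ∀ a ∈ S, a < b

variable {ι κ : Type*} {b : ℕ} {Y : Finset ι} {β : ι → ℂ} {A : ι → Finset ℕ} {φ : QState}

/-- The state vector `∑ y ∈ Y, β y |φ⟩|A y⟩`. -/
noncomputable def fam (Y : Finset ι) (β : ι → ℂ) (A : ι → Finset ℕ) (φ : QState) : QState :=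
  ∑ y ∈ Y, β y • φ.mapDomain (· ∪ A y)

theorem fam_congr {β' : ι → ℂ} {A' : ι → Finset ℕ} (h1 : ∀ y ∈ Y, β y = β' y)
    (h2 : ∀ y ∈ Y, A y = A' y) : fam Y β A φ = fam Y β' A' φ :=
  Finset.sum_congr rfl fun y hy => by rw [h1 y hy, h2 y hy]

theorem fam_reindex {Y' : Finset κ} (e : κ → ι) (h1 : ∀ y ∈ Y', e y ∈ Y)
    (h2 : Set.InjOn e Y') (h3 : ∀ y ∈ Y, ∃ y' ∈ Y', e y' = y) :
    fam Y β A φ = fam Y' (fun y => β (e y)) (fun y => A (e y)) φ :=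
  (Finset.sum_bij (fun y _ => e y) h1 (fun _ h _ h' => h2 h h')
    (fun y hy => by obtain ⟨y', h, h'⟩ := h3 y hy; exact ⟨y', h, h'⟩) fun _ _ => rfl).symm

theorem smul_fam (z : ℂ) : z • fam Y β A φ = fam Y (fun y => z * β y) A φ := by
  simp [fam, Finset.smul_sum, mul_smul]

theorem fam_smul (z : ℂ) : fam Y β A (z • φ) = fam Y (fun y => z * β y) A φ := by
  refine Finset.sum_congr rfl fun y _ => ?_
  rw [Finsupp.mapDomain_smul, smul_smul, mul_comm]

theorem fam_unit (φ : QState) : fam {()} (fun _ => 1) (fun _ => ∅) φ = φ := by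
  simp only [fam, Finset.sum_singleton, one_smul, Finset.union_empty]
  exact Finsupp.mapDomain_id

/-- A register outside of another one. -/
theorem fam_fam {Y' : Finset κ} {β' : κ → ℂ} {A' : κ → Finset ℕ} :
    fam Y' β' A' (fam Y β A φ) =
      fam (Y ×ˢ Y') (fun y => β y.1 * β' y.2) (fun y => A y.1 ∪ A' y.2) φ := by
  unfold fam
  rw [Finset.sum_product_right]
  refine Finset.sum_congr rfl fun y' _ => ?_
  rw [← Finsupp.mapDomain.addMonoidHom_apply, map_sum, Finset.smul_sum]
  refine Finset.sum_congr rfl fun y _ => ?_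
  rw [Finsupp.mapDomain.addMonoidHom_apply, Finsupp.mapDomain_smul, ← Finsupp.mapDomain_comp,
    smul_smul, mul_comm]
  congr 2
  funext S
  simp [Finset.union_assoc]

theorem mapDomain_union_apply_support {A : Finset ℕ} {T : Finset ℕ}
    (h : T ∈ (φ.mapDomain (· ∪ A)).support) : ∃ S ∈ φ.support, T = S ∪ A := by
  have := Finsupp.mapDomain_support h
  simp only [Finset.mem_image] at this
  obtain ⟨S, h1, h2⟩ := this
  exact ⟨S, h1, h2.symm⟩

theorem mem_support_fam {T : Finset ℕ} (h : T ∈ (fam Y β A φ).support) :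
    ∃ y ∈ Y, ∃ S ∈ φ.support, T = S ∪ A y := by
  classical
  have := Finsupp.support_finsetSum h
  simp only [Finset.mem_biUnion] at this
  obtain ⟨y, hy, hT⟩ := this
  obtain ⟨S, h1, h2⟩ := mapDomain_union_apply_support (Finsupp.support_smul hT)
  exact ⟨y, hy, S, h1, h2⟩

theorem Below.fam {b' : ℕ} (h : Below b φ) (hb : b ≤ b') (hA : ∀ y ∈ Y, ∀ a ∈ A y, a < b') :
    Below b' (fam Y β A φ) := by
  intro T hT a ha
  obtain ⟨y, hy, S, hS, rfl⟩ := mem_support_fam hT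
  rcases Finset.mem_union.1 ha with h' | h'
  · exact (h S hS a h').trans_le hb
  · exact hA y hy a h'

theorem Below.smul (h : Below b φ) (z : ℂ) : Below b (z • φ) := fun S hS =>
  h S (Finsupp.support_smul hS)

theorem gate_fam (g : Finset ℕ → QState) :
    gate g (fam Y β A φ) = ∑ y ∈ Y, β y • gate (fun S => g (S ∪ A y)) φ := by
  rw [fam, gate_sum]
  refine Finset.sum_congr rfl fun y _ => ?_
  rw [gate_smul, gate_mapDomain]
  rfl

theorem gate_congr {g g' : Finset ℕ → QState} (h : ∀ S ∈ φ.support, g S = g' S) :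
    gate g φ = gate g' φ := by
  simp only [gate, Finsupp.linearCombination_apply]
  exact Finset.sum_congr rfl fun S hS => by simp only [h S hS]

theorem gate_smul_left {g : Finset ℕ → QState} {z : ℂ} :
    gate (fun S => z • g S) φ = z • gate g φ := by
  simp only [gate, Finsupp.linearCombination_apply, Finsupp.sum, Finset.smul_sum]
  exact Finset.sum_congr rfl fun S _ => smul_comm _ _ _

theorem gate_add_left {g g' : Finset ℕ → QState} :
    gate (fun S => g S + g' S) φ = gate g φ + gate g' φ := by
  simp only [gate, Finsupp.linearCombination_apply, Finsupp.sum, smul_add,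
    Finset.sum_add_distrib]

/-- By this, NOT, CNOT and Toffoli gates on qubits above the spectator `φ` become operations on the
sets `A y` alone. -/
theorem perm_fam (u : Finset ℕ → Finset ℕ) (A' : ι → Finset ℕ)
    (h : ∀ y ∈ Y, ∀ S ∈ φ.support, u (S ∪ A y) = S ∪ A' y) :
    gate (fun S => Finsupp.single (u S) 1) (fam Y β A φ) = fam Y β A' φ := by
  rw [gate_fam, fam]
  refine Finset.sum_congr rfl fun y hy => ?_
  rw [← gate_single]
  congr 1
  exact gate_congr fun S hS => by rw [h y hy S hS]

theorem Below.mem_union (h : Below b φ) {S A : Finset ℕ} (hS : S ∈ φ.support) {a : ℕ}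
    (ha : b ≤ a) : a ∈ S ∪ A ↔ a ∈ A := by
  rw [Finset.mem_union, or_iff_right]
  exact fun h' => absurd (h S hS a h') (by omega)

theorem Below.symmDiff_union (h : Below b φ) {S A : Finset ℕ} (hS : S ∈ φ.support) {q : ℕ}
    (hq : b ≤ q) : symmDiff (S ∪ A) {q} = S ∪ symmDiff A {q} := by
  ext a
  have h1 : a ∈ S → a ≠ q := fun ha e => absurd (h S hS a ha) (by omega)
  simp only [Finset.mem_symmDiff, Finset.mem_union, Finset.mem_singleton]
  tauto

theorem fam_notGate (h : Below b φ) {q : ℕ} (hq : b ≤ q) :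
    notGate q (fam Y β A φ) = fam Y β (fun y => symmDiff (A y) {q}) φ :=
  perm_fam _ _ fun _ _ _ hS => h.symmDiff_union hS hq

theorem fam_cnot (h : Below b φ) {a q : ℕ} (ha : b ≤ a) (hq : b ≤ q) (haq : a ≠ q) :
    cnot a q (fam Y β A φ) = fam Y β (fun y => if a ∈ A y then symmDiff (A y) {q} else A y) φ :=
  perm_fam _ _ fun y _ S hS => by
    simp only [h.mem_union hS ha]
    by_cases h' : a ∈ A y <;> simp [h', haq, h.symmDiff_union hS hq]

theorem fam_ccnot (h : Below b φ) {a c q : ℕ} (ha : b ≤ a) (hc : b ≤ c) (hq : b ≤ q)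
    (haq : a ≠ q) (hcq : c ≠ q) :
    ccnot a c q (fam Y β A φ) =
      fam Y β (fun y => if a ∈ A y ∧ c ∈ A y then symmDiff (A y) {q} else A y) φ :=
  perm_fam _ _ fun y _ S hS => by
    simp only [h.mem_union hS ha, h.mem_union hS hc]
    by_cases h' : a ∈ A y ∧ c ∈ A y
    · simp [h', haq, hcq, h.symmDiff_union hS hq]
    · rw [if_neg h', if_neg (fun h'' => h' ⟨h''.1, h''.2.1⟩)]

/-- The phase `exp(2πi z/2^k)`. -/
noncomputable def ω (k z : ℕ) : ℂ :=
  Complex.exp (2 * Real.pi * Complex.I * (z : ℂ) / (2 : ℂ) ^ k)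

theorem fam_phase (h : Below b φ) {q y k : ℕ} (hq : b ≤ q) :
    phase q y k (fam Y β A φ) = fam Y (fun i => β i * if q ∈ A i then ω k y else 1) A φ := by
  rw [phase, gate_fam, fam]
  refine Finset.sum_congr rfl fun i hi => ?_
  rw [mul_smul]
  congr 1
  rw [← gate_single, ← gate_smul_left]
  exact gate_congr fun S hS => by
    simp only [h.mem_union hS hq, ω]; split_ifs <;> simp
theorem fam_had (h : Below b φ) {q : ℕ} (hq : b ≤ q) :
    had q (fam Y β A φ) = fam (Y ×ˢ (Finset.univ : Finset Bool))
      (fun y => β y.1 * ((if y.2 = true ∧ q ∈ A y.1 then -1 else 1) / (Real.sqrt 2 : ℂ)))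
      (fun y => if y.2 = true then insert q (A y.1) else (A y.1).erase q) φ := by
  rw [had, gate_fam, fam, Finset.sum_product]
  refine Finset.sum_congr rfl fun y _ => ?_
  rw [Fintype.sum_bool]
  simp only [true_and, if_true, Bool.false_eq_true, false_and, if_false, mul_smul, ← smul_add]
  congr 1
  rw [← gate_single, ← gate_single, ← gate_smul_left, ← gate_smul_left,
    ← gate_add_left]
  refine gate_congr fun S hS => ?_
  have h1 : (S ∪ A y).erase q = S ∪ (A y).erase q := by
    ext a
    have h1 : a ∈ S → a ≠ q := fun ha e => absurd (h S hS a ha) (by omega)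
    simp only [Finset.mem_erase, Finset.mem_union]
    tauto
  rw [h1, ← Finset.union_insert, add_comm]
  simp [h.mem_union hS hq]
theorem proj_fam (p p' : Finset ℕ → Prop) [DecidablePred p']
    (h : ∀ y ∈ Y, ∀ S ∈ φ.support, p (S ∪ A y) ↔ p' (A y)) :
    proj p (fam Y β A φ) = fam (Y.filter fun y => p' (A y)) β A φ := by
  classical
  rw [fam, proj_sum, fam, Finset.sum_filter]
  refine Finset.sum_congr rfl fun y hy => ?_
  rw [proj_smul]
  have : proj p (φ.mapDomain (· ∪ A y)) = if p' (A y) then φ.mapDomain (· ∪ A y) else 0 := by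
    ext T
    rw [proj_apply]
    by_cases hT : T ∈ (φ.mapDomain (· ∪ A y)).support
    · obtain ⟨S, hS, rfl⟩ := mapDomain_union_apply_support hT
      simp only [h y hy S hS]
      split_ifs <;> rfl
    · rw [Finsupp.notMem_support_iff] at hT
      rw [hT]
      split_ifs <;> simp [hT]
  rw [this]
  split_ifs <;> simp

theorem normSq_add_of_disjoint {ψ χ : QState} (h : Disjoint ψ.support χ.support) :
    normSq (ψ + χ) = normSq ψ + normSq χ := by
  classical
  rw [normSq_eq_sum (Finsupp.support_add (g₁ := ψ) (g₂ := χ)), Finset.sum_union h,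
    normSq_eq_sum subset_rfl, normSq_eq_sum subset_rfl]
  congr 1
  · refine Finset.sum_congr rfl fun S hS => ?_
    have : χ S = 0 := by simpa using Finset.disjoint_left.1 h hS
    simp [this]
  · refine Finset.sum_congr rfl fun S hS => ?_
    have : ψ S = 0 := by simpa using Finset.disjoint_right.1 h hS
    simp [this]

theorem normSq_mapDomain_of_injOn {u : Finset ℕ → Finset ℕ} (hu : Set.InjOn u φ.support) :
    normSq (φ.mapDomain u) = normSq φ := by
  rw [normSq_eq_sum (Finsupp.mapDomain_support_of_injOn φ hu).subset, normSq_eq_sum subset_rfl,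
    Finset.sum_image hu]
  exact Finset.sum_congr rfl fun S hS => by
    rw [Finsupp.mapDomain_apply' _ _ subset_rfl hu (by exact_mod_cast hS)]

/-- `φ` lives below `b` and the sets `A y` do not, so both can be recovered from a union `S ∪ A y`.
Distinct sets `A y` therefore give summands with disjoint supports. -/
theorem normSq_fam (h : Below b φ) (hA : ∀ y ∈ Y, ∀ a ∈ A y, b ≤ a) (hinj : Set.InjOn A Y) :
    normSq (fam Y β A φ) = (∑ y ∈ Y, ‖β y‖ ^ 2) * normSq φ := by
  classical
  induction Y using Finset.induction_on with
  | empty => simp [fam]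
  | insert y s hy ih =>
    have hs : fam (insert y s) β A φ = β y • φ.mapDomain (· ∪ A y) + fam s β A φ := by
      rw [fam, Finset.sum_insert hy, fam]
    have hrec : ∀ {z : ι} {S : Finset ℕ}, z ∈ insert y s → S ∈ φ.support →
        (S ∪ A z).filter (b ≤ ·) = A z := by
      intro z S hz hS
      ext a
      simp only [Finset.mem_filter]
      constructor
      · rintro ⟨h1, h2⟩; exact (h.mem_union hS h2).1 h1
      · exact fun h1 => ⟨Finset.mem_union_right _ h1, hA z hz a h1⟩
    have hrec' : ∀ {S : Finset ℕ}, S ∈ φ.support → (S ∪ A y).filter (· < b) = S := by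
      intro S hS
      ext a
      simp only [Finset.mem_filter, Finset.mem_union]
      constructor
      · rintro ⟨h1 | h1, h2⟩
        · exact h1
        · exact absurd (hA y (by simp) a h1) (by omega)
      · exact fun h1 => ⟨.inl h1, h S hS a h1⟩
    rw [hs, normSq_add_of_disjoint, ih (fun z hz => hA z (by simp [hz]))
      (hinj.mono (by simp)), Finset.sum_insert hy, add_mul, normSq_smul]
    · rw [normSq_mapDomain_of_injOn]
      intro S hS S' hS' e
      rw [← hrec' hS, ← hrec' hS']
      exact congrArg _ e
    · rw [Finset.disjoint_left]
      intro T hT hT'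
      obtain ⟨S, hS, rfl⟩ := mapDomain_union_apply_support (Finsupp.support_smul hT)
      obtain ⟨z, hz, S', hS', e⟩ := mem_support_fam hT'
      have := hrec (Finset.mem_insert_self y s) hS
      rw [e, hrec (Finset.mem_insert_of_mem hz) hS'] at this
      have := hinj (by simp [hz]) (by simp) this
      exact hy (this ▸ hz)

end QState

/-! ## Flipping a qubit under the control of a register -/

/-- `T` is the set of ones of the quantum memory after `j` rounds of the first loop of `flipIf`,
if it was `S` before. -/
def Cascade (b g v : ℕ) (S : Finset ℕ) (j : ℕ) (T : Finset ℕ) : Prop :=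
  ∀ a, a ∈ T ↔ if g ≤ a ∧ a ≤ g + j then Reads b (a - g) S v else
    if b ≤ a ∧ a < b + j then (a ∈ S ↔ v.testBit (a - b) = true) else a ∈ S

theorem cascade_zero {b g v : ℕ} {S : Finset ℕ} (h : g ∉ S) :
    Cascade b g v S 0 (symmDiff S {g}) := by
  intro a
  by_cases ha : a = g
  · subst ha; simp [Finset.mem_symmDiff, h, Reads]
  · have : ¬ (g ≤ a ∧ a ≤ g + 0) := by omega
    rw [if_neg this, if_neg (by omega), QState.mem_toggle ha]

theorem Cascade.eq_zero {b g v : ℕ} {S T : Finset ℕ} (hT : Cascade b g v S 0 T) (h : g ∉ S) :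
    symmDiff T {g} = S := by
  have : T = symmDiff S {g} := by ext a; rw [hT a, cascade_zero h a]
  simp [this]

theorem Reads.succ_iff {b r v : ℕ} {S : Finset ℕ} :
    Reads b (r + 1) S v ↔ (b + r ∈ S ↔ v.testBit r = true) ∧ Reads b r S v := by
  constructor
  · exact fun h => ⟨h r (by omega), fun i hi => h i (by omega)⟩
  · rintro ⟨h1, h2⟩ i hi
    rcases Nat.lt_succ_iff_lt_or_eq.1 hi with h | rfl
    · exact h2 i h
    · exact h1

theorem mem_ite_toggle {P : Prop} [Decidable P] {S : Finset ℕ} {q a : ℕ} :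
    (a ∈ if P then symmDiff S {q} else S) ↔ if a = q ∧ P then a ∉ S else a ∈ S := by
  by_cases hP : P <;> by_cases h : a = q <;> simp [hP, h, Finset.mem_symmDiff]

/-- The conditional NOT turns qubit `b + j` into the truth value of agreement with bit `j` of `v`.
The Toffoli gate conjoins it with the flag `g + j`, which says that the lower bits agree, and puts
the result on the fresh qubit `g + j + 1`. -/
theorem Cascade.succ {b g v j : ℕ} {S T : Finset ℕ} (hT : Cascade b g v S j T)
    (hbg : b + j < g ∨ g + j + 1 < b) (hg : g + j + 1 ∉ S) :
    Cascade b g v S (j + 1)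
      (if b + j ∈ (if v.testBit j = true then T else symmDiff T {b + j}) ∧
          g + j ∈ (if v.testBit j = true then T else symmDiff T {b + j}) then
        symmDiff (if v.testBit j = true then T else symmDiff T {b + j}) {g + j + 1}
      else (if v.testBit j = true then T else symmDiff T {b + j})) := by
  have hU : ∀ a, a ∈ (if v.testBit j = true then T else symmDiff T {b + j}) ↔
      if a = b + j then (a ∈ S ↔ v.testBit j = true) else a ∈ T := by
    intro a
    rw [← ite_not, mem_ite_toggle]
    by_cases ha : a = b + j
    · have := hT a
      rw [if_neg (by omega), if_neg (by omega)] at this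
      subst ha
      simp only [true_and, if_true, this]
      cases v.testBit j <;> simp
    · simp [ha]
  set U := (if v.testBit j = true then T else symmDiff T {b + j})
  intro a
  rw [mem_ite_toggle]
  by_cases h1 : a = g + j + 1
  · subst h1
    have h2 : g + j + 1 ∉ U := by
      rw [hU, if_neg (by omega), hT, if_neg (by omega), if_neg (by omega)]; exact hg
    have h3 : (b + j ∈ U ∧ g + j ∈ U) ↔ Reads b (j + 1) S v := by
      rw [hU, if_pos rfl, hU, if_neg (by omega), hT, if_pos (by omega), Reads.succ_iff,
        show g + j - g = j by omega]
    rw [if_pos (show g ≤ g + j + 1 ∧ g + j + 1 ≤ g + (j + 1) by omega),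
      show g + j + 1 - g = j + 1 by omega, ← h3]
    by_cases h4 : b + j ∈ U ∧ g + j ∈ U
    · rw [if_pos ⟨rfl, h4⟩]; exact ⟨fun _ => h4, fun _ => h2⟩
    · rw [if_neg (fun h => h4 h.2)]; exact ⟨fun h => absurd h h2, fun h => absurd h h4⟩
  · rw [if_neg (by tauto), hU]
    by_cases h2 : a = b + j
    · rw [if_pos h2, if_neg (by omega), if_pos (by omega), h2, show b + j - b = j by omega]
    · rw [if_neg h2, hT]
      by_cases h3 : g ≤ a ∧ a ≤ g + j
      · rw [if_pos h3, if_pos (by omega)]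
      · rw [if_neg h3, if_neg (show ¬ (g ≤ a ∧ a ≤ g + (j + 1)) by omega)]
        by_cases h4 : b ≤ a ∧ a < b + j
        · rw [if_pos h4, if_pos (by omega)]
        · rw [if_neg h4, if_neg (by omega)]

/-- The same two involutions in the opposite order undo a round and return the flag `g + j + 1` to
`0`. -/
theorem Cascade.pred {b g v j : ℕ} {S T : Finset ℕ} (hT : Cascade b g v S (j + 1) T)
    (hbg : b + j < g ∨ g + j + 1 < b) (hg : g + j + 1 ∉ S) :
    Cascade b g v S j
      (if v.testBit j = true then
        (if b + j ∈ T ∧ g + j ∈ T then symmDiff T {g + j + 1} else T)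
      else symmDiff (if b + j ∈ T ∧ g + j ∈ T then symmDiff T {g + j + 1} else T) {b + j}) := by
  have hV : ∀ a, a ∈ (if b + j ∈ T ∧ g + j ∈ T then symmDiff T {g + j + 1} else T) ↔
      if a = g + j + 1 then False else a ∈ T := by
    intro a
    rw [mem_ite_toggle]
    by_cases h1 : a = g + j + 1
    · subst h1
      have h3 : (b + j ∈ T ∧ g + j ∈ T) ↔ Reads b (j + 1) S v := by
        rw [hT, if_neg (by omega), if_pos (by omega), hT, if_pos (by omega), Reads.succ_iff,
          show g + j - g = j by omega, show b + j - b = j by omega]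
      have h4 := hT (g + j + 1)
      rw [if_pos (by omega), show g + j + 1 - g = j + 1 by omega] at h4
      simp only [true_and, if_true, h3, h4, iff_false]
      by_cases h5 : Reads b (j + 1) S v
      · simp [h5, h3.2 h5]
      · have := mt h3.1 h5
        simp [h5, this]
    · simp [h1]
  set V := (if b + j ∈ T ∧ g + j ∈ T then symmDiff T {g + j + 1} else T)
  intro a
  rw [← ite_not, mem_ite_toggle]
  by_cases h2 : a = b + j
  · subst h2
    have h3 := hT (b + j)
    rw [if_neg (by omega), if_pos (by omega), show b + j - b = j by omega] at h3
    rw [if_neg (show ¬ (g ≤ b + j ∧ b + j ≤ g + j) by omega),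
      if_neg (show ¬ (b ≤ b + j ∧ b + j < b + j) by omega)]
    have h5 : b + j ∈ V ↔ b + j ∈ T := by rw [hV, if_neg (by omega)]
    simp only [h5, h3]
    cases v.testBit j <;> simp
  · rw [if_neg (by tauto), hV]
    by_cases h1 : a = g + j + 1
    · subst h1
      rw [if_pos rfl, if_neg (show ¬ (g ≤ g + j + 1 ∧ g + j + 1 ≤ g + j) by omega),
        if_neg (show ¬ (b ≤ g + j + 1 ∧ g + j + 1 < b + j) by omega)]
      simpa using hg
    · rw [if_neg h1, hT]
      by_cases h3 : g ≤ a ∧ a ≤ g + j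
      · rw [if_pos h3, if_pos (by omega)]
      · rw [if_neg h3, if_neg (show ¬ (g ≤ a ∧ a ≤ g + (j + 1)) by omega)]
        by_cases h4 : b ≤ a ∧ a < b + j
        · rw [if_pos h4, if_pos (by omega)]
        · rw [if_neg h4, if_neg (by omega)]

-- The target lies outside of the register and of the flags, so toggling it commutes with the
-- computation of the flags: the intermediate state is the one belonging to the toggled set.
open Classical in
theorem Cascade.flip {b g v r q : ℕ} {S T : Finset ℕ} (hT : Cascade b g v S r T)
    (hq : q < b ∨ b + r ≤ q) (hqg : q < g ∨ g + r < q) :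
    Cascade b g v (if Reads b r S v then symmDiff S {q} else S) r
      (if g + r ∈ T then symmDiff T {q} else T) := by
  have h0 : g + r ∈ T ↔ Reads b r S v := by
    rw [hT, if_pos (by omega), show g + r - g = r by omega]
  have hS : ∀ a, a ≠ q → (a ∈ (if Reads b r S v then symmDiff S {q} else S) ↔ a ∈ S) := by
    intro a ha
    rw [mem_ite_toggle, if_neg (by tauto)]
  have hR : ∀ k ≤ r, (Reads b k (if Reads b r S v then symmDiff S {q} else S) v ↔
      Reads b k S v) := by
    intro k hk
    exact forall₂_congr fun i hi => by rw [hS _ (by omega)]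
  intro a
  rw [mem_ite_toggle]
  by_cases ha : a = q
  · have h1 := hT a
    rw [if_neg (by omega), if_neg (by omega)] at h1
    rw [if_neg (show ¬ (g ≤ a ∧ a ≤ g + r) by omega),
      if_neg (show ¬ (b ≤ a ∧ a < b + r) by omega), mem_ite_toggle]
    simp only [h0, h1]
  · rw [if_neg (by tauto), hS a ha, hT]
    by_cases h3 : g ≤ a ∧ a ≤ g + r
    · rw [if_pos h3, if_pos h3, hR _ (by omega)]
    · rw [if_neg h3, if_neg h3]

namespace Expr

variable (a b : Expr)

theorem nodes_add : (a + b).nodes = a.nodes + b.nodes + 1 := rfl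
theorem ok_add : (a + b).ok = (a.ok && b.ok) := rfl
theorem nodes_sub : (a - b).nodes = a.nodes + b.nodes + 1 := rfl
theorem ok_sub : (a - b).ok = (a.ok && b.ok) := rfl
theorem small_sub_eq : (a - b).small = (a.small && b.small) := rfl
theorem nodes_one : (1 : Expr).nodes = 1 := rfl
theorem ok_one : (1 : Expr).ok = true := rfl
theorem small_one : (1 : Expr).small = true := rfl
theorem nodes_var (v : ℕ) : (Sieve.var v).nodes = 2 := rfl
theorem ok_var (v : ℕ) : (Sieve.var v).ok = true := rfl
theorem small_var (v : ℕ) : (Sieve.var v).small = smallTape v := rfl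
theorem nodes_bit : (bit a b).nodes = a.nodes + b.nodes + 4 := by
  show a.nodes + (b.nodes + 1) + 1 + 1 + 1 = _
  omega
theorem ok_bit : (bit a b).ok = (a.ok && (b.ok && b.small)) := by
  show (a.ok && (b.ok && b.small) && true) = _
  rw [Bool.and_true]

end Expr

namespace Setting

open Sieve QState Expr

variable {X : Type*} {n : ℕ} {K : Setting X n}
variable {ι : Type*} {base : ℕ} {Y : Finset ι} {β : ι → ℂ} {A : ι → Finset ℕ} {φ : QState}
  {M : ℕ → ℕ → ℕ}

-- Compute the flags, copy the last one onto the target, and compute backwards. The flags are `0`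
-- before and after, so nothing that depends on the index is left behind.
open Classical in
theorem Det.flipIf {b r v q : Expr} {bv rv vv qv gv : ℕ} (hφ : Below base φ)
    (hb : b.ok = true ∧ b.nodes ≤ 5) (hr : r.ok = true ∧ r.small = true ∧ r.nodes ≤ 5)
    (hv : v.ok = true ∧ v.nodes ≤ 12) (hq : q.ok = true ∧ q.nodes ≤ 12)
    (hev : ∀ M', Frame [i0] M M' →
      b.eval M' = bv ∧ r.eval M' = rv ∧ v.eval M' = vv ∧ q.eval M' = qv)
    (hg : M qg 0 = gv) (hbase : base ≤ bv) (hbaseq : base ≤ qv) (hbg : bv + rv ≤ gv ∨ gv + rv < bv)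
    (hbaseg : base ≤ gv) (hbQ : bv + rv ≤ K.Qb)
    (hqb : qv < bv ∨ bv + rv ≤ qv) (hqg : qv < gv ∨ gv + rv < qv)
    (hgQ : gv + rv < K.Qb) (hqQ : qv < K.Qb) (hrB : rv ≤ K.B)
    (hA : ∀ y ∈ Y, ∀ a ∈ A y, a < gv ∨ gv + rv < a) :
    K.Det (flipIf b r v q) M (fam Y β A φ) fun M' ψ' => Frame [i0] M M' ∧
      ψ' = fam Y β (fun y => if Reads bv rv (A y) vv then symmDiff (A y) {qv} else A y) φ := by
  obtain ⟨hb1, hb2⟩ := hb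
  obtain ⟨hr1, hr2, hr3⟩ := hr
  obtain ⟨hv1, hv2⟩ := hv
  obtain ⟨hq1, hq2⟩ := hq
  have hgM : ∀ M', Frame [i0] M M' → M' qg 0 = gv := fun M' h => by rw [h qg (by decide), hg]
  have hqgA : (var qg).Adm := ⟨rfl, by decide⟩
  have hlt : (Expr.bin .lt (var i0) r).Adm :=
    ⟨by simp [ok, var, hr1], by simp [nodes, var]; omega⟩
  have hi0 : smallTape i0 = true := rfl
  have hbitA : (bit v (var i0)).Adm :=
    ⟨by simp [ok_bit, ok_var, small_var, hv1, hi0], by simp only [nodes_bit, nodes_var]; omega⟩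
  have hbitA' : (bit v (r - 1 - var i0)).Adm :=
    ⟨by simp [ok_bit, ok_var, ok_sub, ok_one, small_sub_eq, small_one, small_var, hv1, hr1, hr2, hi0],
      by simp only [nodes_bit, nodes_sub, nodes_one, nodes_var]; omega⟩
  have hbi : (b + var i0).Adm :=
    ⟨by simp [ok_add, ok_var, hb1], by simp only [nodes_add, nodes_var]; omega⟩
  have hgi : (var qg + var i0).Adm := ⟨rfl, by decide⟩
  have hgi1 : (var qg + var i0 + 1).Adm := ⟨rfl, by decide⟩
  have hgr : (var qg + r).Adm :=
    ⟨by simp [ok_add, ok_var, hr1], by simp only [nodes_add, nodes_var]; omega⟩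
  refine Det.cons (Det.notGate hqgA (by simp [hg]; omega) fun _ => ?_)
  rw [eval_var, hg, fam_notGate hφ (by omega)]
  have hgA : ∀ y ∈ Y, ∀ i ≤ rv, gv + i ∉ A y := fun y hy i hi h => by
    rcases hA y hy _ h with h | h <;> omega
  -- the first loop
  refine Det.cons (Det.forLt hlt (by decide) hrB (fun j M' ψ' => Frame [i0] M M' ∧
    ∃ A', ψ' = fam Y β A' φ ∧ ∀ y ∈ Y, Cascade bv gv vv (A y) j (A' y)) ?_ ?_ ?_ ?_)
  · exact ⟨(Frame.refl _ _).upd (by decide) _ _, _, rfl, fun y hy =>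
      cascade_zero (hgA y hy 0 (by omega))⟩
  · rintro j hj M' ψ' ⟨hf, -⟩ -
    exact (hev M' hf).2.1
  · rintro j hj M' ψ' ⟨hf, A', rfl, hA'⟩ hj' -
    obtain ⟨e1, e2, e3, e4⟩ := hev M' hf
    have e5 := hgM M' hf
    have hbit : (bit v (var i0)).eval M' = 0 ↔ vv.testBit j = false := by
      rw [eval_bit_eq_zero, e3, eval_var, hj']
    refine Det.cons (Det.mono (R := fun M'' ψ'' => M'' = M' ∧ ψ'' = fam Y β (fun y =>
      if vv.testBit j = true then A' y else symmDiff (A' y) {bv + j}) φ)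
      (Q := fun M'' ψ'' => M'' = M' ∧ ψ'' = fam Y β (fun y =>
      if vv.testBit j = true then A' y else symmDiff (A' y) {bv + j}) φ)
      (Det.ite hbitA (fun h => ?_) fun h => ?_) (fun _ _ h => h) |>.mono ?_)
    · have h' : vv.testBit j = true := by rw [Ne, hbit] at h; simpa using h
      exact Det.skip ⟨rfl, by simp [h']⟩
    · have h' := hbit.1 h
      have he : (b + var i0).eval M' = bv + j := by simp [e1, hj']
      refine Det.notGate hbi (by rw [he]; omega) ⟨rfl, ?_⟩
      rw [he, fam_notGate hφ (by omega)]; simp [h']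
    · rintro _ _ ⟨rfl, rfl⟩ -
      refine Det.single (Det.ccnot hbi hgi hgi1 ?_ ?_ ?_ ?_)
      · simp [e1, hj']; omega
      · simp [e5, hj']; omega
      · simp [e5, hj']; omega
      · simp only [eval_add, e1, eval_var, hj', e5, eval_one]
        refine ⟨trivial, hf.upd (by decide) _ _, _, fam_ccnot hφ (by omega) (by omega) (by omega)
          (by omega) (by omega), fun y hy => ?_⟩
        exact (hA' y hy).succ (by omega) (by
          have := hgA y hy (j + 1) (by omega); rwa [← add_assoc] at this)
  rintro M₁ ψ₁ ⟨hf₁, A₁, rfl, hA₁⟩ - -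
  obtain ⟨e1, e2, e3, e4⟩ := hev M₁ hf₁
  have e5 := hgM M₁ hf₁
  -- flip the target
  refine Det.cons (Det.cnot hgr ⟨hq1, by omega⟩ (by simp [e5, e2]; omega) (by rw [e4]; omega)
    fun _ => ?_)
  simp only [eval_add, eval_var, e5, e2, e4]
  rw [fam_cnot hφ (by omega) (by omega) (by omega)]
  set A₀ : ι → Finset ℕ := fun y => if Reads bv rv (A y) vv then symmDiff (A y) {qv} else A y
  have hgA₀ : ∀ y ∈ Y, ∀ i ≤ rv, gv + i ∉ A₀ y := fun y hy i hi => by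
    rw [mem_ite_toggle, if_neg (by omega)]
    exact hgA y hy i hi
  have hbi' : (b + (r - 1 - var i0)).Adm :=
    ⟨by simp [ok_add, ok_sub, ok_one, ok_var, hb1, hr1],
      by simp only [nodes_add, nodes_sub, nodes_one, nodes_var]; omega⟩
  have hgi' : (var qg + (r - 1 - var i0)).Adm :=
    ⟨by simp [ok_add, ok_sub, ok_one, ok_var, hr1],
      by simp only [nodes_add, nodes_sub, nodes_one, nodes_var]; omega⟩
  have hgi1' : (var qg + (r - 1 - var i0) + 1).Adm :=
    ⟨by simp [ok_add, ok_sub, ok_one, ok_var, hr1],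
      by simp only [nodes_add, nodes_sub, nodes_one, nodes_var]; omega⟩
  -- the second loop
  refine Det.cons (Det.forLt hlt (by decide) hrB (fun j M' ψ' => Frame [i0] M M' ∧
    ∃ A', ψ' = fam Y β A' φ ∧ ∀ y ∈ Y, Cascade bv gv vv (A₀ y) (rv - j) (A' y)) ?_ ?_ ?_ ?_)
  · exact ⟨hf₁.upd (by decide) _ _, _, rfl, fun y hy => (hA₁ y hy).flip hqb hqg⟩
  · rintro j hj M' ψ' ⟨hf, -⟩ -
    exact (hev M' hf).2.1
  · rintro j hj M' ψ' ⟨hf, A', rfl, hA'⟩ hj' -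
    obtain ⟨e1, e2, e3, e4⟩ := hev M' hf
    have e5 := hgM M' hf
    -- The second loop runs downwards: its round `j` undoes round `k = rv - 1 - j` of the first.
    obtain ⟨k, hk⟩ : ∃ k, rv = j + 1 + k := ⟨rv - (j + 1), by omega⟩
    have e6 : (r - 1 - var i0).eval M' = k := by simp [e2, hj']; omega
    rw [show rv - j = k + 1 by omega] at hA'
    rw [show rv - (j + 1) = k by omega]
    have hbit : (bit v (r - 1 - var i0)).eval M' = 0 ↔ vv.testBit k = false := by
      rw [eval_bit_eq_zero, e3, e6]
    refine Det.cons (Det.ccnot hbi' hgi' hgi1' ?_ ?_ ?_ ?_)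
    · rw [eval_add, e1, e6]; omega
    · rw [eval_add, e6, eval_var, e5]; omega
    · rw [eval_add, eval_add, e6, eval_var, e5, eval_one]; omega
    · intro _
      simp only [eval_add (b := r - 1 - var i0), e6, e1, eval_var, e5]
      rw [eval_add, eval_add, e6, eval_var, e5, eval_one, fam_ccnot hφ (by omega) (by omega)
        (by omega) (by omega) (by omega)]
      have key := fun y hy => (hA' y hy).pred (by omega) (by
          have := hgA₀ y hy (k + 1) (by omega); rwa [← add_assoc] at this)
      refine Det.single (Det.ite hbitA' (fun h => ?_) fun h => ?_)
      · have h' : vv.testBit k = true := by rw [Ne, hbit] at h; simpa using h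
        refine Det.skip ⟨hj', hf.upd (by decide) _ _, _, rfl, fun y hy => ?_⟩
        have := key y hy
        rwa [if_pos h'] at this
      · have h' := hbit.1 h
        have he : (b + (r - 1 - var i0)).eval M' = bv + k := by rw [eval_add, e1, e6]
        refine Det.notGate hbi' (by rw [he]; omega) ⟨hj', hf.upd (by decide) _ _, _,
          (congrArg (fun a => QState.notGate a _) he).trans (fam_notGate hφ (by omega)),
          fun y hy => ?_⟩
        have := key y hy
        rwa [h', if_neg (by simp)] at this
  rintro M₂ ψ₂ ⟨hf₂, A₂, rfl, hA₂⟩ - -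
  have e5' := hgM M₂ hf₂
  refine Det.single (Det.notGate hqgA (by simp [e5']; omega) ⟨hf₂, ?_⟩)
  rw [eval_var, e5', fam_notGate hφ (by omega)]
  refine fam_congr (fun _ _ => rfl) fun y hy => ?_
  have := hA₂ y hy
  rw [Nat.sub_self] at this
  exact this.eq_zero (hgA₀ y hy 0 (by omega))

end Setting

/-! ## Partial measurements -/

namespace Setting

open Sieve QState Expr

variable {X : Type*} {n : ℕ} {K : Setting X n}
variable {ι κ : Type*} {base : ℕ} {Y : Finset ι} {β : ι → ℂ} {A : ι → Finset ℕ} {φ : QState}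
  {M : ℕ → ℕ → ℕ} {ψ : QState} {c : Cmd}

theorem Prb.map {E : (ι → ℝ) → ℝ} {P : ι → (ℕ → ℕ → ℕ) → QState → Prop}
    {E' : (κ → ℝ) → ℝ} {P' : κ → (ℕ → ℕ → ℕ) → QState → Prop} (e : ι → κ)
    (h : K.Prb c M ψ E P) (hE : ∀ g : κ → ℝ, (∀ i, 0 ≤ g i) → E (fun i => g (e i)) ≤ E' g)
    (hP : ∀ i M' ψ', P i M' ψ' → P' (e i) M' ψ') : K.Prb c M ψ E' P' :=
  fun σ T h1 h2 h3 h4 h5 G g hg hG hD =>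
    (h σ T h1 h2 h3 h4 h5 G (fun i => g (e i)) (fun _ => hg _)
      (fun i σ' hl hp => hG (e i) σ' hl (hP _ _ _ hp)) hD).trans (hE g hg)

theorem fam_erase (Z : Finset ι) (q : ℕ) (hZ : ∀ y ∈ Z, q ∈ A y) :
    fam Z β (fun y => symmDiff (A y) {q}) φ = fam Z β (fun y => (A y).erase q) φ := by
  refine fam_congr (fun _ _ => rfl) fun y hy => ?_
  ext a
  have := hZ y hy
  simp only [Finset.mem_symmDiff, Finset.mem_singleton, Finset.mem_erase]
  by_cases h : a = q
  · subst h; simp [this]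
  · simp [h]

/-- After the outcome `1` the qubit belongs to every remaining `A y`, so the NOT gate just erases it
from all of them; both outcomes then have the same form. -/
theorem Prb.measReset {q : Expr} {qv : ℕ} (hφ : Below base φ) (hq : q.Adm)
    (hev : ∀ M', Frame [vo] M M' → q.eval M' = qv) (hbase : base ≤ qv) (hqQ : qv < K.Qb)
    (hB : 1 ≤ K.B) :
    K.Prb (measReset q) M (fam Y β A φ)
      (fun g : Bool → ℝ =>
        (fam (Y.filter fun y => qv ∈ A y ↔ false = true) β (fun y => (A y).erase qv) φ).normSq *
          g false +
        (fam (Y.filter fun y => qv ∈ A y ↔ true = true) β (fun y => (A y).erase qv) φ).normSq *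
          g true)
      fun o M' ψ' => Frame [vo] M M' ∧ M' vo 0 = o.toNat ∧
        ψ' = fam (Y.filter fun y => qv ∈ A y ↔ o = true) β (fun y => (A y).erase qv) φ := by
  have hq0 : q.eval M = qv := hev M (Frame.refl _ _)
  have hproj : ∀ o : Bool, (fam Y β A φ).proj (fun S => qv ∈ S ↔ o = true) =
      fam (Y.filter fun y => qv ∈ A y ↔ o = true) β A φ := fun o =>
    proj_fam (fun S => qv ∈ S ↔ o = true) (fun S => qv ∈ S ↔ o = true)
      fun y _ S hS => by rw [hφ.mem_union hS hbase]
  have h1 : fam (Y.filter fun y => qv ∈ A y ↔ false = true) β A φ =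
      fam (Y.filter fun y => qv ∈ A y ↔ false = true) β (fun y => (A y).erase qv) φ :=
    fam_congr (fun _ _ => rfl) fun y hy => by
      simp only [Finset.mem_filter] at hy
      rw [Finset.erase_eq_of_notMem (by simp [hy.2])]
  have h2 : (fam (Y.filter fun y => qv ∈ A y ↔ true = true) β A φ).notGate qv =
      fam (Y.filter fun y => qv ∈ A y ↔ true = true) β (fun y => (A y).erase qv) φ := by
    rw [fam_notGate hφ hbase]
    exact fam_erase _ _ fun y hy => by simpa using (Finset.mem_filter.1 hy).2
  refine Prb.mono (Prb.cons_det (Prb.meas (t := vo) hq (by omega) (by decide) hB)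
    (P := fun o M' ψ' => Frame [vo] M M' ∧ M' vo 0 = o.toNat ∧
        ψ' = fam (Y.filter fun y => qv ∈ A y ↔ o = true) β (fun y => (A y).erase qv) φ)
    ?_) ?_ fun _ _ _ h => h
  · rintro o _ _ ⟨rfl, rfl⟩ - -
    have hf : Frame [vo] M (upd M vo 0 o.toNat) := (Frame.refl _ _).upd (by decide) _ _
    rw [hq0, hproj]
    refine Det.single (Det.when ⟨rfl, by decide⟩ (fun h => Det.single ?_) fun h => ?_)
    · have ho : o = true := by cases o <;> simp at h ⊢
      subst ho
      refine Det.notGate hq (by rw [hev _ hf]; exact hqQ) ⟨hf, by simp, ?_⟩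
      rw [hev _ hf, h2]
    · have ho : o = false := by cases o <;> simp at h ⊢
      subst ho
      exact ⟨hf, by simp, h1⟩
  · intro g _
    rw [hq0]
    have e1 := hproj false
    have e2 := hproj true
    simp only [iff_true, Bool.false_eq_true, iff_false] at e1 e2 h1 h2 ⊢
    rw [e1, e2, h1, ← normSq_notGate qv (fam (Y.filter fun y => qv ∈ A y) β A φ), h2]

theorem normSq_fam_split {qv : ℕ} (hφ : Below base φ) (hbase : base ≤ qv) :
    (fam (Y.filter fun y => qv ∈ A y ↔ false = true) β (fun y => (A y).erase qv) φ).normSq +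
    (fam (Y.filter fun y => qv ∈ A y ↔ true = true) β (fun y => (A y).erase qv) φ).normSq =
      (fam Y β A φ).normSq := by
  have hproj : ∀ o : Bool, (fam Y β A φ).proj (fun S => qv ∈ S ↔ o = true) =
      fam (Y.filter fun y => qv ∈ A y ↔ o = true) β A φ := fun o =>
    proj_fam (fun S => qv ∈ S ↔ o = true) (fun S => qv ∈ S ↔ o = true)
      fun y _ S hS => by rw [hφ.mem_union hS hbase]
  rw [← normSq_proj_add (fun S => qv ∈ S) (fam Y β A φ)]
  have e1 := hproj false
  have e2 := hproj true
  simp only [iff_true, Bool.false_eq_true, iff_false] at e1 e2 ⊢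
  rw [e1, e2]
  congr 1
  · refine congrArg normSq (fam_congr (fun _ _ => rfl) fun y hy => ?_)
    simp only [Finset.mem_filter] at hy
    rw [Finset.erase_eq_of_notMem hy.2]
  · rw [← normSq_notGate qv (fam _ β A φ), fam_notGate hφ hbase, fam_erase]
    exact fun y hy => (Finset.mem_filter.1 hy).2

/-- For measurements whose outcome is ignored: the label type `Unit` merges the two branches, whose
squared norms add up to that of the state before. -/
theorem Prb.measReset_unit {q : Expr} {qv : ℕ} (hφ : Below base φ) (hq : q.Adm)
    (hev : ∀ M', Frame [vo] M M' → q.eval M' = qv) (hbase : base ≤ qv) (hqQ : qv < K.Qb)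
    (hB : 1 ≤ K.B) :
    K.Prb (Sieve.measReset q) M (fam Y β A φ) (fun g : Unit → ℝ => (fam Y β A φ).normSq * g ())
      fun _ M' ψ' => Frame [vo] M M' ∧
        ∃ Y' ⊆ Y, ψ' = fam Y' β (fun y => (A y).erase qv) φ := by
  refine Prb.map (fun _ => ()) (Prb.measReset hφ hq hev hbase hqQ hB) ?_ ?_
  · intro g _
    rw [← add_mul, normSq_fam_split hφ hbase]
  · rintro o M' ψ' ⟨hf, -, rfl⟩
    exact ⟨hf, _, Finset.filter_subset _ _, rfl⟩

theorem sum_range_two_mul (N : ℕ) (a : ℕ → ℝ) :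
    ∑ x ∈ Finset.range (2 * N), a x = ∑ x ∈ Finset.range N, (a x + a (x + N)) := by
  rw [two_mul, Finset.sum_range_add, Finset.sum_add_distrib]
  simp [add_comm]

theorem mod_two_pow_succ_eq_iff {l x j : ℕ} {o : Bool} (hx : x < 2 ^ j) :
    l % 2 ^ (j + 1) = x + o.toNat * 2 ^ j ↔
      l % 2 ^ j = x ∧ (l.testBit j = true ↔ o = true) := by
  have h := Nat.mod_mul (x := l) (a := 2 ^ j) (b := 2)
  rw [pow_succ, h, Nat.testBit_eq_decide_div_mod_eq, decide_eq_true_eq]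
  have h1 := Nat.mod_lt l (Nat.two_pow_pos j)
  rcases Nat.mod_two_eq_zero_or_one (l / 2 ^ j) with h2 | h2 <;> cases o <;> simp [h2] <;> omega

/-- The bits of the label are measured from the lowest on, so after `j` rounds the indices with
label `x` modulo `2 ^ j` remain. Each bit is computed onto `qf` by going through the whole table of
labels with `flipIf`. This takes time exponential in `R`, but besides the register only `qf` and the
flags are used. -/
theorem Prb.measLabel {k : Expr} {v R kv bv fv gv : ℕ} {Y : Finset ℕ} {β : ℕ → ℂ}
    (hφ : Below base φ) (hv : v = vval ∨ v = vseg)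
    (hk : k.ok = true ∧ k.nodes ≤ 10) (hev : ∀ M', Frame [v, i0, i1, i2, vo] M M' → k.eval M' = kv)
    (hR : M vR 0 = R) (hb : M vbase 0 = bv) (hf : M qf 0 = fv) (hg : M qg 0 = gv)
    (hY : ∀ y ∈ Y, y < 2 ^ R) (hlab : ∀ y ∈ Y, M Alab y < 2 ^ kv)
    (hbase : base ≤ bv) (hbf : bv + R ≤ fv) (hfg : fv < gv) (hgQ : gv + R < K.Qb)
    (hRB : 2 ^ R ≤ K.B) (hkB : 2 ^ kv ≤ K.B) :
    K.Prb (measLabel k v) M (fam Y β (encode bv R) φ)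
      (fun g => ∑ x ∈ Finset.range (2 ^ kv),
        (fam (Y.filter fun y => M Alab y = x) β (encode bv R) φ).normSq * g x)
      fun x M' ψ' => Frame [v, i0, i1, i2, vo] M M' ∧ M' v 0 = x ∧ x < 2 ^ kv ∧
        ψ' = fam (Y.filter fun y => M Alab y = x) β (encode bv R) φ := by
  obtain ⟨hk1, hk2⟩ := hk
  have hfv : ∀ t ∈ [vR, vbase, qf, qg, Alab], t ∉ [v, i0, i1, i2, vo] := by
    rcases hv with rfl | rfl <;> decide
  have hv36 : v < 36 := by rcases hv with rfl | rfl <;> decide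
  have hvs : smallTape v = true := by rcases hv with rfl | rfl <;> rfl
  have hvi : v ∉ [i0, i1, i2, vo] := by rcases hv with rfl | rfl <;> decide
  have hvi1 : i1 ≠ v ∧ v ≠ i1 := by rcases hv with rfl | rfl <;> decide
  have hvA : (var v + pow (var i1)).Adm := by rcases hv with rfl | rfl <;> exact ⟨rfl, by decide⟩
  have hB1 : 1 ≤ K.B := Nat.one_le_two_pow.trans hRB
  set p : ℕ → ℕ → ℝ := fun j x =>
    (fam (Y.filter fun y => M Alab y % 2 ^ j = x) β (encode bv R) φ).normSq with hp
  have hpnn : ∀ j x, 0 ≤ p j x := fun j x => normSq_nonneg _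
  -- The conditional expectation, given that the label is `x` modulo `2 ^ j`. If `p j x = 0`, the
  -- quotient takes the default value `0`, which is harmless because it is multiplied by `p j x`.
  set F : ℕ → ℕ → (ℕ → ℝ) → ℝ := fun j x g =>
    (p (j + 1) x * g x + p (j + 1) (x + 2 ^ j) * g (x + 2 ^ j)) / p j x with hF
  have hnum : ∀ j x (g : ℕ → ℝ), (∀ i, 0 ≤ g i) →
      0 ≤ p (j + 1) x * g x + p (j + 1) (x + 2 ^ j) * g (x + 2 ^ j) := fun j x g hg =>
    add_nonneg (mul_nonneg (hpnn _ _) (hg _)) (mul_nonneg (hpnn _ _) (hg _))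
  have hlast : ∀ x, (Y.filter fun y => M Alab y % 2 ^ kv = x) = Y.filter fun y => M Alab y = x :=
    fun x => Finset.filter_congr fun y hy => by rw [Nat.mod_eq_of_lt (hlab y hy)]
  have hVnn : ∀ j (g : ℕ → ℝ), (∀ i, 0 ≤ g i) → 0 ≤ ∑ x ∈ Finset.range (2 ^ j), p j x * g x :=
    fun j g hg => Finset.sum_nonneg fun x _ => mul_nonneg (hpnn _ _) (hg _)
  have hmain : K.Prb (Sieve.measLabel k v) M (fam Y β (encode bv R) φ)
      (fun g => ∑ x ∈ Finset.range (2 ^ kv), p kv x * g x)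
      fun x M' ψ' => Frame [v, i0, i1, i2, vo] M M' ∧ M' v 0 = x ∧ x < 2 ^ kv ∧
        ψ' = fam (Y.filter fun y => M Alab y % 2 ^ kv = x) β (encode bv R) φ := by
    refine Prb.det_cons (Det.asgSmall adm_zero hv36 (by simp) fun _ _ => Prb.single ?_) (hVnn kv)
    refine Prb.forLt (N := kv) ⟨by simp [ok, ok_var, hk1], by simp [nodes, nodes_var]; omega⟩
      (by decide) ((Nat.lt_two_pow_self).le.trans hkB)
      (fun j x M' ψ' => Frame [v, i0, i1, i2, vo] M M' ∧ M' v 0 = x ∧ x < 2 ^ j ∧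
        ψ' = fam (Y.filter fun y => M Alab y % 2 ^ j = x) β (encode bv R) φ)
      F (fun j x g hg => div_nonneg (hnum j x g hg) (hpnn _ _))
      (fun j g => ∑ x ∈ Finset.range (2 ^ j), p j x * g x) (i₀ := 0) ?_ ?_ (hVnn kv) ?_ ?_ ?_ ?_
    · intro g _
      simp [hp, Nat.mod_one]
    · intro j _ g hg
      rw [pow_succ, mul_comm (2 ^ j) 2, sum_range_two_mul]
      refine Finset.sum_le_sum fun x _ => ?_
      by_cases h0 : p j x = 0
      · rw [h0, zero_mul]; exact hnum j x g hg
      · rw [hF, mul_div_cancel₀ _ h0]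
    · refine ⟨((Frame.refl _ _).upd (by simp) _ _).upd (by simp) _ _, ?_, by simp, by
        simp [Nat.mod_one]⟩
      rw [upd_ne hvi1.2]; simp
    · rintro j - x M' ψ' ⟨hfr, -⟩ -
      exact hev M' hfr
    · rintro j hj x M' _ ⟨hfr, hvx, hx, rfl⟩ hj' hne hM'
      have eR : M' vR 0 = R := by rw [hfr vR (hfv _ (by decide)), hR]
      have eb : M' vbase 0 = bv := by rw [hfr vbase (hfv _ (by decide)), hb]
      have ef : M' qf 0 = fv := by rw [hfr qf (hfv _ (by decide)), hf]
      have eg : M' qg 0 = gv := by rw [hfr qg (hfv _ (by decide)), hg]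
      have eA : M' Alab = M Alab := hfr Alab (hfv _ (by decide))
      set Y' := Y.filter fun y => M Alab y % 2 ^ j = x with hY'
      have hY'R : ∀ y ∈ Y', y < 2 ^ R := fun y hy => hY y (Finset.mem_filter.1 hy).1
      have hqfe : ∀ y, fv ∉ encode bv R y := fun y h => by
        have := mem_encode.1 h; omega
      -- Midway through the table: bit `j` of the label is already on `fv` for the indices below
      -- `i`.
      set A' : ℕ → ℕ → Finset ℕ := fun i y =>
        if y < i ∧ (M Alab y).testBit j = true then symmDiff (encode bv R y) {fv}
        else encode bv R y with hA'
      have hA'm : ∀ i y a, a ≠ fv → (a ∈ A' i y ↔ a ∈ encode bv R y) := fun i y a ha => by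
        rw [mem_ite_toggle, if_neg (by tauto)]
      have hne' : p j x ≠ 0 := fun h => hne (normSq_eq_zero.1 h)
      refine Prb.mono (E := fun g => p (j + 1) x * g x + p (j + 1) (x + 2 ^ j) * g (x + 2 ^ j))
        ?_ (fun g _ => by
          show _ ≤ p j x * (_ / p j x)
          rw [mul_div_cancel₀ _ hne']) (fun _ _ _ h => h)
      refine Prb.det_cons (Det.mono (R := fun M₁ ψ₁ => Frame [i0, i2] M' M₁ ∧
        ψ₁ = fam Y' β (A' (2 ^ R)) φ) (Q := fun M₁ ψ₁ => Frame [i0, i2] M' M₁ ∧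
        ψ₁ = fam Y' β (A' (2 ^ R)) φ) (Det.forLt (N := 2 ^ R) ⟨rfl, by decide⟩ (by decide) hRB
        (fun i M₁ ψ₁ => Frame [i0, i2] M' M₁ ∧ ψ₁ = fam Y' β (A' i) φ) ?_ ?_ ?_ ?_)
        (fun _ _ h => h) |>.mono ?_) (hnum j x)
      · exact ⟨(Frame.refl _ _).upd (by decide) _ _, by simp [hA']⟩
      · rintro i - M₁ ψ₁ ⟨hf₁, -⟩ -
        rw [eval_pow, eval_var, hf₁ vR (by decide), eR]
      · rintro i hi M₁ _ ⟨hf₁, rfl⟩ hi' -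
        have hi1 : M₁ i1 0 = j := by rw [hf₁ i1 (by decide), hj']
        have hbit : (bit (rd Alab (var i2)) (var i1)).eval M₁ = 0 ↔
            (M Alab i).testBit j = false := by
          rw [eval_bit_eq_zero, eval_rd, eval_var, eval_var, hi1, hi', hf₁ Alab (by decide), eA]
        refine Det.single (Det.when ⟨rfl, by decide⟩ (fun h => Det.single ?_) fun h => ?_)
        · have hti : (M Alab i).testBit j = true := by rw [Ne, hbit] at h; simpa using h
          refine (Det.flipIf (bv := bv) (rv := R) (vv := i) (qv := fv) (gv := gv) hφ
            ⟨rfl, by decide⟩ ⟨rfl, rfl, by decide⟩ ⟨rfl, by decide⟩ ⟨rfl, by decide⟩ ?_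
            (by rw [hf₁ qg (by decide), eg]) hbase (by omega) (by omega) (by omega) (by omega)
            (by omega) (by omega) hgQ (by omega) (by have := @Nat.lt_two_pow_self R; omega) ?_).mono ?_
          · intro M₂ hf₂
            simp only [eval_var, hf₂ vbase (by decide), hf₂ vR (by decide), hf₂ i2 (by decide),
              hf₂ qf (by decide), hf₁ vbase (by decide), hf₁ vR (by decide),
              hf₁ qf (by decide), eb, eR, ef, hi', and_self]
          · intro y hy a ha
            by_cases h : a = fv
            · omega
            · rw [hA'm _ _ _ h] at ha; have := mem_encode.1 ha; omega
          · rintro M₂ _ ⟨hf₂, rfl⟩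
            refine ⟨by rw [hf₂ i2 (by decide), hi'], ((hf₁.trans (hf₂.mono (by decide)) (fun _ h => h)).upd
              (by decide) _ _), fam_congr (fun _ _ => rfl) fun y hy => ?_⟩
            have hr : Reads bv R (A' i y) i ↔ y = i := by
              rw [← reads_encode_iff (b := bv) (hY'R y hy) hi]
              exact forall₂_congr fun l hl => by rw [hA'm _ _ _ (by omega)]
            simp only [hr]
            by_cases hyi : y = i
            · subst hyi
              rw [if_pos rfl, hA']
              simp [hti]
            · rw [if_neg hyi, hA']
              have : y < i + 1 ↔ y < i := by omega
              simp only [this]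
        · refine ⟨hi', hf₁.upd (by decide) _ _, fam_congr (fun _ _ => rfl) fun y hy => ?_⟩
          have h' := hbit.1 h
          simp only [hA']
          congr 1
          by_cases hyi : y = i
          · subst hyi; simp [h']
          · have : y < i + 1 ↔ y < i := by omega
            simp only [this]
      · rintro M₁ ψ₁ ⟨h1, h2⟩ -; exact ⟨h1, h2⟩
      rintro M₁ _ ⟨hf₁, rfl⟩ - -
      have hmem : ∀ y ∈ Y', (fv ∈ A' (2 ^ R) y ↔ (M Alab y).testBit j = true) := fun y hy => by
        rw [hA', mem_ite_toggle]
        by_cases h : (M Alab y).testBit j = true <;> simp [h, hY'R y hy, hqfe y]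
      have herase : ∀ y ∈ Y', (A' (2 ^ R) y).erase fv = encode bv R y := fun y _ => by
        ext a
        rw [Finset.mem_erase]
        by_cases ha : a = fv
        · subst ha; simp [hqfe y]
        · simp [ha, hA'm _ _ _ ha]
      have hfilt : ∀ o : Bool,
          fam (Y'.filter fun y => fv ∈ A' (2 ^ R) y ↔ o = true) β
            (fun y => (A' (2 ^ R) y).erase fv) φ =
          fam (Y.filter fun y => M Alab y % 2 ^ (j + 1) = x + o.toNat * 2 ^ j) β
            (encode bv R) φ := fun o => by
        have : (Y'.filter fun y => fv ∈ A' (2 ^ R) y ↔ o = true) =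
            Y.filter fun y => M Alab y % 2 ^ (j + 1) = x + o.toNat * 2 ^ j := by
          rw [hY', Finset.filter_filter]
          refine Finset.filter_congr fun y hy => ?_
          rw [mod_two_pow_succ_eq_iff hx]
          refine and_congr_right fun h => ?_
          rw [hmem y (by rw [hY', Finset.mem_filter]; exact ⟨hy, h⟩)]
        rw [this]
        exact fam_congr (fun _ _ => rfl) fun y hy => herase y (by
          rw [← this] at hy; exact (Finset.mem_filter.1 hy).1)
      refine Prb.map (fun o : Bool => x + o.toNat * 2 ^ j) (Prb.cons_det
        (Prb.measReset (qv := fv) hφ ⟨rfl, by decide⟩ ?_ (by omega) (by omega) hB1)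
        (P := fun o M₃ ψ₃ => M₃ i1 0 = j ∧ Frame [v, i0, i1, i2, vo] M (upd M₃ i1 0 (j + 1)) ∧
          upd M₃ i1 0 (j + 1) v 0 = x + o.toNat * 2 ^ j ∧ x + o.toNat * 2 ^ j < 2 ^ (j + 1) ∧
          ψ₃ = fam (Y.filter fun y => M Alab y % 2 ^ (j + 1) = x + o.toNat * 2 ^ j) β
            (encode bv R) φ) ?_) ?_ ?_
      · intro M₂ hf₂
        rw [eval_var, hf₂ qf (by decide), hf₁ qf (by decide), ef]
      · rintro o M₂ _ ⟨hf₂, ho, rfl⟩ - -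
        rw [hfilt]
        have hx2 : x + o.toNat * 2 ^ j < 2 ^ (j + 1) := by
          rw [pow_succ]; cases o <;> simp <;> omega
        have hfr₂ : Frame [v, i0, i1, i2, vo] M M₂ :=
          (hfr.trans (us := [i0, i2]) hf₁ (by simp)).trans hf₂ (by simp)
        have h2v : M₂ v 0 = x := by
          rw [hf₂ v (by simp at hvi ⊢; tauto), hf₁ v (by simp at hvi ⊢; tauto), hvx]
        have h2i : M₂ i1 0 = j := by rw [hf₂ i1 (by decide), hf₁ i1 (by decide), hj']
        have hval : x + o.toNat * 2 ^ j ≤ K.B := by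
          have : 2 ^ (j + 1) ≤ 2 ^ kv := Nat.pow_le_pow_right (by omega) (by omega)
          omega
        refine Det.single (Det.when ⟨rfl, by decide⟩ (fun h => Det.single ?_) fun h => ?_)
        · have ho' : o.toNat = 1 := by
            rw [eval_var, ho] at h; cases o <;> simp at h ⊢
          have he : (var v + pow (var i1)).eval M₂ = x + o.toNat * 2 ^ j := by
            simp [h2v, h2i, ho']
          refine Det.asgSmall hvA hv36 (by rw [he]; exact hval) ⟨?_, ?_, ?_, hx2, rfl⟩
          · rw [upd_ne hvi1.1, h2i]
          · exact (hfr₂.upd (by simp) _ _).upd (by simp) _ _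
          · rw [upd_ne hvi1.2, upd_self, he]
        · have ho' : o.toNat = 0 := by rwa [eval_var, ho] at h
          refine ⟨h2i, hfr₂.upd (by simp) _ _, ?_, hx2, rfl⟩
          rw [upd_ne hvi1.2, h2v, ho']; simp
      · intro g _
        rw [hfilt, hfilt]
        simp [hp]
      · rintro o M₃ ψ₃ h
        exact h
    · rintro x M' ψ' ⟨h1, h2, h3, h4⟩ -
      exact ⟨h1, h2, h3, h4⟩
  refine Prb.mono hmain (fun g _ => le_of_eq ?_) ?_
  · simp only [hp, hlast]
  · rintro x M' ψ' ⟨h1, h2, h3, h4⟩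
    exact ⟨h1, h2, h3, by rw [h4, hlast]⟩

end Setting

/-! ## Collimation -/

theorem encode_zero (q x : ℕ) : encode q 0 x = ∅ := by simp [encode]

theorem encode_succ (q k x : ℕ) : encode q (k + 1) x =
    if x.testBit k = true then symmDiff (encode q k x) {q + k} else encode q k x := by
  ext a
  rw [mem_ite_toggle, mem_encode, mem_encode]
  by_cases h : a = q + k
  · subst h; simp
  · have : a < q + (k + 1) ↔ a < q + k := by omega
    simp [h, this]

namespace Setting

open Sieve QState Expr

variable {X : Type*} {n : ℕ} {K : Setting X n}
variable {base : ℕ} {φ : QState} {M : ℕ → ℕ → ℕ} {ψ : QState} {β : ℕ → ℂ} {A : ℕ → Finset ℕ}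

/-- Add to the index a register that contains a function of it. -/
theorem Det.xorTable {b r W k V d : Expr} {ev bv rv kv dv gv : ℕ} {Wv Vv : ℕ → ℕ}
    (hφ : Below base φ) (hb : b.ok = true ∧ b.nodes ≤ 5)
    (hr : r.ok = true ∧ r.small = true ∧ r.nodes ≤ 5) (hW : W.ok = true ∧ W.nodes ≤ 12)
    (hV : V.ok = true ∧ V.nodes ≤ 12) (hk : k.ok = true ∧ k.nodes ≤ 5)
    (hd : d.ok = true ∧ d.nodes ≤ 5)
    (hev : ∀ M', Frame [i0, i3, i4] M M' → b.eval M' = bv ∧ r.eval M' = rv ∧ k.eval M' = kv ∧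
      d.eval M' = dv ∧ W.eval M' = Wv (M' i3 0) ∧ V.eval M' = Vv (M' i3 0))
    (he : M ve 0 = ev) (hg : M qg 0 = gv) (hbase : base ≤ bv) (hbased : base ≤ dv)
    (hbg : bv + rv ≤ gv ∨ gv + rv < bv)
    (hbaseg : base ≤ gv) (hbQ : bv + rv ≤ K.Qb) (hdb : dv + kv ≤ bv ∨ bv + rv ≤ dv) (hdg : dv + kv ≤ gv ∨ gv + rv < dv)
    (hgQ : gv + rv < K.Qb) (hdQ : dv + kv ≤ K.Qb) (hrB : rv ≤ K.B) (hkB : kv ≤ K.B)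
    (heB : 2 ^ ev ≤ K.B)
    (hA : ∀ z < 2 ^ ev, ∀ a ∈ A z, a < gv ∨ gv + rv < a)
    (hread : ∀ z < 2 ^ ev, Reads bv rv (A z) (Wv z)) (hWlt : ∀ z < 2 ^ ev, Wv z < 2 ^ rv)
    (hinj : ∀ z < 2 ^ ev, ∀ z' < 2 ^ ev, Wv z = Wv z' → z = z') :
    K.Det (Sieve.forLt i3 (pow (var ve)) [Sieve.forLt i4 k [
        Sieve.when (bit V (var i4)) [Sieve.flipIf b r W (d + var i4)]]]) M
      (fam (Finset.range (2 ^ ev)) β A φ) fun M' ψ' => Frame [i0, i3, i4] M M' ∧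
        ψ' = fam (Finset.range (2 ^ ev)) β (fun z => symmDiff (A z) (encode dv kv (Vv z))) φ := by
  obtain ⟨hV1, hV2⟩ := hV
  obtain ⟨hk1, hk2⟩ := hk
  obtain ⟨hd1, hd2⟩ := hd
  -- Entries below `j` have received their whole value, entry `j` the lowest `i` bits of it, later
  -- entries nothing.
  set A' : ℕ → ℕ → ℕ → Finset ℕ := fun j i z =>
    symmDiff (A z) (if z < j then encode dv kv (Vv z) else if z = j then encode dv i (Vv z) else ∅)
    with hA'
  have hmem : ∀ j, ∀ i ≤ kv, ∀ z a, ¬(dv ≤ a ∧ a < dv + kv) → (a ∈ A' j i z ↔ a ∈ A z) := by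
    intro j i hi z a ha
    simp only [hA', Finset.mem_symmDiff]
    split_ifs <;> simp only [mem_encode, Finset.notMem_empty] <;> grind
  have hA'0 : ∀ j, A' j 0 = fun z => symmDiff (A z) (if z < j then encode dv kv (Vv z) else ∅) := by
    intro j; funext z; simp [hA', encode_zero]
  have hA's : ∀ j, A' j kv = A' (j + 1) 0 := by
    intro j; rw [hA'0]; funext z
    simp only [hA']
    congr 1
    by_cases h : z < j
    · simp [h, show z < j + 1 by omega]
    · by_cases h' : z = j
      · simp [h']
      · simp [h, h', show ¬ z < j + 1 by omega]
  refine Det.forLt (N := 2 ^ ev) ⟨rfl, by decide⟩ (by decide) heB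
    (fun j M₁ ψ₁ => Frame [i0, i3, i4] M M₁ ∧ ψ₁ = fam (Finset.range (2 ^ ev)) β (A' j 0) φ)
    ?_ ?_ ?_ ?_
  · refine ⟨(Frame.refl _ _).upd (by decide) _ _, ?_⟩
    rw [hA'0]; simp [← Finset.bot_eq_empty]
  · rintro j - M₁ ψ₁ ⟨hf, -⟩ -
    rw [eval_pow, eval_var, hf ve (by decide), he]
  · rintro j hj M₁ _ ⟨hf, rfl⟩ hj' -
    refine Det.single (Det.forLt (N := kv) ⟨by simp [ok, ok_var, hk1], by simp [nodes, nodes_var]; omega⟩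
      (by decide) hkB
      (fun i M₂ ψ₂ => Frame [i0, i4] M₁ M₂ ∧ ψ₂ = fam (Finset.range (2 ^ ev)) β (A' j i) φ)
      ?_ ?_ ?_ ?_)
    · exact ⟨(Frame.refl _ _).upd (by decide) _ _, rfl⟩
    · rintro i - M₂ ψ₂ ⟨hf₂, -⟩ -
      exact (hev M₂ (hf.trans hf₂ (by decide))).2.2.1
    · rintro i hi M₂ _ ⟨hf₂, rfl⟩ hi' -
      have hfr : Frame [i0, i3, i4] M M₂ := hf.trans hf₂ (by decide)
      have h3 : M₂ i3 0 = j := by rw [hf₂ i3 (by decide), hj']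
      have hbit : (bit V (var i4)).eval M₂ = 0 ↔ (Vv j).testBit i = false := by
        rw [eval_bit_eq_zero, eval_var, hi', (hev M₂ hfr).2.2.2.2.2, h3]
      have hsucc : ∀ z < 2 ^ ev, A' j (i + 1) z =
          if z = j ∧ (Vv j).testBit i = true then symmDiff (A' j i z) {dv + i} else A' j i z := by
        intro z _
        simp only [hA', encode_succ]
        by_cases h : z = j
        · subst h
          by_cases ht : (Vv z).testBit i = true <;> simp [ht, symmDiff_assoc]
        · simp [h]
      refine Det.single (Det.when ⟨by simp [ok_bit, ok_var, small_var, hV1]; rfl,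
        by simp only [nodes_bit, nodes_var]; omega⟩ (fun h => Det.single ?_) fun h => ?_)
      · have ht : (Vv j).testBit i = true := by rw [Ne, hbit] at h; simpa using h
        refine (Det.flipIf (bv := bv) (rv := rv) (vv := Wv j) (qv := dv + i) (gv := gv) hφ hb hr hW
          ⟨by simp [ok_add, ok_var, hd1], by simp only [nodes_add, nodes_var]; omega⟩ ?_
          (by rw [hfr qg (by decide), hg]) hbase (by omega) hbg hbaseg hbQ (by omega)
          (by omega) hgQ (by omega) hrB ?_).mono ?_
        · intro M₃ hf₃
          obtain ⟨e1, e2, -, e4, e5, -⟩ := hev M₃ (hfr.trans hf₃ (by decide))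
          refine ⟨e1, e2, ?_, ?_⟩
          · rw [e5, hf₃ i3 (by decide), h3]
          · rw [eval_add, e4, eval_var, hf₃ i4 (by decide), hi']
        · intro z hz a ha
          by_cases h : dv ≤ a ∧ a < dv + kv
          · omega
          · exact hA z (Finset.mem_range.1 hz) a ((hmem j i hi.le z a h).1 ha)
        · rintro M₃ _ ⟨hf₃, rfl⟩
          refine ⟨by rw [hf₃ i4 (by decide), hi'],
            (hf₂.trans hf₃ (by decide)).upd (by decide) _ _, fam_congr (fun _ _ => rfl) ?_⟩
          intro z hz
          rw [Finset.mem_range] at hz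
          rw [hsucc z hz]
          -- The register that is read is disjoint from the target, so it still contains `Wv z`, and
          -- `Wv` separates the entries.
          have hR : Reads bv rv (A' j i z) (Wv j) ↔ z = j := by
            have hRz : Reads bv rv (A' j i z) (Wv z) := fun l hl => by
              rw [hmem j i hi.le z _ (by omega)]; exact hread z hz l hl
            constructor
            · exact fun h => hinj z hz j hj (reads_unique hRz h (hWlt z hz) (hWlt j hj))
            · rintro rfl; exact hRz
          simp only [hR, ht, and_true]
      · refine ⟨hi', hf₂.upd (by decide) _ _, fam_congr (fun _ _ => rfl) fun z hz => ?_⟩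
        rw [hsucc z (Finset.mem_range.1 hz), if_neg]
        simp [hbit.1 h]
    · rintro M₂ _ ⟨hf₂, rfl⟩ -
      refine ⟨by rw [hf₂ i3 (by decide), hj'], ((hf.trans hf₂ (by decide)).upd (by decide) _ _), ?_⟩
      rw [hA's]
  · rintro M₁ _ ⟨hf, rfl⟩ -
    refine ⟨hf, fam_congr (fun _ _ => rfl) fun z hz => ?_⟩
    rw [hA'0]
    simp only [Finset.mem_range.1 hz, if_true]

/-- Move a register to qubits that are `0`. -/
theorem Det.moveReg {ev bv yv : ℕ} (hφ : Below base φ) (he : M ve 0 = ev) (hb : M vbase 0 = bv)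
    (hy : M qy 0 = yv) (hbase : base ≤ bv) (hby : bv + ev ≤ yv) (hyQ : yv + ev ≤ K.Qb)
    (heB : ev ≤ K.B) {Y : Finset ℕ} :
    K.Det (Sieve.forLt i4 (var ve) [
        Cmd.cnot (var qy + var i4) (var vbase + var i4),
        Cmd.cnot (var vbase + var i4) (var qy + var i4)]) M (fam Y β (encode yv ev) φ)
      fun M' ψ' => Frame [i4] M M' ∧ ψ' = fam Y β (encode bv ev) φ := by
  -- The lowest `i` bits have been moved, the others are still at `yv`.
  set A' : ℕ → ℕ → Finset ℕ := fun i z =>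
    (encode yv ev z).filter (fun a => yv + i ≤ a) ∪ encode bv i z with hA'
  have hA'm : ∀ i z a, a ∈ A' i z ↔
      (yv ≤ a ∧ a < yv + ev ∧ z.testBit (a - yv) = true ∧ yv + i ≤ a) ∨
        (bv ≤ a ∧ a < bv + i ∧ z.testBit (a - bv) = true) := by
    intro i z a
    simp only [hA', Finset.mem_union, Finset.mem_filter, mem_encode, and_assoc]
  refine Det.forLt (N := ev) ⟨rfl, by decide⟩ (by decide) heB
    (fun i M₁ ψ₁ => Frame [i4] M M₁ ∧ ψ₁ = fam Y β (A' i) φ) ?_ ?_ ?_ ?_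
  · refine ⟨(Frame.refl _ _).upd (by decide) _ _, fam_congr (fun _ _ => rfl) fun z _ => ?_⟩
    ext a
    rw [hA'm, mem_encode]
    constructor
    · rintro ⟨h1, h2, h3⟩; exact .inl ⟨h1, h2, h3, by omega⟩
    · rintro (⟨h1, h2, h3, _⟩ | ⟨h1, h2, _⟩)
      · exact ⟨h1, h2, h3⟩
      · omega
  · rintro i - M₁ ψ₁ ⟨hf, -⟩ -
    rw [eval_var, hf ve (by decide), he]
  · rintro i hi M₁ _ ⟨hf, rfl⟩ hi' -
    have e1 : (var qy + var i4).eval M₁ = yv + i := by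
      rw [eval_add, eval_var, eval_var, hf qy (by decide), hy, hi']
    have e2 : (var vbase + var i4).eval M₁ = bv + i := by
      rw [eval_add, eval_var, eval_var, hf vbase (by decide), hb, hi']
    refine Det.cons (Det.cnot ⟨rfl, by decide⟩ ⟨rfl, by decide⟩ (by omega) (by omega) fun _ =>
      Det.single (Det.cnot ⟨rfl, by decide⟩ ⟨rfl, by decide⟩ (by omega) (by omega) ?_))
    rw [e1, e2, fam_cnot hφ (by omega) (by omega) (by omega),
      fam_cnot hφ (by omega) (by omega) (by omega)]
    refine ⟨hi', hf.upd (by decide) _ _, fam_congr (fun _ _ => rfl) fun z _ => ?_⟩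
    have hyi : yv + i ∈ A' i z ↔ z.testBit i = true := by
      rw [hA'm]
      constructor
      · rintro (⟨_, _, h, _⟩ | ⟨_, h, _⟩)
        · simpa using h
        · omega
      · intro h; exact .inl ⟨by omega, by omega, by simpa using h, le_rfl⟩
    have hbi : bv + i ∉ A' i z := by rw [hA'm]; omega
    ext a
    by_cases ht : z.testBit i = true
    · rw [if_pos (hyi.2 ht), if_pos (by simp [Finset.mem_symmDiff, hbi]), hA'm]
      simp only [Finset.mem_symmDiff, Finset.mem_singleton]
      by_cases h1 : a = bv + i
      · subst h1
        simp [hbi, ht]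
        omega
      · by_cases h2 : a = yv + i
        · subst h2
          have := hyi.2 ht
          simp [this]
          omega
        · simp only [h1, h2, not_false_eq_true, and_true, false_and, or_false, hA'm]
          have e3 : yv + i ≤ a ↔ yv + (i + 1) ≤ a := by omega
          have e4 : a < bv + i ↔ a < bv + (i + 1) := by omega
          rw [e3, e4]
    · have hyi' : yv + i ∉ A' i z := by rwa [hyi]
      simp only [if_neg hyi', if_neg hbi]
      rw [hA'm, hA'm]
      by_cases h1 : a = bv + i
      · subst h1
        simp [ht]
        omega
      · by_cases h2 : a = yv + i
        · subst h2
          simp [ht]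
          omega
        · have e3 : yv + i ≤ a ↔ yv + (i + 1) ≤ a := by omega
          have e4 : a < bv + i ↔ a < bv + (i + 1) := by omega
          rw [e3, e4]
  · rintro M₁ _ ⟨hf, rfl⟩ -
    refine ⟨hf, fam_congr (fun _ _ => rfl) fun z _ => ?_⟩
    ext a
    rw [hA'm, mem_encode]
    constructor
    · rintro (⟨h1, h2, _⟩ | h)
      · omega
      · exact h
    · exact fun h => .inr h

/-- Measure and discard a register. -/
theorem Prb.eraseReg {R bv : ℕ} (hφ : Below base φ) (hR : M vR 0 = R) (hb : M vbase 0 = bv)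
    (hbase : base ≤ bv) (hbQ : bv + R ≤ K.Qb) (hRB : R ≤ K.B) (hB : 1 ≤ K.B) {Y : Finset ℕ} :
    K.Prb (Sieve.forLt i4 (var vR) [Sieve.measReset (var vbase + var i4)]) M
      (fam Y β (encode bv R) φ) (fun g : Unit → ℝ => (fam Y β (encode bv R) φ).normSq * g ())
      fun _ M' ψ' => Frame [i4, vo] M M' ∧ ∃ γ : ℂ, ψ' = γ • φ := by
  have hnn : ∀ (ψ : QState) (g : Unit → ℝ), (∀ i, 0 ≤ g i) → 0 ≤ ψ.normSq * g () :=
    fun ψ g hg => mul_nonneg (normSq_nonneg _) (hg _)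
  set A' : ℕ → ℕ → Finset ℕ := fun i y => (encode bv R y).filter (fun a => bv + i ≤ a) with hA'
  refine Prb.forLt (N := R) ⟨rfl, by decide⟩ (by decide) hRB
    (fun i _ M₁ ψ₁ => Frame [i4, vo] M M₁ ∧ ∃ Y' : Finset ℕ, ψ₁ = fam Y' β (A' i) φ)
    (fun _ _ g => g ()) (fun _ _ g hg => hg _)
    (fun _ g => (fam Y β (encode bv R) φ).normSq * g ()) (i₀ := ()) (fun _ _ => le_rfl)
    (fun _ _ _ _ => le_rfl) (hnn _) ?_ ?_ ?_ ?_
  · refine ⟨(Frame.refl _ _).upd (by decide) _ _, Y, fam_congr (fun _ _ => rfl) fun y _ => ?_⟩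
    ext a
    simp only [hA', Finset.mem_filter, mem_encode]
    constructor
    · exact fun h => ⟨h, h.1⟩
    · exact fun h => h.1
  · rintro i - - M₁ ψ₁ ⟨hf, -⟩ -
    rw [eval_var, hf vR (by decide), hR]
  · rintro i hi - M₁ _ ⟨hf, Y', rfl⟩ hi' - -
    refine Prb.single (Prb.mono (Prb.measReset_unit (qv := bv + i) hφ ⟨rfl, by decide⟩ ?_ (by omega)
      (by omega) hB) (fun g _ => le_rfl) ?_)
    · intro M₂ hf₂
      rw [eval_add, eval_var, eval_var, hf₂ vbase (by decide), hf₂ i4 (by decide),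
        hf vbase (by decide), hb, hi']
    · rintro - M₂ _ ⟨hf₂, Y'', -, rfl⟩
      refine ⟨by rw [hf₂ i4 (by decide), hi'], (hf.trans hf₂ (by decide)).upd (by decide) _ _, Y'',
        fam_congr (fun _ _ => rfl) fun y _ => ?_⟩
      ext a
      simp only [hA', Finset.mem_erase, Finset.mem_filter]
      constructor
      · rintro ⟨h1, h2, h3⟩; exact ⟨h2, by omega⟩
      · rintro ⟨h2, h3⟩; exact ⟨by omega, h2, by omega⟩
  · rintro - M₁ _ ⟨hf, Y', rfl⟩ -
    -- Once the register is empty, all terms are multiples of `φ`: of the discarded vector only a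
    -- scalar remains, and the rest of the quantum memory is not disturbed.
    refine ⟨hf, ∑ y ∈ Y', β y, ?_⟩
    rw [fam, Finset.sum_smul]
    refine Finset.sum_congr rfl fun y _ => ?_
    have : A' R y = ∅ := by
      ext a
      simp only [hA', Finset.mem_filter, mem_encode, Finset.notMem_empty, iff_false]
      omega
    simp only [this, Finset.union_empty]
    rw [show (fun S : Finset ℕ => S) = id from rfl, Finsupp.mapDomain_id]

end Setting

/-! ### Phases of a given height, and the classes of indices with the same label. -/

namespace QState

theorem ω_add (k y z : ℕ) : ω k (y + z) = ω k y * ω k z := by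
  rw [ω, ω, ω, ← Complex.exp_add]
  congr 1
  push_cast
  ring

/-- This is how collimation makes progress: dividing multipliers by `2 ^ c` lowers the height by
`c`. -/
theorem ω_two_pow_mul {k c : ℕ} (h : c ≤ k) (z : ℕ) : ω k (2 ^ c * z) = ω (k - c) z := by
  obtain ⟨d, rfl⟩ := Nat.exists_eq_add_of_le h
  rw [ω, ω, Nat.add_sub_cancel_left, pow_add]
  congr 1
  have : (2 : ℂ) ^ c ≠ 0 := pow_ne_zero _ two_ne_zero
  push_cast
  field_simp

theorem norm_ω (k z : ℕ) : ‖ω k z‖ = 1 := norm_exp_phase _ _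

theorem normSq_fam_unit {ι : Type*} {b : ℕ} {Y : Finset ι} {β : ι → ℂ} {A : ι → Finset ℕ}
    {φ : QState} (h : Below b φ) (hβ : ∀ y ∈ Y, ‖β y‖ = 1) (hA : ∀ y ∈ Y, ∀ a ∈ A y, b ≤ a)
    (hinj : Set.InjOn A Y) : normSq (fam Y β A φ) = Y.card * normSq φ := by
  rw [normSq_fam h hA hinj, Finset.sum_congr rfl fun y hy => by rw [hβ y hy, one_pow]]
  simp

end QState

/-- The numbers `y < 2 ^ R` with label `x`. -/
def labelClass (lab : ℕ → ℕ) (R x : ℕ) : List ℕ := (List.range (2 ^ R)).filter fun y => lab y = x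

section

variable {lab : ℕ → ℕ} {R x : ℕ}

theorem labelClass_get {i : ℕ} (hi : i < (labelClass lab R x).length) :
    (labelClass lab R x).getD i 0 < 2 ^ R ∧ lab ((labelClass lab R x).getD i 0) = x := by
  have : (labelClass lab R x).getD i 0 ∈ labelClass lab R x := by
    rw [List.getD_eq_getElem _ _ hi]; exact List.getElem_mem hi
  simpa [labelClass] using List.mem_filter.1 this

theorem labelClass_inj {i j : ℕ} (hi : i < (labelClass lab R x).length)
    (hj : j < (labelClass lab R x).length)
    (h : (labelClass lab R x).getD i 0 = (labelClass lab R x).getD j 0) : i = j := by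
  rw [List.getD_eq_getElem _ _ hi, List.getD_eq_getElem _ _ hj] at h
  exact ((List.nodup_range.filter _).getElem_inj_iff).1 h

theorem labelClass_surj {y : ℕ} (hy : y < 2 ^ R) (h : lab y = x) :
    ∃ i < (labelClass lab R x).length, (labelClass lab R x).getD i 0 = y := by
  have : y ∈ labelClass lab R x := by
    rw [labelClass, List.mem_filter]; simp [hy, h]
  obtain ⟨i, hi, h'⟩ := List.getElem_of_mem this
  exact ⟨i, hi, by rw [List.getD_eq_getElem _ _ hi, h']⟩

theorem labelClass_length : (labelClass lab R x).length =
    ((Finset.range (2 ^ R)).filter fun y => lab y = x).card := rfl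

theorem labelClass_length_le : (labelClass lab R x).length ≤ 2 ^ R :=
  (List.length_filter_le _ _).trans (by simp)

end

theorem sum_card_filter_mul {ι κ : Type*} [DecidableEq κ] (s : Finset ι) (t : Finset κ)
    (f : ι → κ) (h : ∀ i ∈ s, f i ∈ t) (g : κ → ℝ) :
    ∑ k ∈ t, ((s.filter fun i => f i = k).card : ℝ) * g k = ∑ i ∈ s, g (f i) := by
  rw [← Finset.sum_fiberwise_of_maps_to h]
  refine Finset.sum_congr rfl fun k _ => ?_
  rw [Finset.sum_congr rfl (g := fun _ => g k) fun i hi => by rw [(Finset.mem_filter.1 hi).2]]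
  simp

/-- The table of phase multipliers after the measurement of the label `x` and the segment `q`. -/
def segTable (a : ℕ → ℕ) (c e R x q : ℕ) : ℕ → ℕ := fun z =>
  a ((labelClass (fun y => a y % 2 ^ c) R x).getD (q * 2 ^ e + z) 0) / 2 ^ c

/-- The outcome of collimation if the label is `x` and the segment `q`. -/
def collOutcome (a : ℕ → ℕ) (c e R x q : ℕ) : Option (ℕ → ℕ) :=
  if q * 2 ^ e + 2 ^ e ≤ (labelClass (fun y => a y % 2 ^ c) R x).length then
    some (segTable a c e R x q) else none

/-- The sum over the possible index pairs of a function of the outcome of collimation. -/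
def collSum (a : ℕ → ℕ) (c e R : ℕ) (g : Option (ℕ → ℕ) → ℝ) : ℝ :=
  ∑ x ∈ Finset.range (2 ^ c),
    ∑ i ∈ Finset.range (labelClass (fun y => a y % 2 ^ c) R x).length,
      g (collOutcome a c e R x (i / 2 ^ e))

/-! ### Collimation: listing a class, reindexing a segment, the whole subroutine. -/

namespace Setting

open Sieve QState Expr

variable {X : Type*} {n : ℕ} {K : Setting X n}
variable {base : ℕ} {φ : QState} {M : ℕ → ℕ → ℕ} {ψ : QState} {β : ℕ → ℂ} {A : ℕ → Finset ℕ}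

theorem Det.listClass {R x : ℕ} {lab : ℕ → ℕ} (hR : M vR 0 = R) (hx : M vval 0 = x)
    (hlen : M vlen 0 = 0) (hlab : ∀ y < 2 ^ R, M Alab y = lab y) (hRB : 2 ^ R ≤ K.B) :
    K.Det (Sieve.forLt i3 (pow (var vR)) [
      Sieve.when (bin .eq (rd Alab (var i3)) (var vval)) [
        Cmd.set Aind (var vlen) (var i3), Sieve.asg vlen (var vlen + 1)]]) M ψ
      fun M' ψ' => Frame [i3, vlen, Aind] M M' ∧ ψ' = ψ ∧
        M' vlen 0 = (labelClass lab R x).length ∧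
        ∀ i < (labelClass lab R x).length, M' Aind i = (labelClass lab R x).getD i 0 := by
  set l : ℕ → List ℕ := fun j => (List.range j).filter fun y => lab y = x with hl
  have hlj : ∀ j, (l j).length ≤ j := fun j => (List.length_filter_le _ _).trans (by simp)
  refine Det.forLt (N := 2 ^ R) ⟨rfl, by decide⟩ (by decide) hRB
    (fun j M₁ ψ₁ => Frame [i3, vlen, Aind] M M₁ ∧ ψ₁ = ψ ∧ M₁ vlen 0 = (l j).length ∧
      ∀ i < (l j).length, M₁ Aind i = (l j).getD i 0) ?_ ?_ ?_ ?_
  · refine ⟨(Frame.refl _ _).upd (by decide) _ _, rfl, ?_, by simp [hl]⟩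
    rw [upd_ne (by decide), hlen]; simp [hl]
  · rintro j - M₁ ψ₁ ⟨hf, -⟩ -
    rw [eval_pow, eval_var, hf vR (by decide), hR]
  · rintro j hj M₁ _ ⟨hf, rfl, h1, h2⟩ hj' -
    have ev : (bin .eq (rd Alab (var i3)) (var vval)).eval M₁ = if lab j = x then 1 else 0 := by
      rw [eval_eq, eval_rd, eval_var, eval_var, hj', hf Alab (by decide), hf vval (by decide),
        hlab j hj, hx]
    have hs : l (j + 1) = l j ++ if lab j = x then [j] else [] := by
      simp only [hl, List.range_succ, List.filter_append, List.filter_singleton]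
      congr 1
      by_cases h : lab j = x <;> simp [h]
    have hlt := hlj j
    refine Det.single (Det.when ⟨rfl, by decide⟩ (fun h => ?_) fun h => ?_)
    · have hx' : lab j = x := by rw [ev] at h; by_contra h'; simp [h'] at h
      rw [if_pos hx'] at hs
      refine Det.cons (Det.setSmall ⟨rfl, by decide⟩ ⟨rfl, by decide⟩ (by decide)
        (by rw [eval_var, h1]; omega) (by rw [eval_var, hj']; omega) fun _ =>
        Det.single (Det.asgSmall ⟨rfl, by decide⟩ (by decide) ?_ ?_))
      · rw [eval_add, eval_var, upd_ne (by decide), h1, eval_one]; omega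
      · simp only [eval_add, eval_var, eval_one, h1, hj']
        have e : upd M₁ Aind (l j).length j vlen 0 = (l j).length := by
          rw [upd_ne (by decide), h1]
        refine ⟨?_, (((hf.upd (by decide) _ _).upd (by decide) _ _).upd (by decide) _ _), trivial, ?_, ?_⟩
        · rw [upd_ne (by decide), upd_ne (by decide), hj']
        · rw [upd_ne (by decide), upd_self, e, hs]; simp
        · intro i hi
          rw [upd_ne (by decide), upd_ne (by decide), upd_apply, hs]
          rw [hs] at hi
          simp only [List.length_append, List.length_singleton] at hi
          by_cases h' : i = (l j).length
          · subst h'; simp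
          · rw [if_neg (by tauto), h2 i (by omega), List.getD_append _ _ _ _ (by omega)]
    · have hx' : lab j ≠ x := by intro h'; rw [ev, if_pos h'] at h; omega
      rw [if_neg hx', List.append_nil] at hs
      refine ⟨hj', hf.upd (by decide) _ _, rfl, ?_, ?_⟩
      · rw [upd_ne (by decide), hs, h1]
      · rw [hs]; intro i hi; rw [upd_ne (by decide), h2 i hi]
  · rintro M₁ ψ₁ ⟨hf, h1, h2, h3⟩ -
    exact ⟨hf, h1, h2, h3⟩

/-- A loop that fills an array. -/
theorem Det.fill {t u : ℕ} {e a v : Expr} {N : ℕ} {av vv : ℕ → ℕ} (ht : t < 36) (hu : u < 36) (htu : t ≠ u)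
    (he : e.ok = true ∧ e.nodes ≤ 20) (ha : a.Adm) (hv : v.Adm) (hN : N ≤ K.B)
    (hev : ∀ M' : ℕ → ℕ → ℕ, Frame [u, t] M M' → e.eval M' = N)
    (haev : ∀ j < N, ∀ M' : ℕ → ℕ → ℕ, Frame [u, t] M M' → M' u 0 = j →
      (∀ b, (∀ i < j, b ≠ av i) → M' t b = M t b) → a.eval M' = av j ∧ v.eval M' = vv j)
    (hinj : ∀ i < N, ∀ j < N, av i = av j → i = j) (haB : ∀ i < N, av i ≤ K.B)
    (hvB : ∀ i < N, smallTape t = true → vv i ≤ K.B) (hvs : ∀ i < N, (vv i).size ≤ K.B) :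
    K.Det (Sieve.forLt u e [Cmd.set t a v]) M ψ fun M' ψ' => Frame [u, t] M M' ∧ ψ' = ψ ∧
      (∀ i < N, M' t (av i) = vv i) ∧ ∀ b, (∀ i < N, b ≠ av i) → M' t b = M t b := by
  refine Det.forLt (N := N) ⟨by simp [ok, ok_var, he.1], by simp [nodes, nodes_var]; omega⟩
    hu hN
    (fun j M₁ ψ₁ => Frame [u, t] M M₁ ∧ ψ₁ = ψ ∧ (∀ i < j, M₁ t (av i) = vv i) ∧
      ∀ b, (∀ i < j, b ≠ av i) → M₁ t b = M t b) ?_ ?_ ?_ ?_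
  · refine ⟨(Frame.refl _ _).upd (by simp) _ _, rfl, by simp, fun b _ => ?_⟩
    rw [upd_ne htu]
  · rintro j - M₁ ψ₁ ⟨hf, -⟩ -
    exact hev M₁ hf
  · rintro j hj M₁ _ ⟨hf, rfl, h1, h2⟩ hj' -
    obtain ⟨e1, e2⟩ := haev j hj M₁ hf hj' h2
    refine Det.single (Det.set ha hv ht (by rw [e1]; exact haB j hj)
      (by rw [e2]; exact hvB j hj) (by rw [e2]; exact hvs j hj) ?_)
    rw [e1, e2]
    refine ⟨by rw [upd_ne htu.symm, hj'], ((hf.upd (by simp) _ _).upd (by simp) _ _), rfl, ?_, ?_⟩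
    · intro i hi
      rw [upd_ne htu, upd_apply]
      by_cases h : i = j
      · subst h; simp
      · rw [if_neg (fun h' => h (hinj i (by omega) j hj h'.2)), h1 i (by omega)]
    · intro b hb
      rw [upd_ne htu, upd_apply, if_neg (fun h => hb j (by omega) h.2),
        h2 b fun i hi => hb i (by omega)]
  · rintro M₁ ψ₁ ⟨hf, h1, h2, h3⟩ -
    exact ⟨hf, h1, h2, h3⟩

end Setting

/-- The tapes that collimation writes on. -/
abbrev collTapes : List ℕ := [Sieve.i0, Sieve.i1, Sieve.i2, Sieve.i3, Sieve.i4, Sieve.Alab,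
  Sieve.vval, Sieve.vseg, Sieve.vlen, Sieve.Aind, Sieve.vok, Sieve.vo, Sieve.Anew]

namespace Setting

open Sieve QState Expr

variable {X : Type*} {n : ℕ} {K : Setting X n}
variable {base : ℕ} {φ : QState} {M : ℕ → ℕ → ℕ} {ψ : QState} {β : ℕ → ℂ}

/-- The values of the parameters of a collimation. -/
structure CollParams (K : Setting X n) (M : ℕ → ℕ → ℕ) (base R cv ev : ℕ) : Prop where
  hR : M vR 0 = R
  hc : M vc 0 = cv
  he : M ve 0 = ev
  hb : M vbase 0 = base
  hf : base + R ≤ M qf 0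
  hg : M qf 0 < M qg 0
  hy : M qg 0 + R < M qy 0
  hyQ : M qy 0 + ev ≤ K.Qb
  heR : ev ≤ R
  hRB : 2 ^ R ≤ K.B
  hcB : 2 ^ cv ≤ K.B

theorem CollParams.frame {R cv ev : ℕ} {ts : List ℕ} {M' : ℕ → ℕ → ℕ}
    (h : CollParams K M base R cv ev) (hf : Frame ts M M')
    (hts : ∀ t ∈ [vR, vc, ve, vbase, qf, qg, qy], t ∉ ts) : CollParams K M' base R cv ev := by
  have e : ∀ t ∈ [vR, vc, ve, vbase, qf, qg, qy], M' t 0 = M t 0 := fun t ht => by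
    rw [hf t (hts t ht)]
  have e1 := e vR (by decide)
  have e2 := e vc (by decide)
  have e3 := e ve (by decide)
  have e4 := e vbase (by decide)
  have e5 := e qf (by decide)
  have e6 := e qg (by decide)
  have e7 := e qy (by decide)
  constructor
  · rw [e1, h.hR]
  · rw [e2, h.hc]
  · rw [e3, h.he]
  · rw [e4, h.hb]
  · rw [e5]; exact h.hf
  · rw [e5, e6]; exact h.hg
  · rw [e6, e7]; exact h.hy
  · rw [e7]; exact h.hyQ
  · exact h.heR
  · exact h.hRB
  · exact h.hcB

/-- Reindexing of a segment. -/
theorem Det.reindex {R cv ev q : ℕ} {I : ℕ → ℕ} (hφ : Below base φ)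
    (hp : CollParams K M base R cv ev) (hq : M vseg 0 = q)
    (hI : ∀ z < 2 ^ ev, M Aind (q * 2 ^ ev + z) = I z) (hIR : ∀ z < 2 ^ ev, I z < 2 ^ R)
    (hinj : ∀ z < 2 ^ ev, ∀ z' < 2 ^ ev, I z = I z' → z = z') :
    K.Det (Sieve.block [
      Sieve.forLt i3 (pow (var ve)) [Sieve.forLt i4 (var ve) [
        Sieve.when (bit (var i3) (var i4)) [
          Sieve.flipIf (var vbase) (var vR) (rd Aind (segIx (var i3))) (var qy + var i4)]]],
      Sieve.forLt i3 (pow (var ve)) [Sieve.forLt i4 (var vR) [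
        Sieve.when (bit (rd Aind (segIx (var i3))) (var i4)) [
          Sieve.flipIf (var qy) (var ve) (var i3) (var vbase + var i4)]]],
      Sieve.forLt i4 (var ve) [
        Cmd.cnot (var qy + var i4) (var vbase + var i4),
        Cmd.cnot (var vbase + var i4) (var qy + var i4)],
      Sieve.forLt i3 (pow (var ve)) [
        Cmd.set Anew (var i3) (rd As (rd Aind (segIx (var i3))) / pow (var vc))]]) M
      (fam (Finset.range (2 ^ ev)) β (fun z => encode base R (I z)) φ)
      fun M' ψ' => Frame collTapes M M' ∧ M' vok 0 = M vok 0 ∧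
        (∀ z < 2 ^ ev, M' Anew z = M As (I z) / 2 ^ cv) ∧
        ψ' = fam (Finset.range (2 ^ ev)) β (encode base ev) φ := by
  obtain ⟨hR, hc, he, hb, hf, hg, hy, hyQ, heR, hRB, hcB⟩ := hp
  have heB : 2 ^ ev ≤ K.B := (Nat.pow_le_pow_right (by omega) heR).trans hRB
  have hlt := @Nat.lt_two_pow_self R
  have hlt' := @Nat.lt_two_pow_self ev
  set I' : ℕ → ℕ := fun z => M Aind (q * 2 ^ ev + z) with hI'
  have hseg : ∀ M' : ℕ → ℕ → ℕ, M' vseg 0 = q → M' ve 0 = ev → M' Aind = M Aind →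
      (rd Aind (segIx (var i3))).eval M' = I' (M' i3 0) := fun M' h1 h2 h3 => by
    rw [eval_rd, segIx, eval_add, eval_mul, eval_pow, eval_var, eval_var, eval_var, h1, h2, h3]
  have hI2 : ∀ z < 2 ^ ev, I' z = I z := hI
  have hI'lt : ∀ z < 2 ^ ev, I' z < 2 ^ R := fun z hz => by rw [hI2 z hz]; exact hIR z hz
  have hI'inj : ∀ z < 2 ^ ev, ∀ z' < 2 ^ ev, I' z = I' z' → z = z' := fun z hz z' hz' h =>
    hinj z hz z' hz' (by rwa [hI2 z hz, hI2 z' hz'] at h)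
  have hst : fam (Finset.range (2 ^ ev)) β (fun z => encode base R (I z)) φ =
      fam (Finset.range (2 ^ ev)) β (fun z => encode base R (I' z)) φ :=
    fam_congr (fun _ _ => rfl) fun z hz => by rw [hI2 z (Finset.mem_range.1 hz)]
  rw [hst]
  refine Det.cons ((Det.xorTable (bv := base) (rv := R) (kv := ev) (dv := M qy 0) (gv := M qg 0)
    (Wv := I') (Vv := id) hφ ⟨rfl, by decide⟩ ⟨rfl, rfl, by decide⟩ ⟨rfl, by decide⟩
    ⟨rfl, by decide⟩ ⟨rfl, by decide⟩ ⟨rfl, by decide⟩ ?_ he rfl le_rfl (by omega) (by omega)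
    (by omega) (by omega) (by omega) (by omega) (by omega) (by omega) (by omega) (by omega) heB ?_
    (fun z _ => reads_encode _ _ _) hI'lt hI'inj).mono ?_)
  · intro M' hf'
    refine ⟨?_, ?_, ?_, ?_, hseg M' ?_ ?_ ?_, rfl⟩
    · rw [eval_var, hf' vbase (by decide), hb]
    · rw [eval_var, hf' vR (by decide), hR]
    · rw [eval_var, hf' ve (by decide), he]
    · rw [eval_var, hf' qy (by decide)]
    · rw [hf' vseg (by decide), hq]
    · rw [hf' ve (by decide), he]
    · rw [hf' Aind (by decide)]
  · intro z _ a ha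
    have := mem_encode.1 ha
    omega
  rintro M₁ _ ⟨hf₁, rfl⟩ -
  -- The old and the new index occupy disjoint qubits, so here the symmetric difference is a union.
  have hdisj : ∀ z a, a ∈ symmDiff (encode base R (I' z)) (encode (M qy 0) ev (id z)) ↔
      a ∈ encode base R (I' z) ∨ a ∈ encode (M qy 0) ev z := by
    intro z a
    rw [Finset.mem_symmDiff, id, mem_encode, mem_encode]
    have : ¬ (a < base + R ∧ M qy 0 ≤ a) := by omega
    tauto
  -- Controlled by the new index, the old index is added a second time and so cancels. New and old
  -- index determine each other because a segment has no repetitions.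
  refine Det.cons ((Det.xorTable (bv := M qy 0) (rv := ev) (kv := R) (dv := base) (gv := M qg 0)
    (Wv := id) (Vv := I') hφ ⟨rfl, by decide⟩ ⟨rfl, rfl, by decide⟩ ⟨rfl, by decide⟩
    ⟨rfl, by decide⟩ ⟨rfl, by decide⟩ ⟨rfl, by decide⟩ ?_ (by rw [hf₁ ve (by decide), he])
    (by rw [hf₁ qg (by decide)]) (by omega) le_rfl (by omega) (by omega) (by omega)
    (by omega) (by omega) (by omega) (by omega) (by omega) (by omega) heB ?_
    ?_ (fun z hz => hz) (fun z _ z' _ h => h)).mono ?_)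
  · intro M' hf'
    refine ⟨?_, ?_, ?_, ?_, rfl, hseg M' ?_ ?_ ?_⟩
    · rw [eval_var, hf' qy (by decide), hf₁ qy (by decide)]
    · rw [eval_var, hf' ve (by decide), hf₁ ve (by decide), he]
    · rw [eval_var, hf' vR (by decide), hf₁ vR (by decide), hR]
    · rw [eval_var, hf' vbase (by decide), hf₁ vbase (by decide), hb]
    · rw [hf' vseg (by decide), hf₁ vseg (by decide), hq]
    · rw [hf' ve (by decide), hf₁ ve (by decide), he]
    · rw [hf' Aind (by decide), hf₁ Aind (by decide)]
  · intro z _ a ha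
    rw [hdisj, mem_encode, mem_encode] at ha
    omega
  · intro z _ i hi
    rw [hdisj, mem_encode, mem_encode, id, Nat.add_sub_cancel_left]
    constructor
    · rintro (⟨_, h, _⟩ | ⟨_, _, h⟩)
      · omega
      · exact h
    · exact fun h => .inr ⟨by omega, by omega, h⟩
  rintro M₂ _ ⟨hf₂, rfl⟩ -
  have hst₂ : fam (Finset.range (2 ^ ev)) β (fun z => symmDiff (symmDiff (encode base R (I' z))
      (encode (M qy 0) ev (id z))) (encode base R (I' z))) φ =
      fam (Finset.range (2 ^ ev)) β (encode (M qy 0) ev) φ :=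
    fam_congr (fun _ _ => rfl) fun z _ => by
      rw [symmDiff_comm (encode base R (I' z)), symmDiff_assoc, symmDiff_self]
      simp
  rw [hst₂]
  have hf12 : Frame [i0, i3, i4] M M₂ := hf₁.trans hf₂ (by decide)
  refine Det.cons ((Det.moveReg (ev := ev) (bv := base) (yv := M qy 0) hφ
    (by rw [hf12 ve (by decide), he]) (by rw [hf12 vbase (by decide), hb])
    (by rw [hf12 qy (by decide)]) le_rfl (by omega) (by omega) (by omega)).mono ?_)
  rintro M₃ _ ⟨hf₃, rfl⟩ hM₃
  have hf13 : Frame [i0, i3, i4] M M₃ := hf12.trans hf₃ (by decide)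
  refine Det.single ((Det.fill (t := Anew) (u := i3) (N := 2 ^ ev) (av := fun z => z)
    (vv := fun z => M As (I' z) / 2 ^ cv) (by decide) (by decide) (by decide) ⟨rfl, by decide⟩
    ⟨rfl, by decide⟩ ⟨rfl, by decide⟩ heB ?_ ?_ (fun _ _ _ _ h => h) (fun i hi => by omega)
    (fun _ _ h => by simp [smallTape] at h) ?_).mono ?_)
  · intro M' hf'
    rw [eval_pow, eval_var, hf' ve (by decide), hf13 ve (by decide), he]
  · intro j _ M' hf' hj' _
    refine ⟨by rw [eval_var, hj'], ?_⟩
    have e3 := hseg M' (by rw [hf' vseg (by decide), hf13 vseg (by decide), hq])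
      (by rw [hf' ve (by decide), hf13 ve (by decide), he])
      (by rw [hf' Aind (by decide), hf13 Aind (by decide)])
    rw [eval_div, eval_rd, e3, eval_pow, eval_var, hf' As (by decide), hf13 As (by decide),
      hf' vc (by decide), hf13 vc (by decide), hc, hj']
  · intro z _
    have := hM₃.size_le As (I' z)
    rw [hf13 As (by decide)] at this
    exact (Nat.size_le_size (Nat.div_le_self _ _)).trans this
  · rintro M₄ ψ₄ ⟨hf₄, rfl, h1, -⟩
    refine ⟨(hf13.mono (by decide)).trans hf₄ (by decide), ?_, fun z hz => ?_, rfl⟩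
    · rw [hf₄ vok (by decide), hf13 vok (by decide)]
    · rw [h1 z hz, hI2 z hz]

end Setting

namespace Setting

open Sieve QState Expr

variable {X : Type*} {n : ℕ} {K : Setting X n}
variable {base : ℕ} {φ : QState} {M : ℕ → ℕ → ℕ} {ψ : QState} {β : ℕ → ℂ}

/-- The phases have modulus `1`, so the squared norm counts indices. The probabilities of labels and
segments all come from this. -/
theorem normSq_fam_encode {Z : Finset ℕ} {R : ℕ} {I : ℕ → ℕ} (hφ : Below base φ)
    (hβ : ∀ y, ‖β y‖ = 1) (hI : ∀ i ∈ Z, I i < 2 ^ R)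
    (hinj : ∀ i ∈ Z, ∀ j ∈ Z, I i = I j → i = j) :
    (fam Z (fun i => β (I i)) (fun i => encode base R (I i)) φ).normSq = Z.card * φ.normSq :=
  normSq_fam_unit hφ (fun _ _ => hβ _) (fun _ _ _ ha => (mem_encode.1 ha).1)
    fun i hi j hj h => hinj i hi j hj (encode_injOn base R (hI i hi) (hI j hj) h)

/-- The index is in a list of `L` indices; it is measured in which segment it is, unless the
list is shorter than a segment. -/
theorem Prb.measSegment {R cv ev L : ℕ} {I : ℕ → ℕ} (hφ : Below base φ)
    (hβ : ∀ y, ‖β y‖ = 1) (hp : CollParams K M base R cv ev) (hL : L ≤ 2 ^ R)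
    (hlen : M vlen 0 = L) (hok : M vok 0 = 0)
    (hI : ∀ i < L, M Aind i = I i) (hIR : ∀ i < L, I i < 2 ^ R)
    (hinj : ∀ i < L, ∀ j < L, I i = I j → i = j) :
    K.Prb (Sieve.when (bin .lt (pow (var ve)) (var vlen + 1)) [
        Sieve.forLt i3 (var vlen) [Cmd.set Alab (rd Aind (var i3)) (var i3 / pow (var ve))],
        Sieve.measLabel (var vR - var ve) vseg,
        Sieve.asg vok (bin .lt (segIx (pow (var ve))) (var vlen + 1))]) M
      (fam (Finset.range L) (fun i => β (I i)) (fun i => encode base R (I i)) φ)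
      (fun g => φ.normSq * ∑ i ∈ Finset.range L, g (i / 2 ^ ev))
      fun q M' ψ' => Frame collTapes M M' ∧ M' Aind = M Aind ∧
        M' vok 0 = (if q * 2 ^ ev + 2 ^ ev ≤ L then 1 else 0) ∧
        (q * 2 ^ ev + 2 ^ ev ≤ L → M' vseg 0 = q) ∧
        ψ' = fam ((Finset.range L).filter fun i => i / 2 ^ ev = q) (fun i => β (I i))
          (fun i => encode base R (I i)) φ := by
  have hp' := hp
  obtain ⟨hR, hc, he, hb, hf, hg, hy, hyQ, heR, hRB, hcB⟩ := hp'
  have hlt := @Nat.lt_two_pow_self R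
  have hB1 : 1 ≤ K.B := Nat.one_le_two_pow.trans hRB
  have hIR' : ∀ i ∈ Finset.range L, I i < 2 ^ R := fun i hi => hIR i (Finset.mem_range.1 hi)
  have hinj' : ∀ i ∈ Finset.range L, ∀ j ∈ Finset.range L, I i = I j → i = j :=
    fun i hi j hj => hinj i (Finset.mem_range.1 hi) j (Finset.mem_range.1 hj)
  have hnn : ∀ g : ℕ → ℝ, (∀ i, 0 ≤ g i) →
      0 ≤ φ.normSq * ∑ i ∈ Finset.range L, g (i / 2 ^ ev) := fun g hg =>
    mul_nonneg (normSq_nonneg _) (Finset.sum_nonneg fun _ _ => hg _)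
  have hcond : ∀ M' : ℕ → ℕ → ℕ, M' ve 0 = ev → M' vlen 0 = L → ∀ e : Expr, ∀ v, e.eval M' = v →
      (bin .lt e (var vlen + 1)).eval M' = if v ≤ L then 1 else 0 := fun M' _ h2 e v h => by
    rw [eval_lt, eval_add, eval_var, eval_one, h, h2]
    simp only [Nat.lt_succ_iff]
  have hc0 := hcond M he hlen (pow (var ve)) (2 ^ ev) (by rw [eval_pow, eval_var, he])
  refine Prb.when ⟨rfl, by decide⟩ (fun h => ?_) fun h => ?_
  · have hLe : 2 ^ ev ≤ L := by
      rw [hc0] at h; by_contra h'; simp [h'] at h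
    refine Prb.det_cons ((Det.fill (t := Alab) (u := i3) (N := L) (av := I)
      (vv := fun i => i / 2 ^ ev) (by decide) (by decide) (by decide) ⟨rfl, by decide⟩
      ⟨rfl, by decide⟩ ⟨rfl, by decide⟩ (hL.trans hRB) ?_ ?_ hinj
      (fun i hi => (hIR i hi).le.trans hRB)
      (fun i hi _ => (Nat.div_le_self _ _).trans (by omega))
      (fun i hi => ((Nat.size_le_self' _).trans (Nat.div_le_self _ _)).trans (by omega))).mono ?_) hnn
    · intro M' hf'
      rw [eval_var, hf' vlen (by decide), hlen]
    · intro j hj M' hf' hj' _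
      refine ⟨?_, ?_⟩
      · rw [eval_rd, eval_var, hj', hf' Aind (by decide), hI j hj]
      · rw [eval_div, eval_var, eval_pow, eval_var, hj', hf' ve (by decide), he]
    rintro M₁ _ ⟨hf₁, rfl, h1, -⟩ - -
    set Y : Finset ℕ := (Finset.range L).image I with hY
    have hst : ∀ (Z : Finset ℕ), Z ⊆ Finset.range L →
        fam (Z.image I) β (encode base R) φ =
          fam Z (fun i => β (I i)) (fun i => encode base R (I i)) φ := fun Z hZ =>
      fam_reindex I (fun i hi => Finset.mem_image_of_mem _ hi)
        (fun i hi j hj h => hinj' i (hZ hi) j (hZ hj) h)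
        (fun y hy => by
          obtain ⟨i, hi, rfl⟩ := Finset.mem_image.1 hy
          exact ⟨i, hi, rfl⟩)
    have hst' : ∀ q, fam (Y.filter fun y => M₁ Alab y = q) β (encode base R) φ =
        fam ((Finset.range L).filter fun i => i / 2 ^ ev = q) (fun i => β (I i))
          (fun i => encode base R (I i)) φ := fun q => by
      rw [← hst _ (Finset.filter_subset _ _), hY, Finset.filter_image]
      congr 2
      exact Finset.filter_congr fun i hi => by rw [h1 i (Finset.mem_range.1 hi)]
    rw [← hst _ subset_rfl]
    refine Prb.mono (Prb.cons_det (Prb.measLabel (k := var vR - var ve) (R := R) (kv := R - ev)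
      (bv := base) (fv := M qf 0) (gv := M qg 0) hφ (.inr rfl) ⟨rfl, by decide⟩ ?_
      (by rw [hf₁ vR (by decide), hR]) (by rw [hf₁ vbase (by decide), hb])
      (by rw [hf₁ qf (by decide)]) (by rw [hf₁ qg (by decide)]) ?_ ?_ le_rfl hf hg (by omega) hRB
      ((Nat.pow_le_pow_right (by omega) (Nat.sub_le _ _)).trans hRB)) ?_) ?_ fun _ _ _ h => h
    · intro M' hf'
      rw [eval_sub, eval_var, eval_var, hf' vR (by decide), hf' ve (by decide),
        hf₁ vR (by decide), hf₁ ve (by decide), hR, he]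
    · intro y hy
      obtain ⟨i, hi, rfl⟩ := Finset.mem_image.1 hy
      exact hIR' i hi
    · intro y hy
      obtain ⟨i, hi, rfl⟩ := Finset.mem_image.1 hy
      rw [Finset.mem_range] at hi
      rw [h1 i hi, Nat.div_lt_iff_lt_mul (Nat.two_pow_pos _), ← pow_add, Nat.sub_add_cancel heR]
      omega
    · rintro q M₂ _ ⟨hf₂, hq, -, rfl⟩ - -
      rw [hst']
      have hf₁₂ : Frame collTapes M M₂ := (hf₁.mono (by decide)).trans hf₂ (by decide)
      have e1 : M₂ ve 0 = ev := by rw [hf₁₂ ve (by decide), he]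
      have e2 : M₂ vlen 0 = L := by rw [hf₂ vlen (by decide), hf₁ vlen (by decide), hlen]
      have e3 := hcond M₂ e1 e2 (segIx (pow (var ve))) (q * 2 ^ ev + 2 ^ ev) (by
        rw [segIx, eval_add, eval_mul, eval_pow, eval_var, eval_var, e1, hq])
      refine Det.single (Det.asgSmall ⟨rfl, by decide⟩ (by decide) ?_ ?_)
      · rw [e3]; split_ifs <;> omega
      · rw [e3]
        refine ⟨hf₁₂.upd (by decide) _ _, ?_, upd_self _ _ _ _, fun _ => ?_, rfl⟩
        · rw [upd_ne (by decide), hf₂ Aind (by decide), hf₁ Aind (by decide)]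
        · rw [upd_ne (by decide), hq]
    · intro g _
      refine le_of_eq ?_
      simp only [← hY, hst']
      rw [← sum_card_filter_mul (Finset.range L) (Finset.range (2 ^ (R - ev)))
        (fun i => i / 2 ^ ev), Finset.mul_sum]
      · refine Finset.sum_congr rfl fun q _ => ?_
        rw [normSq_fam_encode hφ hβ (fun i hi => hIR' i (Finset.filter_subset _ _ hi))
          (fun i hi j hj => hinj' i (Finset.filter_subset _ _ hi) j (Finset.filter_subset _ _ hj))]
        ring
      · intro i hi
        rw [Finset.mem_range] at hi ⊢
        rw [Nat.div_lt_iff_lt_mul (Nat.two_pow_pos _), ← pow_add, Nat.sub_add_cancel heR]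
        omega
  · have hLt : ¬ 2 ^ ev ≤ L := by
      rw [hc0] at h; intro h'; simp [h'] at h
    -- With fewer than `2 ^ ev` indices nothing is measured. This counts as the outcome `0`, which
    -- the condition `q * 2 ^ ev + 2 ^ ev ≤ L` recognizes as a leftover.
    have hdiv : ∀ i ∈ Finset.range L, i / 2 ^ ev = 0 := fun i hi => by
      rw [Finset.mem_range] at hi
      exact Nat.div_eq_of_lt (by omega)
    refine Prb.mono (Prb.skip (i := 0) ?_) ?_ fun _ _ _ h => h
    · refine ⟨Frame.refl _ _, rfl, ?_, fun h' => absurd h' (by omega), ?_⟩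
      · rw [hok, if_neg (by omega)]
      · rw [Finset.filter_true_of_mem hdiv]
    · intro g _
      rw [normSq_fam_encode hφ hβ hIR' hinj',
        Finset.sum_congr rfl (g := fun _ => g 0) fun i hi => by rw [hdiv i hi]]
      simp only [Finset.sum_const, Finset.card_range, nsmul_eq_mul]
      exact le_of_eq (by ring)

/-- Measuring a phase vector of height `h` with phase multipliers `a`, to align `cv` bits. -/
theorem Prb.collimate {R cv ev h s : ℕ} (hφ : Below base φ)
    (hp : CollParams K M base R cv ev) (hh : cv ≤ h) :
    K.Prb Sieve.collimate M
      (fam (Finset.range (2 ^ R)) (fun y => ω h (M As y * s)) (encode base R) φ)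
      (fun g => φ.normSq * collSum (M As) cv ev R g)
      fun o M' ψ' => Frame collTapes M M' ∧
        (o = none → M' vok 0 = 0 ∧ ∃ γ : ℂ, ψ' = γ • φ) ∧
        ∀ tab, o = some tab → M' vok 0 = 1 ∧
          (∀ z < 2 ^ ev, M' Anew z = tab z ∧ ∃ y < 2 ^ R, tab z = M As y / 2 ^ cv) ∧
          ∃ γ : ℂ, ψ' = γ • fam (Finset.range (2 ^ ev)) (fun z => ω (h - cv) (tab z * s))
            (encode base ev) φ := by
  have hp' := hp
  obtain ⟨hR, hc, he, hb, hf, hg, hy, hyQ, heR, hRB, hcB⟩ := hp'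
  have hlt := @Nat.lt_two_pow_self R
  have hB1 : 1 ≤ K.B := Nat.one_le_two_pow.trans hRB
  set a := M As with ha
  set β : ℕ → ℂ := fun y => ω h (a y * s) with hβ
  have hβ1 : ∀ y, ‖β y‖ = 1 := fun y => norm_ω _ _
  set lab : ℕ → ℕ := fun y => a y % 2 ^ cv with hlab
  set L : ℕ → ℕ := fun x => (labelClass lab R x).length with hL
  set I : ℕ → ℕ → ℕ := fun x i => (labelClass lab R x).getD i 0 with hI
  have hIR : ∀ x, ∀ i < L x, I x i < 2 ^ R := fun x i hi => (labelClass_get hi).1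
  have hIlab : ∀ x, ∀ i < L x, a (I x i) % 2 ^ cv = x := fun x i hi => (labelClass_get hi).2
  have hinj : ∀ x, ∀ i < L x, ∀ j < L x, I x i = I x j → i = j :=
    fun x i hi j hj h => labelClass_inj hi hj h
  have hst : ∀ x, fam ((Finset.range (2 ^ R)).filter fun y => lab y = x) β (encode base R) φ =
      fam (Finset.range (L x)) (fun i => β (I x i)) (fun i => encode base R (I x i)) φ := fun x =>
    fam_reindex (I x) (fun i hi => by
        rw [Finset.mem_range] at hi
        rw [Finset.mem_filter, Finset.mem_range]; exact labelClass_get hi)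
      (fun i hi j hj => hinj x i (by simpa using hi) j (by simpa using hj))
      (fun y hy => by
        rw [Finset.mem_filter, Finset.mem_range] at hy
        obtain ⟨i, hi, h⟩ := labelClass_surj hy.1 hy.2
        exact ⟨i, Finset.mem_range.2 hi, h⟩)
  have hns : ∀ x, (fam (Finset.range (L x)) (fun i => β (I x i))
      (fun i => encode base R (I x i)) φ).normSq = L x * φ.normSq := fun x => by
    rw [normSq_fam_encode hφ hβ1 (fun i hi => hIR x i (Finset.mem_range.1 hi))
      (fun i hi j hj => hinj x i (Finset.mem_range.1 hi) j (Finset.mem_range.1 hj)),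
      Finset.card_range]
  have hnn : ∀ g : Option (ℕ → ℕ) → ℝ, (∀ i, 0 ≤ g i) →
      0 ≤ φ.normSq * collSum a cv ev R g := fun g hg =>
    mul_nonneg (normSq_nonneg _) (Finset.sum_nonneg fun _ _ => Finset.sum_nonneg fun _ _ => hg _)
  set S : ℕ → (Option (ℕ → ℕ) → ℝ) → ℝ := fun x g =>
    ∑ i ∈ Finset.range (L x), g (collOutcome a cv ev R x (i / 2 ^ ev)) with hS
  have hSnn : ∀ x g, (∀ i, 0 ≤ g i) → 0 ≤ S x g := fun x g hg => Finset.sum_nonneg fun _ _ => hg _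
  refine Prb.det_cons ((Det.fill (t := Alab) (u := i3) (N := 2 ^ R) (av := fun i => i)
      (vv := lab) (by decide) (by decide) (by decide) ⟨rfl, by decide⟩
      ⟨rfl, by decide⟩ ⟨rfl, by decide⟩ hRB ?_ ?_ (fun _ _ _ _ h => h)
      (fun i hi => hi.le.trans hRB) ?_ ?_).mono ?_) hnn
  · intro M' hf'
    rw [eval_pow, eval_var, hf' vR (by decide), hR]
  · intro j _ M' hf' hj' _
    refine ⟨by rw [eval_var, hj'], ?_⟩
    rw [eval_mod, eval_rd, eval_var, eval_pow, eval_var, hj', hf' As (by decide),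
      hf' vc (by decide), hc]
  · exact fun i _ _ => ((Nat.mod_lt _ (Nat.two_pow_pos _)).le).trans hcB
  · exact fun i _ => ((Nat.size_le_self' _).trans (Nat.mod_lt _ (Nat.two_pow_pos _)).le).trans hcB
  rintro M₁ _ ⟨hf₁, rfl, h1, -⟩ - -
  have hst₁ : ∀ x, ((Finset.range (2 ^ R)).filter fun y => M₁ Alab y = x) =
      (Finset.range (2 ^ R)).filter fun y => lab y = x := fun x =>
    Finset.filter_congr fun y hy => by rw [h1 y (Finset.mem_range.1 hy)]
  -- Given the label `x`, the index is uniform among the `L x` members of its class.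
  refine Prb.mono (Prb.cons (fun x g => (L x : ℝ)⁻¹ * S x g) (Prb.measLabel (k := var vc) (R := R)
    (kv := cv) (bv := base) (fv := M qf 0) (gv := M qg 0) hφ (.inl rfl) ⟨rfl, by decide⟩ ?_
    (by rw [hf₁ vR (by decide), hR]) (by rw [hf₁ vbase (by decide), hb])
    (by rw [hf₁ qf (by decide)]) (by rw [hf₁ qg (by decide)]) (fun y hy => Finset.mem_range.1 hy)
    (fun y hy => ?_) le_rfl hf hg (by omega) hRB hcB)
    (fun x g hg => mul_nonneg (by positivity) (hSnn x g hg)) ?_)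
    ?_ fun _ _ _ h => h
  · intro M' hf'
    rw [eval_var, hf' vc (by decide), hf₁ vc (by decide), hc]
  · rw [h1 y (Finset.mem_range.1 hy)]
    exact Nat.mod_lt _ (Nat.two_pow_pos _)
  · rintro x M₂ _ ⟨hf₂, hx, hxc, rfl⟩ h0 -
    rw [hst₁, hst, hns] at *
    have hLx : L x ≤ 2 ^ R := labelClass_length_le
    have hL0 : (L x : ℝ) ≠ 0 := fun h => h0 (normSq_eq_zero.1 (by rw [hns, h, zero_mul]))
    have hf₁₂ : Frame collTapes M M₂ := (hf₁.mono (by decide)).trans hf₂ (by decide)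
    refine Prb.mono (E := fun g => φ.normSq * S x g) ?_ (fun g _ => le_of_eq (by
      field_simp)) fun _ _ _ h => h
    have hnn' : ∀ g : Option (ℕ → ℕ) → ℝ, (∀ i, 0 ≤ g i) → 0 ≤ φ.normSq * S x g := fun g hg =>
      mul_nonneg (normSq_nonneg _) (hSnn x g hg)
    refine Prb.det_cons (Det.asgSmall adm_zero (by decide) (by simp) fun _ _ => ?_) hnn'
    refine Prb.det_cons ((Det.listClass (R := R) (x := x) (lab := lab) ?_ ?_ ?_ ?_ hRB).mono ?_) hnn'
    · rw [upd_ne (by decide), hf₁₂ vR (by decide), hR]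
    · rw [upd_ne (by decide), hx]
    · simp
    · intro y hy
      rw [upd_ne (by decide), hf₂ Alab (by decide), h1 y hy]
    rintro M₃ _ ⟨hf₃, rfl, hlen, hind⟩ - -
    have hf₁₃ : Frame collTapes M M₃ := (hf₁₂.upd (by decide) _ _).trans hf₃ (by decide)
    refine Prb.det_cons (Det.asgSmall adm_zero (by decide) (by simp) fun _ _ => ?_) hnn'
    set M₄ := upd M₃ vok 0 (eval M₃ 0) with hM₄
    have hf₁₄ : Frame collTapes M M₄ := hf₁₃.upd (by decide) _ _
    refine Prb.mono (Prb.cons (fun q g => g (collOutcome a cv ev R x q))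
      (Prb.measSegment (L := L x) (I := I x) hφ hβ1 (hp.frame hf₁₄ (by decide)) hLx ?_ ?_ ?_
        (hIR x) (hinj x)) (fun q g hg => hg _) ?_)
      (fun g _ => le_rfl) fun _ _ _ h => h
    · rw [hM₄, upd_ne (by decide), hlen]
    · rw [hM₄, upd_self]; rfl
    · intro i hi
      rw [hM₄, upd_ne (by decide), hind i hi]
    rintro q M₅ _ ⟨hf₅, hind₅, hok, hseg, rfl⟩ - -
    have hf₁₅ : Frame collTapes M M₅ := hf₁₄.trans hf₅ (by decide)
    have hp₅ := hp.frame hf₁₅ (by decide)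
    set ψ₅ := fam ((Finset.range (L x)).filter fun i => i / 2 ^ ev = q) (fun i => β (I x i))
      (fun i => encode base R (I x i)) φ with hψ₅
    refine Prb.single (Prb.ite ⟨rfl, by decide⟩ (fun h' => ?_) fun h' => ?_)
    · have hq : q * 2 ^ ev + 2 ^ ev ≤ L x := by
        rw [eval_var, hok] at h'; by_contra h''; simp [h''] at h'
      have ho : collOutcome a cv ev R x q = some (segTable a cv ev R x q) := if_pos hq
      rw [ho]
      refine Prb.of_det ?_
      set J : ℕ → ℕ := fun z => I x (q * 2 ^ ev + z) with hJ
      have hJL : ∀ z < 2 ^ ev, q * 2 ^ ev + z < L x := fun z hz => by omega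
      have hst₅ : ψ₅ = fam (Finset.range (2 ^ ev)) (fun z => β (J z))
          (fun z => encode base R (J z)) φ := by
        refine fam_reindex (fun z => q * 2 ^ ev + z) (fun z hz => ?_)
          (fun z _ z' _ h => Nat.add_left_cancel h) (fun i hi => ?_)
        · rw [Finset.mem_range] at hz
          rw [Finset.mem_filter, Finset.mem_range]
          refine ⟨hJL z hz, ?_⟩
          rw [mul_comm, Nat.mul_add_div (Nat.two_pow_pos _), Nat.div_eq_of_lt hz, add_zero]
        · rw [Finset.mem_filter, Finset.mem_range] at hi
          refine ⟨i % 2 ^ ev, Finset.mem_range.2 (Nat.mod_lt _ (Nat.two_pow_pos _)), ?_⟩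
          rw [← hi.2]
          exact Nat.div_add_mod' i _
      rw [hst₅]
      refine (Det.reindex (I := J) (β := fun z => β (J z)) hφ hp₅ (hseg hq) ?_
        (fun z hz => hIR x _ (hJL z hz))
        (fun z hz z' hz' h => Nat.add_left_cancel (hinj x _ (hJL z hz) _ (hJL z' hz') h))).mono ?_
      · intro z hz
        rw [hind₅, hM₄, upd_ne (by decide), hind _ (hJL z hz)]
      · rintro M₆ _ ⟨hf₆, hok₆, hnew, rfl⟩
        refine ⟨hf₁₅.trans hf₆ (by decide), fun h => by simp at h, ?_⟩
        rintro _ ⟨rfl⟩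
        -- All multipliers of the class are congruent to `x` modulo `2 ^ cv`, so `ω h (x * s)` is a
        -- common factor and becomes the scalar `γ`.
        have haz : ∀ z < 2 ^ ev, a (J z) = 2 ^ cv * segTable a cv ev R x q z + x := fun z hz => by
          have e := Nat.div_add_mod (a (J z)) (2 ^ cv)
          rw [show a (J z) % 2 ^ cv = x from hIlab x _ (hJL z hz)] at e
          exact e.symm
        refine ⟨by rw [hok₆, hok, if_pos hq], fun z hz => ⟨?_, J z, hIR x _ (hJL z hz), rfl⟩,
          ω h (x * s), ?_⟩
        · rw [hnew z hz, hf₁₅ As (by decide)]; rfl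
        · rw [smul_fam]
          refine fam_congr (fun z hz => ?_) fun _ _ => rfl
          rw [hβ]
          simp only
          rw [haz z (Finset.mem_range.1 hz), add_mul, mul_assoc, ω_add, ω_two_pow_mul hh, mul_comm]
    · have hq : ¬ (q * 2 ^ ev + 2 ^ ev ≤ L x) := by
        rw [eval_var, hok] at h'; intro h''; simp [h''] at h'
      have ho : collOutcome a cv ev R x q = none := if_neg hq
      rw [ho]
      set Z := (Finset.range (L x)).filter fun i => i / 2 ^ ev = q with hZ
      have hst₅ : ψ₅ = fam (Z.image (I x)) β (encode base R) φ := by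
        refine (fam_reindex (I x) (fun i hi => Finset.mem_image_of_mem _ hi)
          (fun i hi j hj h => ?_) (fun y hy => ?_)).symm
        · rw [Finset.mem_coe, Finset.mem_filter, Finset.mem_range] at hi hj
          exact hinj x i hi.1 j hj.1 h
        · obtain ⟨i, hi, rfl⟩ := Finset.mem_image.1 hy
          exact ⟨i, hi, rfl⟩
      rw [hst₅]
      refine Prb.map (fun _ => none) (Prb.eraseReg (R := R) hφ hp₅.hR hp₅.hb le_rfl (by omega)
        (by omega) hB1) (fun g _ => le_rfl) ?_
      rintro - M₆ ψ₆ ⟨hf₆, hγ⟩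
      refine ⟨hf₁₅.trans hf₆ (by decide), fun _ => ⟨?_, hγ⟩, fun _ h => by simp at h⟩
      rw [hf₆ vok (by decide), hok, if_neg hq]
  · intro g hg
    refine le_of_eq ?_
    simp only [hst₁, hst, hns]
    rw [collSum, Finset.mul_sum]
    refine Finset.sum_congr rfl fun x _ => ?_
    by_cases hL0 : L x = 0
    · have h0 : S x g = 0 := by simp [hS, hL0]
      show L x * φ.normSq * ((L x : ℝ)⁻¹ * S x g) = φ.normSq * S x g
      rw [h0]; simp
    · have : (L x : ℝ) ≠ 0 := Nat.cast_ne_zero.2 hL0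
      field_simp
      rfl

end Setting

/-! ### Phase qubits from the oracle and the Fourier transform. -/

theorem encode_append {b k r x z : ℕ} (hx : x < 2 ^ k) :
    encode b (k + r) (x + 2 ^ k * z) = encode b k x ∪ encode (b + k) r z := by
  ext a
  rw [Finset.mem_union, mem_encode, mem_encode, mem_encode]
  have h : ∀ i, (x + 2 ^ k * z).testBit i = if i < k then x.testBit i else z.testBit (i - k) := by
    intro i
    rw [add_comm, Nat.testBit_two_pow_mul_add _ hx]
  rw [h]
  by_cases h1 : a < b + k
  · by_cases h2 : b ≤ a
    · rw [if_pos (by omega)]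
      have : ¬ b + k ≤ a := by omega
      simp only [h2, h1, this, true_and, false_and, or_false]
      simp only [and_iff_right_iff_imp]
      omega
    · have : ¬ b + k ≤ a := by omega
      simp [h2, this]
  · rw [if_neg (by omega)]
    have h2 : ¬ (b ≤ a ∧ a < b + k ∧ x.testBit (a - b) = true) := fun h => h1 h.2.1
    rw [Nat.sub_sub]
    simp only [h2, false_or]
    constructor
    · rintro ⟨_, h3, h4⟩; exact ⟨by omega, by omega, h4⟩
    · rintro ⟨_, h3, h4⟩; exact ⟨by omega, by omega, h4⟩

namespace QState

theorem ω_two_pow_self_mul (k z : ℕ) : ω k (2 ^ k * z) = 1 := by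
  rw [ω_two_pow_mul le_rfl, Nat.sub_self, ω]
  simp only [pow_zero, div_one]
  rw [mul_comm]
  exact Complex.exp_nat_mul_two_pi_mul_I z

theorem ω_zero (k : ℕ) : ω k 0 = 1 := by simp [ω]

theorem ω_one_one : ω 1 1 = -1 := by
  rw [ω, ← Complex.exp_pi_mul_I]
  congr 1
  push_cast
  ring

theorem ω_congr {k y z : ℕ} (h : y % 2 ^ k = z % 2 ^ k) : ω k y = ω k z := by
  rw [← Nat.mod_add_div y (2 ^ k), ← Nat.mod_add_div z (2 ^ k), h, ω_add, ω_add,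
    ω_two_pow_self_mul, ω_two_pow_self_mul]

variable {ι : Type*} {b : ℕ} {Y : Finset ι} {β : ι → ℂ} {A : ι → Finset ℕ} {φ : QState}

theorem fam_had_fresh (h : Below b φ) {q : ℕ} (hq : b ≤ q) (hA : ∀ y ∈ Y, q ∉ A y) :
    had q (fam Y β A φ) = fam (Y ×ˢ Finset.range 2) (fun y => β y.1 / (Real.sqrt 2 : ℂ))
      (fun y => A y.1 ∪ encode q 1 y.2) φ := by
  rw [fam_had h hq]
  have h2 : ∀ z, z < 2 → (z = 0 ∨ z = 1) := fun z hz => by omega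
  rw [fam_reindex (Y' := Y ×ˢ Finset.range 2) (fun y => (y.1, decide (y.2 = 1)))
    (fun y hy => Finset.mem_product.2 ⟨(Finset.mem_product.1 hy).1, Finset.mem_univ _⟩)
    (fun y hy z hz e => by
      have e1 := h2 _ (Finset.mem_range.1 (Finset.mem_product.1 hy).2)
      have e2 := h2 _ (Finset.mem_range.1 (Finset.mem_product.1 hz).2)
      have e3 := (Prod.ext_iff.1 e).1
      have e4 := (Prod.ext_iff.1 e).2
      simp only [decide_eq_decide] at e3 e4
      exact Prod.ext e3 (by omega))
    (fun y hy => ⟨(y.1, y.2.toNat), by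
      rw [Finset.mem_product] at hy ⊢
      exact ⟨hy.1, Finset.mem_range.2 (Bool.toNat_lt _)⟩, by cases y with | mk a c => cases c <;> simp⟩)]
  refine fam_congr (fun y hy => ?_) fun y hy => ?_
  · simp [hA y.1 (Finset.mem_product.1 hy).1, div_eq_mul_inv]
  · have hq' := hA y.1 (Finset.mem_product.1 hy).1
    rcases h2 _ (Finset.mem_range.1 (Finset.mem_product.1 hy).2) with h | h
    · simp only [h, zero_ne_one, decide_false, Bool.false_eq_true, if_false]
      rw [Finset.erase_eq_of_notMem hq']
      ext a
      simp [mem_encode]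
    · simp only [h, decide_true, if_true]
      ext a
      simp only [Finset.mem_insert, Finset.mem_union, mem_encode]
      constructor
      · rintro (rfl | h)
        · simp
        · exact .inl h
      · rintro (h | ⟨h3, h4, -⟩)
        · exact .inr h
        · left; omega

end QState

namespace Setting

open Sieve QState Expr

variable {X : Type*} {n : ℕ} {K : Setting X n}
variable {base : ℕ} {φ : QState} {M : ℕ → ℕ → ℕ} {ψ : QState}

theorem norm_inv_sqrt_two_pow (k : ℕ) : ‖((1 : ℂ) / (Real.sqrt 2 : ℂ)) ^ k‖ ^ 2 = (1 / 2) ^ k := by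
  rw [norm_pow, ← pow_mul, mul_comm k 2, pow_mul, norm_div, norm_one, div_pow, one_pow,
    Complex.norm_real, Real.norm_eq_abs, sq_abs, Real.sq_sqrt (by norm_num)]

theorem div_two_pow_pred {H k : ℕ} (hk : k < H) (a : ℕ) :
    a / 2 ^ (H - (k + 1)) = 2 * (a / 2 ^ (H - k)) + (a.testBit (H - (k + 1))).toNat := by
  have h : H - k = H - (k + 1) + 1 := by omega
  rw [h, pow_succ, ← Nat.div_div_eq_div_mul, Nat.toNat_testBit]
  omega

/-- One round of the Fourier transform. -/
theorem fourier_coeff {H k : ℕ} (hk : k < H) (a y : ℕ) (o : Bool) :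
    ω k (y * (a / 2 ^ (H - k))) * (if a.testBit (H - (k + 1)) = true then ω (k + 1) y else 1) *
      (if o = true ∧ a.testBit (H - (k + 1)) = true then -1 else 1) =
    ω (k + 1) ((y + o.toNat * 2 ^ k) * (a / 2 ^ (H - (k + 1)))) := by
  rw [div_two_pow_pred hk]
  set A := a / 2 ^ (H - k)
  set c := a.testBit (H - (k + 1))
  -- The four terms are the phase of the earlier rounds, the phase gate, a multiple of `2 ^ (k + 1)`
  -- without effect, and the sign from the Hadamard gate.
  have e : (y + o.toNat * 2 ^ k) * (2 * A + c.toNat) =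
      2 ^ 1 * (y * A) + y * c.toNat + 2 ^ (k + 1) * (o.toNat * A) + 2 ^ k * (o.toNat * c.toNat) := by
    ring
  rw [e, ω_add, ω_add, ω_add, ω_two_pow_self_mul, ω_two_pow_mul (by omega),
    ω_two_pow_mul (by omega), Nat.add_sub_cancel, Nat.add_sub_cancel_left]
  cases c <;> cases o <;> simp [ω_zero, ω_one_one]

/-- Measurement of the Fourier mode of the `H` qubits from address `qa + t` on. -/
theorem Prb.fourier {q t : ℕ} {Z : Finset (ℕ × ℕ)} {ζ : ℕ × ℕ → ℂ} (hφ : Below q φ)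
    (hq : q < M qa 0) (hn : M vn 0 = n) (ht : M vt 0 = t) (htn : t < n)
    (hqQ : M qa 0 + n ≤ K.Qb) (hnB : 2 * n ≤ K.B) (hZ : ∀ p ∈ Z, p.1 < 2)
    (hinj : Set.InjOn Prod.fst (Z : Set (ℕ × ℕ))) (hy : M vy 0 = 0) :
    K.Prb (Sieve.forLt i4 (var vn - var vt) [
        Cmd.phase (var qa + (var vn - 1 - var i4)) (var vy) (var i4 + 1),
        Cmd.had (var qa + (var vn - 1 - var i4)),
        Sieve.measReset (var qa + (var vn - 1 - var i4)),
        Sieve.when (var vo) [Sieve.asg vy (var vy + pow (var i4))]]) M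
      (fam Z ζ (fun p => encode q 1 p.1 ∪ encode (M qa 0 + t) (n - t) p.2) φ)
      (fun g => (fam Z ζ (fun p => encode q 1 p.1 ∪ encode (M qa 0 + t) (n - t) p.2) φ).normSq *
        ((1 / 2) ^ (n - t) * ∑ y ∈ Finset.range (2 ^ (n - t)), g y))
      fun y M' ψ' => Frame [i4, vo, vy] M M' ∧ M' vy 0 = y ∧ y < 2 ^ (n - t) ∧
        ψ' = (1 / (Real.sqrt 2 : ℂ)) ^ (n - t) •
          fam Z (fun p => ζ p * ω (n - t) (y * p.2)) (fun p => encode q 1 p.1) φ := by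
  set d := M qa 0 + t with hd
  set H := n - t with hH
  have hB1 : 1 ≤ K.B := by omega
  set A : ℕ → ℕ × ℕ → Finset ℕ := fun k p => encode q 1 p.1 ∪ encode d (H - k) p.2 with hA
  -- After `k` rounds the upper `k` bits of the register have been converted into a phase. The
  -- highest bit of the register gives the lowest bit of `y`, so the phase gate in each round needs
  -- only those bits of `y` that have already been measured: the transform is semiclassical and no
  -- controlled phase gate is required.
  set β : ℕ → ℕ → ℕ × ℕ → ℂ := fun k y p =>
    (1 / (Real.sqrt 2 : ℂ)) ^ k * (ζ p * ω k (y * (p.2 / 2 ^ (H - k)))) with hβ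
  have hAq : ∀ k, ∀ p ∈ Z, ∀ a ∈ A k p, q ≤ a := by
    intro k p _ a ha
    rcases Finset.mem_union.1 ha with h | h
    · exact (mem_encode.1 h).1
    · have := (mem_encode.1 h).1; omega
  -- Over each value of the qubit `q` there is at most one element of `Z`, so this qubit alone
  -- separates the terms, even when the register has been erased. There is no interference, and all
  -- outcomes are equally likely.
  have hAinj : ∀ k, Set.InjOn (A k) Z := by
    intro k p hp p' hp' h
    refine hinj hp hp' ?_
    have hq1 : ∀ p, (q ∈ A k p ↔ p.1.testBit 0 = true) := fun p => by
      rw [hA, Finset.mem_union, mem_encode, mem_encode]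
      have : ¬ d ≤ q := by omega
      simp [this]
    have h1 := (hq1 p).symm.trans ((by rw [h] : q ∈ A k p ↔ q ∈ A k p').trans (hq1 p'))
    have hp2 := hZ p hp
    have hp2' := hZ p' hp'
    simp only [Nat.testBit_zero, decide_eq_true_eq] at h1
    omega
  set N₀ : ℝ := (∑ p ∈ Z, ‖ζ p‖ ^ 2) * φ.normSq with hN₀
  have hns : ∀ k y, (fam Z (β k y) (A k) φ).normSq = (1 / 2) ^ k * N₀ := by
    intro k y
    rw [normSq_fam hφ (hAq k) (hAinj k), hN₀, ← mul_assoc, Finset.mul_sum]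
    congr 1
    refine Finset.sum_congr rfl fun p _ => ?_
    rw [hβ]
    simp only
    rw [norm_mul, norm_mul, norm_ω, mul_one, mul_pow, norm_inv_sqrt_two_pow]
  have h00 : fam Z ζ (fun p => encode q 1 p.1 ∪ encode d H p.2) φ = fam Z (β 0 0) (A 0) φ :=
    fam_congr (fun p _ => by simp [hβ, ω_zero]) fun _ _ => rfl
  rw [h00, hns]
  have hN₀' : 0 ≤ N₀ := mul_nonneg (Finset.sum_nonneg fun _ _ => sq_nonneg _) (normSq_nonneg _)
  have hHn : H < 2 ^ H := Nat.lt_two_pow_self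
  refine Prb.mono (E := fun g => N₀ * ((1 / 2) ^ H * ∑ y ∈ Finset.range (2 ^ H), g y)) ?_
    (fun g _ => by simp) fun _ _ _ h => h
  refine Prb.forLt (N := H) ⟨rfl, by decide⟩ (by decide) (by omega)
    (fun k y M₁ ψ₁ => Frame [i4, vo, vy] M M₁ ∧ M₁ vy 0 = y ∧ y < 2 ^ k ∧
      ψ₁ = fam Z (β k y) (A k) φ)
    (fun k y g => (g y + g (y + 2 ^ k)) / 2)
    (fun k y g hg => div_nonneg (add_nonneg (hg _) (hg _)) (by norm_num))
    (fun k g => N₀ * ((1 / 2) ^ k * ∑ y ∈ Finset.range (2 ^ k), g y)) (i₀ := 0)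
    (fun g _ => by rw [hns]; simp) ?_
    (fun g hg => mul_nonneg hN₀' (mul_nonneg (by positivity) (Finset.sum_nonneg fun _ _ => hg _)))
    ?_ ?_ ?_ ?_
  · intro k _ g _
    refine le_of_eq ?_
    rw [pow_succ 2 k, mul_comm (2 ^ k) 2, sum_range_two_mul, ← Finset.sum_div, pow_succ]
    ring
  · refine ⟨(Frame.refl _ _).upd (by decide) _ _, ?_, by simp, rfl⟩
    rw [upd_ne (by decide), hy]
  · rintro k - y M₁ ψ₁ ⟨hf, -⟩ -
    rw [eval_sub, eval_var, eval_var, hf vn (by decide), hf vt (by decide), hn, ht]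
  · rintro k hk y M₁ _ ⟨hf, hy₁, hyk, rfl⟩ hk' - hM₁
    have eqa : M₁ qa 0 = M qa 0 := by rw [hf qa (by decide)]
    have en : M₁ vn 0 = n := by rw [hf vn (by decide), hn]
    set e := M qa 0 + (n - 1 - k) with he
    have eq : ∀ M' : ℕ → ℕ → ℕ, M' qa 0 = M qa 0 → M' vn 0 = n → M' i4 0 = k →
        (var qa + (var vn - 1 - var i4)).eval M' = e := fun M' h1 h2 h3 => by
      rw [eval_add, eval_sub, eval_sub, eval_var, eval_var, eval_var, eval_one, h1, h2, h3]
    have he1 := eq M₁ eqa en hk'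
    have heA : ∀ p, e ∈ A k p ↔ p.2.testBit (H - (k + 1)) = true := fun p => by
      rw [hA, Finset.mem_union, mem_encode, mem_encode]
      have h1 : ¬ e < q + 1 := by omega
      have h2 : d ≤ e ∧ e < d + (H - k) := by omega
      have h3 : e - d = H - (k + 1) := by omega
      rw [h3]
      simp only [h1, h2, false_and, and_false, false_or, true_and]
    have heA' : ∀ p, (A k p).erase e = A (k + 1) p := fun p => by
      ext a
      rw [Finset.mem_erase, hA, Finset.mem_union, Finset.mem_union, mem_encode, mem_encode,
        mem_encode]
      constructor
      · rintro ⟨h1, h2 | ⟨h2, h3, h4⟩⟩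
        · exact .inl h2
        · exact .inr ⟨h2, by omega, h4⟩
      · rintro (⟨h1, h2, h3⟩ | ⟨h2, h3, h4⟩)
        · exact ⟨by omega, .inl ⟨h1, h2, h3⟩⟩
        · exact ⟨by omega, .inr ⟨h2, by omega, h4⟩⟩
    have hnn : ∀ g : ℕ → ℝ, (∀ i, 0 ≤ g i) →
        0 ≤ (fam Z (β k y) (A k) φ).normSq * ((g y + g (y + 2 ^ k)) / 2) := fun g hg =>
      mul_nonneg (normSq_nonneg _) (div_nonneg (add_nonneg (hg _) (hg _)) (by norm_num))
    refine Prb.det_cons (Det.phase ⟨rfl, by decide⟩ ⟨rfl, by decide⟩ ⟨rfl, by decide⟩ rfl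
      (by rw [he1]; omega) fun _ _ => Prb.det_cons (Det.had ⟨rfl, by decide⟩ (by rw [he1]; omega)
      fun _ _ => ?_) hnn) hnn
    rw [he1, eval_add, eval_one, eval_var, eval_var, hy₁, hk', fam_phase hφ (by omega),
      fam_had hφ (by omega)]
    have hbr : ∀ o : Bool, fam ((Z ×ˢ (Finset.univ : Finset Bool)).filter fun p =>
          e ∈ (if p.2 = true then insert e (A k p.1) else (A k p.1).erase e) ↔ o = true)
        (fun p => β k y p.1 * (if e ∈ A k p.1 then ω (k + 1) y else 1) *
          ((if p.2 = true ∧ e ∈ A k p.1 then -1 else 1) / (Real.sqrt 2 : ℂ)))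
        (fun p => (if p.2 = true then insert e (A k p.1) else (A k p.1).erase e).erase e) φ =
        fam Z (β (k + 1) (y + o.toNat * 2 ^ k)) (A (k + 1)) φ := fun o => by
      rw [fam_reindex (Y' := Z) (fun p => (p, o)) (fun p hp => by
          rw [Finset.mem_filter, Finset.mem_product]
          refine ⟨⟨hp, Finset.mem_univ _⟩, ?_⟩
          cases o <;> simp)
        (fun p _ p' _ h => (Prod.ext_iff.1 h).1) (fun p hp => by
          rw [Finset.mem_filter, Finset.mem_product] at hp
          refine ⟨p.1, hp.1.1, Prod.ext rfl ?_⟩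
          have := hp.2
          rcases p with ⟨p, c⟩
          cases o <;> cases c <;> simp at this ⊢)]
      refine fam_congr (fun p _ => ?_) fun p _ => ?_
      · simp only [heA, hβ]
        rw [← fourier_coeff hk, pow_succ]
        ring
      · rw [← heA']
        cases o <;> simp
    refine Prb.mono (Prb.map (fun o : Bool => y + o.toNat * 2 ^ k) (Prb.cons_det
        (Prb.measReset (qv := e) hφ ⟨rfl, by decide⟩ ?_ (by omega) (by omega) hB1)
        (P := fun o M₃ ψ₃ => M₃ i4 0 = k ∧ Frame [i4, vo, vy] M (upd M₃ i4 0 (k + 1)) ∧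
          upd M₃ i4 0 (k + 1) vy 0 = y + o.toNat * 2 ^ k ∧ y + o.toNat * 2 ^ k < 2 ^ (k + 1) ∧
          ψ₃ = fam Z (β (k + 1) (y + o.toNat * 2 ^ k)) (A (k + 1)) φ) ?_)
        (fun _ _ => le_rfl) fun o M₃ ψ₃ h => h) ?_ fun _ _ _ h => h
    · intro M₂ hf₂
      exact eq M₂ (by rw [hf₂ qa (by decide), eqa]) (by rw [hf₂ vn (by decide), en])
        (by rw [hf₂ i4 (by decide), hk'])
    · rintro o M₂ _ ⟨hf₂, ho, rfl⟩ - -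
      have hx2 : y + o.toNat * 2 ^ k < 2 ^ (k + 1) := by
        rw [pow_succ]; cases o <;> simp <;> omega
      have h2y : M₂ vy 0 = y := by rw [hf₂ vy (by decide), hy₁]
      have h2i : M₂ i4 0 = k := by rw [hf₂ i4 (by decide), hk']
      have hf₀ : Frame [i4, vo, vy] M M₂ := hf.trans hf₂ (by decide)
      refine Det.single (Det.when ⟨rfl, by decide⟩ (fun h => Det.single ?_) fun h => ?_)
      · have ho' : o.toNat = 1 := by rw [eval_var, ho] at h; cases o <;> simp at h ⊢
        have hev : (var vy + pow (var i4)).eval M₂ = y + o.toNat * 2 ^ k := by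
          simp [h2y, h2i, ho']
        refine Det.asg ⟨rfl, by decide⟩ (by decide) (fun h => by simp [smallTape] at h) ?_ ?_
        · rw [hev]
          exact (Nat.size_le.2 hx2).trans (by omega)
        · refine ⟨by rw [upd_ne (by decide), h2i], (hf₀.upd (by decide) _ _).upd (by decide) _ _,
            ?_, hx2, ?_⟩
          · rw [upd_ne (by decide), upd_self, hev]
          · exact hbr o
      · have ho' : o.toNat = 0 := by rwa [eval_var, ho] at h
        refine ⟨h2i, hf₀.upd (by decide) _ _, ?_, hx2, ?_⟩
        · rw [upd_ne (by decide), h2y, ho']; simp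
        · exact hbr o
    · intro g _
      refine le_of_eq ?_
      have e1 := hbr false
      have e2 := hbr true
      rw [e1, e2, hns, hns, hns, pow_succ]
      simp only [Bool.toNat_false, Bool.toNat_true, zero_mul, add_zero, one_mul]
      ring
  · rintro y M₁ _ ⟨hf, hy₁, hyk, rfl⟩ -
    refine ⟨hf, hy₁, hyk, ?_⟩
    rw [smul_fam]
    refine fam_congr (fun p _ => by simp [hβ]) fun p _ => ?_
    simp [hA, encode_zero]

end Setting

namespace Setting

open Sieve QState Expr

variable {X : Type*} {n : ℕ} {K : Setting X n}
variable {base : ℕ} {φ : QState} {M : ℕ → ℕ → ℕ} {ψ : QState}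

theorem exec_block_append (f : Bool → ZMod (2 ^ n) → X) (fuel : ℕ) (l l' : List Cmd) (σ : Config) :
    exec f fuel (Sieve.block (l ++ l')) σ =
      (exec f fuel (Sieve.block l) σ).bind (exec f fuel (Sieve.block l')) := by
  induction l generalizing σ with
  | nil =>
    show _ = (exec f fuel Cmd.skip σ).bind _
    simp [exec]
  | cons c l ih =>
    show (exec f fuel c σ).bind (exec f fuel (Sieve.block (l ++ l'))) =
      ((exec f fuel c σ).bind (exec f fuel (Sieve.block l))).bind _
    rw [Multiset.bind_assoc]
    exact Multiset.bind_congr fun σ' _ => ih σ'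

theorem timeBound_block_append (κ B : ℕ) (l l' : List Cmd) :
    (Sieve.block (l ++ l')).timeBound κ B =
      (Sieve.block l).timeBound κ B + (Sieve.block l').timeBound κ B := by
  induction l with
  | nil => show _ = 0 + _; simp
  | cons c l ih =>
    show c.timeBound κ B + (Sieve.block (l ++ l')).timeBound κ B =
      (c.timeBound κ B + (Sieve.block l).timeBound κ B) + _
    rw [ih, add_assoc]

/-- Used to split the body of the loop in `leaf` after the commands that prepare one phase qubit. -/
theorem Prb.append {ι : Type*} {l l' : List Cmd} {E : (ι → ℝ) → ℝ}
    {P : ι → (ℕ → ℕ → ℕ) → QState → Prop}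
    (h : K.Prb (.seq (Sieve.block l) (Sieve.block l')) M ψ E P) :
    K.Prb (Sieve.block (l ++ l')) M ψ E P := by
  intro σ T h1 h2 h3 h4 h5 G g hg hG hD
  have ht : K.tau (Sieve.block (l ++ l')) = K.tau (.seq (Sieve.block l) (Sieve.block l')) :=
    timeBound_block_append _ _ _ _
  rw [ht] at hG hD
  rw [exec_block_append]
  exact h σ T h1 h2 h3 h4 h5 G g hg hG hD

/-- The hidden shift `s` is `2 ^ t * s' - l`. -/
structure ShiftData (f : Bool → ZMod (2 ^ n) → X) (t l s' : ℕ) : Prop where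
  inj : Function.Injective (f false)
  shift : ∀ a : ℕ, f true ((l + a : ℕ) : ZMod (2 ^ n)) = f false ((2 ^ t * s' + a : ℕ) : ZMod (2 ^ n))
  lt : l < 2 ^ t
  tn : t < n

/-- On the inputs `j * l + 2 ^ t * a` both functions take the value of `f_0` at `2 ^ t * (a + j *
s')`, and `f_0` is injective. So the oracle measures `a + j * s'` modulo `2 ^ (n - t)` and nothing
else. -/
theorem ShiftData.fiber {f : Bool → ZMod (2 ^ n) → X} {t l s' : ℕ} (h : ShiftData f t l s')
    {j a j' a' : ℕ} (hj : j < 2) (hj' : j' < 2) :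
    f (decide (j = 1)) ((j * l + 2 ^ t * a : ℕ) : ZMod (2 ^ n)) =
      f (decide (j' = 1)) ((j' * l + 2 ^ t * a' : ℕ) : ZMod (2 ^ n)) ↔
    (a + j * s') % 2 ^ (n - t) = (a' + j' * s') % 2 ^ (n - t) := by
  have key : ∀ j a : ℕ, j < 2 → f (decide (j = 1)) ((j * l + 2 ^ t * a : ℕ) : ZMod (2 ^ n)) =
      f false ((2 ^ t * (a + j * s') : ℕ) : ZMod (2 ^ n)) := by
    intro j a hj
    rcases (by omega : j = 0 ∨ j = 1) with rfl | rfl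
    · simp
    · simp only [decide_true, one_mul]
      rw [h.shift]
      congr 2
      ring
  have hn : 2 ^ n = 2 ^ t * 2 ^ (n - t) := by
    rw [← pow_add]; congr 1; have := h.tn; omega
  rw [key j a hj, key j' a' hj', h.inj.eq_iff, ZMod.natCast_eq_natCast_iff']
  conv_lhs => rw [hn, Nat.mul_mod_mul_left, Nat.mul_mod_mul_left]
  exact Nat.mul_right_inj (Nat.two_pow_pos t).ne'

/-- A qubit in the state `|0⟩ + exp(2πi b s'/2^(n - t))|1⟩` with random `b`. -/
theorem Prb.phaseQubit {q t l s' : ℕ} (hs : ShiftData K.f t l s') (hφ : Below q φ)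
    (hq : ∀ M', Frame [i4, vo, vy] M M' → (var vbase + var i3).eval M' = q)
    (hqa : q < M qa 0) (hn : M vn 0 = n) (ht : M vt 0 = t) (hl : M vl 0 = l)
    (hqQ : M qa 0 + n ≤ K.Qb) (hnB : 2 * n ≤ K.B) :
    K.Prb (Sieve.block [
      Cmd.had (var vbase + var i3),
      Sieve.forLt i4 (var vn) [
        Cmd.ite (bin .lt (var i4) (var vt))
          (Sieve.when (bit (var vl) (var i4)) [Cmd.cnot (var vbase + var i3) (var qa + var i4)])
          (Cmd.had (var qa + var i4))],
      Cmd.query (var vbase + var i3) (var qa),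
      Sieve.forLt i4 (var vt) [
        Sieve.when (bit (var vl) (var i4)) [Cmd.cnot (var vbase + var i3) (var qa + var i4)]],
      Sieve.asg vy 0,
      Sieve.forLt i4 (var vn - var vt) [
        Cmd.phase (var qa + (var vn - 1 - var i4)) (var vy) (var i4 + 1),
        Cmd.had (var qa + (var vn - 1 - var i4)),
        Sieve.measReset (var qa + (var vn - 1 - var i4)),
        Sieve.when (var vo) [Sieve.asg vy (var vy + pow (var i4))]]]) M φ
      (fun g => φ.normSq * ((1 / 2) ^ (n - t) * ∑ y ∈ Finset.range (2 ^ (n - t)), g y))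
      fun y M' ψ' => Frame [i4, vo, vy] M M' ∧ M' vy 0 = y ∧ y < 2 ^ (n - t) ∧
        ∃ γ : ℂ, ψ' = γ • fam (Finset.range 2)
          (fun z => ω (n - t) (z * (2 ^ (n - t) - y) * s')) (encode q 1) φ := by
  have htn := hs.tn
  have hlt := hs.lt
  set H := n - t with hH
  set d := M qa 0 with hd
  have hnn : ∀ g : ℕ → ℝ, (∀ i, 0 ≤ g i) →
      0 ≤ φ.normSq * ((1 / 2) ^ H * ∑ y ∈ Finset.range (2 ^ H), g y) := fun g hg =>
    mul_nonneg (normSq_nonneg _) (mul_nonneg (by positivity) (Finset.sum_nonneg fun _ _ => hg _))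
  have hnn' : ∀ g : ℕ → ℝ, (∀ i, 0 ≤ g i) →
      0 ≤ ((1 / 2) ^ H * ∑ y ∈ Finset.range (2 ^ H), g y) := fun g hg =>
    mul_nonneg (by positivity) (Finset.sum_nonneg fun _ _ => hg _)
  -- Pairs of a control bit `j` and a number `a`. Truncated subtraction leaves only `a = 0` while
  -- the first `t` qubits are filled with the bits of `j * l`.
  set Y : ℕ → Finset (ℕ × ℕ) := fun i => Finset.range 2 ×ˢ Finset.range (2 ^ (i - t)) with hY
  set A : ℕ → ℕ × ℕ → Finset ℕ := fun i p =>
    encode q 1 p.1 ∪ encode d i (p.1 * l + 2 ^ t * p.2) with hA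
  have hYm : ∀ i p, p ∈ Y i ↔ p.1 < 2 ∧ p.2 < 2 ^ (i - t) := fun i p => by
    rw [hY, Finset.mem_product, Finset.mem_range, Finset.mem_range]
  have hAm : ∀ i p a, d ≤ a → (a ∈ A i p ↔ a ∈ encode d i (p.1 * l + 2 ^ t * p.2)) := by
    intro i p a ha
    rw [hA, Finset.mem_union, mem_encode (k := 1)]
    have : ¬ a < q + 1 := by omega
    simp [this]
  have hAq : ∀ i p, p.1 < 2 → (q ∈ A i p ↔ p.1 = 1) := by
    intro i p hp
    rw [hA, Finset.mem_union, mem_encode, mem_encode]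
    have : ¬ d ≤ q := by omega
    simp [this]
    omega
  have hval : ∀ i ≥ t, ∀ p ∈ Y i, p.1 * l + 2 ^ t * p.2 < 2 ^ i := by
    intro i hi p hp
    obtain ⟨h1, h2⟩ := (hYm i p).1 hp
    have h3 : 2 ^ i = 2 ^ t * 2 ^ (i - t) := by rw [← pow_add]; congr 1; omega
    have h4 : 2 ^ t * (p.2 + 1) ≤ 2 ^ t * 2 ^ (i - t) := Nat.mul_le_mul_left _ h2
    have h5 : p.1 * l ≤ 1 * l := Nat.mul_le_mul_right _ (by omega)
    rw [h3]
    rw [mul_add, mul_one] at h4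
    omega
  refine Prb.det_cons (Det.had ⟨rfl, by decide⟩ (by rw [hq M (Frame.refl _ _)]; omega)
    fun _ hns₀ => ?_) hnn
  rw [hq M (Frame.refl _ _)] at *
  have hst₀ : ∃ c : ℂ, had q φ = fam (Y 0) (fun _ => c) (A 0) φ := by
    refine ⟨1 / (Real.sqrt 2 : ℂ), ?_⟩
    conv_lhs => rw [← fam_unit φ, fam_had_fresh hφ le_rfl (by simp)]
    rw [fam_reindex (Y' := Y 0) (fun p => ((), p.1))
      (fun p hp => by
        rw [Finset.mem_product]
        exact ⟨by simp, Finset.mem_range.2 ((hYm 0 p).1 hp).1⟩)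
      (fun p hp p' hp' h => by
        have h1 := ((hYm 0 p).1 hp).2
        have h2 := ((hYm 0 p').1 hp').2
        simp only [Nat.zero_sub, pow_zero] at h1 h2
        exact Prod.ext (Prod.ext_iff.1 h).2 (by omega))
      (fun p hp => ⟨(p.2, 0), (hYm 0 _).2 ⟨Finset.mem_range.1 (Finset.mem_product.1 hp).2, by simp⟩,
        rfl⟩)]
    exact fam_congr (fun _ _ => rfl) fun p _ => by simp [hA, encode_zero]
  have hcx : (var vbase + var i3).Adm := ⟨rfl, by decide⟩
  have hcq : (var qa + var i4).Adm := ⟨rfl, by decide⟩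
  refine Prb.det_cons ((Det.forLt (N := n) ⟨rfl, by decide⟩ (by decide) (by omega)
    (fun i M₁ ψ₁ => Frame [i4] M M₁ ∧ ∃ c : ℂ, ψ₁ = fam (Y i) (fun _ => c) (A i) φ)
    (Q := fun M₁ ψ₁ => Frame [i4] M M₁ ∧ ∃ c : ℂ, ψ₁ = fam (Y n) (fun _ => c) (A n) φ)
    ?_ ?_ ?_ ?_).mono ?_) (fun g hg => hnn g hg)
  · exact ⟨(Frame.refl _ _).upd (by decide) _ _, hst₀⟩
  · rintro i - M₁ ψ₁ ⟨hf, -⟩ -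
    rw [eval_var, hf vn (by decide), hn]
  · rintro i hi M₁ _ ⟨hf, c, rfl⟩ hi' -
    have e1 := hq M₁ (hf.mono (by decide))
    have e2 : (var qa + var i4).eval M₁ = d + i := by
      rw [eval_add, eval_var, eval_var, hf qa (by decide), hi']
    have e3 : (bin .lt (var i4) (var vt)).eval M₁ = if i < t then 1 else 0 := by
      rw [eval_lt, eval_var, eval_var, hf vt (by decide), ht, hi']
    have e4 : (bit (var vl) (var i4)).eval M₁ = 0 ↔ l.testBit i = false := by
      rw [eval_bit_eq_zero, eval_var, eval_var, hf vl (by decide), hl, hi']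
    refine Det.single (Det.ite ⟨rfl, by decide⟩ (fun h => ?_) fun h => ?_)
    · have hit : i < t := by rw [e3] at h; by_contra h'; simp [h'] at h
      have hYs : Y (i + 1) = Y i := by
        rw [hY]; simp only; rw [show i + 1 - t = i - t by omega]
      have hp : ∀ p ∈ Y i, (p.1 = 0 ∨ p.1 = 1) ∧ p.2 = 0 := fun p hp => by
        have := (hYm i p).1 hp
        rw [show i - t = 0 by omega, pow_zero] at this
        omega
      have hs' : ∀ p ∈ Y i, A (i + 1) p = if p.1 = 1 ∧ l.testBit i = true then
          symmDiff (A i p) {d + i} else A i p := fun p hpY => by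
        obtain ⟨h1, h2⟩ := hp p hpY
        ext a
        rw [mem_ite_toggle]
        by_cases ha : a = d + i
        · subst ha
          rw [hAm _ _ _ (by omega), hAm _ _ _ (by omega), mem_encode, mem_encode, h2]
          rcases h1 with h1 | h1 <;> simp [h1]
        · rw [if_neg (by tauto)]
          simp only [hA, Finset.mem_union, mem_encode]
          have : a < d + (i + 1) ↔ a < d + i := by omega
          rw [this]
      refine Det.when ⟨rfl, by decide⟩ (fun h => Det.single ?_) fun h => ?_
      · have hb : l.testBit i = true := by rw [Ne, e4] at h; simpa using h
        refine Det.cnot hcx hcq (by rw [e1]; omega) (by rw [e2]; omega)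
          ⟨hi', hf.upd (by decide) _ _, c, ?_⟩
        rw [e1, e2, fam_cnot hφ le_rfl (by omega) (by omega), hYs]
        refine fam_congr (fun _ _ => rfl) fun p hpY => ?_
        rw [hs' p hpY]
        simp only [hAq i p ((hYm i p).1 hpY).1, hb, and_true]
      · have hb := e4.1 h
        refine ⟨hi', hf.upd (by decide) _ _, c, ?_⟩
        rw [hYs]
        refine fam_congr (fun _ _ => rfl) fun p hpY => ?_
        rw [hs' p hpY, if_neg (by simp [hb])]
    · have hit : t ≤ i := by rw [e3] at h; by_contra h'; simp [not_le.1 h'] at h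
      refine Det.had hcq (by rw [e2]; omega) ⟨hi', hf.upd (by decide) _ _,
        c / (Real.sqrt 2 : ℂ), ?_⟩
      have hpow : 2 ^ (i + 1 - t) = 2 * 2 ^ (i - t) := by
        rw [show i + 1 - t = i - t + 1 by omega, pow_succ, mul_comm]
      have hpow' : 2 ^ i = 2 ^ t * 2 ^ (i - t) := by rw [← pow_add]; congr 1; omega
      rw [e2, fam_had_fresh hφ (by omega) (fun p _ => by
        rw [hAm _ _ _ (by omega), mem_encode]; omega)]
      rw [fam_reindex (Y' := Y (i + 1)) (fun p => ((p.1, p.2 % 2 ^ (i - t)), p.2 / 2 ^ (i - t)))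
        (fun p hp => by
          obtain ⟨h1, h2⟩ := (hYm _ p).1 hp
          rw [Finset.mem_product, hYm, Finset.mem_range]
          exact ⟨⟨h1, Nat.mod_lt _ (Nat.two_pow_pos _)⟩,
            Nat.div_lt_of_lt_mul (by rw [mul_comm, ← hpow]; exact h2)⟩)
        (fun p _ p' _ h => by
          simp only [Prod.mk.injEq] at h
          refine Prod.ext h.1.1 ?_
          rw [← Nat.div_add_mod p.2 (2 ^ (i - t)), h.1.2, h.2, Nat.div_add_mod])
        (fun p hp => by
          rw [Finset.mem_product, hYm, Finset.mem_range] at hp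
          refine ⟨(p.1.1, p.1.2 + 2 ^ (i - t) * p.2), (hYm _ _).2 ⟨hp.1.1, ?_⟩, ?_⟩
          · have : 2 ^ (i - t) * p.2 ≤ 2 ^ (i - t) * 1 := Nat.mul_le_mul_left _ (by omega)
            rw [hpow]
            have := hp.1.2
            simp only
            omega
          · have h1 := hp.1.2
            simp only
            rw [Nat.add_mul_mod_self_left, Nat.mod_eq_of_lt h1,
              Nat.add_mul_div_left _ _ (Nat.two_pow_pos _), Nat.div_eq_of_lt h1, zero_add])]
      refine fam_congr (fun _ _ => rfl) fun p hp => ?_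
      obtain ⟨h1, h2⟩ := (hYm _ p).1 hp
      have h3 : p.1 * l + 2 ^ t * p.2 =
          (p.1 * l + 2 ^ t * (p.2 % 2 ^ (i - t))) + 2 ^ i * (p.2 / 2 ^ (i - t)) := by
        conv_lhs => rw [← Nat.mod_add_div p.2 (2 ^ (i - t))]
        rw [hpow']; ring
      have h4 := hval i hit (p.1, p.2 % 2 ^ (i - t))
        ((hYm _ _).2 ⟨h1, Nat.mod_lt _ (Nat.two_pow_pos _)⟩)
      simp only [hA]
      rw [h3, encode_append h4, Finset.union_assoc]
  · rintro M₁ _ ⟨hf, h⟩ -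
    exact ⟨hf, h⟩
  rintro M₁ _ ⟨hf₁, c, rfl⟩ - hns₁
  have hns : (fam (Y n) (fun _ => c) (A n) φ).normSq = φ.normSq := hns₁.trans hns₀
  rw [← hns₀, ← hns₁]
  have e1 := hq M₁ (hf₁.mono (by decide))
  have eqa : M₁ qa 0 = d := by rw [hf₁ qa (by decide)]
  have eqa' : (var qa).eval M₁ = d := eqa
  refine Prb.mono (Prb.cons (fun _ g => (1 / 2) ^ H * ∑ y ∈ Finset.range (2 ^ H), g y)
    (Prb.query (j := var vbase + var i3) (a := var qa) hcx ⟨rfl, by decide⟩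
      (by rw [e1]; omega) (by rw [eqa']; omega)) (fun _ g hg => hnn' g hg) ?_) ?_ fun _ _ _ h => h
  · rintro x M₁ _ ⟨rfl, rfl⟩ h0 -
    rw [e1, eqa'] at *
    classical
    -- The part of the superposition compatible with the unrevealed oracle value `x`.
    set Z := (Y n).filter fun p =>
      K.f (decide (p.1 = 1)) ((p.1 * l + 2 ^ t * p.2 : ℕ) : ZMod (2 ^ n)) = x with hZ
    have hpr : (fam (Y n) (fun _ => c) (A n) φ).proj (fun S => K.f (decide (q ∈ S))
        (Config.readout n d S : ZMod (2 ^ n)) = x) = fam Z (fun _ => c) (A n) φ := by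
      have hA1 : ∀ p ∈ Y n, decide (q ∈ A n p) = decide (p.1 = 1) := fun p hp => by
        rw [decide_eq_decide]; exact hAq n p ((hYm n p).1 hp).1
      have hA2 : ∀ p ∈ Y n, ∀ S, (∀ a ≥ d, a ∈ S ↔ a ∈ A n p) →
          Config.readout n d S = p.1 * l + 2 ^ t * p.2 := fun p hp S hS =>
        readout_of_reads (fun i hi => by
          rw [hS _ (by omega), hAm _ _ _ (by omega)]; exact reads_encode d n _ i hi)
          (hval n htn.le p hp)
      rw [proj_fam _ (fun S => K.f (decide (q ∈ S)) (Config.readout n d S : ZMod (2 ^ n)) = x)]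
      · congr 1
        exact Finset.filter_congr fun p hp => by
          rw [hA1 p hp, hA2 p hp _ fun _ _ => Iff.rfl]
      · intro p hp S hS
        have h1 : q ∈ S ∪ A n p ↔ q ∈ A n p := hφ.mem_union hS le_rfl
        simp only [h1]
        rw [hA2 p hp _ fun _ _ => Iff.rfl, hA2 p hp (S ∪ A n p) fun a ha =>
          hφ.mem_union hS (by omega)]
    rw [hpr] at h0 ⊢
    have hZY : ∀ p ∈ Z, p.1 < 2 ∧ p.2 < 2 ^ H := fun p hp =>
      (hYm n p).1 (Finset.mem_filter.1 hp).1
    have hZf : ∀ p ∈ Z, ∀ p' ∈ Z, (p.2 + p.1 * s') % 2 ^ H = (p'.2 + p'.1 * s') % 2 ^ H :=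
      fun p hp p' hp' => (hs.fiber (hZY p hp).1 (hZY p' hp').1).1
        ((Finset.mem_filter.1 hp).2.trans (Finset.mem_filter.1 hp').2.symm)
    have hZinj : Set.InjOn Prod.fst (Z : Set (ℕ × ℕ)) := by
      intro p hp p' hp' h
      refine Prod.ext h ?_
      have h1 := hZf p hp p' hp'
      rw [h] at h1
      have h2 := Nat.ModEq.add_right_cancel' (p'.1 * s') h1
      rwa [Nat.ModEq, Nat.mod_eq_of_lt (hZY p hp).2, Nat.mod_eq_of_lt (hZY p' hp').2] at h2
    obtain ⟨p₀, hp₀⟩ : Z.Nonempty := by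
      rw [Finset.nonempty_iff_ne_empty]; intro h; exact h0 (by simp [h, fam])
    -- Together with `hZinj` this says that a nonempty fiber has exactly one `a` over each control
    -- bit, so it is a superposition of two basis vectors with the same amplitude.
    have hsurj : ∀ z < 2, ∃ a < 2 ^ H, (z, a) ∈ Z := by
      intro z hz
      set u := (p₀.2 + p₀.1 * s') with hu
      set v := (u + (2 ^ H - (z * s') % 2 ^ H)) with hv
      have hm := Nat.mod_lt (z * s') (Nat.two_pow_pos H)
      refine ⟨v % 2 ^ H, Nat.mod_lt _ (Nat.two_pow_pos _), Finset.mem_filter.2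
        ⟨(hYm n _).2 ⟨hz, Nat.mod_lt _ (Nat.two_pow_pos _)⟩, ?_⟩⟩
      rw [← (Finset.mem_filter.1 hp₀).2, hs.fiber hz (hZY p₀ hp₀).1]
      show (v % 2 ^ H + z * s') % 2 ^ H = u % 2 ^ H
      have h1 : v + (z * s') % 2 ^ H = u + 2 ^ H := by omega
      rw [Nat.mod_add_mod, ← Nat.add_mod_mod, h1, Nat.add_mod_right]
    choose! α hα1 hα2 using hsurj
    set ψ₂ := fam Z (fun _ => c) (A n) φ with hψ₂
    have hnn₂ : ∀ g : ℕ → ℝ, (∀ i, 0 ≤ g i) →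
      0 ≤ ψ₂.normSq * ((1 / 2) ^ H * ∑ y ∈ Finset.range (2 ^ H), g y) := fun g hg =>
      mul_nonneg (normSq_nonneg _) (hnn' g hg)
    -- The bits of `j * l` are uncomputed one by one; after `t` rounds the register holds just `a`,
    -- on the qubits from `d + t` on.
    set A₂ : ℕ → ℕ × ℕ → Finset ℕ := fun i p => (A n p).filter fun a => ¬ (d ≤ a ∧ a < d + i)
      with hA₂
    have hlbit : ∀ p ∈ Z, ∀ i < t, (d + i ∈ A n p ↔ (p.1 = 1 ∧ l.testBit i = true)) := by
      intro p hp i hi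
      rw [hAm _ _ _ (by omega), mem_encode, Nat.add_sub_cancel_left]
      have h1 : (p.1 * l + 2 ^ t * p.2).testBit i = (p.1 * l).testBit i := by
        have h2 : p.1 * l < 2 ^ t := by
          have h5 : p.1 * l ≤ 1 * l := Nat.mul_le_mul_right _ (by have := (hZY p hp).1; omega)
          omega
        rw [add_comm, Nat.testBit_two_pow_mul_add _ h2, if_pos hi]
      rw [h1]
      have := (hZY p hp).1
      rcases (by omega : p.1 = 0 ∨ p.1 = 1) with h | h
      · simp [h]
      · simp [h]; omega
    refine Prb.det_cons ((Det.forLt (N := t) ⟨rfl, by decide⟩ (by decide) (by omega)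
      (fun i M₂ ψ' => Frame [i4] M₁ M₂ ∧ ψ' = fam Z (fun _ => c) (A₂ i) φ)
      (Q := fun M₂ ψ' => Frame [i4] M₁ M₂ ∧ ψ' = fam Z (fun _ => c) (A₂ t) φ)
      ?_ ?_ ?_ ?_).mono ?_) hnn₂
    · refine ⟨(Frame.refl _ _).upd (by decide) _ _, fam_congr (fun _ _ => rfl) fun p _ => ?_⟩
      exact (Finset.filter_true_of_mem fun a _ => by omega).symm
    · rintro i - M₂ ψ₂ ⟨hf, -⟩ -
      rw [eval_var, hf vt (by decide), hf₁ vt (by decide), ht]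
    · rintro i hi M₂ _ ⟨hf, rfl⟩ hi' -
      have hf' : Frame [i4] M M₂ := hf₁.trans hf (by decide)
      have e1' := hq M₂ (hf'.mono (by decide))
      have e2 : (var qa + var i4).eval M₂ = d + i := by
        rw [eval_add, eval_var, eval_var, hf' qa (by decide), hi']
      have e4 : (bit (var vl) (var i4)).eval M₂ = 0 ↔ l.testBit i = false := by
        rw [eval_bit_eq_zero, eval_var, eval_var, hf' vl (by decide), hl, hi']
      have hs' : ∀ p ∈ Z, A₂ (i + 1) p = if p.1 = 1 ∧ l.testBit i = true then
          symmDiff (A₂ i p) {d + i} else A₂ i p := fun p hp => by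
        ext a
        rw [mem_ite_toggle]
        by_cases ha : a = d + i
        · subst ha
          simp only [hA₂, Finset.mem_filter, hlbit p hp i hi]
          have h1 : d ≤ d + i ∧ d + i < d + (i + 1) := by omega
          simp only [h1]
          by_cases h : p.1 = 1 ∧ l.testBit i = true <;> simp [h]
        · rw [if_neg (by tauto)]
          simp only [hA₂, Finset.mem_filter]
          have : a < d + (i + 1) ↔ a < d + i := by omega
          rw [this]
      have hq₂ : ∀ p ∈ Z, (q ∈ A₂ i p ↔ p.1 = 1) := fun p hp => by
        rw [hA₂, Finset.mem_filter, hAq n p (hZY p hp).1]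
        have : ¬ d ≤ q := by omega
        simp [this]
      refine Det.single (Det.when ⟨rfl, by decide⟩ (fun h => Det.single ?_) fun h => ?_)
      · have hb : l.testBit i = true := by rw [Ne, e4] at h; simpa using h
        refine Det.cnot hcx hcq (by rw [e1']; omega) (by rw [e2]; omega)
          ⟨hi', hf.upd (by decide) _ _, ?_⟩
        rw [e1', e2, fam_cnot hφ le_rfl (by omega) (by omega)]
        refine fam_congr (fun _ _ => rfl) fun p hp => ?_
        rw [hs' p hp]
        simp only [hq₂ p hp, hb, and_true]
      · have hb := e4.1 h
        refine ⟨hi', hf.upd (by decide) _ _, fam_congr (fun _ _ => rfl) fun p hp => ?_⟩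
        rw [hs' p hp, if_neg (by simp [hb])]
    · rintro M₂ _ ⟨hf, h⟩ -
      exact ⟨hf, h⟩
    rintro M₂ _ ⟨hf₂, rfl⟩ - hns₂
    refine Prb.det_cons (Det.asg adm_zero (by decide) (fun _ => by simp) (by simp) fun _ _ => ?_)
      hnn₂
    have hf₃ : Frame [i4, vy] M (upd M₂ vy 0 0) := ((hf₁.trans hf₂ (by decide)).mono
      (by decide)).upd (by decide) _ _
    have hst₂ : fam Z (fun _ => c) (A₂ t) φ = fam Z (fun _ => c)
        (fun p => encode q 1 p.1 ∪ encode (d + t) (n - t) p.2) φ :=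
      fam_congr (fun _ _ => rfl) fun p hp => by
        ext a
        simp only [hA₂, hA, Finset.mem_filter, Finset.mem_union]
        by_cases h : d ≤ a
        · have h1 : a ∉ encode q 1 p.1 := by rw [mem_encode]; omega
          simp only [h1, false_or, mem_encode, h, true_and, not_lt]
          constructor
          · rintro ⟨⟨h2, h3⟩, h4⟩
            refine ⟨h4, by omega, ?_⟩
            rw [add_comm, Nat.testBit_two_pow_mul_add _ (by
              have h5 : p.1 * l ≤ 1 * l := Nat.mul_le_mul_right _ (by have := (hZY p hp).1; omega)
              omega), if_neg (by omega)] at h3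
            rwa [← Nat.sub_sub]
          · rintro ⟨h4, h2, h3⟩
            refine ⟨⟨by omega, ?_⟩, h4⟩
            rw [add_comm, Nat.testBit_two_pow_mul_add _ (by
              have h5 : p.1 * l ≤ 1 * l := Nat.mul_le_mul_right _ (by have := (hZY p hp).1; omega)
              omega), if_neg (by omega)]
            rwa [Nat.sub_sub]
        · have h1 : ∀ k i x, a ∉ encode (d + i) k x := fun k i x => by rw [mem_encode]; omega
          have h2 := h1 n 0 (p.1 * l + 2 ^ t * p.2)
          rw [add_zero] at h2
          simp [h1, h2, h]
    rw [hst₂] at hns₂ ⊢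
    rw [← hns₂]
    have ed : upd M₂ vy 0 0 qa 0 = d := by rw [hf₃ qa (by decide)]
    have key := Prb.fourier (K := K) (M := upd M₂ vy 0 0) (q := q) (t := t) (Z := Z) (ζ := fun _ => c) hφ
      (by rw [ed]; exact hqa) (by rw [hf₃ vn (by decide), hn]) (by rw [hf₃ vt (by decide), ht]) htn
      (by rw [ed]; exact hqQ) hnB (fun p hp => (hZY p hp).1) hZinj (upd_self _ _ _ _)
    rw [ed] at key
    refine Prb.single (Prb.mono key (fun g _ => le_rfl) ?_)
    rintro y M₄ _ ⟨hf₄, hy, hyH, rfl⟩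
    refine ⟨(hf₃.mono (by decide)).trans hf₄ (by decide), hy, hyH,
      (1 / (Real.sqrt 2 : ℂ)) ^ H * c * ω H (y * α 0), ?_⟩
    rw [fam_reindex (Y' := Finset.range 2) (fun z => (z, α z))
      (fun z hz => hα2 z (Finset.mem_range.1 hz)) (fun z _ z' _ h => (Prod.ext_iff.1 h).1)
      (fun p hp => ⟨p.1, Finset.mem_range.2 (hZY p hp).1,
        hZinj (hα2 _ (hZY p hp).1) hp rfl⟩), smul_fam, smul_fam]
    refine fam_congr (fun z hz => ?_) fun _ _ => rfl
    rw [Finset.mem_range] at hz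
    rcases (by omega : z = 0 ∨ z = 1) with rfl | rfl
    · rw [zero_mul, zero_mul, ω_zero]; ring
    -- As `α 0` is congruent to `α 1 + s'`, the relative phase has the multiplier `-y`, for which `2
    -- ^ H - y` stands.
    · have h1 := hZf _ (hα2 0 (by omega)) _ (hα2 1 (by omega))
      simp only [zero_mul, add_zero, one_mul] at h1 ⊢
      have h2 : ω H (y * α 0) = ω H (y * α 1) * ω H (y * s') := by
        rw [← ω_add, ← mul_add]
        refine ω_congr ?_
        rw [Nat.mul_mod, h1, ← Nat.mul_mod]
      have h3 : ω H (y * s') * ω H ((2 ^ H - y) * s') = 1 := by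
        rw [← ω_add, ← add_mul, Nat.add_sub_cancel' hyH.le, ω_two_pow_self_mul]
      rw [h2]
      linear_combination (-(1 / (Real.sqrt 2 : ℂ)) ^ H * c * ω H (y * α 1)) * h3
  · intro g _
    classical
    rw [← Finset.sum_mul]
    refine le_of_eq ?_
    congr 1
    exact sum_normSq_proj _ _ _ fun S => Finset.mem_image.2 ⟨(_, _), Finset.mem_univ _, rfl⟩

end Setting

/-! ### The stack of phase vectors, and the initial vectors. -/

namespace QState

theorem fam_append {b k r : ℕ} {β β' : ℕ → ℂ} {φ : QState} :
    fam (Finset.range (2 ^ r)) β' (encode (b + k) r) (fam (Finset.range (2 ^ k)) β (encode b k) φ) =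
      fam (Finset.range (2 ^ (k + r))) (fun y => β (y % 2 ^ k) * β' (y / 2 ^ k))
        (encode b (k + r)) φ := by
  have hk := Nat.two_pow_pos k
  rw [fam_fam, fam_reindex (Y' := Finset.range (2 ^ (k + r))) (fun y => (y % 2 ^ k, y / 2 ^ k))
    (fun y hy => by
      rw [Finset.mem_range, pow_add] at hy
      rw [Finset.mem_product, Finset.mem_range, Finset.mem_range]
      exact ⟨Nat.mod_lt _ hk, Nat.div_lt_of_lt_mul hy⟩)
    (fun y _ y' _ h => by
      have h1 := (Prod.ext_iff.1 h).1
      have h2 := (Prod.ext_iff.1 h).2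
      simp only at h1 h2
      rw [← Nat.mod_add_div y (2 ^ k), h1, h2, Nat.mod_add_div])
    (fun p hp => by
      rw [Finset.mem_product, Finset.mem_range, Finset.mem_range] at hp
      refine ⟨p.1 + 2 ^ k * p.2, ?_, ?_⟩
      · rw [Finset.mem_range, pow_add]
        have : 2 ^ k * (p.2 + 1) ≤ 2 ^ k * 2 ^ r := Nat.mul_le_mul_left _ hp.2
        rw [mul_add, mul_one] at this
        omega
      · rw [Nat.add_mul_mod_self_left, Nat.mod_eq_of_lt hp.1,
          Nat.add_mul_div_left _ _ hk, Nat.div_eq_of_lt hp.1, zero_add])]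
  refine fam_congr (fun _ _ => rfl) fun y _ => ?_
  simp only
  rw [← encode_append (Nat.mod_lt _ hk), Nat.mod_add_div]

end QState

/-- The phase multipliers of a phase vector after adding a qubit with phase multiplier `v`. -/
def extTable (i : ℕ) (b : ℕ → ℕ) (v : ℕ) : ℕ → ℕ := fun j => b (j % 2 ^ i) + j / 2 ^ i * v

/-- The expectation of a function of the phase multipliers of an initial phase vector formed
from `i` qubits. -/
noncomputable def leafMean (H : ℕ) : ℕ → ((ℕ → ℕ) → ℝ) → ℝ
  | 0, g => g fun _ => 0
  | i + 1, g => leafMean H i fun b =>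
      (1 / 2) ^ H * ∑ y ∈ Finset.range (2 ^ H), g (extTable i b (2 ^ H - y))

theorem leafMean_nonneg (H i : ℕ) {g : (ℕ → ℕ) → ℝ} (hg : ∀ b, 0 ≤ g b) : 0 ≤ leafMean H i g := by
  induction i generalizing g with
  | zero => exact hg _
  | succ i ih =>
    exact ih fun b => mul_nonneg (by positivity) (Finset.sum_nonneg fun _ _ => hg _)

/-- The state of the phase vectors on the stack, where `H - λ * m` is the height of a phase
vector that has passed `λ` stages. -/
noncomputable def stackState (H m s' : ℕ) : List (ℕ × (ℕ → ℕ)) → QState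
  | [] => Finsupp.single ∅ 1
  | (lev, b) :: L => QState.fam (Finset.range (2 ^ (m + 1)))
      (fun y => QState.ω (H - lev * m) (b y * s')) (encode (L.length * (m + 1)) (m + 1))
      (stackState H m s' L)

/-- The tables of the phase vectors on the stack are stored in the memory. -/
def StackMem (m : ℕ) (M : ℕ → ℕ → ℕ) : List (ℕ × (ℕ → ℕ)) → Prop
  | [] => True
  | (lev, b) :: L => M Sieve.Alev L.length = lev ∧
      (∀ y < 2 ^ (m + 1), M Sieve.Ab (L.length * 2 ^ (m + 1) + y) = b y) ∧ StackMem m M L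

theorem below_stackState (H m s' : ℕ) (L : List (ℕ × (ℕ → ℕ))) :
    QState.Below (L.length * (m + 1)) (stackState H m s' L) := by
  induction L with
  | nil => intro S hS; simp [stackState] at hS; simp [hS]
  | cons v L ih =>
    rw [stackState, List.length_cons, add_mul, one_mul]
    exact ih.fam (by omega) fun y _ a ha => (mem_encode.1 ha).2.1

theorem StackMem.congr {m : ℕ} {M M' : ℕ → ℕ → ℕ} {L : List (ℕ × (ℕ → ℕ))}
    (h : StackMem m M L) (h1 : ∀ p < L.length, M' Sieve.Alev p = M Sieve.Alev p)
    (h2 : ∀ a < L.length * 2 ^ (m + 1), M' Sieve.Ab a = M Sieve.Ab a) : StackMem m M' L := by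
  induction L with
  | nil => trivial
  | cons v L ih =>
    rw [List.length_cons, add_mul, one_mul] at h2
    obtain ⟨h3, h4, h5⟩ := h
    refine ⟨by rw [h1 _ (by simp), h3], fun y hy => by rw [h2 _ (Nat.add_lt_add_left hy _), h4 y hy],
      ih h5 (fun p hp => h1 p (by simp; omega)) fun a ha => h2 a (ha.trans_le (Nat.le_add_right _ _))⟩

namespace Setting

open Sieve QState Expr

variable {X : Type*} {n : ℕ} {K : Setting X n}
variable {φ : QState} {M : ℕ → ℕ → ℕ} {ψ : QState}

/-- The variables that are constant while the sieve runs, and the bounds. -/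
structure Layout (K : Setting X n) (M : ℕ → ℕ → ℕ) (m t l s' : ℕ) : Prop where
  hn : M vn 0 = n
  hm : M vm 0 = m
  hw : M vw 0 = m + 1
  ht : M vt 0 = t
  hl : M vl 0 = l
  hqa : M qa 0 = (m + 1) * (m + 1)
  hqf : M qf 0 = M qa 0 + n
  hqg : M qg 0 = M qf 0 + 1
  hqy : M qy 0 = M qg 0 + 2 * (m + 1) + 1
  hQ : M qy 0 + (m + 1) ≤ K.Qb
  sq : n = m ^ 2
  one_le : 1 ≤ m
  hB : 2 ^ (4 * m + 8) ≤ K.B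
  hs : ShiftData K.f t l s'

theorem Layout.frame {m t l s' : ℕ} {ts : List ℕ} {M' : ℕ → ℕ → ℕ}
    (h : Layout K M m t l s') (hf : Frame ts M M')
    (hts : ∀ u ∈ [vn, vm, vw, vt, vl, qa, qf, qg, qy], u ∉ ts) : Layout K M' m t l s' := by
  have e : ∀ u ∈ [vn, vm, vw, vt, vl, qa, qf, qg, qy], M' u 0 = M u 0 := fun u hu => by
    rw [hf u (hts u hu)]
  have e1 := e vn (by decide)
  have e2 := e vm (by decide)
  have e3 := e vw (by decide)
  have e4 := e vt (by decide)
  have e5 := e vl (by decide)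
  have e6 := e qa (by decide)
  have e7 := e qf (by decide)
  have e8 := e qg (by decide)
  have e9 := e qy (by decide)
  constructor
  · rw [e1, h.hn]
  · rw [e2, h.hm]
  · rw [e3, h.hw]
  · rw [e4, h.ht]
  · rw [e5, h.hl]
  · rw [e6, h.hqa]
  · rw [e7, e6, h.hqf]
  · rw [e8, e7, h.hqg]
  · rw [e9, e8, h.hqy]
  · rw [e9]; exact h.hQ
  · exact h.sq
  · exact h.one_le
  · exact h.hB
  · exact h.hs

theorem Layout.bounds {m t l s' : ℕ} (h : Layout K M m t l s') :
    2 * n ≤ K.B ∧ m + 1 ≤ K.B ∧ (m + 2) * 2 ^ (m + 1) ≤ K.B ∧ 2 ^ (2 * (m + 1)) ≤ K.B ∧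
      2 ^ (m + 1) ≤ K.B ∧ n + m + 4 ≤ K.B := by
  have h1 := h.hB
  have hm : m < 2 ^ m := Nat.lt_two_pow_self
  have hm1 := h.one_le
  have e1 : 2 ^ (4 * m + 8) = 2 ^ m * 2 ^ m * (2 ^ m * 2 ^ m) * 256 := by
    rw [pow_add, ← pow_add 2 m m, ← pow_add]; ring
  have e2 : 2 ^ (m + 1) = 2 ^ m * 2 := pow_succ _ _
  have e3 : 2 ^ (2 * (m + 1)) = 2 ^ m * 2 ^ m * 4 := by
    rw [mul_add, pow_add, ← pow_add]; ring
  have hn : n ≤ 2 ^ m * 2 ^ m := by rw [h.sq, pow_two]; exact Nat.mul_le_mul hm.le hm.le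
  have h2 : 1 ≤ 2 ^ m * 2 ^ m := Nat.mul_pos (by omega) (by omega)
  have h3 : 2 ^ m * 2 ^ m ≤ 2 ^ m * 2 ^ m * (2 ^ m * 2 ^ m) := Nat.le_mul_of_pos_right _ h2
  have h4 : 2 ^ m ≤ 2 ^ m * 2 ^ m := Nat.le_mul_of_pos_right _ (by omega)
  have h5 : (m + 2) * (2 ^ m * 2) ≤ 3 * 2 ^ m * (2 ^ m * 2) := Nat.mul_le_mul_right _ (by omega)
  have h6 : 3 * 2 ^ m * (2 ^ m * 2) = 6 * (2 ^ m * 2 ^ m) := by ring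
  rw [e2, e3]
  refine ⟨by omega, by omega, by omega, by omega, by omega, by omega⟩

/-- A number that is at most `(m + 1) * 2 ^ n`, or at most twice that, is not too long. -/
theorem Layout.size_le {m t l s' v : ℕ} (h : Layout K M m t l s')
    (hv : v ≤ 2 * ((m + 1) * 2 ^ n)) : v.size ≤ K.B := by
  have h1 := h.bounds.2.2.2.2.2
  have h2 : m + 1 < 2 ^ (m + 1) := Nat.lt_two_pow_self
  have h3 : 2 ^ (n + m + 2) = 2 * (2 ^ (m + 1) * 2 ^ n) := by
    rw [← pow_add, ← pow_succ']; congr 1; omega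
  have h4 : (m + 1) * 2 ^ n < 2 ^ (m + 1) * 2 ^ n :=
    Nat.mul_lt_mul_of_pos_right h2 (Nat.two_pow_pos _)
  have h5 : v < 2 ^ (n + m + 2) := by omega
  exact (Nat.size_le.2 h5).trans (by omega)

/-- The stack is in the memory. -/
structure Good (K : Setting X n) (M : ℕ → ℕ → ℕ) (ψ : QState) (m t l s' : ℕ)
    (L : List (ℕ × (ℕ → ℕ))) : Prop where
  layout : Layout K M m t l s'
  sp : M vsp 0 = L.length
  mem : StackMem m M L
  state : ∃ c : ℂ, ψ = c • stackState (n - t) m s' L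
  le : ∀ v ∈ L, ∀ y < 2 ^ (m + 1), v.2 y ≤ (m + 1) * 2 ^ n

/-- Each new qubit doubles the table, whose upper half is the lower half shifted by the new
multiplier. Multipliers are not reduced modulo `2 ^ H`; each qubit adds at most `2 ^ n`, which
explains the bound `(m + 1) * 2 ^ n` in `Good`. -/
theorem Prb.leaf {m t l s' : ℕ} {L : List (ℕ × (ℕ → ℕ))} (hG : Good K M ψ m t l s' L)
    (hL : L.length ≤ m) :
    K.Prb Sieve.leaf M ψ (fun g => ψ.normSq * leafMean (n - t) (m + 1) g)
      fun b M' ψ' => Good K M' ψ' m t l s' ((0, b) :: L) ∧ M' vdone 0 = M vdone 0 ∧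
        M' vD 0 = M vD 0 ∧ M' vh 0 = M vh 0 := by
  obtain ⟨lay, hsp, hmem, ⟨c₀, rfl⟩, hle⟩ := hG
  obtain ⟨hB1, hB2, hB3, hB4, hB5, hB6⟩ := lay.bounds
  have htn := lay.hs.tn
  set H := n - t with hH
  set p := L.length with hp
  set w := m + 1 with hw
  set Φ := stackState H m s' L with hΦ
  have hbel : Below (p * w) Φ := below_stackState _ _ _ _
  have hw0 := Nat.two_pow_pos w
  have hn0 := Nat.two_pow_pos n
  have hpw : p * 2 ^ w + 2 ^ w ≤ K.B := by
    have : (p + 1) * 2 ^ w ≤ (m + 2) * 2 ^ w := Nat.mul_le_mul_right _ (by omega)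
    rw [add_mul, one_mul] at this
    omega
  have hpwq : p * w + w ≤ w * w := by
    have : (p + 1) * w ≤ w * w := Nat.mul_le_mul_right _ (by omega)
    rw [add_mul, one_mul] at this
    omega
  have hnn : ∀ g : (ℕ → ℕ) → ℝ, (∀ i, 0 ≤ g i) →
      0 ≤ (c₀ • Φ).normSq * leafMean H w g := fun g hg =>
    mul_nonneg (normSq_nonneg _) (leafMean_nonneg _ _ hg)
  have hpw1 : p * w ≤ K.B := by
    have : p * w ≤ p * 2 ^ w := Nat.mul_le_mul_left _ Nat.lt_two_pow_self.le
    omega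
  have hpp : p ≤ K.B := by omega
  refine Prb.det_cons (Det.asgSmall ⟨rfl, by decide⟩ (by decide)
    (by rw [eval_mul, eval_var, eval_var, hsp, lay.hw]; exact hpw1) fun _ _ => ?_) hnn
  rw [eval_mul, eval_var, eval_var, hsp, lay.hw]
  set M₁ := upd M vbase 0 (p * w) with hM₁
  have f1 : Frame [vbase] M M₁ := (Frame.refl _ _).upd (by decide) _ _
  have e1 : M₁ vsp 0 = p := by rw [f1 vsp (by decide), hsp]
  refine Prb.det_cons (Det.setSmall ⟨rfl, by decide⟩ adm_zero (by decide)
    (by rw [eval_var, e1]; exact hpp) (by simp) fun _ _ => ?_) hnn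
  rw [eval_var, e1, eval_zero]
  set M₂ := upd M₁ Alev p 0 with hM₂
  have f2 : Frame [vbase, Alev] M M₂ := (f1.mono (by decide)).upd (by decide) _ _
  have e2 : (var vsp * pow (var vw)).eval M₂ = p * 2 ^ w := by
    rw [eval_mul, eval_pow, eval_var, eval_var, f2 vsp (by decide), hsp, f2 vw (by decide), lay.hw]
  refine Prb.det_cons (Det.set ⟨rfl, by decide⟩ adm_zero (by decide)
    (by rw [e2]; omega) (by simp) (by simp) fun _ _ => ?_) hnn
  rw [e2, eval_zero]
  set M₃ := upd M₂ Ab (p * 2 ^ w) 0 with hM₃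
  have f3 : Frame [vbase, Alev, Ab] M M₃ := (f2.mono (by decide)).upd (by decide) _ _
  set ts : List ℕ := [vbase, Alev, Ab, i3, i4, vo, vy]
  refine Prb.cons_det (P := fun b M' ψ' => Good K M' ψ' m t l s' ((0, b) :: L) ∧
      M' vdone 0 = M vdone 0 ∧ M' vD 0 = M vD 0 ∧ M' vh 0 = M vh 0) (Prb.forLt (N := w)
    ⟨rfl, by decide⟩ (by decide) (by omega)
    (fun i b M' ψ' => Frame ts M M' ∧ M' vbase 0 = p * w ∧ M' Alev p = 0 ∧
      (∀ q < p, M' Alev q = M Alev q) ∧ (∀ y < 2 ^ i, M' Ab (p * 2 ^ w + y) = b y) ∧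
      (∀ a < p * 2 ^ w, M' Ab a = M Ab a) ∧ (∀ y < 2 ^ i, b y ≤ i * 2 ^ n) ∧
      ∃ γ : ℂ, ψ' = γ • fam (Finset.range (2 ^ i)) (fun y => ω H (b y * s')) (encode (p * w) i) Φ)
    (fun i b g => (1 / 2) ^ H * ∑ y ∈ Finset.range (2 ^ H), g (extTable i b (2 ^ H - y)))
    (fun i b g hg => mul_nonneg (by positivity) (Finset.sum_nonneg fun _ _ => hg _))
    (fun i g => (c₀ • Φ).normSq * leafMean H i g) (i₀ := fun _ => 0) (fun _ _ => le_rfl)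
    (fun _ _ _ _ => le_rfl) hnn ?_ ?_ ?_ (fun _ _ _ h _ => h)) ?_
  · refine ⟨(f3.mono (by decide)).upd (by decide) _ _, ?_, ?_, ?_, ?_, ?_, by simp, c₀, ?_⟩
    · rw [upd_ne (by decide), hM₃, upd_ne (by decide), hM₂, upd_ne (by decide), hM₁, upd_self]
    · rw [upd_ne (by decide), hM₃, upd_ne (by decide), hM₂, upd_self]
    · intro q hq
      rw [upd_ne (by decide), hM₃, upd_ne (by decide), hM₂, upd_apply, if_neg (by omega), hM₁,
        upd_ne (by decide)]
    · intro y hy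
      rw [upd_ne (by decide), show y = 0 by omega, add_zero, hM₃, upd_self]
    · intro a ha
      rw [upd_ne (by decide), hM₃, upd_apply, if_neg (by omega), f2 Ab (by decide)]
    · congr 1
      simp only [pow_zero, Finset.range_one, fam, Finset.sum_singleton, encode_zero,
        Finset.union_empty, zero_mul, ω_zero, one_smul]
      exact Finsupp.mapDomain_id.symm
  · rintro i - b M' ψ' ⟨hf, -⟩ -
    rw [eval_var, hf vw (by decide), lay.hw]
  · rintro i hi b M' _ ⟨hf, hb, hlev, hlev', htab, htab', hble, γ, rfl⟩ hi' - hM'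
    have lay' := lay.frame hf (by decide)
    set ψ₁ := γ • fam (Finset.range (2 ^ i)) (fun y => ω H (b y * s')) (encode (p * w) i) Φ with hψ₁
    -- The stack and the part of the new vector built so far are the spectator for the preparation
    -- of the next qubit.
    have hbel₁ : Below (p * w + i) ψ₁ :=
      (hbel.fam (by omega) fun y _ a ha => (mem_encode.1 ha).2.1).smul _
    have h2i : 2 ^ i * 2 ≤ 2 ^ w := by
      rw [← pow_succ]; exact Nat.pow_le_pow_right (by omega) hi
    have hHn : 2 ^ H ≤ 2 ^ n := Nat.pow_le_pow_right (by omega) (Nat.sub_le _ _)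
    have hq₀ : ∀ M'' : ℕ → ℕ → ℕ, Frame [i4, vo, vy] M' M'' →
        (var vbase + var i3).eval M'' = p * w + i := fun M'' hf'' => by
      rw [eval_add, eval_var, eval_var, hf'' vbase (by decide), hf'' i3 (by decide), hb, hi']
    refine Prb.append (l := [_, _, _, _, _, _]) (l' := [_]) (Prb.mono (Prb.seq
      (fun y g => g (extTable i b (2 ^ H - y))) (Prb.phaseQubit lay.hs hbel₁ hq₀
        (by rw [lay'.hqa, ← hw]; omega) lay'.hn lay'.ht lay'.hl (by
          have h1 := lay'.hQ
          have h2 := lay'.hqy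
          have h3 := lay'.hqg
          have h4 := lay'.hqf
          omega) hB1) (fun y g hg => hg _) ?_)
      (fun g _ => le_rfl) fun _ _ _ h => h)
    rintro y M₄ _ ⟨hf₄, hy, hyH, γ', rfl⟩ - hM₄
    have lay₄ := lay'.frame hf₄ (by decide)
    have hw₄ : M₄ vw 0 = w := lay₄.hw
    have hv : 2 ^ H - y ≤ 2 ^ n := by omega
    have htab₄ : ∀ y < 2 ^ i, M₄ Ab (p * 2 ^ w + y) = b y := fun y hy => by
      rw [hf₄ Ab (by decide), htab y hy]
    have hsp₄ : M₄ vsp 0 = p := by rw [hf₄ vsp (by decide), hf vsp (by decide), hsp]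
    have hi₄ : M₄ i3 0 = i := by rw [hf₄ i3 (by decide), hi']
    have hval : ∀ j < 2 ^ i, b j + (2 ^ H - y) ≤ (i + 1) * 2 ^ n := fun j hj => by
      rw [add_mul, one_mul]; exact Nat.add_le_add (hble j hj) hv
    have hile : (i + 1) * 2 ^ n ≤ w * 2 ^ n := Nat.mul_le_mul_right _ hi
    refine Prb.of_det (Det.single ((Det.fill (t := Ab) (u := i4) (N := 2 ^ i)
      (av := fun j => p * 2 ^ w + 2 ^ i + j) (vv := fun j => b j + (2 ^ H - y)) (by decide)
      (by decide) (by decide) ⟨rfl, by decide⟩ ⟨rfl, by decide⟩ ⟨rfl, by decide⟩ (by omega) ?_ ?_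
      (fun _ _ _ _ h => Nat.add_left_cancel h) (fun j hj => by omega)
      (fun _ _ h => by simp [smallTape] at h)
      (fun j hj => lay.size_le (((hval j hj).trans hile).trans (Nat.le_mul_of_pos_left _ two_pos)))).mono ?_))
    · intro M₅ hf₅
      rw [eval_pow, eval_var, hf₅ i3 (by decide), hi₄]
    · intro j hj M₅ hf₅ hj₅ hsame
      refine ⟨?_, ?_⟩
      · simp only [eval_add, eval_mul, eval_pow, eval_var, hf₅ vsp (by decide), hsp₄,
          hf₅ vw (by decide), hw₄, hf₅ i3 (by decide), hi₄, hj₅]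
      · simp only [eval_add, eval_mul, eval_pow, eval_var, eval_sub, eval_rd,
          hf₅ vsp (by decide), hsp₄, hf₅ vw (by decide), hw₄, hj₅, hf₅ vn (by decide), lay₄.hn,
          hf₅ vt (by decide), lay₄.ht, hf₅ vy (by decide), hy]
        rw [hsame _ fun k _ => by omega, htab₄ j hj]
    · rintro M₅ _ ⟨hf₅, rfl, hnew, hsame⟩
      have hf₅' : Frame ts M M₅ := (hf.trans hf₄ (by decide)).trans hf₅ (by decide)
      refine ⟨by rw [hf₅ i3 (by decide), hi₄], hf₅'.upd (by decide) _ _, ?_, ?_, ?_, ?_, ?_, ?_, ?_⟩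
      · rw [upd_ne (by decide), hf₅ vbase (by decide), hf₄ vbase (by decide), hb]
      · rw [upd_ne (by decide), hf₅ Alev (by decide), hf₄ Alev (by decide), hlev]
      · intro q hq
        rw [upd_ne (by decide), hf₅ Alev (by decide), hf₄ Alev (by decide), hlev' q hq]
      · intro j hj
        rw [upd_ne (by decide), extTable]
        rw [pow_succ] at hj
        by_cases h : j < 2 ^ i
        · rw [hsame _ fun k _ => by omega, htab₄ j h, Nat.mod_eq_of_lt h, Nat.div_eq_of_lt h]
          simp
        · have := hnew (j - 2 ^ i) (by omega)
          rw [show p * 2 ^ w + 2 ^ i + (j - 2 ^ i) = p * 2 ^ w + j by omega] at this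
          rw [this]
          have h1 : j = (j - 2 ^ i) + 2 ^ i * 1 := by omega
          have h2 : j - 2 ^ i < 2 ^ i := by omega
          have h3 : j % 2 ^ i = j - 2 ^ i := by
            conv_lhs => rw [h1, Nat.add_mul_mod_self_left, Nat.mod_eq_of_lt h2]
          have h4 : j / 2 ^ i = 1 := by
            conv_lhs => rw [h1, Nat.add_mul_div_left _ _ (Nat.two_pow_pos _), Nat.div_eq_of_lt h2]
          rw [h3, h4, one_mul]
      · intro a ha
        rw [upd_ne (by decide), hsame _ fun k _ => by omega, hf₄ Ab (by decide), htab' a ha]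
      · intro j hj
        rw [pow_succ] at hj
        rw [extTable]
        have h1 := hble (j % 2 ^ i) (Nat.mod_lt _ (Nat.two_pow_pos _))
        have h2 : j / 2 ^ i ≤ 1 := Nat.lt_succ_iff.1 (Nat.div_lt_of_lt_mul hj)
        have h3 : j / 2 ^ i * (2 ^ H - y) ≤ 1 * 2 ^ n := Nat.mul_le_mul h2 hv
        rw [add_mul]
        omega
      · refine ⟨γ' * γ, ?_⟩
        have h1 : fam (Finset.range 2) (fun z => ω H (z * (2 ^ H - y) * s')) (encode (p * w + i) 1) ψ₁
            = γ • fam (Finset.range (2 ^ 1)) (fun z => ω H (z * (2 ^ H - y) * s'))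
              (encode (p * w + i) 1)
              (fam (Finset.range (2 ^ i)) (fun y => ω H (b y * s')) (encode (p * w) i) Φ) := by
          rw [hψ₁, fam_smul, smul_fam, pow_one]
        rw [h1, fam_append, smul_smul]
        congr 1
        refine fam_congr (fun j _ => ?_) fun _ _ => rfl
        rw [← ω_add, extTable, add_mul]
  · rintro b M' _ ⟨hf, hb, hlev, hlev', htab, htab', hble, γ, rfl⟩ - -
    have hsp' : M' vsp 0 = p := by rw [hf vsp (by decide), hsp]
    refine Det.single (Det.asgSmall ⟨rfl, by decide⟩ (by decide) ?_ ?_)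
    · rw [eval_add, eval_var, eval_one, hsp']; omega
    rw [eval_add, eval_var, eval_one, hsp']
    have hf' : Frame (vsp :: ts) M (upd M' vsp 0 (p + 1)) := (hf.mono (by decide)).upd (by decide) _ _
    refine ⟨⟨lay.frame hf' (by decide), by rw [upd_self, List.length_cons], ⟨?_, ?_, ?_⟩,
      ⟨γ, ?_⟩, ?_⟩, ?_, ?_, ?_⟩
    · rw [upd_ne (by decide), hlev]
    · intro y hy
      rw [upd_ne (by decide), htab y hy]
    · refine hmem.congr (fun q hq => ?_) fun a ha => ?_
      · rw [upd_ne (by decide), hlev' q hq]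
      · rw [upd_ne (by decide), htab' a ha]
    · rw [stackState, zero_mul, Nat.sub_zero]
    · intro v hv y hy
      rcases List.mem_cons.1 hv with rfl | hv
      · exact hble y hy
      · exact hle v hv y hy
    · rw [hf' vdone (by decide)]
    · rw [hf' vD (by decide)]
    · rw [hf' vh (by decide)]

end Setting

/-! ### Collimation stages. -/

/-- The phase multipliers of the tensor product of two phase vectors of length `2 ^ w`. -/
def mergeTable (w : ℕ) (b b' : ℕ → ℕ) : ℕ → ℕ := fun y => b (y % 2 ^ w) + b' (y / 2 ^ w)

theorem collSum_congr {a a' : ℕ → ℕ} {c e R : ℕ} {g : Option (ℕ → ℕ) → ℝ}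
    (h : ∀ y < 2 ^ R, a y = a' y) : collSum a c e R g = collSum a' c e R g := by
  have h1 : ∀ x, labelClass (fun y => a y % 2 ^ c) R x = labelClass (fun y => a' y % 2 ^ c) R x := by
    intro x
    refine List.filter_congr fun y hy => ?_
    simp only [h y (List.mem_range.1 hy)]
  have h2 : ∀ x q, collOutcome a c e R x q = collOutcome a' c e R x q := by
    intro x q
    rw [collOutcome, collOutcome, h1]
    split_ifs
    · congr 1
      funext z
      rw [segTable, segTable, h1]
      congr 1
      refine h _ ?_
      by_cases hi : q * 2 ^ e + z < (labelClass (fun y => a' y % 2 ^ c) R x).length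
      · exact (labelClass_get hi).1
      -- Past the end of the list the index is the default `0`, which also is below `2 ^ R`.
      · rw [List.getD_eq_default _ _ (by omega)]; positivity
    · rfl
  rw [collSum, collSum]
  refine Finset.sum_congr rfl fun x _ => ?_
  rw [h1]
  exact Finset.sum_congr rfl fun i _ => by rw [h2]

theorem QState.normSq_fam_range {base R : ℕ} {β : ℕ → ℂ} {φ : QState} (hφ : Below base φ)
    (hβ : ∀ y, ‖β y‖ = 1) :
    (fam (Finset.range (2 ^ R)) β (encode base R) φ).normSq = 2 ^ R * φ.normSq := by
  rw [normSq_fam_unit hφ (fun y _ => hβ y) (fun _ _ _ ha => (mem_encode.1 ha).1)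
    fun i hi j hj h => encode_injOn base R (Finset.mem_range.1 hi) (Finset.mem_range.1 hj) h,
    Finset.card_range]
  push_cast; rfl

namespace Setting

open Sieve QState Expr

variable {X : Type*} {n : ℕ} {K : Setting X n}
variable {φ : QState} {M : ℕ → ℕ → ℕ} {ψ : QState}

theorem Layout.collParams {m t l s' base R cv ev : ℕ} (h : Layout K M m t l s')
    (hb : M vbase 0 = base) (hR : M vR 0 = R) (hc : M vc 0 = cv) (he : M ve 0 = ev)
    (hbR : base + R ≤ (m + 1) * (m + 1)) (hR2 : R ≤ 2 * (m + 1)) (heR : ev ≤ R) (hem : ev ≤ m + 1)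
    (hcm : cv ≤ m) : CollParams K M base R cv ev := by
  have h1 := h.hqa
  have h2 := h.hqf
  have h3 := h.hqg
  have h4 := h.hqy
  have h5 := h.hQ
  obtain ⟨-, -, -, h6, h7, -⟩ := h.bounds
  refine ⟨hR, hc, he, hb, by omega, by omega, by omega, by omega, heR, ?_, ?_⟩
  · exact (Nat.pow_le_pow_right (by omega) hR2).trans h6
  · exact (Nat.pow_le_pow_right (by omega) (by omega)).trans h7

/-- By `fam_append`, the two uppermost vectors, on adjacent registers, are one phase vector with the
sums of their multipliers. The rest of the stack is a spectator, so `Prb.collimate` applies; a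
failure removes both vectors and leaves the rest intact. -/
theorem Prb.stage {m t l s' lev : ℕ} {b₁ b₂ : ℕ → ℕ} {L : List (ℕ × (ℕ → ℕ))}
    (hG : Good K M ψ m t l s' ((lev, b₂) :: (lev, b₁) :: L))
    (hL : L.length + 2 ≤ m + 1) (hlev : lev * m + m ≤ n - t) :
    K.Prb Sieve.stage M ψ (fun g => ψ.normSq * ((1 / 2) ^ (2 * (m + 1)) *
      collSum (mergeTable (m + 1) b₁ b₂) m (m + 1) (2 * (m + 1)) g))
      fun o M' ψ' => (o = none → Good K M' ψ' m t l s' L) ∧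
        (∀ b, o = some b → Good K M' ψ' m t l s' ((lev + 1, b) :: L)) ∧ M' vdone 0 = M vdone 0 ∧
        M' vD 0 = M vD 0 ∧ M' vh 0 = M vh 0 := by
  obtain ⟨lay, hsp, ⟨hm1, hm2, hm3, hm4, hmem⟩, ⟨c₀, rfl⟩, hle⟩ := hG
  obtain ⟨hB1, hB2, hB3, hB4, hB5, hB6⟩ := lay.bounds
  have hle₁ := hle (lev, b₁) (by simp)
  have hle₂ := hle (lev, b₂) (by simp)
  have hle' : ∀ v ∈ L, ∀ y < 2 ^ (m + 1), v.2 y ≤ (m + 1) * 2 ^ n := fun v hv =>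
    hle v (by simp [hv])
  have hone := lay.one_le
  clear hle
  have hw' : M vw 0 = m + 1 := lay.hw
  simp only [List.length_cons] at hsp hm1 hm2 hm3 hm4
  set H := n - t with hH
  set p := L.length with hp
  obtain ⟨w, hw⟩ : ∃ w, w = m + 1 := ⟨_, rfl⟩
  set Φ := stackState H m s' L with hΦ
  have hbel : Below (p * w) Φ := by rw [hw]; exact below_stackState _ _ _ _
  simp only [← hw] at hB2 hB3 hB4 hB5 hle₁ hle₂ hle' hw' hL hm2 hm4 ⊢
  have hwpos := Nat.two_pow_pos w
  set ψ₀ := c₀ • stackState H m s' ((lev, b₂) :: (lev, b₁) :: L) with hψ₀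
  have hst : ψ₀ = fam (Finset.range (2 ^ (2 * w)))
      (fun y => ω (H - lev * m) (mergeTable w b₁ b₂ y * s')) (encode (p * w) (2 * w))
      (c₀ • Φ) := by
    rw [hψ₀, stackState, stackState, List.length_cons, ← hw, ← hp, add_mul, one_mul, fam_append,
      smul_fam, fam_smul, two_mul]
    refine fam_congr (fun y _ => ?_) fun _ _ => rfl
    rw [mergeTable, add_mul, ω_add]
  have hns : ψ₀.normSq = 2 ^ (2 * w) * (c₀ • Φ).normSq := by
    rw [hst, normSq_fam_range (hbel.smul _) fun _ => norm_ω _ _]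
  -- The power of `1 / 2` normalizes: the squared norm of the merged vector is `2 ^ (2 * w)` times
  -- that of the spectator.
  have hE : ∀ g : Option (ℕ → ℕ) → ℝ, ψ₀.normSq * ((1 / 2) ^ (2 * w) *
      collSum (mergeTable w b₁ b₂) m w (2 * w) g) =
        (c₀ • Φ).normSq * collSum (mergeTable w b₁ b₂) m w (2 * w) g := fun g => by
    rw [hns, one_div, inv_pow]; field_simp
  have hnn : ∀ g : Option (ℕ → ℕ) → ℝ, (∀ i, 0 ≤ g i) → 0 ≤ ψ₀.normSq * ((1 / 2) ^ (2 * w) *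
      collSum (mergeTable w b₁ b₂) m w (2 * w) g) := fun g hg =>
    mul_nonneg (normSq_nonneg _) (mul_nonneg (by positivity)
      (Finset.sum_nonneg fun _ _ => Finset.sum_nonneg fun _ _ => hg _))
  have hpm : p + 2 ≤ m + 1 := hw ▸ hL
  have hpw : p * 2 ^ w + 2 * 2 ^ w ≤ K.B := by
    have : (p + 2) * 2 ^ w ≤ (m + 2) * 2 ^ w := Nat.mul_le_mul_right _ (by omega)
    rw [add_mul] at this
    omega
  have hpwq : p * w + 2 * w ≤ w * w := by
    have : (p + 2) * w ≤ w * w := Nat.mul_le_mul_right _ (by omega)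
    rw [add_mul] at this
    omega
  have hpw1 : p * w ≤ K.B := by
    have : p * w ≤ p * 2 ^ w := Nat.mul_le_mul_left _ Nat.lt_two_pow_self.le
    omega
  have hw2 : w < 2 ^ w := Nat.lt_two_pow_self
  have hsp' : ∀ M' : ℕ → ℕ → ℕ, M' vsp 0 = p + 1 + 1 → M' vw 0 = w →
      ((var vsp - 2) * var vw : Expr).eval M' = p * w := fun M' h1 h2 => by
    rw [eval_mul, eval_sub, eval_var, eval_var, eval_two, h1, h2]; rfl
  refine Prb.det_cons (Det.asgSmall ⟨rfl, by decide⟩ (by decide)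
    (by rw [hsp' M hsp hw']; exact hpw1) fun _ _ => ?_) hnn
  rw [hsp' M hsp hw']
  set M₁ := upd M vbase 0 (p * w) with hM₁
  have f1 : Frame [vbase] M M₁ := (Frame.refl _ _).upd (by decide) _ _
  have e1 : (2 * var vw : Expr).eval M₁ = 2 * w := by
    rw [eval_mul, eval_var, eval_two, f1 vw (by decide), hw']
  refine Prb.det_cons (Det.asgSmall ⟨rfl, by decide⟩ (by decide)
    (by rw [e1]; omega) fun _ _ => ?_) hnn
  rw [e1]
  set M₂ := upd M₁ vR 0 (2 * w) with hM₂
  have f2 : Frame [vbase, vR] M M₂ := (f1.mono (by decide)).upd (by decide) _ _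
  have e2 : (var vm : Expr).eval M₂ = m := by rw [eval_var, f2 vm (by decide), lay.hm]
  refine Prb.det_cons (Det.asgSmall ⟨rfl, by decide⟩ (by decide)
    (by rw [e2]; omega) fun _ _ => ?_) hnn
  rw [e2]
  set M₃ := upd M₂ vc 0 m with hM₃
  have f3 : Frame [vbase, vR, vc] M M₃ := (f2.mono (by decide)).upd (by decide) _ _
  have e3 : (var vw : Expr).eval M₃ = w := by rw [eval_var, f3 vw (by decide), hw']
  refine Prb.det_cons (Det.asgSmall ⟨rfl, by decide⟩ (by decide)
    (by rw [e3]; omega) fun _ _ => ?_) hnn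
  rw [e3]
  set M₄ := upd M₃ ve 0 w with hM₄
  have f4 : Frame [vbase, vR, vc, ve] M M₄ := (f3.mono (by decide)).upd (by decide) _ _
  have hbase₄ : M₄ vbase 0 = p * w := by
    rw [hM₄, upd_ne (by decide), hM₃, upd_ne (by decide), hM₂, upd_ne (by decide), hM₁, upd_self]
  have hR₄ : M₄ vR 0 = 2 * w := by
    rw [hM₄, upd_ne (by decide), hM₃, upd_ne (by decide), hM₂, upd_self]
  have hc₄ : M₄ vc 0 = m := by rw [hM₄, upd_ne (by decide), hM₃, upd_self]
  have he₄ : M₄ ve 0 = w := by rw [hM₄, upd_self]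
  have hsp₄ : M₄ vsp 0 = p + 1 + 1 := by rw [f4 vsp (by decide), hsp]
  have hw₄ : M₄ vw 0 = w := by rw [f4 vw (by decide), hw']
  have hlt : ∀ j < 2 ^ (2 * w), j % 2 ^ w < 2 ^ w ∧ j / 2 ^ w < 2 ^ w := fun j hj => by
    rw [two_mul, pow_add] at hj
    exact ⟨Nat.mod_lt _ hwpos, Nat.div_lt_of_lt_mul hj⟩
  have hmle : ∀ j < 2 ^ (2 * w), mergeTable w b₁ b₂ j ≤ 2 * (w * 2 ^ n) := fun j hj => by
    have h1 := hle₁ _ (hlt j hj).1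
    have h2 := hle₂ _ (hlt j hj).2
    rw [mergeTable]
    omega
  have hsz : ∀ {v}, v ≤ 2 * (w * 2 ^ n) → v.size ≤ K.B := fun {v} hv =>
    lay.size_le (by rw [← hw]; exact hv)
  refine Prb.det_cons ((Det.fill (t := As) (u := i3) (N := 2 ^ (2 * w)) (av := id)
    (vv := mergeTable w b₁ b₂) (by decide) (by decide) (by decide)
    ⟨rfl, by decide⟩ ⟨rfl, by decide⟩ ⟨rfl, by decide⟩ hB4 ?_ ?_ (fun _ _ _ _ h => h)
    (fun j hj => hj.le.trans hB4) (fun _ _ h => by simp [smallTape] at h)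
    (fun j hj => hsz (hmle j hj))).mono ?_) hnn
  · intro M' hf'
    rw [eval_pow, eval_var, hf' vR (by decide), hR₄]
  · rintro j hj M' hf' hj' -
    obtain ⟨h1, h2⟩ := hlt j hj
    refine ⟨by rw [eval_var, hj']; rfl, ?_⟩
    have hAb : M' Ab = M Ab := by rw [hf' Ab (by decide), f4 Ab (by decide)]
    simp only [eval_add, eval_rd, eval_mul, eval_sub, eval_mod, eval_div, eval_pow, eval_var, eval_two,
      eval_one, hf' vsp (by decide), hf' vw (by decide), hsp₄, hw₄, hj', hAb]
    rw [show p + 1 + 1 - 2 = p by omega, show p + 1 + 1 - 1 = p + 1 by omega, hm4 _ h1, hm2 _ h2]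
    rfl
  rintro M₅ _ ⟨hf₅, rfl, hnew, -⟩ - -
  have f5 : Frame [vbase, vR, vc, ve, i3, As] M M₅ := (f4.mono (by decide)).trans hf₅ (by decide)
  have lay₅ := lay.frame f5 (by decide)
  have hcp : CollParams K M₅ (p * w) (2 * w) m w := lay₅.collParams
    (by rw [hf₅ vbase (by decide), hbase₄]) (by rw [hf₅ vR (by decide), hR₄])
    (by rw [hf₅ vc (by decide), hc₄]) (by rw [hf₅ ve (by decide), he₄]) (by rw [← hw]; omega)
    (by omega) (by omega) (by omega) le_rfl
  have hcs : ∀ g, collSum (M₅ As) m w (2 * w) g =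
      collSum (mergeTable w b₁ b₂) m w (2 * w) g := fun g => collSum_congr fun y hy => hnew y hy
  have hcoll := Prb.collimate (h := H - lev * m) (s := s') (hbel.smul c₀) hcp (by omega)
  rw [show fam (Finset.range (2 ^ (2 * w))) (fun y => ω (H - lev * m) (M₅ As y * s'))
    (encode (p * w) (2 * w)) (c₀ • Φ) = ψ₀ by
      rw [hst]
      exact fam_congr (fun y hy => by rw [← hnew y (Finset.mem_range.1 hy)]; rfl) fun _ _ => rfl]
    at hcoll
  refine Prb.mono (Prb.cons_det (P := fun o M' ψ' => (o = none → Good K M' ψ' m t l s' L) ∧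
        (∀ b, o = some b → Good K M' ψ' m t l s' ((lev + 1, b) :: L)) ∧ M' vdone 0 = M vdone 0 ∧
        M' vD 0 = M vD 0 ∧ M' vh 0 = M vh 0) hcoll ?_)
    (fun g _ => by rw [hE, hcs]) fun _ _ _ h => h
  rintro o M₆ ψ₆ ⟨hf₆, hnone, hsome⟩ - -
  have f6 : Frame (collTapes ++ [vbase, vR, vc, ve, i3, As]) M M₆ :=
    Frame.trans (f5.mono (by decide)) hf₆ (by decide)
  have e6 : (var vsp - 2 : Expr).eval M₆ = p := by
    rw [eval_sub, eval_var, eval_two, f6 vsp (by decide), hsp]; rfl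
  have e7 : ∀ a < p * 2 ^ w, M₆ Ab a = M Ab a := fun a _ => by rw [f6 Ab (by decide)]
  have hlev₆ : M₆ Alev = M Alev := f6 Alev (by decide)
  refine Det.cons (Det.asgSmall ⟨rfl, by decide⟩ (by decide) (by rw [e6]; omega) fun _ => ?_)
  rw [e6]
  set M₇ := upd M₆ vsp 0 p with hM₇
  have f7 : Frame (vsp :: (collTapes ++ [vbase, vR, vc, ve, i3, As])) M M₇ :=
    (f6.mono (by decide)).upd (by decide) _ _
  have hM₇₆ : ∀ t ≠ vsp, M₇ t = M₆ t := fun t ht => by rw [hM₇]; exact upd_ne ht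
  cases o with
  | none =>
    obtain ⟨hok, γ, rfl⟩ := hnone rfl
    refine Det.single (Det.when ⟨rfl, by decide⟩ (fun h => absurd ?_ h) fun _ => ?_)
    · rw [eval_var, hM₇₆ vok (by decide), hok]
    refine ⟨fun _ => ⟨lay.frame f7 (by decide), by rw [hM₇, upd_self], hmem.congr ?_ ?_,
      ⟨γ * c₀, by rw [smul_smul]⟩, ?_⟩, fun _ h => by simp at h, by rw [f7 vdone (by decide)],
      by rw [f7 vD (by decide)], by rw [f7 vh (by decide)]⟩
    · intro q _
      rw [f7 Alev (by decide)]
    · intro a _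
      rw [f7 Ab (by decide)]
    · rw [← hw]; exact hle'
  | some b =>
    obtain ⟨hok, hb, γ, rfl⟩ := hsome b rfl
    refine Det.single (Det.when ⟨rfl, by decide⟩ (fun _ => ?_) fun h => absurd h ?_)
    swap
    · rw [eval_var, hM₇₆ vok (by decide), hok]; decide
    have hble : ∀ y < 2 ^ w, b y ≤ w * 2 ^ n := fun z hz => by
      obtain ⟨-, y, hy, h⟩ := hb z hz
      have h1 : M₅ As y ≤ 2 * (w * 2 ^ n) := (hnew y hy).le.trans (hmle y hy)
      rw [h]
      -- The sum of two multipliers doubles the bound, and the division by `2 ^ m` with `m ≥ 1` at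
      -- least halves it. So the bound is the same at all levels.
      refine (Nat.div_le_div_left (Nat.le_self_pow (by omega) 2) two_pos).trans ?_
      omega
    have hsp₇ : M₇ vsp 0 = p := by rw [hM₇, upd_self]
    have hw₇ : M₇ vw 0 = w := by rw [f7 vw (by decide), hw']
    refine Det.cons ((Det.fill (t := Ab) (u := i3) (N := 2 ^ w) (av := fun i => p * 2 ^ w + i)
      (vv := b) (by decide) (by decide) (by decide)
      ⟨rfl, by decide⟩ ⟨rfl, by decide⟩ ⟨rfl, by decide⟩ hB5 ?_ ?_
      (fun _ _ _ _ h => Nat.add_left_cancel h)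
      (fun j hj => by omega) (fun _ _ h => by simp [smallTape] at h)
      (fun j hj => hsz ((hble j hj).trans (by omega)))).mono ?_)
    · intro M' hf'
      rw [eval_pow, eval_var, hf' vw (by decide), hw₇]
    · rintro j hj M' hf' hj' -
      refine ⟨?_, ?_⟩
      · rw [eval_add, eval_mul, eval_pow, eval_var, eval_var, eval_var, hf' vsp (by decide),
          hf' vw (by decide), hsp₇, hw₇, hj']
      · rw [eval_rd, eval_var, hj', hf' Anew (by decide), hM₇₆ Anew (by decide), (hb j hj).1]
    rintro M₈ _ ⟨hf₈, rfl, hnew₈, hsame₈⟩ hM₈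
    have hsp₈ : M₈ vsp 0 = p := by rw [hf₈ vsp (by decide), hsp₇]
    have hlev₈ : M₈ Alev = M Alev := by rw [hf₈ Alev (by decide), f7 Alev (by decide)]
    have e8 : (rd Alev (var vsp) + 1 : Expr).eval M₈ = lev + 1 := by
      rw [eval_add, eval_rd, eval_var, eval_one, hsp₈, hlev₈, hm3]
    have hlevB : lev + 1 ≤ K.B := by
      have : lev * 1 ≤ lev * m := Nat.mul_le_mul_left _ hone
      omega
    refine Det.cons (Det.setSmall ⟨rfl, by decide⟩ ⟨rfl, by decide⟩ (by decide)
      (by rw [eval_var, hsp₈]; omega) (by rw [e8]; exact hlevB) fun _ => ?_)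
    rw [eval_var, hsp₈, e8]
    set M₉ := upd M₈ Alev p (lev + 1) with hM₉
    have hsp₉ : (var vsp + 1 : Expr).eval M₉ = p + 1 := by
      rw [eval_add, eval_var, eval_one, hM₉, upd_ne (by decide), hsp₈]
    refine Det.single (Det.asgSmall ⟨rfl, by decide⟩ (by decide) (by rw [hsp₉]; omega) ?_)
    rw [hsp₉]
    have f10 : Frame (Ab :: Alev :: vsp :: (collTapes ++ [vbase, vR, vc, ve, i3, As])) M
        (upd M₉ vsp 0 (p + 1)) :=
      ((Frame.trans (ts := Ab :: Alev :: vsp :: (collTapes ++ [vbase, vR, vc, ve, i3, As]))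
        (f7.mono (by decide)) hf₈ (by decide)).upd (by decide) _ _).upd
        (by decide) _ _
    refine ⟨fun h => by simp at h, ?_, by rw [f10 vdone (by decide)], by rw [f10 vD (by decide)],
      by rw [f10 vh (by decide)]⟩
    rintro _ ⟨rfl⟩
    refine ⟨lay.frame f10 (by decide), by rw [upd_self, List.length_cons], ⟨?_, ?_, ?_⟩, ⟨γ * c₀, ?_⟩, ?_⟩
    · rw [upd_ne (by decide), hM₉, upd_self]
    · intro y hy
      rw [← hw] at hy ⊢
      rw [upd_ne (by decide), hM₉, upd_ne (by decide)]
      exact hnew₈ y hy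
    · refine hmem.congr (fun q hq => ?_) fun a ha => ?_
      · rw [upd_ne (by decide), hM₉, upd_apply, if_neg (by omega), hlev₈]
      · rw [← hw, ← hp] at ha
        rw [upd_ne (by decide), hM₉, upd_ne (by decide), hsame₈ a fun i _ => by omega,
          f7 Ab (by decide)]
    · rw [stackState, ← hw, ← hp, ← smul_smul, smul_fam, fam_smul, smul_fam, smul_fam]
      refine fam_congr (fun y _ => ?_) fun _ _ => rfl
      rw [show H - (lev + 1) * m = H - lev * m - m by rw [add_mul, one_mul]; omega]
      ring
    · rw [← hw]
      intro v hv y hy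
      rcases List.mem_cons.1 hv with rfl | hv
      · exact hble y hy
      · exact hle' v hv y hy

end Setting

/-! ### The last stage and the measurement of the parity. -/

namespace QState

variable {b : ℕ} {φ : QState}

theorem ω_one (z : ℕ) : ω 1 z = if z % 2 = 0 then 1 else -1 := by
  split_ifs with h
  · rw [← ω_zero 1]; exact ω_congr (by omega)
  · rw [← ω_one_one]; exact ω_congr (by omega)

theorem fam_had_qubit (h : Below b φ) (β : ℕ → ℂ) :
    had b (fam (Finset.range (2 ^ 1)) β (encode b 1) φ) =
      fam (Finset.range (2 ^ 1)) (fun x => (β 0 + ω 1 x * β 1) / (Real.sqrt 2 : ℂ)) (encode b 1) φ := by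
  have e0 : encode b 1 0 = ∅ := by ext a; simp [mem_encode]
  have e1 : encode b 1 1 = {b} := by
    ext a
    simp only [mem_encode, Finset.mem_singleton]
    constructor
    · rintro ⟨h1, h2, -⟩; omega
    · rintro rfl; simp
  rw [fam_had h le_rfl]
  simp only [fam, Finset.sum_product, pow_one, Finset.sum_range_succ, Finset.range_zero,
    Finset.sum_empty, zero_add, Fintype.sum_bool, e0, e1, ω_one]
  simp
  module

end QState

/-- The collimated phase vector consists of two indices whose phase multipliers have different
parities. -/
def oddPair : Option (ℕ → ℕ) → Bool
  | none => false
  | some b => (b 0 + b 1) % 2 = 1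

namespace Setting

open Sieve QState Expr

variable {X : Type*} {n : ℕ} {K : Setting X n}
variable {φ : QState} {M : ℕ → ℕ → ℕ} {ψ : QState}

/-- The measurement of the parity. -/
theorem Prb.measParity {β : ℕ → ℂ} {s : ℕ} {b : ℕ → ℕ} {γ : ℂ} (hb : (b 0 + b 1) % 2 = 1)
    (hφ : Below 0 φ) (hβ : ∀ z, β z = γ * ω 1 (b z * s)) (hbase : M vbase 0 = 0) (hQ : 0 < K.Qb)
    (hB : 1 ≤ K.B) :
    K.Prb (Sieve.block [Cmd.had (var vbase), Sieve.measReset (var vbase), Sieve.asg vpar (var vo),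
        Sieve.asg vdone 1]) M (fam (Finset.range (2 ^ 1)) β (encode 0 1) φ)
      (fun g : Unit → ℝ => (fam (Finset.range (2 ^ 1)) β (encode 0 1) φ).normSq * g ())
      fun _ M' ψ' => Frame [vo, vpar, vdone] M M' ∧ M' vdone 0 = 1 ∧ M' vpar 0 = s % 2 ∧
        ∃ γ' : ℂ, ψ' = γ' • φ := by
  have hnn : ∀ g : Unit → ℝ, (∀ i, 0 ≤ g i) →
      0 ≤ (fam (Finset.range (2 ^ 1)) β (encode 0 1) φ).normSq * g () := fun g hg =>
    mul_nonneg (normSq_nonneg _) (hg _)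
  refine Prb.det_cons (Det.had ⟨rfl, by decide⟩ (by rw [eval_var, hbase]; exact hQ) ?_) hnn
  rw [eval_var, hbase, fam_had_qubit hφ]
  intro _ hns
  rw [← hns]
  set β' : ℕ → ℂ := fun x => (β 0 + ω 1 x * β 1) / (Real.sqrt 2 : ℂ) with hβ'
  -- Exactly one of the two multipliers is odd, so `β 1` is `(-1) ^ s` times `β 0`, and the two
  -- contributions to the wrong outcome cancel.
  have hzero : ∀ o : Bool, o.toNat ≠ s % 2 → β' o.toNat = 0 := by
    intro o ho
    have hs : s % 2 = 0 ∨ s % 2 = 1 := by omega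
    have e : β 0 + ω 1 o.toNat * β 1 = 0 := by
      rw [hβ, hβ, ω_one, ω_one, ω_one, Nat.mul_mod, Nat.mul_mod (b 1)]
      have h0 : b 0 % 2 = 0 ∧ b 1 % 2 = 1 ∨ b 0 % 2 = 1 ∧ b 1 % 2 = 0 := by omega
      rcases hs with h | h <;> rcases h0 with ⟨h1, h2⟩ | ⟨h1, h2⟩ <;> cases o <;>
        simp_all
    rw [hβ']
    simp only [e, zero_div]
  have hmeas : K.Prb (Sieve.measReset (var vbase)) M
      (fam (Finset.range (2 ^ 1)) β' (encode 0 1) φ)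
      (fun g : Unit → ℝ => (fam (Finset.range (2 ^ 1)) β' (encode 0 1) φ).normSq * g ())
      fun _ M' ψ' => ∃ o : Bool, Frame [vo] M M' ∧ M' vo 0 = o.toNat ∧
        ψ' = fam ((Finset.range (2 ^ 1)).filter fun y => 0 ∈ encode 0 1 y ↔ o = true) β'
          (fun y => (encode 0 1 y).erase 0) φ := by
    refine Prb.map (fun _ => ()) (Prb.measReset (qv := 0) hφ
      ⟨rfl, by decide⟩ (fun M' hf => by rw [eval_var, hf vbase (by decide), hbase]) le_rfl hQ hB)
      ?_ fun o _ _ h => ⟨o, h⟩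
    intro g _
    rw [← add_mul, normSq_fam_split hφ le_rfl]
  refine Prb.cons_det hmeas ?_
  rintro - M₁ _ ⟨o, hf, ho, rfl⟩ h0 -
  have herase : ∀ y, (encode 0 1 y).erase 0 = ∅ := fun y => by
    ext a; simp [mem_encode]; omega
  have hmem : ∀ y, y < 2 → (0 ∈ encode 0 1 y ↔ o = true) → y = o.toNat := by
    intro y hy h
    rw [mem_encode] at h
    interval_cases y <;> cases o <;> simp_all
  have hsum : fam ((Finset.range (2 ^ 1)).filter fun y => 0 ∈ encode 0 1 y ↔ o = true) β'
      (fun y => (encode 0 1 y).erase 0) φ =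
        (∑ y ∈ (Finset.range (2 ^ 1)).filter fun y => 0 ∈ encode 0 1 y ↔ o = true, β' y) • φ := by
    rw [fam, Finset.sum_smul]
    refine Finset.sum_congr rfl fun y _ => ?_
    congr 1
    rw [herase]
    simp only [Finset.union_empty]
    exact Finsupp.mapDomain_id
  -- The branch with the wrong outcome has the state `0`, and only nonzero states need to be
  -- considered.
  have hpar : o.toNat = s % 2 := by
    by_contra hne
    refine h0 ?_
    rw [hsum, Finset.sum_eq_zero fun y hy => ?_, zero_smul]
    rw [Finset.mem_filter, Finset.mem_range] at hy
    rw [hmem y hy.1 hy.2, hzero o hne]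
  have ho1 : M₁ vo 0 ≤ 1 := by rw [ho]; exact Bool.toNat_le o
  refine Det.cons (Det.asgSmall ⟨rfl, by decide⟩ (by decide) (by rw [eval_var]; omega) fun _ => ?_)
  rw [eval_var, ho, hpar]
  refine Det.single (Det.asgSmall ⟨rfl, by decide⟩ (by decide) hB ?_)
  refine ⟨((hf.mono (by decide)).upd (by decide) _ _).upd (by decide) _ _, ?_, ?_, _, hsum⟩
  · rw [upd_self, eval_one]
  · rw [upd_ne (by decide), upd_self]

/-- The vector has height `h`, so aligning `h - 1` bits leaves height `1`, where only the parities
of the multipliers matter. If they are equal, the qubit carries no information on `s'` and is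
measured only to reset it. -/
theorem Prb.lastStage {m t l s' D h : ℕ} {b : ℕ → ℕ}
    (hG : Good K M ψ m t l s' [(D, b)]) (hvh : M vh 0 = h) (hD : n - t = D * m + h)
    (h1 : 1 ≤ h) (hm : h ≤ m) (hdone : M vdone 0 = 0) :
    K.Prb Sieve.lastStage M ψ (fun g => ψ.normSq * ((1 / 2) ^ (m + 1) *
      collSum b (h - 1) 1 (m + 1) fun o => g (oddPair o)))
      fun done M' ψ' => Good K M' ψ' m t l s' [] ∧ M' vdone 0 = done.toNat ∧
        (done = true → M' vpar 0 = s' % 2) ∧ M' vD 0 = M vD 0 ∧ M' vh 0 = M vh 0 := by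
  obtain ⟨lay, hsp, ⟨hm1, hm2, -⟩, ⟨c₀, rfl⟩, hle⟩ := hG
  obtain ⟨hB1, hB2, hB3, hB4, hB5, hB6⟩ := lay.bounds
  have hle₁ := hle (D, b) (by simp)
  clear hle
  have hw' : M vw 0 = m + 1 := lay.hw
  simp only [List.length_cons, List.length_nil, zero_add, zero_mul] at hsp hm1 hm2
  obtain ⟨w, hw⟩ : ∃ w, w = m + 1 := ⟨_, rfl⟩
  set Φ : QState := Finsupp.single ∅ 1 with hΦ
  have hbel : Below 0 Φ := by
    have := below_stackState (n - t) m s' []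
    rwa [List.length_nil, zero_mul] at this
  simp only [← hw] at hB2 hB3 hB4 hB5 hle₁ hw' hm2 ⊢
  have hwpos := Nat.two_pow_pos w
  set ψ₀ := c₀ • stackState (n - t) m s' [(D, b)] with hψ₀
  have hst : ψ₀ = fam (Finset.range (2 ^ w)) (fun y => ω h (b y * s')) (encode 0 w) (c₀ • Φ) := by
    rw [hψ₀, stackState, stackState, List.length_nil, ← hw, zero_mul, smul_fam, fam_smul,
      show n - t - D * m = h by omega]
  have hns : ψ₀.normSq = 2 ^ w * (c₀ • Φ).normSq := by
    rw [hst, normSq_fam_range (hbel.smul _) fun _ => norm_ω _ _]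
  have hE : ∀ g : Option (ℕ → ℕ) → ℝ, ψ₀.normSq * ((1 / 2) ^ w *
      collSum b (h - 1) 1 w g) = (c₀ • Φ).normSq * collSum b (h - 1) 1 w g := fun g => by
    rw [hns, one_div, inv_pow]; field_simp
  have hnn : ∀ g : Bool → ℝ, (∀ i, 0 ≤ g i) → 0 ≤ ψ₀.normSq * ((1 / 2) ^ w *
      collSum b (h - 1) 1 w fun o => g (oddPair o)) := fun g hg =>
    mul_nonneg (normSq_nonneg _) (mul_nonneg (by positivity)
      (Finset.sum_nonneg fun _ _ => Finset.sum_nonneg fun _ _ => hg _))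
  have hB0 : 1 ≤ K.B := by omega
  have e0 : ∀ M' : ℕ → ℕ → ℕ, M' vsp 0 = 1 → ((var vsp - 1) * var vw : Expr).eval M' = 0 :=
    fun M' h => by rw [eval_mul, eval_sub, eval_var, eval_one, h, Nat.sub_self, zero_mul]
  refine Prb.det_cons (Det.asgSmall ⟨rfl, by decide⟩ (by decide)
    (by rw [e0 M hsp]; exact Nat.zero_le _) fun _ _ => ?_) hnn
  rw [e0 M hsp]
  set M₁ := upd M vbase 0 0 with hM₁
  have f1 : Frame [vbase] M M₁ := (Frame.refl _ _).upd (by decide) _ _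
  have e1 : (var vw : Expr).eval M₁ = w := by rw [eval_var, f1 vw (by decide), hw']
  refine Prb.det_cons (Det.asgSmall ⟨rfl, by decide⟩ (by decide)
    (by rw [e1]; omega) fun _ _ => ?_) hnn
  rw [e1]
  set M₂ := upd M₁ vR 0 w with hM₂
  have f2 : Frame [vbase, vR] M M₂ := (f1.mono (by decide)).upd (by decide) _ _
  have e2 : (var vh - 1 : Expr).eval M₂ = h - 1 := by
    rw [eval_sub, eval_var, eval_one, f2 vh (by decide), hvh]
  refine Prb.det_cons (Det.asgSmall ⟨rfl, by decide⟩ (by decide)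
    (by rw [e2]; omega) fun _ _ => ?_) hnn
  rw [e2]
  set M₃ := upd M₂ vc 0 (h - 1) with hM₃
  have f3 : Frame [vbase, vR, vc] M M₃ := (f2.mono (by decide)).upd (by decide) _ _
  refine Prb.det_cons (Det.asgSmall ⟨rfl, by decide⟩ (by decide) hB0 fun _ _ => ?_) hnn
  rw [eval_one]
  set M₄ := upd M₃ ve 0 1 with hM₄
  have f4 : Frame [vbase, vR, vc, ve] M M₄ := (f3.mono (by decide)).upd (by decide) _ _
  have hbase₄ : M₄ vbase 0 = 0 := by
    rw [hM₄, upd_ne (by decide), hM₃, upd_ne (by decide), hM₂, upd_ne (by decide), hM₁, upd_self]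
  have hR₄ : M₄ vR 0 = w := by
    rw [hM₄, upd_ne (by decide), hM₃, upd_ne (by decide), hM₂, upd_self]
  have hc₄ : M₄ vc 0 = h - 1 := by rw [hM₄, upd_ne (by decide), hM₃, upd_self]
  have he₄ : M₄ ve 0 = 1 := by rw [hM₄, upd_self]
  have hsp₄ : M₄ vsp 0 = 1 := by rw [f4 vsp (by decide), hsp]
  have hw₄ : M₄ vw 0 = w := by rw [f4 vw (by decide), hw']
  refine Prb.det_cons ((Det.fill (t := As) (u := i3) (N := 2 ^ w) (av := id)
    (vv := b) (by decide) (by decide) (by decide)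
    ⟨rfl, by decide⟩ ⟨rfl, by decide⟩ ⟨rfl, by decide⟩ hB5 ?_ ?_ (fun _ _ _ _ h => h)
    (fun j hj => hj.le.trans hB5) (fun _ _ h => by simp [smallTape] at h)
    (fun j hj => lay.size_le (by
      have := hle₁ j hj
      rw [← hw]
      omega))).mono ?_) hnn
  · intro M' hf'
    rw [eval_pow, eval_var, hf' vR (by decide), hR₄]
  · rintro j hj M' hf' hj' -
    refine ⟨by rw [eval_var, hj']; rfl, ?_⟩
    have hAb : M' Ab = M Ab := by rw [hf' Ab (by decide), f4 Ab (by decide)]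
    simp only [eval_add, eval_rd, eval_mul, eval_sub, eval_pow, eval_var,
      eval_one, hf' vsp (by decide), hf' vw (by decide), hsp₄, hw₄, hj', hAb]
    rw [Nat.sub_self, zero_mul, zero_add]
    exact hm2 j hj
  rintro M₅ _ ⟨hf₅, rfl, hnew, -⟩ - -
  have f5 : Frame [vbase, vR, vc, ve, i3, As] M M₅ := (f4.mono (by decide)).trans hf₅ (by decide)
  have lay₅ := lay.frame f5 (by decide)
  have hcp : CollParams K M₅ 0 w (h - 1) 1 := lay₅.collParams
    (by rw [hf₅ vbase (by decide), hbase₄]) (by rw [hf₅ vR (by decide), hR₄])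
    (by rw [hf₅ vc (by decide), hc₄]) (by rw [hf₅ ve (by decide), he₄])
    (by rw [← hw, zero_add]; exact Nat.le_mul_of_pos_left _ (by omega))
    (by omega) (by omega) (by omega) (by omega)
  have hcs : ∀ g, collSum (M₅ As) (h - 1) 1 w g = collSum b (h - 1) 1 w g :=
    fun g => collSum_congr fun y hy => hnew y hy
  have hcoll := Prb.collimate (h := h) (s := s') (hbel.smul c₀) hcp (by omega)
  rw [show fam (Finset.range (2 ^ w)) (fun y => ω h (M₅ As y * s'))
    (encode 0 w) (c₀ • Φ) = ψ₀ by
      rw [hst]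
      exact fam_congr (fun y hy => by rw [← hnew y (Finset.mem_range.1 hy)]; rfl) fun _ _ => rfl]
    at hcoll
  refine Prb.mono (Prb.cons (fun o g => g (oddPair o)) hcoll (fun _ _ hg => hg _) ?_)
    (fun g _ => by rw [hE, hcs]) fun _ _ _ h => h
  rintro o M₆ ψ₆ ⟨hf₆, hnone, hsome⟩ - -
  have f6 : Frame (collTapes ++ [vbase, vR, vc, ve, i3, As]) M M₆ :=
    Frame.trans (f5.mono (by decide)) hf₆ (by decide)
  have hnn' : ∀ g : Bool → ℝ, (∀ i, 0 ≤ g i) → 0 ≤ ψ₆.normSq * g (oddPair o) := fun g hg =>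
    mul_nonneg (normSq_nonneg _) (hg _)
  refine Prb.det_cons (Det.asgSmall adm_zero (by decide) (Nat.zero_le _) fun _ _ => ?_) hnn'
  rw [eval_zero]
  set M₇ := upd M₆ vsp 0 0 with hM₇
  have f7 : Frame (vsp :: (collTapes ++ [vbase, vR, vc, ve, i3, As])) M M₇ :=
    (f6.mono (by decide)).upd (by decide) _ _
  have hM₇₆ : ∀ t ≠ vsp, M₇ t = M₆ t := fun t ht => by rw [hM₇]; exact upd_ne ht
  have hgood : ∀ (us : List ℕ) (M' : ℕ → ℕ → ℕ) (γ : ℂ), Frame us M₇ M' →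
      us ⊆ [vo, vpar, vdone] → Good K M' (γ • c₀ • Φ) m t l s' [] := fun us M' γ hf hus => by
    refine ⟨lay.frame (ts := vdone :: vpar :: vo :: vsp ::
      (collTapes ++ [vbase, vR, vc, ve, i3, As])) ((f7.mono (by decide)).trans hf
        (fun u hu => ?_)) (by decide), ?_, trivial, ⟨γ * c₀, ?_⟩, by simp⟩
    · have := hus hu
      simp only [List.mem_cons, List.not_mem_nil, or_false] at this ⊢
      tauto
    · rw [hf vsp (fun h => absurd (hus h) (by decide)), hM₇, upd_self, List.length_nil]
    · rw [smul_smul, stackState]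
  cases o with
  | none =>
    obtain ⟨hok, γ, rfl⟩ := hnone rfl
    refine Prb.single (Prb.when ⟨rfl, by decide⟩ (fun h => absurd ?_ h) fun _ => ?_)
    · rw [eval_var, hM₇₆ vok (by decide), hok]
    refine Prb.skip ⟨hgood [] M₇ γ (Frame.refl _ _) (by simp), ?_, fun h => by simp [oddPair] at h,
      by rw [f7 vD (by decide)], by rw [f7 vh (by decide)]⟩
    rw [f7 vdone (by decide), hdone]; rfl
  | some b' =>
    obtain ⟨hok, hb', γ, rfl⟩ := hsome b' rfl
    refine Prb.single (Prb.when ⟨rfl, by decide⟩ (fun _ => ?_) fun h => absurd h ?_)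
    swap
    · rw [eval_var, hM₇₆ vok (by decide), hok]; decide
    have hpv : ((rd Anew 0 + rd Anew 1) % 2 : Expr).eval M₇ = (b' 0 + b' 1) % 2 := by
      rw [eval_mod, eval_add, eval_rd, eval_rd, eval_zero, eval_one, eval_two,
        hM₇₆ Anew (by decide), (hb' 0 (by norm_num)).1, (hb' 1 (by norm_num)).1]
    have hQ0 : 0 < K.Qb := by have := lay.hQ; omega
    have hbase₇ : M₇ vbase 0 = 0 := by
      rw [hM₇₆ vbase (by decide), hf₆ vbase (by decide), hf₅ vbase (by decide), hbase₄]
    rw [smul_fam]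
    refine Prb.single (Prb.ite ⟨rfl, by decide⟩ (fun h' => ?_) fun h' => ?_)
    · rw [hpv] at h'
      have hodd : (b' 0 + b' 1) % 2 = 1 := by omega
      have ho : oddPair (some b') = true := by simp [oddPair, hodd]
      rw [ho]
      refine Prb.map (fun _ => true) (Prb.measParity (s := s') (b := b') (γ := γ) hodd (hbel.smul c₀)
        (fun z => ?_) hbase₇ hQ0 hB0) (fun g _ => le_rfl) ?_
      · rw [show h - (h - 1) = 1 by omega]
      · rintro - M₈ _ ⟨hf₈, hd₈, hp₈, γ', rfl⟩
        refine ⟨hgood _ M₈ γ' hf₈ (by decide), by rw [hd₈]; rfl, fun _ => hp₈, ?_, ?_⟩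
        · rw [hf₈ vD (by decide), f7 vD (by decide)]
        · rw [hf₈ vh (by decide), f7 vh (by decide)]
    · rw [hpv] at h'
      have ho : oddPair (some b') = false := by simp [oddPair, h']
      rw [ho]
      refine Prb.map (fun _ => false) (Prb.measReset_unit (qv := 0) (hbel.smul c₀) ⟨rfl, by decide⟩
        (fun M' hf => by rw [eval_var, hf vbase (by decide), hbase₇]) le_rfl hQ0 hB0)
        (fun g _ => le_rfl) ?_
      rintro - M₈ ψ₈ ⟨hf₈, Y', hY', hψ₈⟩
      have herase : ∀ y, (encode 0 1 y).erase 0 = ∅ := fun y => by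
        ext a; simp [mem_encode]; omega
      have hψ₈' : ∃ γ' : ℂ, ψ₈ = γ' • c₀ • Φ := by
        refine ⟨∑ y ∈ Y', γ * ω (h - (h - 1)) (b' y * s'), ?_⟩
        rw [hψ₈, fam, Finset.sum_smul]
        refine Finset.sum_congr rfl fun y _ => ?_
        congr 1
        rw [herase]
        simp only [Finset.union_empty]
        exact Finsupp.mapDomain_id
      obtain ⟨γ', rfl⟩ := hψ₈'
      refine ⟨hgood _ M₈ γ' hf₈ (by decide), ?_, fun h => by simp at h, ?_, ?_⟩
      · rw [hf₈ vdone (by decide), f7 vdone (by decide), hdone]; rfl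
      · rw [hf₈ vD (by decide), f7 vD (by decide)]
      · rw [hf₈ vh (by decide), f7 vh (by decide)]

end Setting

/-! ### Statistics of the phase multipliers: balanced random tables. -/

/-- The sign given by the bit of weight `2 ^ g`. -/
def bitSign (g x : ℕ) : ℝ := (-1) ^ (x / 2 ^ g)

/-- The correction is the carry into place `g`, which depends on the low bits only. -/
theorem bitSign_add (g x y : ℕ) : bitSign g (x + y) =
    bitSign g x * bitSign g y * if 2 ^ g ≤ x % 2 ^ g + y % 2 ^ g then -1 else 1 := by
  rw [bitSign, bitSign, bitSign, Nat.add_div (Nat.two_pow_pos g), pow_add, pow_add]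
  split_ifs <;> simp

theorem bitSign_two_pow_add (g x : ℕ) : bitSign g (x + 2 ^ g) = -bitSign g x := by
  rw [bitSign, bitSign, Nat.add_div_right _ (Nat.two_pow_pos g), pow_succ, mul_neg_one]

theorem bitSign_zero (g : ℕ) : bitSign g 0 = 1 := by simp [bitSign]

theorem bitSign_div {g c : ℕ} (h : c ≤ g) (x : ℕ) : bitSign (g - c) (x / 2 ^ c) = bitSign g x := by
  rw [bitSign, bitSign, Nat.div_div_eq_div_mul, ← pow_add, Nat.add_sub_cancel' h]

theorem bitSign_zero_left (x : ℕ) : bitSign 0 x = if x % 2 = 0 then 1 else -1 := by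
  rw [bitSign, pow_zero, Nat.div_one]
  split_ifs with h
  · exact (Nat.even_iff.2 h).neg_one_pow
  · exact (Nat.not_even_iff_odd.1 fun h' => h (Nat.even_iff.1 h')).neg_one_pow

/-- A random table of `N` numbers of which the low `g` bits are constant, while the signs given by
the next bit are pairwise uncorrelated. -/
structure BalancedTable {Ω : Type} [Fintype Ω] (g N : ℕ) (b : Ω → ℕ → ℕ) : Prop where
  low : ∀ ω ω', ∀ j < N, b ω j % 2 ^ g = b ω' j % 2 ^ g
  corr : ∀ j < N, ∀ j' < N, j ≠ j' → ∑ ω, bitSign g (b ω j) * bitSign g (b ω j') = 0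

section

variable {Ω Ω' : Type} [Fintype Ω] [Fintype Ω'] {g N : ℕ} {b : Ω → ℕ → ℕ} {b' : Ω' → ℕ → ℕ}

/-- The low bits are constant, hence so is the carry, and the sign of a sum is the product of the
two signs up to a deterministic factor `ε`. For `j ≠ j'` one of the two components of the index
differs, and the corresponding factor of the correlation vanishes. -/
theorem BalancedTable.merge {i : ℕ} (h : BalancedTable g (2 ^ i) b) (h' : BalancedTable g N b') :
    BalancedTable g (2 ^ i * N) fun p : Ω × Ω' => mergeTable i (b p.1) (b' p.2) := by
  have hi := Nat.two_pow_pos i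
  constructor
  · intro p p' j hj
    rw [mergeTable, mergeTable, Nat.add_mod, h.low p.1 p'.1 _ (Nat.mod_lt _ hi),
      h'.low p.2 p'.2 _ (Nat.div_lt_of_lt_mul hj), ← Nat.add_mod]
  · intro j hj j' hj' hne
    rcases isEmpty_or_nonempty (Ω × Ω') with hem | ⟨⟨ω₀, ω₀'⟩⟩
    · simp
    have hlt : ∀ j, j < 2 ^ i * N → j % 2 ^ i < 2 ^ i ∧ j / 2 ^ i < N := fun j hj =>
      ⟨Nat.mod_lt _ hi, Nat.div_lt_of_lt_mul hj⟩
    set ε : ℕ → ℝ := fun j =>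
      if 2 ^ g ≤ b ω₀ (j % 2 ^ i) % 2 ^ g + b' ω₀' (j / 2 ^ i) % 2 ^ g then -1 else 1 with hε
    have e : ∀ p : Ω × Ω', ∀ j < 2 ^ i * N, bitSign g (mergeTable i (b p.1) (b' p.2) j) =
        bitSign g (b p.1 (j % 2 ^ i)) * bitSign g (b' p.2 (j / 2 ^ i)) * ε j := fun p j hj => by
      rw [mergeTable, bitSign_add, h.low p.1 ω₀ _ (hlt j hj).1, h'.low p.2 ω₀' _ (hlt j hj).2]
    have e2 : ∀ p : Ω × Ω', bitSign g (mergeTable i (b p.1) (b' p.2) j) *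
        bitSign g (mergeTable i (b p.1) (b' p.2) j') = ε j * ε j' *
        ((bitSign g (b p.1 (j % 2 ^ i)) * bitSign g (b p.1 (j' % 2 ^ i))) *
          (bitSign g (b' p.2 (j / 2 ^ i)) * bitSign g (b' p.2 (j' / 2 ^ i)))) := fun p => by
      rw [e p j hj, e p j' hj']; ring
    rw [Finset.sum_congr rfl fun p _ => e2 p, ← Finset.mul_sum, Fintype.sum_prod_type]
    simp only
    rw [← Finset.sum_mul_sum]
    by_cases h1 : j % 2 ^ i = j' % 2 ^ i
    · have h2 : j / 2 ^ i ≠ j' / 2 ^ i := fun h2 => hne (by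
        rw [← Nat.mod_add_div j (2 ^ i), h1, h2, Nat.mod_add_div])
      rw [h'.corr _ (hlt j hj).2 _ (hlt j' hj').2 h2]; simp
    · rw [h.corr _ (hlt j hj).1 _ (hlt j' hj').1 h1]; simp

/-- The indices `I` are chosen by labels, which are low bits and thus do not depend on `ω`. The
division moves the sign bit from place `g` to place `g - c`. -/
theorem BalancedTable.select {N' c : ℕ} {I : ℕ → ℕ} (h : BalancedTable g N b) (hI : ∀ z < N', I z < N)
    (hinj : ∀ z < N', ∀ z' < N', I z = I z' → z = z') (hc : c ≤ g) :
    BalancedTable (g - c) N' fun ω z => b ω (I z) / 2 ^ c := by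
  constructor
  · intro ω ω' j hj
    have e : ∀ x : ℕ, x / 2 ^ c % 2 ^ (g - c) = x % 2 ^ g / 2 ^ c := fun x => by
      rw [← Nat.mod_mul_right_div_self, ← pow_add, Nat.add_sub_cancel' hc]
    rw [e, e, h.low ω ω' _ (hI j hj)]
  · intro j hj j' hj' hne
    simp only [bitSign_div hc]
    exact h.corr _ (hI j hj) _ (hI j' hj') fun h => hne (hinj j hj j' hj' h)

theorem BalancedTable.unit : BalancedTable g 1 fun (_ : Unit) (_ : ℕ) => 0 :=
  ⟨fun _ _ _ _ => rfl, fun j hj j' hj' h => absurd (by omega) h⟩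

/-- One qubit whose multiplier has fixed low bits and a fair bit in place `g`. The entry `0` has
sign `1`, and the two signs of the other entry cancel. -/
theorem BalancedTable.bool (v : ℕ) :
    BalancedTable g 2 fun (o : Bool) (z : ℕ) => z * (v + o.toNat * 2 ^ g) := by
  constructor
  · intro o o' j hj
    interval_cases j
    · simp
    · cases o <;> cases o' <;> simp
  · intro j hj j' hj' hne
    interval_cases j <;> interval_cases j' <;>
      simp_all [bitSign_zero, bitSign_two_pow_add]

end

/-- The measured modes are grouped so that within a group the low `H - 1` bits of all multipliers
are fixed and the top bits run freely. By `BalancedTable.merge` and `BalancedTable.bool` the table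
of each group is balanced, so a bound for all balanced tables holds for the whole average. -/
theorem leafMean_le {H i : ℕ} {g : (ℕ → ℕ) → ℝ} {C : ℝ} (hH : 1 ≤ H)
    (h : ∀ (Ω : Type) [Fintype Ω] [Nonempty Ω] (b : Ω → ℕ → ℕ), BalancedTable (H - 1) (2 ^ i) b →
      (Fintype.card Ω : ℝ)⁻¹ * ∑ ω, g (b ω) ≤ C) : leafMean H i g ≤ C := by
  induction i generalizing g with
  | zero => simpa [leafMean] using h Unit _ BalancedTable.unit
  | succ i ih =>
    rw [leafMean]
    refine ih fun Ω _ _ b hb => ?_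
    obtain ⟨G, rfl⟩ : ∃ G, H = G + 1 := ⟨H - 1, by omega⟩
    simp only [Nat.add_sub_cancel] at h hb
    have hcard : (0 : ℝ) < Fintype.card Ω := by exact_mod_cast Fintype.card_pos
    -- The modes `y` and `y + 2 ^ G` give multipliers that differ by `2 ^ G`, that is, in the top
    -- bit; together they are one table with a fair bit.
    have hy : ∀ y ∈ Finset.range (2 ^ G), ∑ ω, (g (extTable i (b ω) (2 ^ (G + 1) - y)) +
        g (extTable i (b ω) (2 ^ (G + 1) - (y + 2 ^ G)))) ≤ 2 * Fintype.card Ω * C := by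
      intro y hy
      rw [Finset.mem_range] at hy
      have h1 := h (Ω × Bool) (fun p => mergeTable i (b p.1)
        fun z => z * (2 ^ G - y + p.2.toNat * 2 ^ G)) (by
          rw [pow_succ]
          exact hb.merge (BalancedTable.bool (2 ^ G - y)))
      rw [Fintype.sum_prod_type, Fintype.card_prod, Fintype.card_bool] at h1
      simp only [Fintype.sum_bool, Bool.toNat_true, Bool.toNat_false, one_mul, zero_mul,
        add_zero] at h1
      rw [show 2 ^ (G + 1) - y = 2 ^ G - y + 2 ^ G by rw [pow_succ]; omega,
        show 2 ^ (G + 1) - (y + 2 ^ G) = 2 ^ G - y by rw [pow_succ]; omega]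
      rw [inv_mul_le_iff₀ (by positivity)] at h1
      refine (le_of_eq ?_).trans (h1.trans (le_of_eq ?_))
      · rfl
      · push_cast; ring
    rw [← Finset.mul_sum, Finset.sum_comm, pow_succ 2 G, mul_comm _ 2, Setting.sum_range_two_mul]
    simp only [← Finset.sum_add_distrib]
    rw [mul_comm 2 (2 ^ G), ← pow_succ]
    have h2 := Finset.sum_le_sum hy
    rw [Finset.sum_const, Finset.card_range, nsmul_eq_mul] at h2
    rw [inv_mul_le_iff₀ hcard]
    calc _ ≤ (1 / 2) ^ (G + 1) * (((2 ^ G : ℕ) : ℝ) * (2 * Fintype.card Ω * C)) :=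
          mul_le_mul_of_nonneg_left h2 (by positivity)
      _ = _ := by
        push_cast
        rw [pow_succ, one_div, inv_pow]
        field_simp

/-- That the averages can be exchanged expresses the independence of a new vector from those on the
stack. -/
theorem leafMean_comm {S : Type*} (Λ : (S → ℝ) →ₗ[ℝ] ℝ) (H i : ℕ) (G : S → (ℕ → ℕ) → ℝ) :
    Λ (fun L => leafMean H i (G L)) = leafMean H i fun b => Λ fun L => G L b := by
  induction i generalizing G with
  | zero => rfl
  | succ i ih =>
    simp only [leafMean]
    rw [ih]
    congr 1
    funext b
    rw [show (fun L => (1 / 2 : ℝ) ^ H * ∑ y ∈ Finset.range (2 ^ H), G L (extTable i b (2 ^ H - y))) =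
      (1 / 2 : ℝ) ^ H • ∑ y ∈ Finset.range (2 ^ H), fun L => G L (extTable i b (2 ^ H - y)) by
        funext L; simp [Finset.sum_apply], map_smul, map_sum, smul_eq_mul]

/-- If at most half of the indices are lost in the leftovers, then the average of a function which
is at most `α` if collimation succeeds and at most `β` if not is at most `(α + β) / 2`. -/
theorem collSum_le {lab : ℕ → ℕ} {c e R : ℕ} {α β : ℝ} {V : ℕ → ℕ → ℝ}
    (hlab : ∀ y, lab y < 2 ^ c) (hR : c + e + 1 ≤ R) (hαβ : α ≤ β)
    (h1 : ∀ x < 2 ^ c, ∀ i, i / 2 ^ e * 2 ^ e + 2 ^ e ≤ (labelClass lab R x).length → V x i ≤ α)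
    (h2 : ∀ x < 2 ^ c, ∀ i, ¬ i / 2 ^ e * 2 ^ e + 2 ^ e ≤ (labelClass lab R x).length → V x i ≤ β) :
    ∑ x ∈ Finset.range (2 ^ c), ∑ i ∈ Finset.range (labelClass lab R x).length, V x i ≤
      2 ^ R * ((α + β) / 2) := by
  have hlen : ∑ x ∈ Finset.range (2 ^ c), ((labelClass lab R x).length : ℝ) = 2 ^ R := by
    have := sum_card_filter_mul (Finset.range (2 ^ R)) (Finset.range (2 ^ c)) lab
      (fun y _ => Finset.mem_range.2 (hlab y)) fun _ => 1
    simpa [labelClass_length] using this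
  have hx : ∀ x ∈ Finset.range (2 ^ c), ∑ i ∈ Finset.range (labelClass lab R x).length, V x i ≤
      (labelClass lab R x).length * α + 2 ^ e * (β - α) := by
    intro x hx
    rw [Finset.mem_range] at hx
    set N := (labelClass lab R x).length
    -- The indices in the leftover, which are the last ones of the class and fewer than a segment.
    set F := (Finset.range N).filter fun i => ¬ i / 2 ^ e * 2 ^ e + 2 ^ e ≤ N with hF
    have hcard : F.card ≤ 2 ^ e := by
      have : F ⊆ Finset.Ico (N / 2 ^ e * 2 ^ e) N := by
        intro i hi
        rw [hF, Finset.mem_filter, Finset.mem_range] at hi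
        rw [Finset.mem_Ico]
        refine ⟨?_, hi.1⟩
        by_contra hlt
        have h3 : i / 2 ^ e < N / 2 ^ e := (Nat.div_lt_iff_lt_mul (Nat.two_pow_pos e)).2 (by omega)
        have h4 : (i / 2 ^ e + 1) * 2 ^ e ≤ N / 2 ^ e * 2 ^ e := Nat.mul_le_mul_right _ h3
        have h5 := Nat.div_mul_le_self N (2 ^ e)
        rw [add_mul, one_mul] at h4
        exact hi.2 (by omega)
      refine (Finset.card_le_card this).trans ?_
      rw [Nat.card_Ico]
      have h5 := Nat.div_add_mod' N (2 ^ e)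
      have h6 := Nat.mod_lt N (Nat.two_pow_pos e)
      omega
    have hV : ∀ i ∈ Finset.range N, V x i ≤
        α + if ¬ i / 2 ^ e * 2 ^ e + 2 ^ e ≤ N then β - α else 0 := by
      intro i _
      split_ifs with h
      · rw [add_zero]; exact h1 x hx i h
      · rw [add_sub_cancel]; exact h2 x hx i h
    refine (Finset.sum_le_sum hV).trans ?_
    rw [Finset.sum_add_distrib, Finset.sum_const, Finset.card_range, nsmul_eq_mul,
      ← Finset.sum_filter, Finset.sum_const, nsmul_eq_mul]
    have : (F.card : ℝ) ≤ 2 ^ e := by exact_mod_cast hcard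
    have := mul_le_mul_of_nonneg_right this (sub_nonneg.2 hαβ)
    exact add_le_add_right this _
  refine (Finset.sum_le_sum hx).trans ?_
  rw [Finset.sum_add_distrib, ← Finset.sum_mul, hlen, Finset.sum_const, Finset.card_range,
    nsmul_eq_mul]
  -- Each of the `2 ^ c` classes loses at most `2 ^ e` indices, so at most half of the `2 ^ R`
  -- indices are lost.
  have h3 : (2 : ℝ) ^ c * 2 ^ e * 2 ≤ 2 ^ R := by
    rw [← pow_add, ← pow_succ]
    exact pow_le_pow_right₀ one_le_two hR
  push_cast
  nlinarith [mul_le_mul_of_nonneg_right h3 (sub_nonneg.2 hαβ)]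

/-! ### The levels on the stack, and the potential argument. -/

/-- The levels of the phase vectors on the stack, if there are `D` collimation stages. -/
def ValidStack (D : ℕ) : List ℕ → Prop
  | [] => True
  | a :: l => (a = D ∧ l = []) ∨ (a < D ∧ l.Pairwise (· < ·) ∧ ∀ x ∈ l, a ≤ x ∧ x < D)

/-- Distinct levels from `a` to `D - 1` have a geometric sum of at most `(6 ^ D - 6 ^ a) / 5`. The
other half limits the number of vectors and thereby the number of qubits. -/
theorem sorted_levels {D a : ℕ} {l : List ℕ} (h : l.Pairwise (· < ·)) (ha : a ≤ D)
    (hl : ∀ x ∈ l, a ≤ x ∧ x < D) :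
    l.length + a ≤ D ∧ 5 * (l.map fun x => (6 : ℝ) ^ x).sum + 6 ^ a ≤ 6 ^ D := by
  induction l generalizing a with
  | nil => exact ⟨by simpa using ha, by simpa using pow_le_pow_right₀ (by norm_num) ha⟩
  | cons x l ih =>
    obtain ⟨h1, h2⟩ := List.pairwise_cons.1 h
    obtain ⟨h3, h4⟩ := hl x (by simp)
    obtain ⟨h5, h6⟩ := ih (a := x + 1) h2 h4 fun y hy => ⟨h1 y hy, (hl y (by simp [hy])).2⟩
    refine ⟨by rw [List.length_cons]; omega, ?_⟩
    rw [List.map_cons, List.sum_cons]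
    have h7 : (6 : ℝ) ^ a ≤ 6 ^ x := pow_le_pow_right₀ (by norm_num) h3
    rw [pow_succ] at h6
    linarith

section

variable {D a : ℕ} {l : List ℕ}

theorem ValidStack.length_le (h : ValidStack D l) : l.length ≤ D + 1 := by
  cases l with
  | nil => simp
  | cons a l =>
    rcases h with ⟨-, rfl⟩ | ⟨h1, h2, h3⟩
    · simp
    · have := (sorted_levels h2 h1.le h3).1
      rw [List.length_cons]; omega

/-- Only the two uppermost levels can coincide, which adds one term to a geometric sum. This keeps
the bound in `stackMean_sieveCost_le` nonnegative. -/
theorem ValidStack.sum_le (h : ValidStack D l) : (l.map fun x => (6 : ℝ) ^ x).sum ≤ 2 * 6 ^ D := by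
  have h0 : (0 : ℝ) < 6 ^ D := by positivity
  cases l with
  | nil => simp
  | cons a l =>
    rcases h with ⟨rfl, rfl⟩ | ⟨h1, h2, h3⟩
    · simp
    · have h4 := (sorted_levels h2 h1.le h3).2
      have h5 : (6 : ℝ) ^ a ≤ 6 ^ D := pow_le_pow_right₀ (by norm_num) h1.le
      have h6 : (0 : ℝ) < 6 ^ a := by positivity
      rw [List.map_cons, List.sum_cons]
      linarith

theorem ValidStack.eq_nil (h : ValidStack D (D :: l)) : l = [] := by
  rcases h with ⟨-, h⟩ | ⟨h, -⟩
  · exact h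
  · omega

/-- The coincidence of the two uppermost levels is removed. On success the level `a + 1` may
coincide with the next one below, but no worse; and if it is `D`, nothing can lie below it. -/
theorem ValidStack.stage (h : ValidStack D (a :: a :: l)) :
    a < D ∧ ValidStack D l ∧ ValidStack D ((a + 1) :: l) := by
  rcases h with ⟨-, h⟩ | ⟨h1, h2, h3⟩
  · simp at h
  obtain ⟨h4, h5⟩ := List.pairwise_cons.1 h2
  refine ⟨h1, ?_, ?_⟩
  · cases l with
    | nil => trivial
    | cons x l =>
      obtain ⟨h6, h7⟩ := List.pairwise_cons.1 h5
      exact .inr ⟨(h3 x (by simp)).2, h7, fun y hy => ⟨(h6 y hy).le, (h3 y (by simp [hy])).2⟩⟩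
  · by_cases hD : a + 1 = D
    · refine .inl ⟨hD, ?_⟩
      cases l with
      | nil => rfl
      | cons x l =>
        have := h4 x (by simp)
        have := (h3 x (by simp)).2
        omega
    · exact .inr ⟨by omega, h5, fun y hy => ⟨h4 y hy, (h3 y (by simp [hy])).2⟩⟩

/-- If no other step applies, then the two uppermost levels differ, so the levels strictly increase
downwards and stay below `D`. Hence a vector of level `0` can be added without breaking the order or
the length bound. -/
theorem ValidStack.leaf (h : ValidStack D l) (h1 : ∀ a l', l = a :: l' → a ≠ D)
    (h2 : ∀ a a' l', l = a :: a' :: l' → a ≠ a') : ValidStack D (0 :: l) ∧ l.length ≤ D := by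
  cases l with
  | nil =>
    refine ⟨?_, by simp⟩
    rcases Nat.eq_zero_or_pos D with h | h
    · exact .inl ⟨h.symm, rfl⟩
    · exact .inr ⟨h, .nil, by simp⟩
  | cons a l =>
    rcases h with ⟨h, -⟩ | ⟨h3, h4, h5⟩
    · exact absurd h (h1 a l rfl)
    have hlt : ∀ x ∈ l, a < x := by
      cases l with
      | nil => simp
      | cons a' l =>
        have h6 : a < a' := lt_of_le_of_ne (h5 a' (by simp)).1 (h2 a a' l rfl)
        intro x hx
        rcases List.mem_cons.1 hx with rfl | hx
        · exact h6
        · exact h6.trans ((List.pairwise_cons.1 h4).1 x hx)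
    have h6 : (a :: l).Pairwise (· < ·) := List.pairwise_cons.2 ⟨hlt, h4⟩
    have h7 : ∀ x ∈ a :: l, 0 ≤ x ∧ x < D := fun x hx => by
      rcases List.mem_cons.1 hx with rfl | hx
      · exact ⟨Nat.zero_le _, h3⟩
      · exact ⟨Nat.zero_le _, (h5 x hx).2⟩
    exact ⟨.inr ⟨by omega, h6, h7⟩, (sorted_levels h6 (Nat.zero_le _) h7).1⟩

end

/-- The stack after a collimation that leads to level `a`. -/
def pushOutcome (a : ℕ) (L : List (ℕ × (ℕ → ℕ))) : Option (ℕ → ℕ) → List (ℕ × (ℕ → ℕ))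
  | none => L
  | some b => (a, b) :: L

/-- The expectation of a function of the stack after one step of the sieve; it is `none` when the
parity has been found. -/
noncomputable def stepMean (H m D : ℕ) :
    List (ℕ × (ℕ → ℕ)) → (Option (List (ℕ × (ℕ → ℕ))) → ℝ) → ℝ
  | [], G => leafMean H (m + 1) fun b => G (some [(0, b)])
  | [(a, b)], G =>
    if a = D then (1 / 2) ^ (m + 1) * collSum b (H - 1 - D * m) 1 (m + 1) fun o =>
      G (if oddPair o then none else some [])
    else leafMean H (m + 1) fun b' => G (some [(0, b'), (a, b)])
  | (a, b) :: (a', b') :: L, G =>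
    if a = a' then (1 / 2) ^ (2 * (m + 1)) *
      collSum (mergeTable (m + 1) b' b) m (m + 1) (2 * (m + 1)) fun o =>
        G (some (pushOutcome (a + 1) L o))
    else leafMean H (m + 1) fun b'' => G (some ((0, b'') :: (a, b) :: (a', b') :: L))

theorem stepMean_leaf {H m D : ℕ} {L : List (ℕ × (ℕ → ℕ))}
    {G : Option (List (ℕ × (ℕ → ℕ))) → ℝ}
    (h1 : ∀ a l', L.map Prod.fst = a :: l' → a ≠ D)
    (h2 : ∀ a a' l', L.map Prod.fst = a :: a' :: l' → a ≠ a') :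
    stepMean H m D L G = leafMean H (m + 1) fun b => G (some ((0, b) :: L)) := by
  match L with
  | [] => rfl
  | [(a, b)] => exact if_neg (h1 a _ rfl)
  | (a, b) :: (a', b') :: L => exact if_neg (h2 a a' _ rfl)

/-- The expected cost of the sieve, where every step costs `κ`, if it is cut off after some
steps. -/
noncomputable def sieveCost (κ : ℝ) (H m D : ℕ) : ℕ → Option (List (ℕ × (ℕ → ℕ))) → ℝ
  | 0, _ => 0
  | _ + 1, none => κ
  | k + 1, some L => κ + stepMean H m D L (sieveCost κ H m D k)

/-- A random table of phase multipliers of a phase vector that has passed `lev` stages. -/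
structure RandomTable where
  lev : ℕ
  Ω : Type
  [fin : Fintype Ω]
  [ne : Nonempty Ω]
  tab : Ω → ℕ → ℕ

attribute [instance] RandomTable.fin RandomTable.ne

/-- The expectation of a function of the tables if they are independent. -/
noncomputable def stackMean : List RandomTable → (List (ℕ × (ℕ → ℕ)) → ℝ) →ₗ[ℝ] ℝ
  | [] => LinearMap.proj []
  | F :: Fs => (Fintype.card F.Ω : ℝ)⁻¹ • ∑ ω : F.Ω,
      (stackMean Fs) ∘ₗ LinearMap.funLeft ℝ ℝ fun L => (F.lev, F.tab ω) :: L

theorem stackMean_nil (g : List (ℕ × (ℕ → ℕ)) → ℝ) : stackMean [] g = g [] := rfl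

theorem stackMean_cons (F : RandomTable) (Fs : List RandomTable) (g : List (ℕ × (ℕ → ℕ)) → ℝ) :
    stackMean (F :: Fs) g = (Fintype.card F.Ω : ℝ)⁻¹ * ∑ ω : F.Ω,
      stackMean Fs fun L => g ((F.lev, F.tab ω) :: L) := by
  simp only [stackMean, LinearMap.smul_apply, LinearMap.sum_apply, LinearMap.comp_apply, smul_eq_mul]
  rfl

theorem stackMean_const (Fs : List RandomTable) (κ : ℝ) : stackMean Fs (fun _ => κ) = κ := by
  induction Fs with
  | nil => rfl
  | cons F Fs ih =>
    rw [stackMean_cons, ih]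
    have : (Fintype.card F.Ω : ℝ) ≠ 0 := by simp
    simp [this]

/-- Only the tables are random. The levels are those of `Fs`, so the kind of the next step is the
same throughout the average. -/
theorem stackMean_congr {Fs : List RandomTable} {g g' : List (ℕ × (ℕ → ℕ)) → ℝ}
    (h : ∀ L, L.map Prod.fst = Fs.map RandomTable.lev → g L = g' L) :
    stackMean Fs g = stackMean Fs g' := by
  induction Fs generalizing g g' with
  | nil => exact h [] rfl
  | cons F Fs ih =>
    rw [stackMean_cons, stackMean_cons]
    congr 1
    refine Finset.sum_congr rfl fun ω _ => ih fun L hL => h _ ?_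
    simp [hL]

theorem collSum_comm {S : Type*} (Λ : (S → ℝ) →ₗ[ℝ] ℝ) (a : ℕ → ℕ) (c e R : ℕ)
    (G : S → Option (ℕ → ℕ) → ℝ) :
    Λ (fun L => collSum a c e R (G L)) = collSum a c e R fun o => Λ fun L => G L o := by
  rw [collSum]
  simp only [← map_sum]
  congr 1
  funext L
  simp [collSum, Finset.sum_apply]

/-- The average of a function of the outcome of the collimation of a phase vector with a
balanced random table. -/
theorem mean_collSum_le {Ω : Type} [Fintype Ω] [Nonempty Ω] {g c e R : ℕ} {b : Ω → ℕ → ℕ}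
    (hb : BalancedTable g (2 ^ R) b) (hc : c ≤ g) (hR : c + e + 1 ≤ R) {α β : ℝ} (hαβ : α ≤ β)
    {Φ : Option (ℕ → ℕ) → ℝ} (h1 : ∀ b' : Ω → ℕ → ℕ, BalancedTable (g - c) (2 ^ e) b' →
      (Fintype.card Ω : ℝ)⁻¹ * ∑ ω, Φ (some (b' ω)) ≤ α) (h2 : Φ none ≤ β) :
    (Fintype.card Ω : ℝ)⁻¹ * ∑ ω, collSum (b ω) c e R Φ ≤ 2 ^ R * ((α + β) / 2) := by
  obtain ⟨ω₀⟩ := ‹Nonempty Ω›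
  have hcard : (Fintype.card Ω : ℝ) ≠ 0 := by simp
  -- Labels consist of `c ≤ g` low bits, which are the same for all `ω`. So the division into
  -- classes and segments is independent of the random signs.
  have hcls : ∀ ω x, labelClass (fun y => b ω y % 2 ^ c) R x =
      labelClass (fun y => b ω₀ y % 2 ^ c) R x := fun ω x => by
    refine List.filter_congr fun y hy => ?_
    have e : ∀ z : ℕ, z % 2 ^ c = z % 2 ^ g % 2 ^ c := fun z =>
      (Nat.mod_mod_of_dvd _ (pow_dvd_pow 2 hc)).symm
    have : b ω y % 2 ^ c = b ω₀ y % 2 ^ c := by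
      rw [e, hb.low ω ω₀ y (List.mem_range.1 hy), ← e]
    simp only [this]
  set len : ℕ → ℕ := fun x => (labelClass (fun y => b ω₀ y % 2 ^ c) R x).length with hlen
  have hout : ∀ ω x q, collOutcome (b ω) c e R x q = if q * 2 ^ e + 2 ^ e ≤ len x then
      some (fun z => b ω ((labelClass (fun y => b ω₀ y % 2 ^ c) R x).getD (q * 2 ^ e + z) 0) / 2 ^ c)
      else none := fun ω x q => by
    have : segTable (b ω) c e R x q = fun z =>
      b ω ((labelClass (fun y => b ω₀ y % 2 ^ c) R x).getD (q * 2 ^ e + z) 0) / 2 ^ c := by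
        funext z; rw [segTable, hcls]
    rw [collOutcome, hcls, this]
  have key := collSum_le (lab := fun y => b ω₀ y % 2 ^ c) (c := c) (e := e) (R := R) (V := fun x i =>
    (Fintype.card Ω : ℝ)⁻¹ * ∑ ω, Φ (collOutcome (b ω) c e R x (i / 2 ^ e)))
    (fun y => Nat.mod_lt _ (Nat.two_pow_pos _)) hR hαβ ?_ ?_
  · refine le_trans (le_of_eq ?_) key
    simp only [collSum, hcls, ← Finset.mul_sum]
    rw [Finset.sum_comm]
    congr 1
    refine Finset.sum_congr rfl fun x _ => ?_
    rw [Finset.sum_comm]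
  · intro x _ i hi
    simp only [hout, if_pos (show i / 2 ^ e * 2 ^ e + 2 ^ e ≤ len x from hi)]
    refine h1 _ (hb.select (fun z hz => (labelClass_get ?_).1) (fun z hz z' hz' h => ?_) hc)
    · omega
    · exact Nat.add_left_cancel (labelClass_inj (by omega) (by omega) h)
  · intro x _ i hi
    simp only [hout, if_neg (show ¬ i / 2 ^ e * 2 ^ e + 2 ^ e ≤ len x from hi)]
    rw [Finset.sum_const, Finset.card_univ, nsmul_eq_mul, inv_mul_cancel_left₀ hcard]
    exact h2

theorem stackMean_add_const (Fs : List RandomTable) (κ : ℝ) (g : List (ℕ × (ℕ → ℕ)) → ℝ) :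
    stackMean Fs (fun L => κ + g L) = κ + stackMean Fs g := by
  rw [show (fun L => κ + g L) = (fun _ => κ) + g from rfl, map_add, stackMean_const]

theorem stackMean_mul (Fs : List RandomTable) (κ : ℝ) (g : List (ℕ × (ℕ → ℕ)) → ℝ) :
    stackMean Fs (fun L => κ * g L) = κ * stackMean Fs g :=
  map_smul (stackMean Fs) κ g

/-- The potential of a stack. -/
noncomputable def stackPotential (Fs : List RandomTable) : ℝ :=
  ((Fs.map RandomTable.lev).map fun x => (6 : ℝ) ^ x).sum

theorem stackPotential_cons (F : RandomTable) (Fs : List RandomTable) :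
    stackPotential (F :: Fs) = 6 ^ F.lev + stackPotential Fs := by
  simp [stackPotential]

theorem half_pow_mul_two_pow_mul (k : ℕ) (x : ℝ) : (1 / 2) ^ k * (2 ^ k * x) = x := by
  rw [← mul_assoc, ← mul_pow, one_div, inv_mul_cancel₀ two_ne_zero, one_pow, one_mul]

/-- A drift argument, by induction on the cut-off, over all stacks of independent balanced tables;
every step stays within this class. A new vector or a stage raises the potential by at least `1` on
average, which pays for the step. The last stage ends the sieve with probability at least `1/4` and
otherwise restarts it at full cost `S = 4 * (2 + 6 ^ D)`; the constants are such that `1 + 1/4 + 3/4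
* S ≤ S - 6 ^ D`. -/
theorem stackMean_sieveCost_le {κ : ℝ} {H m D : ℕ} (hκ : 0 ≤ κ) (hH : D * m + 1 ≤ H)
    (hm : H ≤ D * m + m) (k : ℕ) (Fs : List RandomTable)
    (hV : ValidStack D (Fs.map RandomTable.lev))
    (hF : ∀ F ∈ Fs, BalancedTable (H - 1 - F.lev * m) (2 ^ (m + 1)) F.tab) :
    stackMean Fs (fun L => sieveCost κ H m D k (some L)) ≤
      κ * (4 * (2 + 6 ^ D) - stackPotential Fs) := by
  have hD0 : (0 : ℝ) < 6 ^ D := by positivity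
  induction k generalizing Fs with
  | zero =>
    simp only [sieveCost]
    rw [stackMean_const]
    have := hV.sum_le
    exact mul_nonneg hκ (by rw [stackPotential]; linarith)
  | succ k ih =>
    simp only [sieveCost]
    rw [stackMean_add_const]
    set T := sieveCost κ H m D k with hT
    have hleaf : (∀ a l', Fs.map RandomTable.lev = a :: l' → a ≠ D) →
        (∀ a a' l', Fs.map RandomTable.lev = a :: a' :: l' → a ≠ a') →
        κ + stackMean Fs (fun L => stepMean H m D L T) ≤
          κ * (4 * (2 + 6 ^ D) - stackPotential Fs) := by
      intro h1 h2
      rw [stackMean_congr (g' := fun L => leafMean H (m + 1) fun b => T (some ((0, b) :: L)))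
        fun L hL => stepMean_leaf (by rwa [hL]) (by rwa [hL]), leafMean_comm]
      have : leafMean H (m + 1) (fun b => stackMean Fs fun L => T (some ((0, b) :: L))) ≤
          κ * (4 * (2 + 6 ^ D) - (1 + stackPotential Fs)) := by
        refine leafMean_le (by omega) fun Ω _ _ b hb => ?_
        have := ih (⟨0, Ω, b⟩ :: Fs) (hV.leaf h1 h2).1 (by
          intro F hF'
          rcases List.mem_cons.1 hF' with rfl | hF'
          · simpa using hb
          · exact hF F hF')
        rwa [stackPotential_cons, stackMean_cons, pow_zero] at this
      linarith
    match Fs with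
    | [] => exact hleaf (by simp) (by simp)
    | [F] =>
      by_cases hFD : F.lev = D
      · have hb := hF F (by simp)
        rw [hFD] at hb
        rw [stackMean_congr (g' := fun L => stepMean H m D L T) fun _ _ => rfl, stackMean_cons]
        simp only [stackMean_nil, stepMean, if_pos hFD]
        have hnil : T (some []) ≤ κ * (4 * (2 + 6 ^ D)) := by
          have := ih [] trivial (by simp)
          rwa [stackMean_nil, show stackPotential [] = 0 from rfl, sub_zero] at this
        have hnone : T none ≤ κ := by
          rw [hT]
          cases k with
          | zero => exact hκ
          | succ k => exact le_rfl
        -- A pair ends the sieve with probability one half, so that `α` is the mean cost after it. A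
        -- singleton forces a restart, at cost `β`.
        have hcs := mean_collSum_le (e := 1) (α := (κ + κ * (4 * (2 + 6 ^ D))) / 2)
          (β := κ * (4 * (2 + 6 ^ D))) (Φ := fun o => T (if oddPair o then none else some [])) hb
          le_rfl (by omega) (by nlinarith) ?_ (by simpa [oddPair] using hnil)
        · rw [← Finset.mul_sum, mul_left_comm]
          have h2 := mul_le_mul_of_nonneg_left hcs (show (0 : ℝ) ≤ (1 / 2) ^ (m + 1) by positivity)
          rw [half_pow_mul_two_pow_mul] at h2
          rw [stackPotential_cons, hFD, show stackPotential [] = 0 from rfl]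
          linarith
        · intro b' hb'
          rw [Nat.sub_self] at hb'
          have hcard : (0 : ℝ) < Fintype.card F.Ω := by exact_mod_cast Fintype.card_pos
          have hcorr := hb'.corr 0 (by norm_num) 1 (by norm_num) (by norm_num)
          -- The outcome depends on the product of the two parity signs in an affine way, and the
          -- mean of this product is `0` by `hcorr`.
          have e : ∀ ω, T (if oddPair (some (b' ω)) then none else some []) =
              (T none + T (some [])) / 2 +
                (T (some []) - T none) / 2 * (bitSign 0 (b' ω 0) * bitSign 0 (b' ω 1)) := by
            intro ω
            rw [bitSign_zero_left, bitSign_zero_left]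
            have h0 : b' ω 0 % 2 = 0 ∨ b' ω 0 % 2 = 1 := by omega
            have h1 : b' ω 1 % 2 = 0 ∨ b' ω 1 % 2 = 1 := by omega
            rcases h0 with h0 | h0 <;> rcases h1 with h1 | h1 <;>
              simp [oddPair, Nat.add_mod, h0, h1] <;> ring
          simp only [e]
          rw [Finset.sum_add_distrib, ← Finset.mul_sum, hcorr, mul_zero, add_zero, Finset.sum_const,
            Finset.card_univ, nsmul_eq_mul, inv_mul_cancel_left₀ hcard.ne']
          linarith
      · exact hleaf (by rintro a l' ⟨rfl, rfl⟩; exact hFD) (by simp)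
    | F :: F' :: Fs =>
      by_cases hFF : F.lev = F'.lev
      · have hV' := hV
        simp only [List.map_cons, ← hFF] at hV'
        obtain ⟨haD, hv1, hv2⟩ := hV'.stage
        have hlev : F.lev * m + m ≤ D * m := by
          have : (F.lev + 1) * m ≤ D * m := Nat.mul_le_mul_right _ haD
          rwa [add_mul, one_mul] at this
        have hb := hF F (by simp)
        have hb' := hF F' (by simp)
        rw [← hFF] at hb'
        have hFs : ∀ G ∈ Fs, BalancedTable (H - 1 - G.lev * m) (2 ^ (m + 1)) G.tab :=
          fun G hG => hF G (by simp [hG])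
        have hmerge := hb'.merge hb
        rw [← pow_add, ← two_mul] at hmerge
        set Φ : Option (ℕ → ℕ) → ℝ := fun o =>
          stackMean Fs fun L => T (some (pushOutcome (F.lev + 1) L o)) with hΦ
        -- The average of the potentials after success and after failure is that of the remaining
        -- stack plus `3 * 6 ^ F.lev`, where the two merged vectors contributed `2 * 6 ^ F.lev`.
        have hcs := mean_collSum_le (c := m) (e := m + 1) (Φ := Φ)
          (α := κ * (4 * (2 + 6 ^ D) - (6 ^ (F.lev + 1) + stackPotential Fs)))
          (β := κ * (4 * (2 + 6 ^ D) - stackPotential Fs)) hmerge (by omega) (by omega)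
          (mul_le_mul_of_nonneg_left (by
            have : (0 : ℝ) < 6 ^ (F.lev + 1) := by positivity
            linarith) hκ) ?_ (ih Fs hv1 hFs)
        · have e : stackMean (F :: F' :: Fs) (fun L => stepMean H m D L T) =
              (1 / 2) ^ (2 * (m + 1)) * ((Fintype.card (F'.Ω × F.Ω) : ℝ)⁻¹ * ∑ p : F'.Ω × F.Ω,
                collSum (mergeTable (m + 1) (F'.tab p.1) (F.tab p.2)) m (m + 1) (2 * (m + 1)) Φ) := by
            rw [stackMean_cons]
            simp only [stackMean_cons, stepMean, if_pos hFF, stackMean_mul, collSum_comm]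
            rw [Fintype.sum_prod_type_right, Fintype.card_prod]
            push_cast
            rw [mul_inv]
            simp only [← Finset.mul_sum]
            ring
          rw [e]
          have h2 := mul_le_mul_of_nonneg_left hcs
            (show (0 : ℝ) ≤ (1 / 2) ^ (2 * (m + 1)) by positivity)
          rw [half_pow_mul_two_pow_mul] at h2
          rw [stackPotential_cons, stackPotential_cons, ← hFF]
          have h3 : (1 : ℝ) ≤ 6 ^ F.lev := one_le_pow₀ (by norm_num)
          have h4 := mul_le_mul_of_nonneg_left h3 hκ
          rw [pow_succ] at h2
          linarith
        · intro b' hb'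
          have := ih (⟨F.lev + 1, F'.Ω × F.Ω, b'⟩ :: Fs) hv2 (by
            intro G hG
            rcases List.mem_cons.1 hG with rfl | hG
            · simp only
              rwa [add_mul, one_mul, ← Nat.sub_sub]
            · exact hFs G hG)
          rwa [stackPotential_cons, stackMean_cons] at this
      · refine hleaf ?_ ?_
        · rintro a l' ⟨rfl, rfl⟩ h
          have := hV
          simp only [List.map_cons, h] at this
          simpa using this.eq_nil
        · rintro a a' l' ⟨rfl, rfl⟩
          exact hFF

/-- Needed for `Ends.step`, where a mean of `0` excludes unwanted branches altogether. -/
theorem stepMean_zero (H m D : ℕ) (L : List (ℕ × (ℕ → ℕ))) : stepMean H m D L (fun _ => 0) = 0 := by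
  have h1 : leafMean H (m + 1) (fun _ => 0) = 0 := by
    have h : ∀ i, leafMean H i (fun _ => 0) = 0 := fun i => by
      induction i with
      | zero => rfl
      | succ i ih => simpa [leafMean] using ih
    exact h _
  match L with
  | [] => exact h1
  | [(a, b)] => simp [stepMean, h1, collSum]
  | (a, b) :: (a', b') :: L => simp [stepMean, h1, collSum]

/-! ### The loop body of the sieve as one step of the random process. -/

/-- One step of the sieve. -/
def Sieve.sieveBody : Cmd :=
  .ite (Expr.bin .lt 0 (var vsp) * Expr.bin .eq (.rd Alev (var vsp - 1)) (var vD))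
    lastStage
    (.ite (Expr.bin .lt 1 (var vsp) *
        Expr.bin .eq (.rd Alev (var vsp - 1)) (.rd Alev (var vsp - 2)))
      stage
      leaf)

namespace Setting

open Sieve QState Expr

variable {X : Type*} {n : ℕ} {K : Setting X n}
variable {φ : QState} {M : ℕ → ℕ → ℕ} {ψ : QState}

/-- The state of the sieve before a step; `none` means that the parity has been found. -/
structure SieveInv (K : Setting X n) (m t l s' D : ℕ) (o : Option (List (ℕ × (ℕ → ℕ))))
    (M : ℕ → ℕ → ℕ) (ψ : QState) : Prop where
  good : Good K M ψ m t l s' (o.getD [])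
  valid : ValidStack D ((o.getD []).map Prod.fst)
  hD : M vD 0 = D
  hh : M vh 0 = n - t - D * m
  done : M vdone 0 = if o = none then 1 else 0
  par : o = none → M vpar 0 = s' % 2

/-- The tests of the program agree with the case distinction in `stepMean`. By `D + 1 ≤ m` the
stack, of at most `D + 1` vectors, fits on the `(m + 1) * (m + 1)` qubits reserved for it. -/
theorem Prb.sieveBody {m t l s' D : ℕ} {L : List (ℕ × (ℕ → ℕ))}
    (hI : SieveInv K m t l s' D (some L) M ψ) (hH : D * m + 1 ≤ n - t)
    (hH' : n - t ≤ D * m + m) (hDm : D + 1 ≤ m) :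
    K.Prb Sieve.sieveBody M ψ (fun g => ψ.normSq * stepMean (n - t) m D L g)
      (SieveInv K m t l s' D) := by
  obtain ⟨hG, hV, hD, hh, hdone, -⟩ := hI
  simp only [Option.getD_some, reduceCtorEq, if_false] at hG hV hdone
  have hsp := hG.sp
  have hleaf : (∀ a l', L.map Prod.fst = a :: l' → a ≠ D) →
      (∀ a a' l', L.map Prod.fst = a :: a' :: l' → a ≠ a') →
      K.Prb Sieve.leaf M ψ (fun g => ψ.normSq * stepMean (n - t) m D L g)
        (SieveInv K m t l s' D) := by
    intro h1 h2
    obtain ⟨hV', hlen⟩ := hV.leaf h1 h2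
    rw [List.length_map] at hlen
    refine Prb.map (fun b => some ((0, b) :: L)) (Prb.leaf hG (by omega))
      (fun g _ => by rw [stepMean_leaf h1 h2]) ?_
    rintro b M' ψ' ⟨hG', h3, h4, h5⟩
    exact ⟨hG', hV', by rw [h4, hD], by rw [h5, hh], by rw [h3, hdone]; simp, fun h => by simp at h⟩
  have hcond1 : ∀ a b L', L = (a, b) :: L' →
      ((bin .lt 0 (var vsp) * bin .eq (rd Alev (var vsp - 1)) (var vD) : Expr).eval M ≠ 0 ↔
        a = D) := by
    rintro a b L' rfl
    rw [List.length_cons] at hsp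
    have := hG.mem.1
    simp only [eval_mul, eval_lt, eval_eq, eval_var, eval_sub, eval_zero, eval_one, eval_rd, hsp, hD,
      Nat.add_sub_cancel, this]
    simp
  have hcond2 : ∀ a b a' b' L', L = (a, b) :: (a', b') :: L' →
      ((bin .lt 1 (var vsp) * bin .eq (rd Alev (var vsp - 1)) (rd Alev (var vsp - 2)) : Expr).eval M
        ≠ 0 ↔ a = a') := by
    rintro a b a' b' L' rfl
    rw [List.length_cons, List.length_cons] at hsp
    have h1 := hG.mem.1
    have h2 := hG.mem.2.2.1
    rw [List.length_cons] at h1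
    simp only [eval_mul, eval_lt, eval_eq, eval_var, eval_sub, eval_two, eval_one, eval_rd, hsp,
      Nat.add_sub_cancel, h1, show L'.length + 1 + 1 - 2 = L'.length by omega, h2]
    simp
  refine Prb.ite ⟨rfl, by decide⟩ (fun h1 => ?_) fun h1 => Prb.ite ⟨rfl, by decide⟩ (fun h2 => ?_)
    fun h2 => ?_
  · match L with
    | [] =>
      rw [List.length_nil] at hsp
      exact absurd (by simp [hsp]) h1
    | (a, b) :: L =>
      obtain rfl := (hcond1 a b L rfl).1 h1
      simp only [List.map_cons] at hV
      obtain rfl := List.map_eq_nil_iff.1 hV.eq_nil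
      refine Prb.map (fun done => if done then none else some []) (Prb.lastStage hG hh (by omega)
        (by omega) (by omega) hdone) (fun g _ => le_of_eq ?_) ?_
      · rw [stepMean, if_pos rfl, Nat.sub_right_comm]
      · rintro done M' ψ' ⟨hG', h3, h4, h5, h6⟩
        cases done with
        | true => exact ⟨hG', trivial, by rw [h5, hD], by rw [h6, hh], h3, fun _ => h4 rfl⟩
        | false => exact ⟨hG', trivial, by rw [h5, hD], by rw [h6, hh], h3, fun h => by simp at h⟩
  · match L with
    | [] =>
      rw [List.length_nil] at hsp
      exact absurd (by simp [hsp]) h2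
    | [(a, b)] =>
      rw [List.length_singleton] at hsp
      exact absurd (by simp [hsp]) h2
    | (a, b) :: (a', b') :: L =>
      obtain rfl := (hcond2 a b a' b' L rfl).1 h2
      simp only [List.map_cons] at hV
      have hlen := hV.length_le
      simp only [List.length_cons, List.length_map] at hlen
      obtain ⟨haD, hv1, hv2⟩ := hV.stage
      have hlev : (a + 1) * m ≤ D * m := Nat.mul_le_mul_right _ haD
      rw [add_mul, one_mul] at hlev
      refine Prb.map (fun o => some (pushOutcome (a + 1) L o))
        (Prb.stage hG (by omega) (by omega)) (fun g _ => le_of_eq ?_) ?_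
      · rw [stepMean, if_pos rfl]
      · rintro o M' ψ' ⟨h3, h4, h5, h6, h7⟩
        have hd : M' vdone 0 = if some (pushOutcome (a + 1) L o) = none then 1 else 0 := by
          rw [h5, hdone]; simp
        cases o with
        | none => exact ⟨h3 rfl, hv1, by rw [h6, hD], by rw [h7, hh], hd, fun h => by simp at h⟩
        | some b'' =>
          exact ⟨h4 b'' rfl, hv2, by rw [h6, hD], by rw [h7, hh], hd, fun h => by simp at h⟩
  · refine hleaf ?_ ?_
    · intro a l' h
      obtain ⟨v, L', rfl, rfl, -⟩ := List.map_eq_cons_iff.1 h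
      exact fun h => (hcond1 _ v.2 L' rfl).2 h h1
    · intro a a' l' h
      match L with
      | [] => simp at h
      | [_] => simp at h
      | (x, b) :: (y, b') :: L' =>
        simp only [List.map_cons, List.cons.injEq] at h
        obtain ⟨rfl, rfl, -⟩ := h
        exact fun h => (hcond2 _ b _ b' L' rfl).2 h h2

end Setting

/-! ### Expected running time. -/

/-- A branching process that preserves the probability, and stops when it is cut off. -/
structure Branching (f : Config → Multiset Config) : Prop where
  stuck : ∀ σ : Config, σ.stuck = true → f σ = {σ}
  prob : ∀ σ, ((f σ).map Config.prob).sum = σ.prob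

theorem Branching.qstate_zero {f : Config → Multiset Config} (hf : Branching f) {σ σ' : Config}
    (h : σ.qstate = 0) (h' : σ' ∈ f σ) : σ'.qstate = 0 := by
  have h1 := hf.prob σ
  rw [show σ.prob = 0 by simp [Config.prob, h]] at h1
  refine QState.normSq_eq_zero.1 (le_antisymm ?_ (QState.normSq_nonneg _))
  rw [← h1]
  exact Multiset.single_le_sum (fun x hx => by
    obtain ⟨τ, -, rfl⟩ := Multiset.mem_map.1 hx
    exact QState.normSq_nonneg _) _ (Multiset.mem_map_of_mem _ h')

theorem Branching.sum_time_zero {f : Config → Multiset Config} (hf : Branching f) {σ : Config}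
    (h : σ.qstate = 0) : ((f σ).map fun σ' => σ'.prob * (σ'.time : ℝ)).sum = 0 := by
  rw [Multiset.map_congr rfl fun σ' h' => by
    rw [show σ'.prob = 0 by simp [Config.prob, hf.qstate_zero h h'], zero_mul]]
  simp

theorem exec_branching {X : Type*} {n : ℕ} (f : Bool → ZMod (2 ^ n) → X) (fuel : ℕ) (c : Cmd) :
    Branching (exec f fuel c) := ⟨fun _ h => exec_of_stuck f fuel c h, exec_prob f fuel c⟩

theorem Branching.iterate {f : Config → Multiset Config} (hf : Branching f) (e : Expr) (k : ℕ) :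
    Branching (Config.iterate e f k) := by
  induction k with
  | zero => exact ⟨fun σ h => by cases σ; simp_all [Config.iterate],
      fun σ => by simp [Config.iterate, Config.prob]⟩
  | succ k ih =>
    refine ⟨fun σ h => by simp [Config.iterate, h], fun σ => ?_⟩
    simp only [Config.iterate]
    split_ifs
    · simp
    · simp [Config.prob, Config.charge]
    · simp only [sum_map_bind, ih.prob, hf.prob]; rfl

namespace Setting

open Sieve QState Expr

variable {X : Type*} {n : ℕ} {K : Setting X n}
variable {c d : Cmd} {l : List Cmd} {M : ℕ → ℕ → ℕ} {ψ : QState}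
  {Q R : (ℕ → ℕ → ℕ) → QState → Prop}

/-- The branches `S` of a run started with `σ` stay within the bounds, and satisfy `Q` unless cut
off; the expected time is at most `τ`. -/
structure Ends (K : Setting X n) (S : Multiset Config) (σ : Config) (τ : ℝ)
    (Q : (ℕ → ℕ → ℕ) → QState → Prop) : Prop where
  ends : ∀ σ' ∈ S, σ'.qstate ≠ 0 → K.Res σ' ∧ (σ'.stuck = false → Q σ'.mem σ'.qstate)
  time : (S.map fun σ' => σ'.prob * (σ'.time : ℝ)).sum ≤ σ.prob * (σ.time + τ)

/-- The `Prb` statement is used twice. Applied to the indicator of the branches that are neither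
live nor dead, it shows that there are none. Applied to the expected time of the continuation minus
the deadline of the step, it bounds the mean. -/
theorem Ends.step {ι : Type*} {P : ι → (ℕ → ℕ → ℕ) → QState → Prop} {V : (ι → ℝ) → ℝ}
    {f : Config → Multiset Config} {σ : Config} {τ : ι → ℝ} (hf : Branching f)
    (h : K.Prb c σ.mem σ.qstate (fun g => σ.qstate.normSq * V g) P) (hV : V (fun _ => 0) = 0)
    (hs : σ.stuck = false) (hσ : K.Res σ) (hτ : ∀ i, 0 ≤ τ i)
    (h' : ∀ i (σ' : Config), K.Res σ' → σ'.stuck = false → P i σ'.mem σ'.qstate →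
      K.Ends (f σ') σ' (τ i) Q) :
    K.Ends ((exec K.f K.fuel c σ).bind f) σ (K.tau c + V τ) Q := by
  classical
  set T₁ := σ.time + K.tau c with hT₁
  have hall : ∀ σ' ∈ exec K.f K.fuel c σ,
      (∃ i, K.Live T₁ σ' ∧ P i σ'.mem σ'.qstate) ∨ K.Dead T₁ σ' := by
    have h0 := h σ σ.time rfl rfl hs hσ le_rfl
      (fun σ' => if (∃ i, K.Live T₁ σ' ∧ P i σ'.mem σ'.qstate) ∨ K.Dead T₁ σ' then 0 else 1)
      (fun _ => 0) (fun _ => le_rfl)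
      (fun i σ' hl hp => by rw [if_pos (.inl ⟨i, hl, hp⟩), mul_zero])
      (fun σ' hd => by rw [if_pos (.inr hd)])
    simp only [hV, mul_zero] at h0
    intro σ' hσ'
    by_contra hn
    have h1 := Multiset.single_le_sum (s := (exec K.f K.fuel c σ).map fun σ' =>
      if (∃ i, K.Live T₁ σ' ∧ P i σ'.mem σ'.qstate) ∨ K.Dead T₁ σ' then (0 : ℝ) else 1)
      (fun x hx => by
        obtain ⟨σ₁, -, rfl⟩ := Multiset.mem_map.1 hx
        split_ifs <;> norm_num) _ (Multiset.mem_map_of_mem _ hσ')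
    simp only [if_neg hn] at h1
    linarith
  constructor
  · intro σ'' hσ'' hne
    obtain ⟨σ', h1, h2⟩ := Multiset.mem_bind.1 hσ''
    rcases hall σ' h1 with ⟨i, hl, hp⟩ | hd | ⟨hs', -, hr⟩
    · exact (h' i σ' hl.res hl.stuck hp).ends σ'' h2 hne
    · exact absurd (hf.qstate_zero hd h2) hne
    · rw [hf.stuck σ' hs', Multiset.mem_singleton] at h2
      subst h2
      exact ⟨hr, fun h => by simp [hs'] at h⟩
  · have h1 := h σ σ.time rfl rfl hs hσ le_rfl
      (fun σ' => ((f σ').map fun σ'' => σ''.prob * (σ''.time : ℝ)).sum - σ'.prob * T₁) τ hτ ?_ ?_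
    · rw [Multiset.sum_map_sub, Multiset.sum_map_mul_right, exec_prob] at h1
      rw [sum_map_bind]
      have : ((T₁ : ℕ) : ℝ) = σ.time + K.tau c := by rw [hT₁]; push_cast; rfl
      rw [this] at h1
      have e : σ.prob = σ.qstate.normSq := rfl
      rw [e] at h1 ⊢
      linarith
    · intro i σ' hl hp
      have h2 := (h' i σ' hl.res hl.stuck hp).time
      have h3 : (σ'.time : ℝ) ≤ T₁ := by exact_mod_cast hl.time
      have h4 : 0 ≤ σ'.prob := normSq_nonneg _
      nlinarith
    · rintro σ' (hd | ⟨hs', ht, -⟩)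
      · have h2 : σ'.prob = 0 := by simp [Config.prob, hd]
        simp only [hf.sum_time_zero hd, h2]
        simp
      · rw [hf.stuck σ' hs', Multiset.map_singleton, Multiset.sum_singleton, sub_nonpos]
        exact mul_le_mul_of_nonneg_left (by exact_mod_cast ht) (normSq_nonneg _)

theorem Ends.mono_start {S : Multiset Config} {σ σ' : Config} {τ τ' : ℝ} (h : K.Ends S σ τ Q)
    (hp : σ.prob = σ'.prob) (ht : σ.time + τ ≤ σ'.time + τ') : K.Ends S σ' τ' Q :=
  ⟨h.ends, h.time.trans (by rw [hp]; exact mul_le_mul_of_nonneg_left ht (normSq_nonneg _))⟩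

theorem Ends.singleton {σ σ' : Config} {τ : ℝ} (hp : σ'.prob = σ.prob) (ht : σ'.time ≤ σ.time + τ)
    (hr : K.Res σ') (hQ : σ'.stuck = false → Q σ'.mem σ'.qstate) : K.Ends {σ'} σ τ Q :=
  ⟨fun σ'' h _ => by rw [Multiset.mem_singleton.1 h]; exact ⟨hr, hQ⟩, by
    rw [Multiset.map_singleton, Multiset.sum_singleton, hp]
    exact mul_le_mul_of_nonneg_left ht (normSq_nonneg _)⟩

theorem Ends.bind {S : Multiset Config} {σ : Config} {τ τ' : ℝ} {f : Config → Multiset Config}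
    (hf : Branching f) (h : K.Ends S σ τ Q) (hS : (S.map Config.prob).sum = σ.prob) (hτ : 0 ≤ τ')
    (h' : ∀ σ' : Config, K.Res σ' → σ'.stuck = false → Q σ'.mem σ'.qstate →
      K.Ends (f σ') σ' τ' R) : K.Ends (S.bind f) σ (τ + τ') R := by
  constructor
  · intro σ'' hσ'' hne
    obtain ⟨σ', h1, h2⟩ := Multiset.mem_bind.1 hσ''
    by_cases h0 : σ'.qstate = 0
    · exact absurd (hf.qstate_zero h0 h2) hne
    obtain ⟨hr, hq⟩ := h.ends σ' h1 h0
    cases hs : σ'.stuck with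
    | true =>
      rw [hf.stuck σ' hs, Multiset.mem_singleton] at h2
      subst h2
      exact ⟨hr, fun h => by simp [hs] at h⟩
    | false => exact (h' σ' hr hs (hq hs)).ends σ'' h2 hne
  · rw [sum_map_bind]
    have h1 : (S.map fun σ' => ((f σ').map fun σ'' => σ''.prob * (σ''.time : ℝ)).sum).sum ≤
        (S.map fun σ' => σ'.prob * (σ'.time : ℝ) + σ'.prob * τ').sum := by
      refine Multiset.sum_map_le_sum_map _ _ fun σ' h1 => ?_
      by_cases h0 : σ'.qstate = 0
      · have h2 : σ'.prob = 0 := by simp [Config.prob, h0]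
        simp only [hf.sum_time_zero h0, h2]
        simp
      obtain ⟨hr, hq⟩ := h.ends σ' h1 h0
      have hp : 0 ≤ σ'.prob := normSq_nonneg _
      cases hs : σ'.stuck with
      | true =>
        rw [hf.stuck σ' hs, Multiset.map_singleton, Multiset.sum_singleton]
        have := mul_nonneg hp hτ
        linarith
      | false =>
        have := (h' σ' hr hs (hq hs)).time
        linarith
    rw [Multiset.sum_map_add, Multiset.sum_map_mul_right, hS] at h1
    have := h.time
    linarith

end Setting

theorem stepMean_nonneg (H m D : ℕ) (L : List (ℕ × (ℕ → ℕ)))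
    {G : Option (List (ℕ × (ℕ → ℕ))) → ℝ} (hG : ∀ o, 0 ≤ G o) : 0 ≤ stepMean H m D L G := by
  have h1 : ∀ (a : ℕ → ℕ) (c e R : ℕ) (g : Option (ℕ → ℕ) → ℝ), (∀ o, 0 ≤ g o) →
      0 ≤ collSum a c e R g := fun a c e R g hg =>
    Finset.sum_nonneg fun _ _ => Finset.sum_nonneg fun _ _ => hg _
  match L with
  | [] => exact leafMean_nonneg _ _ fun _ => hG _
  | [(a, b)] =>
    rw [stepMean]
    split_ifs
    · exact mul_nonneg (by positivity) (h1 _ _ _ _ _ fun _ => hG _)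
    · exact leafMean_nonneg _ _ fun _ => hG _
  | (a, b) :: (a', b') :: L =>
    rw [stepMean]
    split_ifs
    · exact mul_nonneg (by positivity) (h1 _ _ _ _ _ fun _ => hG _)
    · exact leafMean_nonneg _ _ fun _ => hG _

theorem sieveCost_nonneg {κ : ℝ} (hκ : 0 ≤ κ) (H m D k : ℕ) (o : Option (List (ℕ × (ℕ → ℕ)))) :
    0 ≤ sieveCost κ H m D k o := by
  induction k generalizing o with
  | zero => exact le_rfl
  | succ k ih =>
    cases o with
    | none => exact hκ
    | some L => exact add_nonneg hκ (stepMean_nonneg H m D L ih)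

namespace Setting

open Sieve QState Expr

variable {X : Type*} {n : ℕ} {K : Setting X n}
variable {c d : Cmd} {l : List Cmd} {M : ℕ → ℕ → ℕ} {ψ : QState}
  {Q R : (ℕ → ℕ → ℕ) → QState → Prop}

/-- The expected time of the command is at most `τ`, and `Q` holds in the end unless it is
cut off. -/
def Avg (K : Setting X n) (c : Cmd) (M : ℕ → ℕ → ℕ) (ψ : QState) (τ : ℝ)
    (Q : (ℕ → ℕ → ℕ) → QState → Prop) : Prop :=
  ∀ σ : Config, σ.mem = M → σ.qstate = ψ → σ.stuck = false → K.Res σ →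
    K.Ends (exec K.f K.fuel c σ) σ τ Q

theorem Avg.mono {τ τ' : ℝ} (h : K.Avg c M ψ τ Q) (hτ : τ ≤ τ') (hQ : ∀ M' ψ', Q M' ψ' → R M' ψ') :
    K.Avg c M ψ τ' R := fun σ h1 h2 h3 h4 =>
  let h5 := (h σ h1 h2 h3 h4).mono_start rfl (add_le_add_right hτ _)
  ⟨fun σ' h' hne => (h5.ends σ' h' hne).imp id fun h6 hs => hQ _ _ (h6 hs), h5.time⟩

theorem Avg.of_det (h : K.Det c M ψ Q) : K.Avg c M ψ (K.tau c) Q := by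
  intro σ h1 h2 h3 h4
  obtain ⟨σ', a, b, r, d⟩ := h σ h1 h2 h3 h4
  have hp := exec_prob K.f K.fuel c σ
  rw [a] at hp ⊢
  exact .singleton (by simpa using hp) (by exact_mod_cast b) r d

theorem Avg.seq {τ τ' : ℝ} (hτ : 0 ≤ τ')
    (h : K.Avg c M ψ τ fun M' ψ' => MemOK K.B M' → K.Avg d M' ψ' τ' Q) :
    K.Avg (.seq c d) M ψ (τ + τ') Q := fun σ h1 h2 h3 h4 =>
  (h σ h1 h2 h3 h4).bind (exec_branching _ _ d) (exec_prob _ _ c σ) hτ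
    fun σ' hr hs hq => hq hr.mem σ' rfl rfl hs hr

theorem Avg.cons {τ τ' : ℝ} (hτ : 0 ≤ τ')
    (h : K.Avg c M ψ τ fun M' ψ' => MemOK K.B M' → K.Avg (Sieve.block l) M' ψ' τ' Q) :
    K.Avg (Sieve.block (c :: l)) M ψ (τ + τ') Q := Avg.seq hτ h

theorem Avg.nil (h : Q M ψ) : K.Avg (Sieve.block []) M ψ 0 Q :=
  (Avg.of_det (Det.nil h)).mono (by simp [tau, Sieve.block, Cmd.timeBound]) fun _ _ h => h

theorem Avg.single {τ : ℝ} (h : K.Avg c M ψ τ Q) : K.Avg (Sieve.block [c]) M ψ τ Q :=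
  (Avg.cons le_rfl (h.mono le_rfl fun _ _ hq _ => Avg.nil hq)).mono (add_zero _).le fun _ _ h => h

theorem Avg.asg_cons {v : ℕ} {e : Expr} {τ : ℝ} (he : e.Adm) (ht : v < 36) (hv : e.eval M ≤ K.B)
    (hτ : 0 ≤ τ) (h : MemOK K.B (upd M v 0 (e.eval M)) →
      K.Avg (Sieve.block l) (upd M v 0 (e.eval M)) ψ τ Q) :
    K.Avg (Sieve.block (Sieve.asg v e :: l)) M ψ (stepBound K.B n + τ) Q :=
  Avg.cons hτ (Avg.of_det (Det.asgSmall he ht hv h))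

theorem Avg.loop {e : Expr} (he : e.Adm) {N : ℕ} {τ : ℝ} (hτ : 0 ≤ τ)
    (I : ℕ → (ℕ → ℕ → ℕ) → QState → Prop) (h0 : I 0 M ψ)
    (hlt : ∀ j < N, ∀ M' ψ', I j M' ψ' → e.eval M' ≠ 0)
    (hle : ∀ M' ψ', I N M' ψ' → e.eval M' = 0)
    (hstep : ∀ j < N, ∀ M' ψ', I j M' ψ' → MemOK K.B M' → K.Avg c M' ψ' τ (I (j + 1)))
    (hQ : ∀ M' ψ', I N M' ψ' → Q M' ψ') :
    K.Avg (.loop e c) M ψ ((N + 1) * (stepBound K.B n + τ)) Q := by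
  intro σ e1 e2 h3 h4
  subst e1 e2
  have hes : ∀ e' ∈ [e], e'.Adm := by simp [he]
  suffices H : ∀ j ≤ N, ∀ k (σ : Config), I (N - j) σ.mem σ.qstate → σ.stuck = false → K.Res σ →
      K.Ends (Config.iterate e (exec K.f K.fuel c) k σ) σ ((j + 1) * (stepBound K.B n + τ)) Q by
    exact H N le_rfl K.fuel σ (by simpa using h0) h3 h4
  have hκ : (0 : ℝ) ≤ stepBound K.B n := Nat.cast_nonneg _
  intro j
  induction j with
  | zero =>
    intro _ k σ hI hs hr
    cases k with
    | zero => exact .singleton rfl (le_add_of_nonneg_right (by positivity)) hr.stuck (by simp)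
    | succ k =>
      have ht : ((σ.charge [e] 1 ∅).time : ℝ) ≤ σ.time + stepBound K.B n := by
        exact_mod_cast hr.charge_time (U := ∅) (k := 1) hes (by simp) (by omega)
      simp only [Config.iterate, hs, Bool.false_eq_true, if_false, hle _ _ hI, if_true]
      exact .singleton rfl (by push_cast; linarith) (hr.charge hes (by simp)) fun _ => hQ _ _ hI
  | succ j ih =>
    intro hj k σ hI hs hr
    cases k with
    | zero => exact .singleton rfl (le_add_of_nonneg_right (by positivity)) hr.stuck (by simp)
    | succ k =>
      have ht : ((σ.charge [e] 1 ∅).time : ℝ) ≤ σ.time + stepBound K.B n := by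
        exact_mod_cast hr.charge_time (U := ∅) (k := 1) hes (by simp) (by omega)
      simp only [Config.iterate, hs, Bool.false_eq_true, if_false, hlt _ (show N - (j + 1) < N by omega) _ _ hI]
      refine (Ends.bind ((exec_branching _ _ c).iterate e k) (hstep _ (show N - (j + 1) < N by omega) _ _ hI
        hr.mem (σ.charge [e] 1 ∅) rfl rfl hs (hr.charge hes (by simp))) (exec_prob _ _ c _)
        (τ' := (j + 1) * (stepBound K.B n + τ)) (by positivity)
        fun σ' hr' hs' hI' => ih (by omega) k σ'
          (by rwa [show N - (j + 1) + 1 = N - j by omega] at hI') hs' hr').mono_start rfl ?_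
      push_cast
      linarith

theorem Avg.forLt {v : ℕ} {e : Expr} (he : (Expr.bin .lt (Sieve.var v) e).Adm) (hv : v < 36)
    {N : ℕ} (hN : N ≤ K.B) {τ : ℝ} (hτ : 0 ≤ τ) (I : ℕ → (ℕ → ℕ → ℕ) → QState → Prop)
    (h0 : I 0 (upd M v 0 0) ψ)
    (hev : ∀ j ≤ N, ∀ M' ψ', I j M' ψ' → M' v 0 = j → e.eval M' = N)
    (hstep : ∀ j < N, ∀ M' ψ', I j M' ψ' → M' v 0 = j → MemOK K.B M' →
      K.Avg (Sieve.block l) M' ψ' τ fun M'' ψ'' =>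
        M'' v 0 = j ∧ I (j + 1) (upd M'' v 0 (j + 1)) ψ'')
    (hQ : ∀ M' ψ', I N M' ψ' → M' v 0 = N → Q M' ψ') :
    K.Avg (Sieve.forLt v e l) M ψ
      (stepBound K.B n + (N + 1) * (stepBound K.B n + (τ + stepBound K.B n))) Q := by
  have hvar : (Sieve.var v + 1).Adm := ⟨rfl, show 4 ≤ 40 by omega⟩
  refine Avg.cons (by positivity) ((Avg.of_det (Det.asgSmall adm_zero hv (by simp) ?_)))
  refine fun _ => Avg.single (Avg.loop he (by positivity) (fun j M' ψ' => I j M' ψ' ∧ M' v 0 = j)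
    ⟨h0, by simp⟩ ?_ ?_ ?_ fun M' ψ' h => hQ _ _ h.1 h.2)
  · rintro j hj M' ψ' ⟨h, hj'⟩
    simp [hev j hj.le _ _ h hj', hj', hj]
  · rintro M' ψ' ⟨h, hj'⟩
    simp [hev N le_rfl _ _ h hj', hj']
  · rintro j hj M' ψ' ⟨h, hj'⟩ hM
    refine Avg.cons (by positivity) ((hstep j hj M' ψ' h hj' hM).mono le_rfl ?_)
    rintro M'' ψ'' ⟨h1, h2⟩ -
    have e1 : (var v + 1 : Expr).eval M'' = j + 1 := by rw [eval_add, eval_var, eval_one, h1]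
    refine Avg.single ((Avg.of_det (Det.asgSmall hvar hv (by rw [e1]; omega) ?_)))
    rw [e1]
    exact ⟨h2, by simp⟩

/-- A bound for the time of one step of the sieve. -/
def stepTime (K : Setting X n) : ℕ := stepBound K.B n + K.tau Sieve.sieveBody

/-- No fixed number of rounds suffices for this loop, so `Prb.loop` does not apply. The induction is
on the fuel `k`, along which the recursion of `sieveCost` unfolds. -/
theorem Ends.sieveLoop {m t l s' D : ℕ} (hH : D * m + 1 ≤ n - t) (hH' : n - t ≤ D * m + m)
    (hDm : D + 1 ≤ m) (k : ℕ) (o : Option (List (ℕ × (ℕ → ℕ)))) (σ : Config)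
    (hI : SieveInv K m t l s' D o σ.mem σ.qstate) (hs : σ.stuck = false) (hr : K.Res σ) :
    K.Ends (Config.iterate (bin .eq (var vdone) 0) (exec K.f K.fuel Sieve.sieveBody) k σ) σ
      (sieveCost K.stepTime (n - t) m D k o) (SieveInv K m t l s' D none) := by
  have hκ : (0 : ℝ) ≤ K.stepTime := Nat.cast_nonneg _
  have hes : ∀ e' ∈ [(bin .eq (var vdone) 0 : Expr)], e'.Adm := by
    intro e he
    rw [List.mem_singleton] at he
    subst he
    exact ⟨rfl, by decide⟩
  induction k generalizing o σ with
  | zero => exact .singleton rfl (by simp [sieveCost]) hr.stuck (by simp)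
  | succ k ih =>
    have ht : ((σ.charge [(bin .eq (var vdone) 0 : Expr)] 1 ∅).time : ℝ) ≤
        σ.time + stepBound K.B n := by
      exact_mod_cast hr.charge_time (U := ∅) (k := 1) hes (by simp) (by omega)
    have hst : (K.stepTime : ℝ) = stepBound K.B n + K.tau Sieve.sieveBody := by
      rw [stepTime]; push_cast; rfl
    have htau : (0 : ℝ) ≤ K.tau Sieve.sieveBody := Nat.cast_nonneg _
    have hdone := hI.done
    cases o with
    | none =>
      rw [if_pos rfl] at hdone
      simp only [Config.iterate, hs, Bool.false_eq_true, if_false, eval_eq, eval_var, eval_zero, hdone,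
        one_ne_zero, if_true]
      exact .singleton rfl (by rw [sieveCost]; linarith) (hr.charge hes (by simp)) fun _ => hI
    | some L =>
      rw [if_neg (by simp)] at hdone
      simp only [Config.iterate, hs, Bool.false_eq_true, if_false, eval_eq, eval_var, eval_zero, hdone,
        if_true, one_ne_zero]
      refine (Ends.step (σ := σ.charge [(bin .eq (var vdone) 0 : Expr)] 1 ∅)
        ((exec_branching _ _ _).iterate _ k) (Prb.sieveBody hI hH hH' hDm) (stepMean_zero _ _ _ _)
        hs (hr.charge hes (by simp)) (fun i => sieveCost_nonneg hκ (n - t) m D k i)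
        fun i σ' hr' hs' hP => ih i σ' hP hs' hr').mono_start rfl ?_
      rw [sieveCost, hst]
      linarith

/-- A bound for the expected time of the sieve. -/
noncomputable def sieveTime (K : Setting X n) : ℝ :=
  4 * stepBound K.B n + K.stepTime * (8 + 4 * K.B)

theorem sieveTime_nonneg (K : Setting X n) : 0 ≤ K.sieveTime := by
  rw [sieveTime]; positivity

/-- With `D = (n - t - 1) / m` stages the remaining height is between `1` and `m`, as the last stage
requires. Moreover `D < m` since `n = m ^ 2`, so the expected number of steps, about `6 ^ D`, is
bounded by `B`. -/
theorem Avg.sieve {m t l s' : ℕ} (lay : Layout K M m t l s') (hψ : ∃ z : ℂ, ψ = z • Finsupp.single ∅ 1) :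
    K.Avg Sieve.sieve M ψ K.sieveTime fun M' ψ' => Layout K M' m t l s' ∧ M' vpar 0 = s' % 2 ∧
      ∃ z : ℂ, ψ' = z • Finsupp.single ∅ 1 := by
  have hone := lay.one_le
  have htn := lay.hs.tn
  obtain ⟨hB1, hB2, -⟩ := lay.bounds
  set D := (n - t - 1) / m with hDdef
  have h1 : D * m ≤ n - t - 1 := Nat.div_mul_le_self _ _
  have h2 : n - t - 1 < D * m + m := by
    have := Nat.lt_mul_div_succ (n - t - 1) hone
    rw [← hDdef] at this
    linarith
  have hDm : D < m := by
    rw [hDdef, Nat.div_lt_iff_lt_mul hone, ← pow_two, ← lay.sq]; omega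
  have h6 : (6 : ℝ) ^ D ≤ K.B := by
    have : 6 ^ D ≤ K.B := calc
      6 ^ D ≤ 8 ^ D := Nat.pow_le_pow_left (by norm_num) _
      _ = 2 ^ (3 * D) := by rw [pow_mul]; norm_num
      _ ≤ 2 ^ (4 * m + 8) := Nat.pow_le_pow_right (by norm_num) (by omega)
      _ ≤ K.B := lay.hB
    exact_mod_cast this
  have hκ : (0 : ℝ) ≤ K.stepTime := Nat.cast_nonneg _
  have hX : (0 : ℝ) ≤ K.stepTime * (8 + 4 * K.B) := by positivity
  have hsb : (0 : ℝ) ≤ stepBound K.B n := Nat.cast_nonneg _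
  have hsum : (stepBound K.B n : ℝ) + (stepBound K.B n + (stepBound K.B n + (stepBound K.B n +
      K.stepTime * (8 + 4 * K.B)))) ≤ K.sieveTime := by
    rw [sieveTime]
    generalize (stepBound K.B n : ℝ) = x
    linarith
  have hsv : Sieve.sieve = Sieve.block [Sieve.asg vD ((var vn - var vt - 1) / var vm),
    Sieve.asg vh (var vn - var vt - var vD * var vm), Sieve.asg vdone 0, Sieve.asg vsp 0,
    Cmd.loop (bin .eq (var vdone) 0) Sieve.sieveBody] := rfl
  rw [hsv]
  refine Avg.mono ?_ hsum fun _ _ h => h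
  refine Avg.asg_cons ⟨rfl, by decide⟩ (by decide) ?_
    (add_nonneg hsb (add_nonneg hsb (add_nonneg hsb hX))) fun _ => ?_
  · simp only [eval_div, eval_sub, eval_var, eval_one, lay.hn, lay.ht, lay.hm]
    exact hDm.le.trans (by omega)
  rw [show ((var vn - var vt - 1) / var vm : Expr).eval M = D by
    simp only [eval_div, eval_sub, eval_var, eval_one, lay.hn, lay.ht, lay.hm]; rfl]
  set M₁ := upd M vD 0 D with hM₁
  have f1 : Frame [vD] M M₁ := (Frame.refl _ _).upd (by decide) _ _
  have e1 : (var vn - var vt - var vD * var vm : Expr).eval M₁ = n - t - D * m := by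
    simp only [eval_sub, eval_mul, eval_var, f1 vn (by decide), f1 vt (by decide),
      f1 vm (by decide), lay.hn, lay.ht, lay.hm]
    rw [hM₁, upd_self]
  refine Avg.asg_cons ⟨rfl, by decide⟩ (by decide) (by rw [e1]; omega)
    (add_nonneg hsb (add_nonneg hsb hX)) fun _ => ?_
  rw [e1]
  set M₂ := upd M₁ vh 0 (n - t - D * m) with hM₂
  have f2 : Frame [vD, vh] M M₂ := (f1.mono (by decide)).upd (by decide) _ _
  refine Avg.asg_cons adm_zero (by decide) (Nat.zero_le _) (add_nonneg hsb hX) fun _ => ?_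
  refine Avg.asg_cons adm_zero (by decide) (Nat.zero_le _) hX fun _ => ?_
  rw [eval_zero, eval_zero]
  set M₄ := upd (upd M₂ vdone 0 0) vsp 0 0 with hM₄
  have f4 : Frame [vD, vh, vdone, vsp] M M₄ :=
    ((f2.mono (by decide)).upd (by decide) _ _).upd (by decide) _ _
  have hI : SieveInv K m t l s' D (some []) M₄ ψ := by
    refine ⟨⟨lay.frame f4 (by decide), by rw [hM₄, upd_self]; rfl, trivial, hψ, by simp⟩, trivial,
      ?_, ?_, ?_, fun h => by simp at h⟩
    · rw [hM₄, upd_ne (by decide), upd_ne (by decide), hM₂, upd_ne (by decide), hM₁, upd_self]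
    · rw [hM₄, upd_ne (by decide), upd_ne (by decide), hM₂, upd_self]
    · rw [hM₄, upd_ne (by decide), upd_self]; simp
  refine Avg.single fun σ e1 e2 e3 e4 => ?_
  have hI' : SieveInv K m t l s' D (some []) σ.mem σ.qstate := by rw [e1, e2]; exact hI
  have hE := Ends.sieveLoop (D := D) (m := m) (t := t) (by omega) (by omega) hDm K.fuel _ σ hI' e3 e4
  have hc := stackMean_sieveCost_le (H := n - t) (D := D) (m := m) hκ (by omega) (by omega) K.fuel [] trivial (by simp)
  rw [stackMean_nil, show stackPotential [] = 0 from rfl, sub_zero] at hc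
  have hc' := mul_le_mul_of_nonneg_left (show 4 * (2 + (6 : ℝ) ^ D) ≤ 8 + 4 * K.B by linarith) hκ
  have hE' := hE.mono_start (σ' := σ) (τ' := K.stepTime * (8 + 4 * K.B)) rfl (by linarith)
  exact ⟨fun σ' h hne => (hE'.ends σ' h hne).imp id fun h hs =>
    ⟨(h hs).good.layout, (h hs).par rfl, (h hs).good.state⟩, hE'.time⟩

end Setting

/-! ### The program for the parity and the program for the shift. -/

namespace Setting

open Sieve QState Expr

variable {X : Type*} {n : ℕ} {K : Setting X n} {M : ℕ → ℕ → ℕ} {ψ : QState} {m : ℕ}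

/-- The variables that do not change after the setup. -/
structure Wires (K : Setting X n) (M : ℕ → ℕ → ℕ) (m : ℕ) : Prop where
  hn : M vn 0 = n
  hm : M vm 0 = m
  hw : M vw 0 = m + 1
  hqa : M qa 0 = (m + 1) * (m + 1)
  hqf : M qf 0 = M qa 0 + n
  hqg : M qg 0 = M qf 0 + 1
  hqy : M qy 0 = M qg 0 + 2 * (m + 1) + 1

theorem Layout.wires {t l s' : ℕ} (h : Layout K M m t l s') : Wires K M m :=
  ⟨h.hn, h.hm, h.hw, h.hqa, h.hqf, h.hqg, h.hqy⟩

theorem Wires.frame {M' : ℕ → ℕ → ℕ} (h : Wires K M m) (hf : Frame [vt, vl] M M') :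
    Wires K M' m := by
  have e : ∀ u ∈ [vn, vm, vw, qa, qf, qg, qy], M' u 0 = M u 0 := fun u hu => by
    rw [hf u (by revert u; decide)]
  obtain ⟨h1, h2, h3, h4, h5, h6, h7⟩ := h
  simp only [List.forall_mem_cons] at e
  obtain ⟨e1, e2, e3, e4, e5, e6, e7, -⟩ := e
  exact ⟨by omega, by omega, by omega, by rw [e4, h4], by omega, by omega, by omega⟩

/-- The conditions on the bounds. -/
structure Roomy (K : Setting X n) (m : ℕ) : Prop where
  sq : n = m ^ 2
  one_le : 1 ≤ m
  B_eq : K.B = 2 ^ (4 * m + 8)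
  Qb_eq : K.Qb = 13 * n

/-- The number of qubits laid out is `2 * m ^ 2 + 5 * m + 6`, at most `13 * m ^ 2` with equality for
`m = 1`. -/
theorem Roomy.bounds (h : Roomy K m) : (m + 1) * (m + 1) + n + 1 + 2 * (m + 1) + 1 + (m + 1) ≤ K.Qb ∧
    K.Qb + 100 ≤ K.B := by
  have h1 : m < 2 ^ m := Nat.lt_two_pow_self
  have h2 : m * m ≤ 2 ^ m * 2 ^ m := Nat.mul_le_mul h1.le h1.le
  have h3 : m ≤ m * m := Nat.le_mul_of_pos_left _ h.one_le
  have h4 := h.one_le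
  have e1 : 2 ^ (4 * m + 8) = 2 ^ m * 2 ^ m * (2 ^ m * 2 ^ m) * 256 := by
    rw [pow_add, ← pow_add 2 m m, ← pow_add]; ring
  have h5 : 2 ^ m * 2 ^ m ≤ 2 ^ m * 2 ^ m * (2 ^ m * 2 ^ m) :=
    Nat.le_mul_of_pos_right _ (Nat.mul_pos (by omega) (by omega))
  have e2 : (m + 1) * (m + 1) = m * m + 2 * m + 1 := by ring
  rw [h.B_eq, h.Qb_eq, e1, h.sq, pow_two, e2]
  constructor <;> omega

theorem Wires.layout {t l s' : ℕ} (h : Wires K M m) (hK : Roomy K m) (ht : M vt 0 = t)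
    (hl : M vl 0 = l) (hs : ShiftData K.f t l s') : Layout K M m t l s' :=
  ⟨h.hn, h.hm, h.hw, ht, hl, h.hqa, h.hqf, h.hqg, h.hqy,
    by have := hK.bounds.1; rw [h.hqy, h.hqg, h.hqf, h.hqa]; omega, hK.sq, hK.one_le, hK.B_eq.ge, hs⟩

theorem Det.setup (hK : Roomy K m) (hn : M vn 0 = n) :
    K.Det Sieve.setup M ψ fun M' ψ' => Wires K M' m ∧ M' vt 0 = 0 ∧ M' vl 0 = 0 ∧ ψ' = ψ := by
  obtain ⟨hQ, hB⟩ := hK.bounds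
  have hsq := hK.sq
  refine Det.cons (Det.asgSmall adm_zero (by decide) (Nat.zero_le _) fun _ => Det.cons ?_)
  refine Det.loop ⟨rfl, by decide⟩ (N := m) (by omega)
    (fun j M' ψ' => M' vm 0 = j ∧ M' vn 0 = n ∧ ψ' = ψ) ⟨by simp, by rw [upd_ne (by decide), hn], rfl⟩
    ?_ ?_ ?_ ?_
  · rintro j hj M' ψ' ⟨h1, h2, -⟩
    simp only [eval_lt, eval_mul, eval_var, h1, h2]
    rw [if_pos (by rw [hsq, pow_two]; exact Nat.mul_self_lt_mul_self hj)]
    exact one_ne_zero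
  · rintro M' ψ' ⟨h1, h2, -⟩
    simp only [eval_lt, eval_mul, eval_var, h1, h2]
    rw [if_neg (by rw [hsq, pow_two]; exact lt_irrefl _)]
  · rintro j hj M' ψ' ⟨h1, h2, h3⟩ -
    have e : (var vm + 1 : Expr).eval M' = j + 1 := by simp [h1]
    refine Det.asgSmall ⟨rfl, by decide⟩ (by decide) (by rw [e]; omega) ?_
    rw [e]
    exact ⟨by simp, by rw [upd_ne (by decide), h2], h3⟩
  rintro M₀ ψ₀ ⟨h1, h2, rfl⟩ -
  refine Det.cons (Det.asgSmall (e := var vm + 1) ⟨rfl, by decide⟩ (by decide) (by simp [h1]; omega) ?_)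
  rw [show (var vm + 1 : Expr).eval M₀ = m + 1 by simp [h1]]
  set M₁ := upd M₀ vw 0 (m + 1) with hM₁
  have e1 : (var vw * var vw : Expr).eval M₁ = (m + 1) * (m + 1) := by simp [hM₁]
  refine fun _ => Det.cons (Det.asgSmall (e := var vw * var vw) ⟨rfl, by decide⟩ (by decide)
    (by rw [e1]; omega) ?_)
  rw [e1]
  set M₂ := upd M₁ qa 0 ((m + 1) * (m + 1)) with hM₂
  have e2 : (var qa + var vn : Expr).eval M₂ = (m + 1) * (m + 1) + n := by
    simp [hM₂, hM₁, upd_apply, h2]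
  refine fun _ => Det.cons (Det.asgSmall (e := var qa + var vn) ⟨rfl, by decide⟩ (by decide)
    (by rw [e2]; omega) ?_)
  rw [e2]
  set M₃ := upd M₂ qf 0 ((m + 1) * (m + 1) + n) with hM₃
  have e3 : (var qf + 1 : Expr).eval M₃ = (m + 1) * (m + 1) + n + 1 := by simp [hM₃]
  refine fun _ => Det.cons (Det.asgSmall (e := var qf + 1) ⟨rfl, by decide⟩ (by decide)
    (by rw [e3]; omega) ?_)
  rw [e3]
  set M₄ := upd M₃ qg 0 ((m + 1) * (m + 1) + n + 1) with hM₄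
  have e4 : (var qg + 2 * var vw + 1 : Expr).eval M₄ =
      (m + 1) * (m + 1) + n + 1 + 2 * (m + 1) + 1 := by
    simp [hM₄, hM₃, hM₂, hM₁, upd_apply]
  refine fun _ => Det.cons (Det.asgSmall (e := var qg + 2 * var vw + 1) ⟨rfl, by decide⟩ (by decide)
    (by rw [e4]; omega) ?_)
  rw [e4]
  refine fun _ => Det.cons (Det.asgSmall adm_zero (by decide) (Nat.zero_le _) ?_)
  refine fun _ => Det.single (Det.asgSmall adm_zero (by decide) (Nat.zero_le _) ?_)
  refine ⟨⟨?_, ?_, ?_, ?_, ?_, ?_, ?_⟩, ?_, ?_, rfl⟩ <;>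
    simp [hM₄, hM₃, hM₂, hM₁, upd_apply, h1, h2]

theorem ShiftData.of_isHiddenShift {f : Bool → ZMod (2 ^ n) → X} {s : ZMod (2 ^ n)}
    (h : IsHiddenShift f s) {t l s' : ℕ} (hl : l < 2 ^ t) (ht : t < n)
    (hs : l + s.val = 2 ^ t * s') : ShiftData f t l s' := by
  refine ⟨h.injective _, fun a => ?_, hl, ht⟩
  have : NeZero (2 ^ n) := ⟨(Nat.two_pow_pos n).ne'⟩
  rw [h.shift, ← hs]
  push_cast
  rw [ZMod.natCast_zmod_val]
  congr 1
  ring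

/-- A bound for the expected time of the program for the parity. -/
noncomputable def parityTime (K : Setting X n) : ℝ :=
  K.tau Sieve.setup + (K.sieveTime + stepBound K.B n)

/-- A bound for the expected time of the program for the shift. -/
noncomputable def shiftTime (K : Setting X n) : ℝ :=
  K.tau Sieve.setup + ((stepBound K.B n + (n + 1) * (stepBound K.B n +
    ((K.sieveTime + stepBound K.B n) + stepBound K.B n))) + stepBound K.B n)

theorem Avg.asg_single {v : ℕ} {e : Expr} {Q : (ℕ → ℕ → ℕ) → QState → Prop} (he : e.Adm) (ht : v < 36)
    (hv : Expr.smallTape v = true → e.eval M ≤ K.B) (hs : (e.eval M).size ≤ K.B)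
    (h : Q (upd M v 0 (e.eval M)) ψ) :
    K.Avg (Sieve.block [Sieve.asg v e]) M ψ (stepBound K.B n) Q :=
  Avg.single (Avg.of_det (Det.asg he ht hv hs h))

variable {s : ZMod (2 ^ n)}

theorem Avg.parityProgram (hK : Roomy K m) (hs : IsHiddenShift K.f s) (hn : M vn 0 = n) :
    K.Avg Sieve.parityProgram M (Finsupp.single ∅ 1) K.parityTime
      fun M' _ => M' vout 0 = s.val % 2 := by
  have hsb : (0 : ℝ) ≤ stepBound K.B n := Nat.cast_nonneg _
  have hB := hK.bounds.2
  have h1 := hK.one_le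
  refine Avg.cons (add_nonneg (sieveTime_nonneg K) hsb) ((Avg.of_det (Det.setup hK hn)).mono le_rfl ?_)
  rintro M₁ ψ₁ ⟨hw, ht, hl, rfl⟩ -
  have hn0 : 0 < n := by rw [hK.sq]; positivity
  refine Avg.cons hsb ((Avg.sieve (hw.layout hK ht hl (.of_isHiddenShift hs (s' := s.val) (by simp) hn0 (by simp)))
    ⟨1, (one_smul _ _).symm⟩).mono le_rfl ?_)
  rintro M₂ ψ₂ ⟨-, hp, -⟩ -
  have h2 : s.val % 2 < 2 := Nat.mod_lt _ (by norm_num)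
  refine Avg.asg_single ⟨rfl, by decide⟩ (by decide) (fun _ => ?_) ?_ ?_
  · rw [eval_var, hp]; omega
  · rw [eval_var, hp]; exact (Nat.size_le_self' _).trans (by omega)
  · rw [upd_self, eval_var, hp]

theorem Avg.shiftProgram (hK : Roomy K m) (hs : IsHiddenShift K.f s) (hn : M vn 0 = n) :
    K.Avg Sieve.shiftProgram M (Finsupp.single ∅ 1) K.shiftTime fun M' _ => M' vout 0 = s.val := by
  have hsb : (0 : ℝ) ≤ stepBound K.B n := Nat.cast_nonneg _
  have hst := sieveTime_nonneg K
  have hB := hK.bounds.2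
  have hQ := hK.bounds.1
  have : NeZero (2 ^ n) := ⟨(Nat.two_pow_pos n).ne'⟩
  have hsv := ZMod.val_lt s
  have hx : (0 : ℝ) ≤ K.sieveTime + stepBound K.B n := add_nonneg hst hsb
  have hy : (0 : ℝ) ≤ stepBound K.B n + (n + 1) * (stepBound K.B n +
      ((K.sieveTime + stepBound K.B n) + stepBound K.B n)) :=
    add_nonneg hsb (mul_nonneg (by positivity) (add_nonneg hsb (add_nonneg hx hsb)))
  refine Avg.cons (add_nonneg hy hsb) ((Avg.of_det (Det.setup hK hn)).mono le_rfl ?_)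
  rintro M₁ ψ₁ ⟨hw, ht, hl, rfl⟩ -
  refine Avg.cons hsb (Avg.forLt ⟨rfl, by decide⟩ (by decide) (N := n) (by omega) hx
    (fun j M' ψ' => Wires K M' m ∧ (∃ s', M' vl 0 < 2 ^ j ∧ M' vl 0 + s.val = 2 ^ j * s') ∧
      ∃ z : ℂ, ψ' = z • Finsupp.single ∅ 1) ?_ ?_ ?_ ?_)
  · refine ⟨hw.frame ((Frame.refl _ _).upd (by decide) _ _), ⟨s.val, ?_⟩, 1, (one_smul _ _).symm⟩
    rw [upd_ne (by decide), hl]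
    simp
  · rintro j - M' ψ' ⟨h, -⟩ -
    rw [eval_var, h.hn]
  · rintro j hj M' ψ' ⟨hw', ⟨s', hlt, hls⟩, hz⟩ ht' -
    refine Avg.cons hsb ((Avg.sieve (hw'.layout hK ht' rfl (.of_isHiddenShift hs hlt hj hls)) hz).mono
      le_rfl ?_)
    rintro M₂ ψ₂ ⟨lay, hp, hz'⟩ -
    generalize M' vl 0 = l at *
    have he : (var vl + var vpar * pow (var vt) : Expr).eval M₂ = l + s' % 2 * 2 ^ j := by
      simp [lay.hl, lay.ht, hp]
    have h3 : s' % 2 * 2 ^ j ≤ 1 * 2 ^ j := Nat.mul_le_mul_right _ (by omega)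
    have h4 : 2 ^ (j + 1) = 2 * 2 ^ j := pow_succ' _ _
    have hlt' : l + s' % 2 * 2 ^ j < 2 ^ (j + 1) := by omega
    refine Avg.asg_single ⟨rfl, by decide⟩ (by decide) (fun h => absurd h (by decide)) ?_ ?_
    · rw [he]; exact (Nat.size_le.2 hlt').trans (by omega)
    rw [he]
    -- Adding the bit `s' % 2` to `l` in place `j` rounds `s'` up to the even number `s' + s' % 2`,
    -- half of which is the shift in the next round.
    refine ⟨by rw [upd_ne (by decide), lay.ht],
      lay.wires.frame (((Frame.refl _ _).upd (by decide) _ _).upd (by decide) _ _),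
      ⟨(s' + s' % 2) / 2, ?_⟩, hz'⟩
    rw [upd_ne (by decide), upd_self]
    refine ⟨hlt', ?_⟩
    have h5 : s' + s' % 2 = 2 * ((s' + s' % 2) / 2) := by omega
    calc l + s' % 2 * 2 ^ j + s.val = 2 ^ j * (s' + s' % 2) := by rw [mul_add, ← hls]; ring
      _ = _ := by rw [h5, h4]; simp; ring
  · rintro M₂ ψ₂ ⟨hw', ⟨s', hlt, hls⟩, -⟩ - -
    have he : ((pow (var vn) - var vl) % pow (var vn) : Expr).eval M₂ = s.val := by
      simp only [eval_mod, eval_sub, eval_pow, eval_var, hw'.hn]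
      -- Both `l` and `s` are below `2 ^ n`, so their sum, a multiple of `2 ^ n`, is `0` or `2 ^ n`.
      -- The final reduction modulo `2 ^ n` in the program takes care of the first case.
      have h5 : s' < 2 := by
        by_contra h
        have := Nat.mul_le_mul_left (2 ^ n) (show 2 ≤ s' by omega)
        omega
      interval_cases s'
      · rw [show M₂ vl 0 = 0 by omega, Nat.sub_zero, Nat.mod_self]; omega
      · rw [Nat.mod_eq_of_lt (by omega)]; omega
    refine Avg.asg_single ⟨rfl, by decide⟩ (by decide) (fun h => absurd h (by decide)) ?_ ?_
    · rw [he]; exact (Nat.size_le.2 hsv).trans (by omega)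
    · rw [upd_self, he]

end Setting

/-- A fixed program has a fixed nesting of loops, so its static time bound is at most `κ` times a
power of `B + 2` whose exponent does not depend on `n`. The exponent need not be computed. -/
theorem Cmd.exists_timeBound_le (c : Cmd) :
    ∃ w : ℕ, ∀ κ B : ℕ, c.timeBound κ B ≤ κ * (B + 2) ^ w := by
  have hmono : ∀ (κ B : ℕ) {x y : ℕ}, x ≤ y → κ * (B + 2) ^ x ≤ κ * (B + 2) ^ y :=
    fun κ B x y h => Nat.mul_le_mul_left _ (Nat.pow_le_pow_right (by omega) h)
  have hsucc : ∀ (κ B x : ℕ), κ * (B + 2) ^ (x + 1) = (B + 2) * (κ * (B + 2) ^ x) := fun κ B x => by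
    rw [pow_succ]; ring
  have htwo : ∀ B x : ℕ, 2 * x ≤ (B + 2) * x := fun B x => Nat.mul_le_mul_right _ (by omega)
  induction c with
  | seq c d ihc ihd =>
    obtain ⟨x, hx⟩ := ihc
    obtain ⟨y, hy⟩ := ihd
    refine ⟨max x y + 1, fun κ B => ?_⟩
    have h1 := (hx κ B).trans (hmono κ B (le_max_left x y))
    have h2 := (hy κ B).trans (hmono κ B (le_max_right x y))
    have h3 := htwo B (κ * (B + 2) ^ max x y)
    rw [hsucc, Cmd.timeBound]
    omega
  | ite e c d ihc ihd =>
    obtain ⟨x, hx⟩ := ihc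
    obtain ⟨y, hy⟩ := ihd
    refine ⟨max x y + 1 + 1, fun κ B => ?_⟩
    have h1 := (hx κ B).trans (hmono κ B (le_max_left x y))
    have h2 := (hy κ B).trans (hmono κ B (le_max_right x y))
    have h3 := htwo B (κ * (B + 2) ^ max x y)
    have h4 := htwo B (κ * (B + 2) ^ (max x y + 1))
    have h5 := hmono κ B (Nat.zero_le (max x y))
    rw [pow_zero, mul_one] at h5
    rw [hsucc, Cmd.timeBound]
    rw [hsucc] at h4 ⊢
    omega
  | loop e c ih =>
    obtain ⟨x, hx⟩ := ih
    refine ⟨x + 1 + 1, fun κ B => ?_⟩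
    have h1 := hx κ B
    have h3 := htwo B (κ * (B + 2) ^ x)
    have h5 := hmono κ B (Nat.zero_le x)
    rw [pow_zero, mul_one] at h5
    rw [hsucc, Cmd.timeBound]
    refine Nat.mul_le_mul (by omega) ?_
    rw [hsucc]
    omega
  | skip => exact ⟨0, fun κ B => Nat.zero_le _⟩
  | _ => exact ⟨0, fun κ B => (mul_one κ).ge⟩

theorem stepBound_le {B n : ℕ} (hn : n ≤ B) (hB : 4096 ≤ B) : stepBound B n ≤ (B + 2) ^ 41 := by
  have h : B + 2 ≤ (B + 2) ^ 40 := Nat.le_self_pow (by norm_num) _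
  have h' : 4098 * (B + 2) ^ 40 ≤ (B + 2) * (B + 2) ^ 40 := Nat.mul_le_mul_right _ (by omega)
  rw [stepBound, wordBound, pow_succ' _ 40]
  generalize (B + 2) ^ 40 = x at *
  omega

theorem sum_map_filter {α : Type*} (S : Multiset α) (p : α → Prop) [DecidablePred p] (g : α → ℝ) :
    ((S.filter p).map g).sum = (S.map fun a => if p a then g a else 0).sum := by
  induction S using Multiset.induction with
  | empty => simp
  | cons a S ih => by_cases h : p a <;> simp [h, ih]

/-- `x`, `y` and `v` stand for the bounds of an elementary operation, of the setup and of the loop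
body. `Y` dominates all three, and four more factors `B + 2` absorb the loops around them. -/
theorem arith_time {n B x y v Y : ℝ} (hB : 4098 ≤ B + 2) (hn : n ≤ B) (hn0 : 0 ≤ n) (hx : 0 ≤ x)
    (h1 : x ≤ Y) (h2 : y ≤ Y) (h3 : v ≤ Y) :
    y + (4 * x + (x + v) * (8 + 4 * B) + x) ≤ Y * (B + 2) ^ 4 ∧
    y + (x + (n + 1) * (x + (4 * x + (x + v) * (8 + 4 * B) + x + x)) + x) ≤ Y * (B + 2) ^ 4 := by
  have hY0 : 0 ≤ Y := hx.trans h1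
  have h5 : 4 * x + (x + v) * (8 + 4 * B) ≤ (B + 2) ^ 2 * Y := by
    refine (add_le_add (mul_le_mul_of_nonneg_left h1 (by norm_num))
      (mul_le_mul_of_nonneg_right (add_le_add h1 h3) (by linarith))).trans ?_
    rw [show 4 * Y + (Y + Y) * (8 + 4 * B) = (4 + 8 * (B + 2)) * Y by ring]
    exact mul_le_mul_of_nonneg_right (by nlinarith) hY0
  generalize 4 * x + (x + v) * (8 + 4 * B) = z at *
  obtain ⟨b, hb⟩ : ∃ b, b = B + 2 := ⟨_, rfl⟩
  have hnb : n + 1 ≤ b := by linarith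
  rw [← hb] at hB h5 ⊢
  have hYb : Y ≤ b ^ 2 * Y := le_mul_of_one_le_left hY0 (by nlinarith)
  have e4 : Y * b ^ 4 = b ^ 2 * (b ^ 2 * Y) := by ring
  have hZ0 : 0 ≤ b ^ 2 * Y := by positivity
  have hb2 : 4098 * b ≤ b ^ 2 := by nlinarith
  rw [e4]
  generalize b ^ 2 * Y = Z at *
  have hbZ : 4098 * b * Z ≤ b ^ 2 * Z := mul_le_mul_of_nonneg_right hb2 hZ0
  have hZb : 4098 * Z ≤ b * Z := mul_le_mul_of_nonneg_right hB hZ0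
  have hs : (n + 1) * (x + (z + x + x)) ≤ b * (4 * Z) :=
    (mul_le_mul_of_nonneg_left (show x + (z + x + x) ≤ 4 * Z by linarith)
      (by linarith)).trans (mul_le_mul_of_nonneg_right hnb (by linarith))
  constructor <;> linarith

namespace Setting

open Sieve QState Expr

variable {X : Type*} {n : ℕ} {K : Setting X n}

theorem exists_time_le : ∃ w : ℕ, ∀ (X : Type*) (n : ℕ) (K : Setting X n), n ≤ K.B → 4096 ≤ K.B →
    K.parityTime ≤ ((K.B : ℝ) + 2) ^ w ∧ K.shiftTime ≤ ((K.B : ℝ) + 2) ^ w := by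
  obtain ⟨u, hu⟩ := Cmd.exists_timeBound_le Sieve.setup
  obtain ⟨v, hv⟩ := Cmd.exists_timeBound_le Sieve.sieveBody
  refine ⟨41 + u + v + 4, fun X n K hn hB => ?_⟩
  have hb : (4098 : ℝ) ≤ K.B + 2 := by
    have : (4096 : ℝ) ≤ K.B := by exact_mod_cast hB
    linarith
  have hn' : (n : ℝ) ≤ K.B := by exact_mod_cast hn
  set Y : ℝ := ((K.B : ℝ) + 2) ^ (41 + u + v) with hY
  have hT := stepBound_le hn hB
  have hle : ∀ {x w : ℕ}, x ≤ stepBound K.B n * (K.B + 2) ^ w → w ≤ u + v → (x : ℝ) ≤ Y := by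
    intro x w hx hw
    have : x ≤ (K.B + 2) ^ (41 + u + v) := hx.trans ((Nat.mul_le_mul_right _ hT).trans (by
      rw [← pow_add]; exact Nat.pow_le_pow_right (by omega) (by omega)))
    rw [hY]
    exact_mod_cast this
  have h1 : (stepBound K.B n : ℝ) ≤ Y := hle (w := 0) (by simp) (Nat.zero_le _)
  have h2 : (K.tau Sieve.setup : ℝ) ≤ Y := hle (hu _ _) (Nat.le_add_right _ _)
  have h3 : (K.tau Sieve.sieveBody : ℝ) ≤ Y := hle (hv _ _) (Nat.le_add_left _ _)
  have hY0 : 0 ≤ Y := by positivity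
  have h0 : (0 : ℝ) ≤ stepBound K.B n := Nat.cast_nonneg _
  rw [pow_add, ← hY, parityTime, shiftTime, sieveTime, stepTime, Nat.cast_add]
  generalize (stepBound K.B n : ℝ) = x at *
  generalize (K.tau Sieve.setup : ℝ) = y at *
  generalize (K.tau Sieve.sieveBody : ℝ) = v at *
  exact arith_time hb (by linarith) (Nat.cast_nonneg n) h0 h1 h2 h3

/-- Markov's inequality: a branch that is cut off has used time at least `fuel`, so such branches
have total probability at most `τ / fuel`. Every other branch of nonzero probability has the right
output. -/
theorem Avg.outputs {f : Bool → ZMod (2 ^ n) → X} {P : Cmd} {B Qb v : ℕ} {τ T A Q : ℝ} (hB : n ≤ B)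
    (h : ∀ fuel, Avg ⟨f, fuel, B, Qb⟩ P (start n).mem (Finsupp.single ∅ 1) τ
      fun M' _ => M' vout 0 = v)
    (hT : τ ≤ T) (hA : ((36 * (B + 1) * wordBound B : ℕ) : ℝ) ≤ A) (hQ : (Qb : ℝ) ≤ Q) :
    Outputs P f v ∧ RunsWithin P f T A Q := by
  classical
  have hmem : ∀ t i, (start n).mem t i ≤ n := fun t i => by
    simp only [start]; split_ifs <;> omega
  have hsz : n.size ≤ n := Nat.size_le_self' n
  have hw : B ≤ wordBound B := (Nat.le_add_right B 2).trans (Nat.le_self_pow (by norm_num) _)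
  have hres : ∀ fuel, Setting.Res ⟨f, fuel, B, Qb⟩ (start n) := fun fuel => by
    refine ⟨⟨fun t _ i => (hmem t i).trans hB,
      fun t i => (Nat.size_le_self' _).trans ((hmem t i).trans hB)⟩,
      (hsz.trans hB).trans hw, ?_, Finset.empty_subset _⟩
    rw [show (start n).cells = {(vn, 0)} from rfl, Finset.singleton_subset_iff]
    simp
  have hE := fun fuel => h fuel (start n) rfl rfl rfl (hres fuel)
  have hprob : (start n).prob = 1 := by
    show QState.normSq (Finsupp.single ∅ 1) = 1
    simp [QState.normSq]
  have htime : ∀ fuel, expectedTime P f fuel ≤ τ := fun fuel => by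
    have := (hE fuel).time
    rw [hprob, one_mul, show ((start n).time : ℝ) = 0 from Nat.cast_zero, zero_add] at this
    exact this
  have hsum : ∀ fuel, ((branches P f fuel).map Config.prob).sum = 1 := fun fuel =>
    (exec_prob f fuel P (start n)).trans hprob
  have hnn : ∀ σ : Config, 0 ≤ σ.prob := fun σ => normSq_nonneg _
  have hne : ∀ σ : Config, σ.prob ≠ 0 → σ.qstate ≠ 0 := fun σ h h0 => h (normSq_eq_zero.2 h0)
  refine ⟨?_, fun fuel => (htime fuel).trans hT, fun fuel σ hσ h0 => ?_, fun fuel σ hσ h0 => ?_⟩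
  · have hlim : Filter.Tendsto (fun fuel : ℕ => 1 - τ / (fuel : ℝ)) Filter.atTop (nhds 1) := by
      simpa using tendsto_const_nhds.sub (tendsto_const_div_atTop_nhds_zero_nat τ)
    refine tendsto_of_tendsto_of_tendsto_of_le_of_le' hlim tendsto_const_nhds ?_
      (.of_forall fun fuel => ?_)
    · filter_upwards [Filter.eventually_gt_atTop 0] with fuel hf
      have hf' : (0 : ℝ) < fuel := by exact_mod_cast hf
      have h1 : 1 - τ / fuel ≤ 1 - expectedTime P f fuel / fuel :=
        sub_le_sub_left (div_le_div_of_nonneg_right (htime fuel) hf'.le) _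
      refine h1.trans ?_
      rw [outputProb, sum_map_filter, expectedTime, ← hsum fuel, ← Multiset.sum_map_div,
        ← Multiset.sum_map_sub]
      refine Multiset.sum_map_le_sum_map _ _ fun σ hσ => ?_
      by_cases h0 : σ.prob = 0
      · simp [h0]
      split_ifs with hq
      · exact sub_le_self _ (div_nonneg (mul_nonneg (hnn σ) (Nat.cast_nonneg _)) hf'.le)
      · have hstuck : σ.stuck = true := by
          by_contra hs
          rw [Bool.not_eq_true] at hs
          exact hq ⟨hs, ((hE fuel).ends σ hσ (hne σ h0)).2 hs⟩
        have ht := exec_stuck_time f fuel P hσ rfl hstuck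
        have ht' : (fuel : ℝ) ≤ σ.time := by exact_mod_cast (Nat.le_add_left _ _).trans ht
        rw [sub_nonpos, le_div_iff₀ hf']
        exact mul_le_mul_of_nonneg_left ht' (hnn σ)
    · rw [outputProb, sum_map_filter, ← hsum fuel]
      refine Multiset.sum_map_le_sum_map _ _ fun σ _ => ?_
      split_ifs
      · exact le_rfl
      · exact hnn σ
  · have hr := ((hE fuel).ends σ hσ (hne σ h0)).1
    refine le_trans ?_ hA
    have hc := Finset.card_le_card hr.cells
    rw [Finset.card_product, Finset.card_range, Finset.card_range] at hc
    exact_mod_cast Nat.mul_le_mul hc hr.word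
  · have hr := ((hE fuel).ends σ hσ (hne σ h0)).1
    have hc := Finset.card_le_card hr.qubits
    rw [Finset.card_range] at hc
    exact le_trans (by exact_mod_cast hc) hQ

end Setting

open Setting in
theorem mainTheorem1 :
    ∃ C : ℝ, ∀ (m n : ℕ), 1 ≤ m → n = m ^ 2 →
      ∀ (X : Type*) (f : Bool → ZMod (2 ^ n) → X) (s : ZMod (2 ^ n)), IsHiddenShift f s →
        (Outputs Sieve.parityProgram f (s.val % 2) ∧
          RunsWithin Sieve.parityProgram f ((2 : ℝ) ^ (C * Real.sqrt (n : ℝ)))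
            ((2 : ℝ) ^ (C * Real.sqrt (n : ℝ))) (C * Real.logb 2 ((2 : ℝ) ^ n))) ∧
        (Outputs Sieve.shiftProgram f s.val ∧
          RunsWithin Sieve.shiftProgram f ((2 : ℝ) ^ (C * Real.sqrt (n : ℝ)))
            ((2 : ℝ) ^ (C * Real.sqrt (n : ℝ))) (C * Real.logb 2 ((2 : ℝ) ^ n))) := by
  obtain ⟨w, hw⟩ := exists_time_le
  -- One has `B + 2 ≤ 2 ^ (4 * m + 9) ≤ 2 ^ (13 * m)`. The expected time is at most `(B + 2) ^ w`,
  -- and the classical space, with `36 * (B + 1)` cells and the word bound `(B + 2) ^ 40`, is at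
  -- most `(B + 2) ^ 43`. The constant also covers the `13 * n` qubits.
  refine ⟨13 * (w + 43 : ℕ), fun m n hm hn X f s hs => ?_⟩
  set B : ℕ := 2 ^ (4 * m + 8) with hB
  have hK : ∀ fuel, Roomy (⟨f, fuel, B, 13 * n⟩ : Setting X n) m := fun _ => ⟨hn, hm, rfl, rfl⟩
  have hQB : 13 * n + 100 ≤ B := (hK 0).bounds.2
  have hB4 : 4096 ≤ B := (show 4096 = 2 ^ 12 by norm_num).le.trans
    (Nat.pow_le_pow_right (by norm_num) (by omega))
  have hsqrt : Real.sqrt (n : ℝ) = m := by rw [hn]; push_cast; exact Real.sqrt_sq (by positivity)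
  have hlog : Real.logb 2 ((2 : ℝ) ^ n) = n := by
    rw [← Real.rpow_natCast, Real.logb_rpow (by norm_num) (by norm_num)]
  have hpow : ∀ x ≤ w + 43, ((B : ℝ) + 2) ^ x ≤
      (2 : ℝ) ^ ((13 * (w + 43 : ℕ) : ℝ) * Real.sqrt (n : ℝ)) := by
    intro x hx
    have h1 : B + 2 ≤ 2 ^ (13 * m) := calc
      B + 2 ≤ 2 ^ (4 * m + 8) * 2 := by omega
      _ = 2 ^ (4 * m + 9) := (pow_succ _ _).symm
      _ ≤ _ := Nat.pow_le_pow_right (by norm_num) (by omega)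
    have h2 : (B + 2) ^ x ≤ 2 ^ (13 * (w + 43) * m) := calc
      (B + 2) ^ x ≤ (2 ^ (13 * m)) ^ (w + 43) :=
        (Nat.pow_le_pow_right (by omega) hx).trans (Nat.pow_le_pow_left h1 _)
      _ = _ := by rw [← pow_mul]; congr 1; ring
    rw [hsqrt, show ((13 * (w + 43 : ℕ) : ℝ) * m) = ((13 * (w + 43) * m : ℕ) : ℝ) by push_cast; ring,
      Real.rpow_natCast]
    exact_mod_cast h2
  have hspace : ((36 * (B + 1) * wordBound B : ℕ) : ℝ) ≤
      (2 : ℝ) ^ ((13 * (w + 43 : ℕ) : ℝ) * Real.sqrt (n : ℝ)) := by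
    refine le_trans ?_ (hpow 43 (by omega))
    have : 36 * (B + 1) * wordBound B ≤ (B + 2) ^ 43 := calc
      36 * (B + 1) * wordBound B ≤ (B + 2) * (B + 2) * (B + 2) ^ 40 :=
        Nat.mul_le_mul_right _ (Nat.mul_le_mul (by omega) (by omega))
      _ = (B + 2) ^ 42 := by ring
      _ ≤ _ := Nat.pow_le_pow_right (by omega) (by norm_num)
    exact_mod_cast this
  have hqubits : ((13 * n : ℕ) : ℝ) ≤ 13 * (w + 43 : ℕ) * Real.logb 2 ((2 : ℝ) ^ n) := by
    rw [hlog]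
    have : 13 * n ≤ 13 * (w + 43) * n := Nat.mul_le_mul_right _ (by omega)
    exact_mod_cast this
  have hmem : (Sieve.start n).mem Sieve.vn 0 = n := rfl
  have ht := hw X n ⟨f, 0, B, 13 * n⟩ (show n ≤ B by omega) hB4
  exact ⟨Avg.outputs (by omega) (fun fuel => Avg.parityProgram (hK fuel) hs hmem)
      (ht.1.trans (hpow w (by omega))) hspace hqubits,
    Avg.outputs (by omega) (fun fuel => Avg.shiftProgram (hK fuel) hs hmem)
      (ht.2.trans (hpow w (by omega))) hspace hqubits⟩
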